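/- **Conventions.** Let $A$ be a ring with involution $a\mapsto\bar a$ and $n\ge 0$ an integer. Modules are left $A$-modules, $M^*=\mathrm{Hom}_A(M,A)$ with $(af)(x)=f(x)\bar a$, and $M^{**}=M$ for $M$ finitely generated projective. Chain complexes are graded by $\mathbb Z$; a complex is finite if it is bounded and consists of finitely generated projective modules, and it is $m$-dimensional if it is finite and chain equivalent to a complex of finitely generated projective modules concentrated in degrees $0,\dots,m$. Write $C^r=(C_r)^*$; $C^{n-*}$ is the complex with $(C^{n-*})_r=C^{n-r}$ and $d=(-1)^rd^*$. The mapping cone of $f:C\to D$ is $C(f)_r=D_r\oplus C_{r-1}$, $d(x,y)=(dx+(-1)^{r-1}fy,\,dy)$. An $m$-chain $\theta$ of $\widehat W^{\%}C$ is a family $\theta_s:C^p\to C_q$ ($s\in\mathbb Z$, $p+q=m+s$) and $$(d\theta)_s=d\theta_s+(-1)^q\theta_sd^*+(-1)^{m+s-1}(\theta_{s-1}+(-1)^sT\theta_{s-1}):C^p\to C_q ,\qquad T\theta=(-1)^{pq}\theta^* .$$ The complex $W^{\%}C$ consists of the chains with $\theta_s=0$ for $s<0$, with inclusion $J:W^{\%}C\to\widehat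 W^{\%}C$ (and $d$ as above). An $m$-chain of $W_{\%}C$ is a family $\psi_s:C^p\to C_q$ ($s\ge0$, $p+q=m-s$), with $(d\psi)_s=d\psi_s+(-1)^q\psi_sd^*+(-1)^{m-s-1}(\psi_{s+1}+(-1)^{s+1}T\psi_{s+1})$; $(1+T)\psi\in W^{\%}C$ is $(1+T)\psi_0$ in index $s=0$ and $0$ otherwise. For an $(m-1)$-chain $\psi$ of $W_{\%}C$ let $H\psi$ be the $m$-chain of $\widehat W^{\%}C$ with $(H\psi)_s=\psi_{-s-1}$ for $s<0$ and $(H\psi)_s=0$ for $s\ge0$. For $f:C\to D$ let $f^{\%}\theta=f\theta_sf^*$, and for a chain homotopy $h$ with $dh+hd=f'-f$ let $$\big((h;f,f')^{\%}\theta\big)_s=h\theta_sf^*+(-1)^qf'\theta_sh^*+(-1)^{m+q+1}h(T\theta_{s-1})h^* :D^p\to D_q,\quad p+q=m+1+s .$$ Chains of $\widehat W^{\%}C^{0-*}$ are families $\gamma_s:C_a\to C^b$ ($-a-b=m+s$). A bundle over a complex $C$ is a $0$-cycle $\gamma$ of $\widehat W^{\%}C^{0-*}$, an equivalence $\chi:\gamma\to\gamma'$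 is a $1$-chain with $d\chi=\gamma'-\gamma$, and a map of chain bundles $(g,\chi):(C,\gamma)\to(B,\beta)$ is a chain map $g$ with an equivalence $\chi:\gamma\to g^*\beta=g^*\beta_sg$. The suspension $(S^n\gamma)_s=(-1)^{n(n-q)}\gamma_{s-n}:C_{n-p}\to C^{n-q}$ is a chain map $\widehat W^{\%}C^{0-*}\to\widehat W^{\%}C^{n-*}$ of degree $n$. **Normal complexes.** An $n$-dimensional normal complex $(C,\phi,\gamma,\theta)$ consists of an $n$-dimensional $C$, an $n$-cycle $\phi$ of $W^{\%}C$, a bundle $\gamma$ over $C$ and an $(n+1)$-chain $\theta$ of $\widehat W^{\%}C$ with $J\phi-\phi_0^{\%}(S^n\gamma)=d\theta$. It is connected if $H_0(\phi_0:C^{n-*}\to C)=0$. A map $(f,\xi,\chi,\eta)$ to $(C',\phi',\gamma',\theta')$ consists of a chain map $f$, an $(n+1)$-chain $\xi$ of $W^{\%}C'$ with $\phi'-f^{\%}\phi=d\xi$, an equivalence $\chi:\gamma\to f^*\gamma'$, and an $(n+2)$-chain $\eta$ of $\widehat W^{\%}C'$ with $$\theta'-f^{\%}\theta-J\xi+(\xi_0;f\phi_0f^*,\phi_0')^{\%}(S^n\gamma')+(f\phi_0)^{\%}(S^n\chi)=d\eta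 .$$ It is a homotopy equivalence if $f$ is a chain equivalence. **Pairs.** An $n$-dimensional (symmetric, quadratic) pair $(f:C\to D,(\delta\phi,\psi))$ consists of a chain map $f$ from an $(n-1)$-dimensional to an $n$-dimensional complex, an $(n-1)$-cycle $\psi$ of $W_{\%}C$ and an $n$-chain $\delta\phi$ of $W^{\%}D$ with $d\delta\phi+(-1)^{n-1}f^{\%}(1+T)\psi=0$. It is Poincaré if $(\delta\phi_0,(-1)^{n-r}(1+T)\psi_0f^*):D^{n-r}\to C(f)_r$ is a chain equivalence $D^{n-*}\to C(f)$. A homotopy equivalence to $(f':C'\to D',(\delta\phi',\psi'))$ consists of chain equivalences $g:C\to C'$, $h:D\to D'$, a chain homotopy $k$ with $dk+kd=f'g-hf$, and chains $\xi\in(W_{\%}C')_n$, $\delta\xi\in(W^{\%}D')_{n+1}$ with $\psi'-g_{\%}\psi=d\xi$ and $$\delta\phi'-h^{\%}\delta\phi-(-1)^n(k;hf,f'g)^{\%}(1+T)\psi=d\delta\xi+(-1)^nf'^{\%}(1+T)\xi .$$ On a pair put $\alpha=J\delta\phi+f^{\%}H\psi$, i.e. $\alpha_s=\delta\phi_s$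 for $s\ge0$ and $\alpha_s=f\psi_{-s-1}f^*$ for $s<0$, and let $E=(\delta\phi_0,\,f(1+T)\psi_0):C(f)^{n-*}\to D$. A normal structure $(\gamma,\theta)$ on the pair is a bundle $\gamma$ over $C(f)$ and an $(n+1)$-chain $\theta$ of $\widehat W^{\%}D$ with $\alpha-E^{\%}(S^n\gamma)=d\theta$; $(\gamma,\theta)$ and $(\gamma',\theta')$ are equivalent if there are an equivalence $\chi:\gamma\to\gamma'$ and an $(n+2)$-chain $\eta$ of $\widehat W^{\%}D$ with $\theta-\theta'-E^{\%}(S^n\chi)=d\eta$. **The pair of a normal complex.** For a connected $n$-dimensional normal complex $X=(C,\phi,\gamma,\theta)$ let $\partial X=(i_C:\partial C\to C^{n-*},(\delta\phi,\psi))$, where $\partial C_r=C_{r+1}\oplus C^{n-r}$, $i_C=(0\ \ 1)$, $$d_{\partial C}=\begin{pmatrix}d&(-1)^r\phi_0\\0&(-1)^rd^*\end{pmatrix},\qquad \delta\phi_s=(-1)^{n(n-q)}\gamma_{s-n}:C_{n-p}\to C^{n-q}\quad(s\ge0,\ p+q=n+s),$$ $$\psi_s=\begin{pmatrix}(-1)^{n+p+1}\theta_{-s}&0\\(-1)^{(n+1)s+n(p+1)}\gamma_{-n-s}\phi_0^*-\varepsilon_s&(-1)^{n+sp}\gamma_{-n-s-1}^*\end{pmatrix}:C^{p+1}\oplus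 C_{n-p}\to C_{q+1}\oplus C^{n-q}$$ for $s\ge0$ and $p+q=n-1-s$, with $\varepsilon_0=1:C^{p+1}\to C^{n-q}=C^{p+1}$ and $\varepsilon_s=0$ for $s\ge1$. **The normal complex of a pair.** For a Poincaré pair $P=(f:C\to D,(\delta\phi,\psi))$ with normal structure $(\gamma,\theta_D)$ let $N(P,\gamma,\theta_D)=(C(f),\phi,\gamma,\theta)$, where $\phi_s:C(f)^p=D^p\oplus C^{p-1}\to C(f)_q=D_q\oplus C_{q-1}$ ($p+q=n+s$) is $$\phi_0=\begin{pmatrix}\delta\phi_0&0\\(-1)^{n-q}(1+T)\psi_0f^*&0\end{pmatrix},\quad \phi_1=\begin{pmatrix}\delta\phi_1&0\\0&(-1)^{n-q+1}(1+T)\psi_0\end{pmatrix},\quad \phi_s=\begin{pmatrix}\delta\phi_s&0\\0&0\end{pmatrix}\ (s\ge2)$$ and, with $e:D\to C(f)$ the inclusion, $\kappa:C_i\to C(f)_{i+1}$, $\kappa(y)=(0,(-1)^{i+1}y)$, the null-homotopy of $ef$, and $K=\begin{pmatrix}0&0\\0&(-1)^q(1+T)\psi_0\end{pmatrix}:C(f)^p\to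 C(f)_q$ ($p+q=n+1$), $$\theta=(\kappa;ef,0)^{\%}(H\psi)+e^{\%}\theta_D-(K;eE,\phi_0)^{\%}(S^n\gamma).$$ **$(B,\beta)$-versions.** Let $(B,\beta)$ be a chain bundle over $A$ (the complex $B$ need not be finite). A connected $n$-dimensional $(B,\beta)$-normal complex is a connected $n$-dimensional normal complex $(C,\phi,\gamma,\theta)$ with a map of chain bundles $(g,\chi):(C,\gamma)\to(B,\beta)$; an $n$-dimensional (symmetric, quadratic) $(B,\beta)$-normal Poincaré pair is an $n$-dimensional (symmetric, quadratic) Poincaré pair with a normal structure $(\gamma,\theta)$ and a map of chain bundles $(g,\chi):(C(f),\gamma)\to(B,\beta)$. A homotopy of bundle maps $(g,\chi)\simeq(g',\chi'):(C,\gamma)\to(B,\beta)$ is a chain homotopy $l$ with $dl+ld=g'-g$ together with a $2$-chain $\mu$ of $\widehat W^{\%}C^{0-*}$ with $\chi-\chi'+(l;g,g')^{\%}\beta=-d\mu$, where $(l;g,g')^{\%}\beta$ is the $1$-chain given by the formula above for the dual homotopy from $g^*$ to $g'^*$. Homotopy equivalences of $(B,\beta)$-normal complexes are homotopy equivalences $(f,\xi,\chi_f,\eta)$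 of normal complexes with a homotopy of bundle maps $(g,\chi)\simeq(g'f,\chi_f+f^*\chi')$. Homotopy equivalences of $(B,\beta)$-normal pairs are homotopy equivalences $(g_C,h,k,\delta\xi,\xi)$ of pairs together with, for the induced map $c:C(f)\to C(f')$, $c(x,y)=(hx+(-1)^rky,\,g_Cy)$, an equivalence $\zeta:\gamma\to c^*\gamma'$, an $(n+2)$-chain $\eta$ of $\widehat W^{\%}D'$ with $$\theta'-h^{\%}\theta-\big(J\delta\xi+f'^{\%}H\xi+(k;hf,f'g_C)^{\%}H\psi\big)+(L;hEc^*,E')^{\%}(S^n\gamma')+(hE)^{\%}(S^n\zeta)=d\eta ,$$ $$L=\big(\delta\xi_0+(-1)^pk(1+T)\psi_0k^*,\ \ k(1+T)\psi_0g_C^*+f'(1+T)\xi_0\big):D'^p\oplus C'^{p-1}\to D'_q\qquad(p+q=n+1),$$ and a homotopy of bundle maps $(g,\chi)\simeq(g'c,\zeta+c^*\chi')$. In every case homotopy equivalence classes are the classes of the equivalence relation generated by homotopy equivalences. **Theorem.** 1. For every connected $n$-dimensional normal complex $X$ over $A$, $\partial X$ is an $n$-dimensional (symmetric, quadratic) Poincaré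 pair, and the quadratic boundary $(\partial C,\psi)$ is an $(n-1)$-dimensional quadratic Poincaré complex, i.e. it is an $(n-1)$-dimensional complex with a cycle $\psi\in(W_{\%}\partial C)_{n-1}$ such that $(1+T)\psi_0:\partial C^{n-1-*}\to\partial C$ is a chain equivalence. 2. Every $n$-dimensional (symmetric, quadratic) Poincaré pair $P=(f:C\to D,(\delta\phi,\psi))$ over $A$ admits a normal structure $(\gamma,\theta_D)$, any two normal structures on $P$ are equivalent, and for every normal structure $N(P,\gamma,\theta_D)$ is a connected $n$-dimensional normal complex on $C(f)$. 3. There is a bijection $\Phi$ from the homotopy equivalence classes of connected $n$-dimensional normal complexes over $A$ to the homotopy equivalence classes of $n$-dimensional (symmetric, quadratic) Poincaré pairs over $A$ with $\Phi[X]=[\partial X]$ for all $X$ and $\Phi^{-1}[P]=[N(P,\gamma,\theta_D)]$ for all $P$ and all normal structures $(\gamma,\theta_D)$ on $P$. 4. For every chain bundle $(B,\beta)$ over $A$ there is a bijection $\Psi$ from the homotopy equivalence classes of connected $n$-dimensional $(B,\beta)$-normal complexes over $A$ to the homotopy equivalence classes of $n$-dimensional (symmetric, quadratic) $(B,\beta)$-normal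 Poincaré pairs over $A$ such that for every $X$ the class $\Psi[X]$ is represented by the pair $\partial X$ of the underlying normal complex with some normal structure and some map of chain bundles to $(B,\beta)$, and for every $(B,\beta)$-normal Poincaré pair $(P,\gamma,\theta_D,g,\chi)$ the class $\Psi^{-1}$ of it is represented by $(N(P,\gamma,\theta_D),g,\chi)$. -/

import Mathlib

universe u

open CategoryTheory

namespace APC

noncomputable section

/-! ### Duality for modules over a ring with involution -/

section Duality

variable (A : Type u) [Ring A]

/-- The dual `M^* = Hom_A(M, A)` of a left `A`-module, a left `A`-module
by `(a f)(x) = f(x) * star a`. -/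
def Dual (M : Type u) [AddCommGroup M] [Module A M] : Type u := M →ₗ[A] A

variable {M N : Type u} [AddCommGroup M] [Module A M] [AddCommGroup N] [Module A N]

instance : AddCommGroup (Dual A M) := inferInstanceAs (AddCommGroup (M →ₗ[A] A))

instance : FunLike (Dual A M) M A := inferInstanceAs (FunLike (M →ₗ[A] A) M A)

instance : LinearMapClass (Dual A M) A M A :=
  inferInstanceAs (LinearMapClass (M →ₗ[A] A) A M A)

variable {A}

@[ext] theorem Dual.ext {f g : Dual A M} (h : ∀ x, f x = g x) : f = g := DFunLike.ext f g h

@[simp] theorem Dual.add_apply (f g : Dual A M) (x : M) : (f + g) x = f x + g x := rfl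

@[simp] theorem Dual.zero_apply (x : M) : (0 : Dual A M) x = 0 := rfl

variable [StarRing A]

instance : SMul A (Dual A M) where
  smul a f := LinearMap.mk ⟨fun x => f x * star a, fun x y => by simp [add_mul]⟩
    (fun r x => by simp [mul_assoc])

@[simp] theorem Dual.smul_apply (a : A) (f : Dual A M) (x : M) : (a • f) x = f x * star a := rfl

instance : Module A (Dual A M) where
  one_smul f := by ext x; simp
  mul_smul a b f := by ext x; simp [mul_assoc]
  smul_zero a := by ext x; simp
  smul_add a f g := by ext x; simp [add_mul]
  add_smul a b f := by ext x; simp [mul_add]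
  zero_smul f := by ext x; simp

/-- The dual `f^* : N^* → M^*` of a morphism `f : M → N`. -/
def dualMap (f : M →ₗ[A] N) : Dual A N →ₗ[A] Dual A M where
  toFun g := LinearMap.comp (show N →ₗ[A] A from g) f
  map_add' _ _ := rfl
  map_smul' _ _ := rfl

@[simp] theorem dualMap_apply (f : M →ₗ[A] N) (g : Dual A N) (x : M) :
    dualMap f g x = g (f x) := rfl

theorem dualMap_zero : dualMap (0 : M →ₗ[A] N) = 0 := by
  ext g x
  exact map_zero g

theorem dualMap_comp {L : Type u} [AddCommGroup L] [Module A L] (f : M →ₗ[A] N)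
    (g : N →ₗ[A] L) : dualMap (g ∘ₗ f) = dualMap f ∘ₗ dualMap g := rfl

/-- The natural morphism `M → M^{**}`, `x ↦ (f ↦ star (f x))`. -/
def ev : M →ₗ[A] Dual A (Dual A M) where
  toFun x := LinearMap.mk ⟨fun f : Dual A M => star (f x), fun f g => by simp⟩
    (fun a f => by simp)
  map_add' x y := by
    apply Dual.ext; intro f
    change star (f (x + y)) = star (f x) + star (f y)
    simp
  map_smul' a x := by
    apply Dual.ext; intro f
    change star (f (a • x)) = star (f x) * star a
    simp

@[simp] theorem ev_apply (x : M) (f : Dual A M) : ev x f = star (f x) := rfl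

/-- For a finitely generated projective module the natural morphism `M → M^{**}` is bijective. -/
theorem ev_bijective [Module.Finite A M] [Module.Projective A M] :
    Function.Bijective (ev : M →ₗ[A] Dual A (Dual A M)) := by
  obtain ⟨n, p, i, -, -, hpi⟩ := Module.Finite.exists_comp_eq_id_of_projective A M
  let m : Fin n → M := fun k => p (Pi.single k 1)
  let c : Fin n → Dual A M := fun k => (LinearMap.proj k ∘ₗ i : M →ₗ[A] A)
  have hx : ∀ x : M, x = ∑ k, c k x • m k := by
    intro x
    have h1 : p (i x) = x := LinearMap.congr_fun hpi x
    conv_lhs => rw [← h1, pi_eq_sum_univ' (i x)]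
    rw [map_sum]
    refine Finset.sum_congr rfl fun k _ => ?_
    rw [map_smul]
    congr 1
  have hsum : ∀ (s : Finset (Fin n)) (a : Fin n → A) (x : M),
      (∑ k ∈ s, a k • c k) x = ∑ k ∈ s, c k x * star (a k) := by
    intro s a x
    induction s using Finset.induction_on with
    | empty => simp
    | insert j s hj ih => simp [Finset.sum_insert hj, ih]
  have hg : ∀ g : Dual A M, g = ∑ k, star (g (m k)) • c k := by
    intro g
    ext x
    rw [hsum]
    conv_lhs => rw [hx x]
    simp
  constructor
  · intro x y hxy
    rw [hx x, hx y]
    refine Finset.sum_congr rfl fun k _ => ?_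
    have := DFunLike.congr_fun hxy (c k)
    simp only [ev_apply] at this
    rw [star_injective this]
  · intro F
    refine ⟨∑ k, star (F (c k)) • m k, ?_⟩
    ext g
    conv_rhs => rw [hg g]
    rw [map_sum, map_sum]
    have hsum' : ∀ (s : Finset (Fin n)) (G : Fin n → Dual A (Dual A M)),
        (∑ k ∈ s, G k) g = ∑ k ∈ s, G k g := by
      intro s G
      induction s using Finset.induction_on with
      | empty => simp
      | insert j s hj ih => simp [Finset.sum_insert hj, ih]
    rw [hsum']
    simp

open Classical in
/-- The inverse `M^{**} → M` of the natural morphism, which is an isomorphism for every finitely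
generated projective module (the only case in which it is used). -/
def unev : Dual A (Dual A M) →ₗ[A] M :=
  if h : Function.Bijective (ev : M →ₗ[A] Dual A (Dual A M)) then
    (LinearEquiv.ofBijective ev h).symm.toLinearMap else 0

/-- The dual `φ^* : N^* → M^{**} = M` of a morphism `φ : M^* → N`. -/
def adj (φ : Dual A M →ₗ[A] N) : Dual A N →ₗ[A] M := unev ∘ₗ dualMap φ

/-- The dual `γ^* : N = N^{**} → M^*` of a morphism `γ : M → N^*`. -/
def transp (γ : M →ₗ[A] Dual A N) : N →ₗ[A] Dual A M := dualMap γ ∘ₗ ev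

end Duality

/-! ### Chain complexes -/

section Complexes

variable (A : Type u) [Ring A]

/-- Chain complexes of left `A`-modules, graded by `ℤ`. -/
abbrev Cx := ChainComplex (ModuleCat.{u} A) ℤ

variable {A}

/-- Bounded complexes of finitely generated projective modules. -/
def IsFinite (C : Cx A) : Prop :=
  (∀ i, Module.Finite A (C.X i) ∧ Module.Projective A (C.X i)) ∧
    ∃ N : ℤ, ∀ i, (i < -N ∨ N < i) → Subsingleton (C.X i)

/-- A finite complex is `n`-dimensional if it is chain equivalent to a complex of finitely
generated projective modules concentrated in degrees `0, …, n`. -/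
def IsDim (n : ℤ) (C : Cx A) : Prop :=
  IsFinite C ∧ ∃ P : Cx A, IsFinite P ∧ (∀ i, (i < 0 ∨ n < i) → Subsingleton (P.X i)) ∧
    Nonempty (HomotopyEquiv C P)

/-- A chain map is a chain equivalence. -/
def IsChainEquiv {C D : Cx A} (f : C ⟶ D) : Prop := ∃ e : HomotopyEquiv C D, e.hom = f

/-- The components of a chain map. -/
def comps {C D : Cx A} (f : C ⟶ D) : ∀ i, C.X i →ₗ[A] D.X i := fun i => (f.f i).hom

/-- The components of a chain homotopy. -/
def hcomps {C D : Cx A} {f g : C ⟶ D} (h : Homotopy f g) : ∀ i j, C.X i →ₗ[A] D.X j :=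
  fun i j => (h.hom i j).hom

/-- The identity `C_i → C_j` if `i = j`, and zero otherwise. -/
def idMap (C : Cx A) (i j : ℤ) : C.X i →ₗ[A] C.X j :=
  if h : i = j then (C.XIsoOfEq h).hom.hom else 0

/-- The map `C_i → D_j` given by a chain map if `i = j`, and zero otherwise. -/
def tot {C D : Cx A} (f : C ⟶ D) (i j : ℤ) : C.X i →ₗ[A] D.X j := idMap D i j ∘ₗ comps f i

theorem d_comp_d_hom (C : Cx A) (i j k : ℤ) : (C.d j k).hom ∘ₗ (C.d i j).hom = 0 := by
  rw [← ModuleCat.hom_comp, C.d_comp_d]; rfl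

theorem tot_comm {C D : Cx A} (f : C ⟶ D) {i j i' j' : ℤ} (h : i = j) (h' : i' = j') :
    (D.d j j').hom ∘ₗ tot f i j = tot f i' j' ∘ₗ (C.d i i').hom := by
  subst h h'
  have := congrArg ModuleCat.Hom.hom (f.comm i i')
  simpa only [tot, idMap, comps, HomologicalComplex.XIsoOfEq_rfl, Iso.refl_hom, dite_true,
    ModuleCat.hom_id, LinearMap.id_comp, ModuleCat.hom_comp] using this

theorem tot_comp {C D E : Cx A} (f : C ⟶ D) (g : D ⟶ E) {i j : ℤ} (h : i = j) :
    tot (f ≫ g) i j = comps g j ∘ₗ tot f i j ∧ tot (f ≫ g) i j = tot g i j ∘ₗ comps f i := by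
  subst h
  simp only [tot, idMap, comps, HomologicalComplex.XIsoOfEq_rfl, Iso.refl_hom, dite_true,
    ModuleCat.hom_id, LinearMap.id_comp, ModuleCat.hom_comp, HomologicalComplex.comp_f, and_self]

theorem hcomps_comm {C D : Cx A} {f g : C ⟶ D} (h : Homotopy f g) {i i' j k : ℤ}
    (hi : i = i') (hj : j + 1 = i) (hk : i + 1 = k) :
    tot f i i' = hcomps h j i' ∘ₗ (C.d i j).hom + (D.d k i').hom ∘ₗ hcomps h i k + tot g i i' := by
  subst hi
  have h1 := h.comm i
  rw [dNext_eq h.hom (show (ComplexShape.down ℤ).Rel i j from hj),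
    prevD_eq h.hom (show (ComplexShape.down ℤ).Rel k i from hk)] at h1
  have h2 := congrArg ModuleCat.Hom.hom h1
  simpa only [tot, idMap, comps, hcomps, HomologicalComplex.XIsoOfEq_rfl, Iso.refl_hom, dite_true,
    ModuleCat.hom_id, LinearMap.id_comp, ModuleCat.hom_comp, ModuleCat.hom_add] using h2

theorem tot_eq_zero {C D : Cx A} (f : C ⟶ D) {i j : ℤ} (h : i ≠ j) : tot f i j = 0 := by
  simp [tot, idMap, h]

/-- The algebraic mapping cone, `C(f)_r = D_r ⊕ C_{r-1}` with differential
`(x, y) ↦ (d x + (-1)^{r-1} f y, d y)`. -/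
def cone {C D : Cx A} (f : C ⟶ D) : Cx A where
  X r := ModuleCat.of A (D.X r × C.X (r - 1))
  d i j := ModuleCat.ofHom (LinearMap.prod
    ((D.d i j).hom ∘ₗ LinearMap.fst A (D.X i) (C.X (i - 1)) +
      (i - 1).negOnePow • (tot f (i - 1) j ∘ₗ LinearMap.snd A (D.X i) (C.X (i - 1))))
    ((C.d (i - 1) (j - 1)).hom ∘ₗ LinearMap.snd A (D.X i) (C.X (i - 1))))
  shape i j hij := by
    simp only [ComplexShape.down_Rel] at hij
    have h1 : D.d i j = 0 := D.shape _ _ hij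
    have h2 : C.d (i - 1) (j - 1) = 0 := C.shape _ _ (by
      simp only [ComplexShape.down_Rel]; omega)
    rw [h1, h2, tot_eq_zero f (by omega)]
    ext x <;> simp
  d_comp_d' i j k hij hjk := by
    simp only [ComplexShape.down_Rel] at hij hjk
    have h1 := d_comp_d_hom D i j k
    have h2 := d_comp_d_hom C (i - 1) (j - 1) (k - 1)
    have h3 := tot_comm f (show i - 1 = j by omega) (show j - 1 = k by omega)
    have h4 : (i - 1).negOnePow = -(j - 1).negOnePow := by
      rw [show i - 1 = (j - 1) + 1 by omega, Int.negOnePow_succ]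
    rw [← ModuleCat.ofHom_comp]
    refine ModuleCat.hom_ext (LinearMap.ext fun x => ?_)
    obtain ⟨x, y⟩ := x
    have e1 := LinearMap.congr_fun h1 x
    have e2 := LinearMap.congr_fun h2 y
    have e3 := LinearMap.congr_fun h3 y
    simp only [LinearMap.comp_apply, LinearMap.zero_apply] at e1 e2 e3
    refine Prod.ext ?_ ?_
    · simp [h4, e1, e3]
    · simp [e2]

variable [StarRing A]

/-- The `n`-dual complex `C^{n-*}`, with `(C^{n-*})_r = C^{n-r}` and differential
`(-1)^r d^* : C^{n-r} → C^{n-r+1}`. -/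
def nDual (n : ℤ) (C : Cx A) : Cx A where
  X r := ModuleCat.of A (Dual A (C.X (n - r)))
  d i j := ModuleCat.ofHom (i.negOnePow • dualMap (C.d (n - j) (n - i)).hom)
  shape i j hij := by
    have h : C.d (n - j) (n - i) = 0 := C.shape _ _ (by
      simp only [ComplexShape.down_Rel] at hij ⊢; omega)
    rw [h, ModuleCat.hom_zero, dualMap_zero, smul_zero]
    rfl
  d_comp_d' i j k _ _ := by
    rw [← ModuleCat.ofHom_comp, LinearMap.smul_comp, LinearMap.comp_smul, ← dualMap_comp,
      d_comp_d_hom, dualMap_zero, smul_zero, smul_zero]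
    rfl

end Complexes

/-! ### Symmetric, quadratic and hyperquadratic structures

A chain of `Hom_A(C^{-*}, C)`, with an index `s`, is a family `θ s p q : C^p → C_q`; a chain of
`Hom_A((C^{0-*})^{-*}, C^{0-*})` is a family `γ s a b : C_a → C^b`. -/

section Structures

variable {A : Type u} [Ring A] [StarRing A]

/-- Families of morphisms `θ_s : C^p → C_q`. -/
abbrev Fam (C : Cx A) : Type u := ∀ _s p q : ℤ, Dual A (C.X p) →ₗ[A] C.X q

/-- Families of morphisms `γ_s : C_a → C^b`. -/
abbrev Form (C : Cx A) : Type u := ∀ _s a b : ℤ, C.X a →ₗ[A] Dual A (C.X b)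

/-- Families of morphisms `C^p → D_q`. -/
abbrev DMap (C D : Cx A) : Type u := ∀ p q : ℤ, Dual A (C.X p) →ₗ[A] D.X q

/-- Families of morphisms `C_i → D_i`. -/
abbrev GMap (C D : Cx A) : Type u := ∀ i : ℤ, C.X i →ₗ[A] D.X i

/-- Families of morphisms `C_i → D_j`. -/
abbrev HMap (C D : Cx A) : Type u := ∀ i j : ℤ, C.X i →ₗ[A] D.X j

/-- The transposition `T φ = (-1)^{pq} φ^*`. -/
def famT {C : Cx A} (φ : Fam C) : Fam C := fun s p q =>
  (p * q).negOnePow • adj (φ s q p)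

/-- The transposition on forms. -/
def formT {C : Cx A} (γ : Form C) : Form C := fun s a b =>
  (a * b).negOnePow • transp (γ s b a)

/-- The differential `d θ_s + (-1)^q θ_s d^*` of `Hom_A(C^{-*}, C)`. -/
def famD {C : Cx A} (θ : Fam C) : Fam C := fun s p q =>
  (C.d (q + 1) q).hom ∘ₗ θ s p (q + 1) +
    q.negOnePow • (θ s (p + 1) q ∘ₗ dualMap (C.d (p + 1) p).hom)

/-- The same differential for the complex `C^{0-*}`, whose differential `C^{b-1} → C^b`
is `(-1)^{b-1} d^*`. -/
def formD {C : Cx A} (γ : Form C) : Form C := fun s a b =>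
  (b + 1).negOnePow • (dualMap (C.d b (b - 1)).hom ∘ₗ γ s a (b - 1)) +
    (a + b + 1).negOnePow • (γ s (a - 1) b ∘ₗ (C.d a (a - 1)).hom)

/-- The differential on the `n`-chains of `Ŵ^% C`, and on its subset `W^% C`:
`(dθ)_s = d(θ_s) + (-1)^{n+s-1} (θ_{s-1} + (-1)^s T θ_{s-1})`. -/
def dHyp {C : Cx A} (n : ℤ) (θ : Fam C) : Fam C := fun s p q =>
  famD θ s p q + (n + s - 1).negOnePow • (θ (s - 1) p q + s.negOnePow • famT θ (s - 1) p q)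

/-- The differential on the `n`-chains of `W_% C`:
`(dψ)_s = d(ψ_s) + (-1)^{n-s-1} (ψ_{s+1} + (-1)^{s+1} T ψ_{s+1})` for `s ≥ 0`. -/
def dQuad {C : Cx A} (n : ℤ) (ψ : Fam C) : Fam C := fun s p q =>
  if s < 0 then 0 else famD ψ s p q +
    (n - s - 1).negOnePow • (ψ (s + 1) p q + (s + 1).negOnePow • famT ψ (s + 1) p q)

/-- The differential on the `m`-chains of `Ŵ^% C^{0-*}`. -/
def dForm {C : Cx A} (m : ℤ) (γ : Form C) : Form C := fun s a b =>
  formD γ s a b + (m + s - 1).negOnePow • (γ (s - 1) a b + s.negOnePow • formT γ (s - 1) a b)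

/-- `n`-chains of `Ŵ^% C`: `θ_s : C^p → C_q` with `p + q = n + s`, `s ∈ ℤ`. -/
def IsHyp {C : Cx A} (n : ℤ) (θ : Fam C) : Prop :=
  ∀ s p q, p + q ≠ n + s → θ s p q = 0

/-- `n`-chains of `W^% C`: `φ_s : C^p → C_q` with `p + q = n + s`, `s ≥ 0`. The inclusion
`J : W^% C → Ŵ^% C` is extension by zero, hence the identity on these families. -/
def IsSym {C : Cx A} (n : ℤ) (φ : Fam C) : Prop :=
  ∀ s p q, (s < 0 ∨ p + q ≠ n + s) → φ s p q = 0

/-- `n`-chains of `W_% C`: `ψ_s : C^p → C_q` with `p + q = n - s`, `s ≥ 0`. -/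
def IsQuad {C : Cx A} (n : ℤ) (ψ : Fam C) : Prop :=
  ∀ s p q, (s < 0 ∨ p + q ≠ n - s) → ψ s p q = 0

/-- `m`-chains of `Ŵ^% C^{0-*}`: `γ_s : C_a → C^b` with `(-a) + (-b) = m + s`, `s ∈ ℤ`. -/
def IsForm {C : Cx A} (m : ℤ) (γ : Form C) : Prop :=
  ∀ s a b, -a + -b ≠ m + s → γ s a b = 0

/-- The symmetrization `1 + T : W_% C → W^% C`. -/
def oneT {C : Cx A} (ψ : Fam C) : Fam C := fun s p q =>
  if s = 0 then ψ 0 p q + famT ψ 0 p q else 0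

/-- An `(n-1)`-chain `ψ` of `W_% C` regarded as the `n`-chain `θ` of `Ŵ^% C` with
`θ_s = ψ_{-s-1}` for `s < 0` and `θ_s = 0` for `s ≥ 0`. -/
def hyp {C : Cx A} (ψ : Fam C) : Fam C := fun s p q => ψ (-s - 1) p q

/-- The induced map `θ_s ↦ f θ_s f^*`. -/
def push {C D : Cx A} (f : GMap C D) (θ : Fam C) : Fam D := fun s p q =>
  f q ∘ₗ θ s p q ∘ₗ dualMap (f p)

/-- The pullback `γ_s ↦ f^* γ_s f`. -/
def pull {C D : Cx A} (f : GMap C D) (γ : Form D) : Form C := fun s a b =>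
  dualMap (f b) ∘ₗ γ s a b ∘ₗ f a

/-- The chain homotopy `(h; f, f')^%` on the `n`-chains of `Ŵ^% C` (and of `W^% C`) given by
a chain homotopy `h` with `d h + h d = f' - f`. It satisfies
`d (h; f, f')^% + (h; f, f')^% d = f'^% - f^%`. -/
def pushHtpy {C D : Cx A} (n : ℤ) (h : HMap C D) (f f' : GMap C D) (θ : Fam C) : Fam D :=
  fun s p q =>
    h (q - 1) q ∘ₗ θ s p (q - 1) ∘ₗ dualMap (f p) +
    q.negOnePow • (f' q ∘ₗ θ s (p - 1) q ∘ₗ dualMap (h (p - 1) p)) +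
    (n + q + 1).negOnePow •
      (h (q - 1) q ∘ₗ famT θ (s - 1) (p - 1) (q - 1) ∘ₗ dualMap (h (p - 1) p))

/-- The chain homotopy `(h^*; f^*, f'^*)^%` on the `m`-chains of `Ŵ^% D^{0-*}` given by
a chain homotopy `h` with `d h + h d = f' - f : C → D`. -/
def pullHtpy {C D : Cx A} (m : ℤ) (h : HMap C D) (f f' : GMap C D) (γ : Form D) : Form C :=
  fun s a b =>
    b.negOnePow • (dualMap (h b (b + 1)) ∘ₗ γ s a (b + 1) ∘ₗ f a) +
    (a + b).negOnePow • (dualMap (f' b) ∘ₗ γ s (a + 1) b ∘ₗ h a (a + 1)) +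
    (m + a + 1).negOnePow •
      (dualMap (h b (b + 1)) ∘ₗ formT γ (s - 1) (a + 1) (b + 1) ∘ₗ h a (a + 1))

/-- The `n`-fold suspension `S^n : Ŵ^% C^{0-*} → Ŵ^% C^{n-*}`, with components
`(S^n γ)_s = (-1)^{n(n-q)} γ_{s-n} : (C^{n-*})^p = C_{n-p} → (C^{n-*})_q = C^{n-q}`.
The sign makes it a chain map of degree `n`. -/
def susp {C : Cx A} (n : ℤ) (γ : Form C) (s p q : ℤ) :
    C.X (n - p) →ₗ[A] Dual A (C.X (n - q)) :=
  (n * (n - q)).negOnePow • γ (s - n) (n - p) (n - q)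

/-- The chain `G^% (S^n γ)` induced by `G : C^{n-*} → D` from a bundle chain `γ`, with components
`G (S^n γ)_s G^*`. -/
def pushDual {C D : Cx A} (n : ℤ) (G : DMap C D) (γ : Form C) : Fam D := fun s p q =>
  G (n - q) q ∘ₗ susp n γ s p q ∘ₗ adj (G (n - p) p)

/-- The chain `(K; G, G')^% (S^n γ)` for a `0`-chain `γ` of `Ŵ^% C^{0-*}` and a chain homotopy
`K : C^{n-r} → D_{r+1}` with `d K + K d = G' - G : C^{n-*} → D`. -/
def pushDualHtpy {C D : Cx A} (n : ℤ) (K G G' : DMap C D) (γ : Form C) : Fam D :=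
  fun s p q =>
    K (n - (q - 1)) q ∘ₗ susp n γ s p (q - 1) ∘ₗ adj (G (n - p) p) +
    q.negOnePow • (G' (n - q) q ∘ₗ susp n γ s (p - 1) q ∘ₗ adj (K (n - (p - 1)) p)) +
    (n + q + 1).negOnePow • (K (n - (q - 1)) q ∘ₗ
      (((p - 1) * (q - 1)).negOnePow • transp (susp n γ (s - 1) (q - 1) (p - 1))) ∘ₗ
        adj (K (n - (p - 1)) p))

/-- `n`-dimensional symmetric structures: `n`-cycles of `W^% C`. -/
def IsSymStructure {C : Cx A} (n : ℤ) (φ : Fam C) : Prop := IsSym n φ ∧ dHyp n φ = 0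

/-- `n`-dimensional quadratic structures: `n`-cycles of `W_% C`. -/
def IsQuadStructure {C : Cx A} (n : ℤ) (ψ : Fam C) : Prop := IsQuad n ψ ∧ dQuad n ψ = 0

/-- Bundles over `C`: `0`-cycles of `Ŵ^% C^{0-*}`. -/
def IsBundle {C : Cx A} (γ : Form C) : Prop := IsForm 0 γ ∧ dForm 0 γ = 0

/-- An equivalence of bundles `χ : γ → γ'`. -/
def IsBundleEquiv {C : Cx A} (χ γ γ' : Form C) : Prop := IsForm 1 χ ∧ dForm 1 χ = γ' - γ

theorem symStructure_comm {C : Cx A} {n : ℤ} {φ : Fam C} (h : IsSymStructure n φ)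
    (p p' q q' : ℤ) (hp : p' = p + 1) (hq : q' = q + 1) :
    (C.d q' q).hom ∘ₗ φ 0 p q' + q.negOnePow • (φ 0 p' q ∘ₗ dualMap (C.d p' p).hom) = 0 := by
  subst hp hq
  have h1 := congrFun (congrFun (congrFun h.2 0) p) q
  have h2 : φ (0 - 1) = 0 := by
    funext a b
    exact h.1 _ a b (Or.inl (by norm_num))
  have h3 : famT φ (0 - 1) p q = 0 := by
    simp only [famT, h2, adj]
    rw [show (0 : ∀ p q : ℤ, Dual A (C.X p) →ₗ[A] C.X q) q p = 0 from rfl, dualMap_zero]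
    simp
  simp only [dHyp, h3, h2] at h1
  simpa [famD] using h1

/-- The chain map `φ_0 : C^{n-*} → C` of a symmetric structure. -/
def dualityMap {C : Cx A} {n : ℤ} {φ : Fam C} (h : IsSymStructure n φ) : nDual n C ⟶ C where
  f r := ModuleCat.ofHom (φ 0 (n - r) r)
  comm' i j hij := by
    simp only [ComplexShape.down_Rel] at hij
    have h1 := symStructure_comm h (n - i) (n - j) j i (by omega) (by omega)
    have h2 : i.negOnePow = -j.negOnePow := by rw [← hij, Int.negOnePow_succ]
    refine ModuleCat.hom_ext ?_
    rw [add_eq_zero_iff_eq_neg] at h1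
    simp only [ModuleCat.hom_comp, ModuleCat.hom_ofHom, nDual]
    rw [h1, h2, LinearMap.comp_smul, Units.neg_smul]

/-- The complex `∂C`, with `∂C_r = C_{r+1} ⊕ C^{n-r}` and differential
`(x, y) ↦ (d x + (-1)^r φ_0 y, (-1)^r d^* y)`. -/
def bdryCx {C : Cx A} {n : ℤ} {φ : Fam C} (h : IsSymStructure n φ) : Cx A where
  X r := ModuleCat.of A (C.X (r + 1) × Dual A (C.X (n - r)))
  d i j := ModuleCat.ofHom (LinearMap.prod
    ((C.d (i + 1) (j + 1)).hom ∘ₗ LinearMap.fst A (C.X (i + 1)) (Dual A (C.X (n - i))) +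
      i.negOnePow • (φ 0 (n - i) (j + 1) ∘ₗ
        LinearMap.snd A (C.X (i + 1)) (Dual A (C.X (n - i)))))
    (i.negOnePow • (dualMap (C.d (n - j) (n - i)).hom ∘ₗ
      LinearMap.snd A (C.X (i + 1)) (Dual A (C.X (n - i))))))
  shape i j hij := by
    simp only [ComplexShape.down_Rel] at hij
    have h1 : C.d (i + 1) (j + 1) = 0 := C.shape _ _ (by
      simp only [ComplexShape.down_Rel]; omega)
    have h2 : C.d (n - j) (n - i) = 0 := C.shape _ _ (by
      simp only [ComplexShape.down_Rel]; omega)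
    have h3 : φ 0 (n - i) (j + 1) = 0 := h.1 _ _ _ (Or.inr (by omega))
    rw [h1, h2, h3, ModuleCat.hom_zero, ModuleCat.hom_zero, dualMap_zero]
    refine ModuleCat.hom_ext (LinearMap.ext fun x => Prod.ext ?_ ?_) <;> simp
  d_comp_d' i j k hij hjk := by
    simp only [ComplexShape.down_Rel] at hij hjk
    have h1 := d_comp_d_hom C (i + 1) (j + 1) (k + 1)
    have h2 := symStructure_comm h (n - i) (n - j) (k + 1) (j + 1) (by omega) (by omega)
    have h3 : dualMap (C.d (n - k) (n - j)).hom ∘ₗ dualMap (C.d (n - j) (n - i)).hom = 0 := by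
      rw [← dualMap_comp, d_comp_d_hom, dualMap_zero]
    have h4 : (k + 1).negOnePow = j.negOnePow := by rw [hjk]
    have h5 : i.negOnePow = -j.negOnePow := by rw [← hij, Int.negOnePow_succ]
    rw [← ModuleCat.ofHom_comp]
    refine ModuleCat.hom_ext (LinearMap.ext fun x => ?_)
    obtain ⟨x, y⟩ := x
    have e1 := LinearMap.congr_fun h1 x
    have e2 := LinearMap.congr_fun h2 y
    have e3 := LinearMap.congr_fun h3 y
    rw [h4] at e2
    simp only [LinearMap.comp_apply, LinearMap.add_apply, LinearMap.smul_apply,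
      LinearMap.zero_apply] at e1 e2 e3
    rw [add_eq_zero_iff_eq_neg] at e2
    refine Prod.ext ?_ ?_
    · simp [h5, e1, e2]
    · simp [e3]

end Structures

/-! ### Normal complexes -/

section Normal

variable {A : Type u} [Ring A] [StarRing A]

/-- `(C, φ)` is connected: `H_0(φ_0 : C^{n-*} → C) = 0`. -/
def IsConnected {C : Cx A} {n : ℤ} {φ : Fam C} (h : IsSymStructure n φ) : Prop :=
  (cone (dualityMap h)).ExactAt 0

/-- A normal structure `(γ, θ)` on `(C, φ)`: a bundle `γ` over `C` and `θ ∈ (Ŵ^% C)_{n+1}`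
with `J φ - (φ_0)^% (S^n γ) = d θ`. -/
def IsNormalStructure {C : Cx A} (n : ℤ) (φ : Fam C) (γ : Form C) (θ : Fam C) : Prop :=
  IsBundle γ ∧ IsHyp (n + 1) θ ∧ φ - pushDual n (φ 0) γ = dHyp (n + 1) θ

variable (A) in
/-- The data of a normal complex `(C, φ, γ, θ)`. -/
structure NormalData where
  C : Cx A
  φ : Fam C
  γ : Form C
  θ : Fam C

/-- `n`-dimensional normal complexes. -/
structure NormalData.IsNormal (n : ℤ) (X : NormalData A) : Prop where
  dim : IsDim n X.C
  sym : IsSymStructure n X.φ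
  normal : IsNormalStructure n X.φ X.γ X.θ

/-- Connected `n`-dimensional normal complexes. -/
structure NormalData.IsConnNormal (n : ℤ) (X : NormalData A) : Prop extends X.IsNormal n where
  conn : IsConnected sym

/-- The composite `f φ_0 : C^{n-*} → D`. -/
def compL {C D : Cx A} (f : GMap C D) (G : DMap C C) : DMap C D := fun p q => f q ∘ₗ G p q

/-- The composite `f φ_0 f^* : D^{n-*} → D`. -/
def compLR {C D : Cx A} (f : GMap C D) (G : DMap C C) : DMap D D := fun p q =>
  f q ∘ₗ G p q ∘ₗ dualMap (f p)

/-- A map `(f, ξ, χ, η) : X → X'` of `n`-dimensional normal complexes. -/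
structure IsNormalMap (n : ℤ) (X X' : NormalData A) (f : X.C ⟶ X'.C) (ξ : Fam X'.C)
    (χ : Form X.C) (η : Fam X'.C) : Prop where
  sym_chain : IsSym (n + 1) ξ
  sym_equiv : X'.φ - push (comps f) X.φ = dHyp (n + 1) ξ
  bundle_equiv : IsBundleEquiv χ X.γ (pull (comps f) X'.γ)
  hyp_chain : IsHyp (n + 2) η
  hyp_equiv : X'.θ - push (comps f) X.θ - ξ
      + pushDualHtpy n (ξ 0) (compLR (comps f) (X.φ 0)) (X'.φ 0) X'.γ
      + pushDual n (compL (comps f) (X.φ 0)) χ = dHyp (n + 2) η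

/-- Homotopy equivalence of `n`-dimensional normal complexes. -/
def NormalHE (n : ℤ) (X X' : NormalData A) : Prop :=
  ∃ (f : X.C ⟶ X'.C) (ξ : Fam X'.C) (χ : Form X.C) (η : Fam X'.C),
    IsChainEquiv f ∧ IsNormalMap n X X' f ξ χ η

end Normal

/-! ### (Symmetric, quadratic) pairs -/

section Pairs

variable {A : Type u} [Ring A] [StarRing A]

/-- `(C, ψ)` is an `n`-dimensional quadratic Poincaré complex. -/
def IsQuadPoincare (n : ℤ) (C : Cx A) (ψ : Fam C) : Prop :=
  IsDim n C ∧ IsQuadStructure n ψ ∧ ∃ e : HomotopyEquiv (nDual n C) C,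
    ∀ r, (e.hom.f r).hom = oneT ψ 0 (n - r) r

variable (A) in
/-- The data of a (symmetric, quadratic) pair `(f : C → D, (δφ, ψ))`. -/
structure PairData where
  C : Cx A
  D : Cx A
  f : C ⟶ D
  δφ : Fam D
  ψ : Fam C

/-- `n`-dimensional (symmetric, quadratic) pairs: `C` is `(n-1)`-dimensional, `D` is
`n`-dimensional, and `(δφ, ψ)` is an `n`-cycle of the mapping cone of
`(1 + T) f_% : W_% C → W^% D`. -/
structure PairData.IsPair (n : ℤ) (P : PairData A) : Prop where
  dimC : IsDim (n - 1) P.C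
  dimD : IsDim n P.D
  sym_chain : IsSym n P.δφ
  quad : IsQuadStructure (n - 1) P.ψ
  cycle : dHyp n P.δφ + (n - 1).negOnePow • push (comps P.f) (oneT P.ψ) = 0

/-- The morphism `(δφ_0, (-1)^{n-r} (1 + T) ψ_0 f^*) : D^{n-r} → C(f)_r = D_r ⊕ C_{r-1}`. -/
def PairData.dualityComp (n : ℤ) (P : PairData A) (r : ℤ) :
    Dual A (P.D.X (n - r)) →ₗ[A] P.D.X r × P.C.X (r - 1) :=
  LinearMap.prod (P.δφ 0 (n - r) r)
    ((n - r).negOnePow • (oneT P.ψ 0 (n - r) (r - 1) ∘ₗ dualMap (comps P.f (n - r))))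

/-- `n`-dimensional (symmetric, quadratic) Poincaré pairs: the duality chain map
`D^{n-*} → C(f)` is a chain equivalence. -/
structure PairData.IsPoincare (n : ℤ) (P : PairData A) : Prop extends P.IsPair n where
  duality : ∃ e : HomotopyEquiv (nDual n P.D) (cone P.f),
    ∀ r, (e.hom.f r).hom = P.dualityComp n r

/-- A map `(g, h; k)` of pairs (`k` a homotopy from `h f` to `f' g`) together with an equivalence
`(δξ, ξ)` from the image of `(δφ, ψ)` to `(δφ', ψ')`. -/
structure IsPairMap (n : ℤ) (P P' : PairData A) (g : P.C ⟶ P'.C) (h : P.D ⟶ P'.D)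
    (k : Homotopy (g ≫ P'.f) (P.f ≫ h)) (δξ : Fam P'.D) (ξ : Fam P'.C) : Prop where
  sym_chain : IsSym (n + 1) δξ
  quad_chain : IsQuad n ξ
  quad_equiv : P'.ψ - push (comps g) P.ψ = dQuad n ξ
  sym_equiv : P'.δφ - (push (comps h) P.δφ + n.negOnePow •
      pushHtpy (n - 1) (hcomps k) (comps (P.f ≫ h)) (comps (g ≫ P'.f)) (oneT P.ψ)) =
    dHyp (n + 1) δξ + n.negOnePow • push (comps P'.f) (oneT ξ)

/-- Homotopy equivalence of `n`-dimensional (symmetric, quadratic) pairs. -/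
def PairHE (n : ℤ) (P P' : PairData A) : Prop :=
  ∃ (g : P.C ⟶ P'.C) (h : P.D ⟶ P'.D) (k : Homotopy (g ≫ P'.f) (P.f ≫ h)) (δξ : Fam P'.D)
    (ξ : Fam P'.C), IsChainEquiv g ∧ IsChainEquiv h ∧ IsPairMap n P P' g h k δξ ξ

/-! The pair of a connected normal complex. -/

/-- The projection `i_C = (0 1) : ∂C_r = C_{r+1} ⊕ C^{n-r} → C^{n-r}`. -/
def bdryProj {C : Cx A} {n : ℤ} {φ : Fam C} (h : IsSymStructure n φ) :
    bdryCx h ⟶ nDual n C where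
  f r := ModuleCat.ofHom (LinearMap.snd A (C.X (r + 1)) (Dual A (C.X (n - r))))
  comm' _ _ _ := rfl

/-- The first component `C^{p+1}` of `∂C^p = C^{p+1} ⊕ C_{n-p}`. -/
def bdryDualFst {C : Cx A} {n : ℤ} {φ : Fam C} (h : IsSymStructure n φ) (p : ℤ) :
    Dual A ((bdryCx h).X p) →ₗ[A] Dual A (C.X (p + 1)) :=
  dualMap (LinearMap.inl A (C.X (p + 1)) (Dual A (C.X (n - p))))

/-- The second component `C_{n-p}` of `∂C^p = C^{p+1} ⊕ C_{n-p}`. -/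
def bdryDualSnd {C : Cx A} {n : ℤ} {φ : Fam C} (h : IsSymStructure n φ) (p : ℤ) :
    Dual A ((bdryCx h).X p) →ₗ[A] C.X (n - p) :=
  unev ∘ₗ dualMap (LinearMap.inr A (C.X (p + 1)) (Dual A (C.X (n - p))))

/-- The quadratic structure on `∂C`: `ψ_s : C^{p+1} ⊕ C_{n-p} → C_{q+1} ⊕ C^{n-q}`
(`p + q = n - 1 - s`) is the matrix
`((-1)^{n+p+1} θ_{-s}, 0; (-1)^{(n+1)s+n(p+1)} γ_{-n-s} φ_0^*, (-1)^{n+sp} γ_{-n-s-1}^*)`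
for `s ≥ 1`, and the same matrix with the additional entry `-1 : C^{p+1} → C^{n-q}` in the lower
left hand corner for `s = 0`. -/
def bdryψ {C : Cx A} {n : ℤ} {φ : Fam C} (h : IsSymStructure n φ) (γ : Form C) (θ : Fam C) :
    Fam (bdryCx h) := fun s p q =>
  if s < 0 then 0 else
    (LinearMap.prod
      ((n + p + 1).negOnePow • (θ (-s) (p + 1) (q + 1) ∘ₗ bdryDualFst h p))
      ((((n + 1) * s + n * (p + 1)).negOnePow •
          (γ (-n - s) (n - (p + 1)) (n - q) ∘ₗ adj (φ 0 (n - (p + 1)) (p + 1))) -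
        (if s = 0 then dualMap (idMap C (n - q) (p + 1)) else 0)) ∘ₗ bdryDualFst h p +
        (n + s * p).negOnePow • (transp (γ (-n - s - 1) (n - q) (n - p)) ∘ₗ bdryDualSnd h p)) :
      Dual A ((bdryCx h).X p) →ₗ[A] C.X (q + 1) × Dual A (C.X (n - q)))

/-- The symmetric structure `δφ_s = (S^n γ)_s = (-1)^{n(n-q)} γ_{s-n} : C_{n-p} → C^{n-q}`,
`s ≥ 0`, on `C^{n-*}`. -/
def bdryδφ {C : Cx A} (n : ℤ) (γ : Form C) : Fam (nDual n C) := fun s p q =>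
  if s < 0 then 0 else (susp n γ s p q ∘ₗ unev : Dual A (Dual A (C.X (n - p))) →ₗ[A] _)

/-- The pair `(i_C : ∂C → C^{n-*}, (δφ, ψ))` of a normal complex. -/
def NormalData.bdryPair {n : ℤ} (X : NormalData A) (h : IsSymStructure n X.φ) : PairData A where
  C := bdryCx h
  D := nDual n X.C
  f := bdryProj h
  δφ := bdryδφ n X.γ
  ψ := bdryψ h X.γ X.θ

/-! The normal complex of a pair. -/

/-- The first component `D^p` of `C(f)^p = D^p ⊕ C^{p-1}`. -/
def coneDualFst {C D : Cx A} (f : C ⟶ D) (p : ℤ) : Dual A ((cone f).X p) →ₗ[A] Dual A (D.X p) :=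
  dualMap (LinearMap.inl A (D.X p) (C.X (p - 1)))

/-- The second component `C^{p-1}` of `C(f)^p = D^p ⊕ C^{p-1}`. -/
def coneDualSnd {C D : Cx A} (f : C ⟶ D) (p : ℤ) :
    Dual A ((cone f).X p) →ₗ[A] Dual A (C.X (p - 1)) :=
  dualMap (LinearMap.inr A (D.X p) (C.X (p - 1)))

/-- The symmetric structure on `C(f)`, with
`φ_s : C(f)^p = D^p ⊕ C^{p-1} → C(f)_q = D_q ⊕ C_{q-1}` given by
`(δφ_0, 0; (-1)^{n-q} (1+T)ψ_0 f^*, 0)` for `s = 0`,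
`(δφ_1, 0; 0, (-1)^{n-q+1} (1+T)ψ_0)` for `s = 1` and `(δφ_s, 0; 0, 0)` for `s ≥ 2`. -/
def PairData.thomφ (n : ℤ) (P : PairData A) : Fam (cone P.f) := fun s p q =>
  (LinearMap.prod (P.δφ s p q ∘ₗ coneDualFst P.f p)
    (if s = 0 then (n - q).negOnePow •
        (oneT P.ψ 0 p (q - 1) ∘ₗ dualMap (comps P.f p) ∘ₗ coneDualFst P.f p)
      else if s = 1 then (n - q + 1).negOnePow •
        (oneT P.ψ 0 (p - 1) (q - 1) ∘ₗ coneDualSnd P.f p)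
      else 0) : Dual A ((cone P.f).X p) →ₗ[A] P.D.X q × P.C.X (q - 1))

/-- The chain map `(δφ_0, f (1+T)ψ_0) : C(f)^{n-*} → D`, a chain equivalence for a Poincaré
pair. -/
def PairData.evD (P : PairData A) : DMap (cone P.f) P.D := fun p q =>
  P.δφ 0 p q ∘ₗ coneDualFst P.f p +
    comps P.f q ∘ₗ oneT P.ψ 0 (p - 1) q ∘ₗ coneDualSnd P.f p

/-- The hyperquadratic structure `α` on `D`: `α_s = δφ_s` for `s ≥ 0` and
`α_s = f ψ_{-s-1} f^*` for `s < 0`. -/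
def PairData.α (P : PairData A) : Fam P.D := P.δφ + push (comps P.f) (hyp P.ψ)

/-- A normal structure `(γ, θ)` on a (symmetric, quadratic) pair: a bundle `γ` over `C(f)` and
`θ ∈ (Ŵ^% D)_{n+1}` with `α - (δφ_0, f (1+T)ψ_0)^% (S^n γ) = d θ`. -/
def PairData.IsNormalStr (n : ℤ) (P : PairData A) (γ : Form (cone P.f)) (θ : Fam P.D) : Prop :=
  IsBundle γ ∧ IsHyp (n + 1) θ ∧ P.α - pushDual n P.evD γ = dHyp (n + 1) θ

/-- Equivalence of normal structures on a pair. -/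
def PairData.NormalStrEquiv (n : ℤ) (P : PairData A) (γ : Form (cone P.f)) (θ : Fam P.D)
    (γ' : Form (cone P.f)) (θ' : Fam P.D) : Prop :=
  ∃ (χ : Form (cone P.f)) (η : Fam P.D), IsBundleEquiv χ γ γ' ∧ IsHyp (n + 2) η ∧
    θ - θ' - pushDual n P.evD χ = dHyp (n + 2) η

/-- The inclusion `e : D → C(f)`. -/
def coneInl {C D : Cx A} (f : C ⟶ D) : GMap D (cone f) := fun i =>
  LinearMap.inl A (D.X i) (C.X (i - 1))

/-- The null-homotopy `y ↦ (0, (-1)^{i+1} y)`, `C_i → C(f)_{i+1} = D_{i+1} ⊕ C_i`, of `e f`. -/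
def coneNull {C D : Cx A} (f : C ⟶ D) : HMap C (cone f) := fun i j =>
  j.negOnePow • (LinearMap.inr A (D.X j) (C.X (j - 1)) ∘ₗ idMap C i (j - 1))

/-- The chain homotopy `(0, 0; 0, (-1)^q (1+T)ψ_0) : C(f)^p → C(f)_q`, `p + q = n + 1`, between
`e ∘ (δφ_0, f (1+T)ψ_0)` and `φ_0`. -/
def PairData.thomHtpy (P : PairData A) : DMap (cone P.f) (cone P.f) := fun p q =>
  LinearMap.inr A (P.D.X q) (P.C.X (q - 1)) ∘ₗ
    (q.negOnePow • (oneT P.ψ 0 (p - 1) (q - 1) ∘ₗ coneDualSnd P.f p))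

/-- The connected normal complex `(C(f), φ, γ, θ)` of a Poincaré pair with normal structure
`(γ, θ_D)`: the equivalence `θ` is the sum of the equivalences `Jφ ∼ e^% α`,
`e^% α ∼ (e (δφ_0, f (1+T)ψ_0))^% (S^n γ)` and
`(e (δφ_0, f (1+T)ψ_0))^% (S^n γ) ∼ (φ_0)^% (S^n γ)`. -/
def PairData.thom (n : ℤ) (P : PairData A) (γ : Form (cone P.f)) (θ : Fam P.D) :
    NormalData A where
  C := cone P.f
  φ := P.thomφ n
  γ := γ
  θ := pushHtpy n (coneNull P.f) (fun i => coneInl P.f i ∘ₗ comps P.f i) 0 (hyp P.ψ)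
    + push (coneInl P.f) θ
    - pushDualHtpy n P.thomHtpy (fun p q => coneInl P.f q ∘ₗ P.evD p q) (P.thomφ n 0) γ

end Pairs

/-! ### `(B, β)`-normal complexes and pairs -/

section Bundles

variable {A : Type u} [Ring A] [StarRing A]

/-- The data of a `(B, β)`-normal complex `(C, φ, γ, θ, g, χ)`. -/
structure BNormalData (B : Cx A) extends NormalData A where
  g : C ⟶ B
  χ : Form C

/-- Connected `n`-dimensional `(B, β)`-normal complexes: `(g, χ) : (C, γ) → (B, β)` is a map of
chain bundles. -/
structure BNormalData.IsConnNormal (n : ℤ) {B : Cx A} (β : Form B) (X : BNormalData B) :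
    Prop where
  conn_normal : X.toNormalData.IsConnNormal n
  bundle_map : IsBundleEquiv X.χ X.γ (pull (comps X.g) β)

/-- A homotopy of chain bundle maps `(h, μ) : (g, χ) ≃ (g', χ') : (C, γ) → (B, β)`. -/
def IsBundleHtpy {C B : Cx A} (β : Form B) (g : C ⟶ B) (χ : Form C) (g' : C ⟶ B) (χ' : Form C)
    (h : Homotopy g' g) (μ : Form C) : Prop :=
  IsForm 2 μ ∧ χ - χ' + pullHtpy 0 (hcomps h) (comps g) (comps g') β = - dForm 2 μ

/-- Homotopy equivalence of `n`-dimensional `(B, β)`-normal complexes. -/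
def BNormalHE (n : ℤ) {B : Cx A} (β : Form B) (X X' : BNormalData B) : Prop :=
  ∃ (f : X.C ⟶ X'.C) (ξ : Fam X'.C) (χ : Form X.C) (η : Fam X'.C)
    (h : Homotopy (f ≫ X'.g) X.g) (μ : Form X.C),
    IsChainEquiv f ∧ IsNormalMap n X.toNormalData X'.toNormalData f ξ χ η ∧
      IsBundleHtpy β X.g X.χ (f ≫ X'.g) (χ + pull (comps f) X'.χ) h μ

/-- The data of a (symmetric, quadratic) `(B, β)`-normal pair: a pair, a normal structure
`(γ, θ)` on it, and a map of chain bundles `(g, χ) : (C(f), γ) → (B, β)`. -/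
structure BPairData (B : Cx A) extends PairData A where
  γ : Form (cone f)
  θ : Fam D
  g : cone f ⟶ B
  χ : Form (cone f)

/-- `n`-dimensional (symmetric, quadratic) `(B, β)`-normal Poincaré pairs. -/
structure BPairData.IsPoincare (n : ℤ) {B : Cx A} (β : Form B) (P : BPairData B) : Prop where
  poincare : P.toPairData.IsPoincare n
  normal : P.toPairData.IsNormalStr n P.γ P.θ
  bundle_map : IsBundleEquiv P.χ P.γ (pull (comps P.g) β)

/-- The chain map `C(f) → C(f')`, `(x, y) ↦ (h x + (-1)^r k y, g y)`, induced by
`g : C → C'`, `h : D → D'` and a homotopy `k` from `h f` to `f' g`. -/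
def coneMap {C D C' D' : Cx A} {f : C ⟶ D} {f' : C' ⟶ D'} (g : C ⟶ C') (h : D ⟶ D')
    (k : Homotopy (g ≫ f') (f ≫ h)) : cone f ⟶ cone f' where
  f r := ModuleCat.ofHom (LinearMap.prod
    (comps h r ∘ₗ LinearMap.fst A (D.X r) (C.X (r - 1)) +
      r.negOnePow • (hcomps k (r - 1) r ∘ₗ LinearMap.snd A (D.X r) (C.X (r - 1))))
    (comps g (r - 1) ∘ₗ LinearMap.snd A (D.X r) (C.X (r - 1))))
  comm' i j hij := by
    simp only [ComplexShape.down_Rel] at hij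
    have h1 := hcomps_comm k (show i - 1 = j by omega) (show (j - 1) + 1 = i - 1 by omega)
      (show i - 1 + 1 = i by omega)
    rw [(tot_comp g f' (show i - 1 = j by omega)).2,
      (tot_comp f h (show i - 1 = j by omega)).1] at h1
    have h2 := congrArg ModuleCat.Hom.hom (h.comm i j)
    have h3 := congrArg ModuleCat.Hom.hom (g.comm (i - 1) (j - 1))
    have h4 : i.negOnePow = -j.negOnePow := by rw [← hij, Int.negOnePow_succ]
    have h5 : (i - 1).negOnePow = j.negOnePow := by rw [← hij, add_sub_cancel_right]
    refine ModuleCat.hom_ext (LinearMap.ext fun x => ?_)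
    obtain ⟨x, y⟩ := x
    have e1 := LinearMap.congr_fun h1 y
    have e2 := LinearMap.congr_fun h2 x
    have e3 := LinearMap.congr_fun h3 y
    simp only [ModuleCat.hom_comp, LinearMap.comp_apply, LinearMap.add_apply] at e1 e2 e3
    refine Prod.ext ?_ ?_
    · change (D'.d i j).hom ((h.f i).hom x + i.negOnePow • hcomps k (i - 1) i y) +
          (i - 1).negOnePow • tot f' (i - 1) j (comps g (i - 1) y) =
        (h.f j).hom ((D.d i j).hom x + (i - 1).negOnePow • tot f (i - 1) j y) +
          j.negOnePow • hcomps k (j - 1) j ((C.d (i - 1) (j - 1)).hom y)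
      rw [h4, h5, e1, map_add, map_add, e2]
      simp only [Units.neg_smul, map_neg, LinearMap.map_smul_of_tower, smul_add, comps]
      abel
    · exact e3

/-- The part of the equivalence of `α` structures determined by a map of pairs:
`α' - h^% α = d (pairMapα)`. -/
def pairMapα (n : ℤ) {P P' : PairData A} {g : P.C ⟶ P'.C} {h : P.D ⟶ P'.D}
    (k : Homotopy (g ≫ P'.f) (P.f ≫ h)) (δξ : Fam P'.D) (ξ : Fam P'.C) : Fam P'.D :=
  δξ + push (comps P'.f) (hyp ξ) +
    pushHtpy n (hcomps k) (comps (P.f ≫ h)) (comps (g ≫ P'.f)) (hyp P.ψ)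

/-- The chain homotopy `h ∘ (δφ_0, f (1+T)ψ_0) ∘ c^* ≃ (δφ'_0, f' (1+T)ψ'_0) : C(f')^{n-*} → D'`
determined by a map of pairs, with `c : C(f) → C(f')` the induced map. -/
def pairMapHtpy {P P' : PairData A} {g : P.C ⟶ P'.C} {h : P.D ⟶ P'.D}
    (k : Homotopy (g ≫ P'.f) (P.f ≫ h)) (δξ : Fam P'.D) (ξ : Fam P'.C) :
    DMap (cone P'.f) P'.D := fun p q =>
  (δξ 0 p q + p.negOnePow • (hcomps k (q - 1) q ∘ₗ oneT P.ψ 0 (p - 1) (q - 1) ∘ₗ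
      dualMap (hcomps k (p - 1) p))) ∘ₗ coneDualFst P'.f p +
    (hcomps k (q - 1) q ∘ₗ oneT P.ψ 0 (p - 1) (q - 1) ∘ₗ dualMap (comps g (p - 1)) +
      comps P'.f q ∘ₗ oneT ξ 0 (p - 1) q) ∘ₗ coneDualSnd P'.f p

/-- A map of `n`-dimensional (symmetric, quadratic) pairs with normal structures: a map of pairs,
an equivalence `ζ : γ → c^* γ'` of bundles over `C(f)` and an equivalence `η` relating `θ` and
`θ'`. -/
structure IsNormalPairMap (n : ℤ) (P P' : PairData A) (γ : Form (cone P.f)) (θ : Fam P.D)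
    (γ' : Form (cone P'.f)) (θ' : Fam P'.D) (g : P.C ⟶ P'.C) (h : P.D ⟶ P'.D)
    (k : Homotopy (g ≫ P'.f) (P.f ≫ h)) (δξ : Fam P'.D) (ξ : Fam P'.C)
    (ζ : Form (cone P.f)) (η : Fam P'.D) : Prop where
  pair_map : IsPairMap n P P' g h k δξ ξ
  bundle_equiv : IsBundleEquiv ζ γ (pull (comps (coneMap g h k)) γ')
  hyp_chain : IsHyp (n + 2) η
  hyp_equiv : θ' - push (comps h) θ - pairMapα n k δξ ξ
      + pushDualHtpy n (pairMapHtpy k δξ ξ)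
          (fun p q => comps h q ∘ₗ P.evD p q ∘ₗ dualMap (comps (coneMap g h k) p)) P'.evD γ'
      + pushDual n (fun p q => comps h q ∘ₗ P.evD p q) ζ = dHyp (n + 2) η

/-- Homotopy equivalence of `n`-dimensional (symmetric, quadratic) `(B, β)`-normal pairs. -/
def BPairHE (n : ℤ) {B : Cx A} (β : Form B) (P P' : BPairData B) : Prop :=
  ∃ (g : P.C ⟶ P'.C) (h : P.D ⟶ P'.D) (k : Homotopy (g ≫ P'.f) (P.f ≫ h)) (δξ : Fam P'.D)
    (ξ : Fam P'.C) (ζ : Form (cone P.f)) (η : Fam P'.D)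
    (l : Homotopy (coneMap g h k ≫ P'.g) P.g) (μ : Form (cone P.f)),
    IsChainEquiv g ∧ IsChainEquiv h ∧
      IsNormalPairMap n P.toPairData P'.toPairData P.γ P.θ P'.γ P'.θ g h k δξ ξ ζ η ∧
      IsBundleHtpy β P.g P.χ (coneMap g h k ≫ P'.g)
        (ζ + pull (comps (coneMap g h k)) P'.χ) l μ

/-- The `(B, β)`-normal complex of a (symmetric, quadratic) `(B, β)`-normal Poincaré pair. -/
def BPairData.thom (n : ℤ) {B : Cx A} (P : BPairData B) : BNormalData B where
  toNormalData := P.toPairData.thom n P.γ P.θ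
  g := P.g
  χ := P.χ

end Bundles

/-! ### Homotopy equivalence classes -/

section Classes

/-- Homotopy equivalence classes of connected `n`-dimensional normal complexes over `A`. -/
def NormalClass (A : Type u) [Ring A] [StarRing A] (n : ℤ) : Type (u + 1) :=
  Quot fun X X' : {X : NormalData A // X.IsConnNormal n} => NormalHE n X.1 X'.1

/-- Homotopy equivalence classes of `n`-dimensional (symmetric, quadratic) Poincaré pairs. -/
def PairClass (A : Type u) [Ring A] [StarRing A] (n : ℤ) : Type (u + 1) :=
  Quot fun P P' : {P : PairData A // P.IsPoincare n} => PairHE n P.1 P'.1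

variable {A : Type u} [Ring A] [StarRing A]

/-- Homotopy equivalence classes of connected `n`-dimensional `(B, β)`-normal complexes. -/
def BNormalClass (n : ℤ) {B : Cx A} (β : Form B) : Type (u + 1) :=
  Quot fun X X' : {X : BNormalData B // X.IsConnNormal n β} => BNormalHE n β X.1 X'.1

/-- Homotopy equivalence classes of `n`-dimensional (symmetric, quadratic) `(B, β)`-normal
Poincaré pairs. -/
def BPairClass (n : ℤ) {B : Cx A} (β : Form B) : Type (u + 1) :=
  Quot fun P P' : {P : BPairData B // P.IsPoincare n β} => BPairHE n β P.1 P'.1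

end Classes

end

end APC

namespace APC

set_option linter.unusedSectionVars false
set_option linter.unusedSimpArgs false

noncomputable section

open LinearMap (comp_zero zero_comp smul_comp comp_smul comp_assoc add_comp comp_add)
open Int (negOnePow_add negOnePow_sub negOnePow_one negOnePow_succ
  negOnePow_zero negOnePow_even negOnePow_neg)

variable {A : Type u} [Ring A] [StarRing A]

section Adjoints

variable {M N M' N' : Type u} [AddCommGroup M] [Module A M] [AddCommGroup N] [Module A N]
  [AddCommGroup M'] [Module A M'] [AddCommGroup N'] [Module A N']

theorem dualMap_add (f g : M →ₗ[A] N) : dualMap (f + g) = dualMap f + dualMap g := by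
  ext φ x; exact map_add φ _ _

theorem dualMap_neg (f : M →ₗ[A] N) : dualMap (-f) = -dualMap f := by
  rw [eq_neg_iff_add_eq_zero, ← dualMap_add, neg_add_cancel, dualMap_zero]

theorem dualMap_sub (f g : M →ₗ[A] N) : dualMap (f - g) = dualMap f - dualMap g := by
  rw [sub_eq_add_neg, dualMap_add, dualMap_neg, ← sub_eq_add_neg]

theorem dualMap_usmul (e : ℤˣ) (f : M →ₗ[A] N) : dualMap (e • f) = e • dualMap f := by
  rcases Int.units_eq_one_or e with rfl | rfl
  · simp
  · simp [dualMap_neg]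

theorem dualMap_id : dualMap (LinearMap.id : M →ₗ[A] M) = LinearMap.id := rfl

theorem unev_ev [Module.Finite A M] [Module.Projective A M] (x : M) :
    unev (ev x : Dual A (Dual A M)) = x := by
  rw [unev, dif_pos ev_bijective]
  exact (LinearEquiv.ofBijective ev ev_bijective).symm_apply_apply x

theorem ev_unev [Module.Finite A M] [Module.Projective A M] (F : Dual A (Dual A M)) :
    ev (unev F) = F := by
  rw [unev, dif_pos ev_bijective]
  exact (LinearEquiv.ofBijective ev ev_bijective).apply_symm_apply F

theorem unev_comp_ev [Module.Finite A M] [Module.Projective A M] :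
    (unev ∘ₗ ev : M →ₗ[A] M) = LinearMap.id := LinearMap.ext unev_ev

theorem ev_comp_unev [Module.Finite A M] [Module.Projective A M] :
    (ev ∘ₗ unev : Dual A (Dual A M) →ₗ[A] _) = LinearMap.id := LinearMap.ext ev_unev

theorem dualMap_dualMap_ev (f : M →ₗ[A] N) (x : M) : dualMap (dualMap f) (ev x) = ev (f x) := rfl

theorem unev_dualMap_dualMap [Module.Finite A M] [Module.Projective A M] [Module.Finite A N]
    [Module.Projective A N] (f : M →ₗ[A] N) :
    unev ∘ₗ dualMap (dualMap f) = f ∘ₗ unev := by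
  ext F
  obtain ⟨x, rfl⟩ := ev_bijective.2 F
  simp only [LinearMap.comp_apply, dualMap_dualMap_ev, unev_ev]

theorem dualMap_unev [Module.Finite A M] [Module.Projective A M] :
    dualMap (unev : Dual A (Dual A M) →ₗ[A] M) = ev := by
  ext f F
  obtain ⟨x, rfl⟩ := ev_bijective.2 F
  rw [dualMap_apply, unev_ev]
  simp

theorem adj_comp_dualMap [Module.Finite A M] [Module.Projective A M] [Module.Finite A M']
    [Module.Projective A M'] (g : N →ₗ[A] N') (φ : Dual A M →ₗ[A] N) (f : M →ₗ[A] M') :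
    adj (g ∘ₗ φ ∘ₗ dualMap f) = f ∘ₗ adj φ ∘ₗ dualMap g := by
  rw [adj, adj, dualMap_comp, dualMap_comp, ← comp_assoc, ← comp_assoc,
    unev_dualMap_dualMap]
  rfl

theorem adj_comp (g : N →ₗ[A] N') (φ : Dual A M →ₗ[A] N) :
    adj (g ∘ₗ φ) = adj φ ∘ₗ dualMap g := rfl

theorem adj_comp_dualMap' [Module.Finite A M] [Module.Projective A M] [Module.Finite A M']
    [Module.Projective A M'] (φ : Dual A M →ₗ[A] N) (f : M →ₗ[A] M') :
    adj (φ ∘ₗ dualMap f) = f ∘ₗ adj φ := adj_comp_dualMap LinearMap.id φ f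

theorem adj_add (φ φ' : Dual A M →ₗ[A] N) : adj (φ + φ') = adj φ + adj φ' := by
  rw [adj, dualMap_add, comp_add]; rfl

theorem adj_zero : adj (0 : Dual A M →ₗ[A] N) = 0 := by
  rw [adj, dualMap_zero, comp_zero]

theorem adj_neg (φ : Dual A M →ₗ[A] N) : adj (-φ) = - adj φ := by
  rw [adj, dualMap_neg, LinearMap.comp_neg]; rfl

theorem adj_usmul (e : ℤˣ) (φ : Dual A M →ₗ[A] N) : adj (e • φ) = e • adj φ := by
  rw [adj, dualMap_usmul, comp_smul]; rfl

theorem adj_adj [Module.Finite A M] [Module.Projective A M] [Module.Finite A N]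
    [Module.Projective A N] (φ : Dual A M →ₗ[A] N) : adj (adj φ) = φ := by
  rw [adj, adj, dualMap_comp, dualMap_unev]
  ext f
  change unev (dualMap (dualMap φ) (ev f)) = φ f
  rw [dualMap_dualMap_ev, unev_ev]

/-- The dual of a free module of finite rank is free. -/
def dualPi (n : ℕ) : Dual A (Fin n → A) ≃ₗ[A] (Fin n → A) where
  toFun f k := star (f (Pi.single k 1))
  map_add' f g := by ext k; simp
  map_smul' a f := by ext k; simp
  invFun a := LinearMap.mk ⟨fun x => ∑ k, x k * star (a k), fun x y => by
    simp [add_mul, Finset.sum_add_distrib]⟩ fun c x => by simp [Finset.mul_sum, mul_assoc]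
  left_inv f := by
    ext x
    change ∑ k, x k * star (star (f (Pi.single k 1))) = f x
    conv_rhs => rw [pi_eq_sum_univ' x, map_sum]
    simp
  right_inv a := by
    ext k
    change star (∑ j, (Pi.single k 1 : Fin n → A) j * star (a j)) = a k
    simp [Pi.single_apply]

theorem dual_finite_projective [Module.Finite A M] [Module.Projective A M] :
    Module.Finite A (Dual A M) ∧ Module.Projective A (Dual A M) := by
  obtain ⟨n, p, i, -, -, hpi⟩ := Module.Finite.exists_comp_eq_id_of_projective A M
  have h : dualMap i ∘ₗ dualMap p = LinearMap.id := by
    rw [← dualMap_comp, hpi, dualMap_id]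
  have := Module.Finite.equiv (dualPi (A := A) n).symm
  have := Module.Projective.of_equiv (dualPi (A := A) n).symm
  exact ⟨Module.Finite.of_surjective (dualMap i) fun x =>
    ⟨dualMap p x, LinearMap.congr_fun h x⟩, Module.Projective.of_split _ _ h⟩

instance [Module.Finite A M] [Module.Projective A M] : Module.Finite A (Dual A M) :=
  dual_finite_projective.1

instance [Module.Finite A M] [Module.Projective A M] : Module.Projective A (Dual A M) :=
  dual_finite_projective.2

theorem adj_comp_unev [Module.Finite A M] [Module.Projective A M] [Module.Finite A N]
    [Module.Projective A N] (γ : M →ₗ[A] Dual A N) :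
    adj (γ ∘ₗ unev) = transp γ ∘ₗ unev := by
  rw [adj, dualMap_comp, dualMap_unev, transp, comp_assoc, ev_comp_unev,
    ← comp_assoc, unev_comp_ev]
  rfl

end Adjoints

/-- Complexes of finitely generated projective modules. -/
class FinCx {A : Type u} [Ring A] (C : Cx A) : Prop where
  finite : ∀ i, Module.Finite A (C.X i)
  projective : ∀ i, Module.Projective A (C.X i)

section Ops

variable {A : Type u} [Ring A]

instance (C : Cx A) [FinCx C] (i : ℤ) : Module.Finite A (C.X i) := FinCx.finite i
instance (C : Cx A) [FinCx C] (i : ℤ) : Module.Projective A (C.X i) := FinCx.projective i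

open DirectSum

theorem dsum_induct {M : ℤ → Type u} [∀ i, AddCommMonoid (M i)] {p : (⨁ i, M i) → Prop}
    (of : ∀ i x, p (DirectSum.of M i x)) (zero : p 0 := by simp)
    (add : ∀ x y, p x → p y → p (x + y) := by
      intro x y hx hy
      first
        | simp only [map_add, hx, hy]; done
        | simp only [map_add, hx, hy, add_zero]; done
        | simp only [map_add, hx, hy]; abel1
        | simp only [map_add, hx, hy, smul_add]; done
        | simp only [map_add, hx, hy, smul_add]; abel1) (x) : p x :=
  DirectSum.induction_on x zero of add

theorem sgn_cases (n : ℤ) : n.negOnePow = 1 ∨ n.negOnePow = -1 := Int.units_eq_one_or _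

/-- The rules for the evaluation of signs. -/
theorem sign_simps : (∀ a b : ℤ, (a + b).negOnePow = a.negOnePow * b.negOnePow) ∧
    (∀ a b : ℤ, (a - b).negOnePow = a.negOnePow * b.negOnePow) ∧
    (∀ a : ℤ, (-a).negOnePow = a.negOnePow) ∧ Int.negOnePow 1 = -1 ∧ Int.negOnePow 0 = 1 ∧
    (∀ e : ℤˣ, 1 * e = e) ∧ (∀ e : ℤˣ, e * 1 = e) ∧ (∀ e f : ℤˣ, e * -f = -(e * f)) ∧
    (∀ e f : ℤˣ, -e * f = -(e * f)) ∧ ∀ e : ℤˣ, - -e = e :=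
  ⟨negOnePow_add, negOnePow_sub, negOnePow_neg, negOnePow_one,
    negOnePow_zero, one_mul, mul_one, mul_neg, neg_mul, neg_neg⟩

/-- The rules for the multiplication with signs. -/
theorem smul_simps (M : Type u) [AddCommGroup M] : (∀ x : M, (1 : ℤˣ) • x = x) ∧
    (∀ x : M, - -x = x) ∧ (∀ (e : ℤˣ) (x : M), -e • x = -(e • x)) ∧
    (∀ (e : ℤˣ) (x : M), e • -x = -(e • x)) ∧
    (∀ (e : ℤˣ) (x y : M), e • (x + y) = e • x + e • y) ∧
    ∀ (e : ℤˣ) (x y : M), e • (x - y) = e • x - e • y :=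
  ⟨one_smul _, neg_neg, Units.neg_smul, smul_neg, smul_add, smul_sub⟩

section Hat

variable {X Y : ℤ → Type u} [∀ i, AddCommGroup (X i)] [∀ i, Module A (X i)]
  [∀ i, AddCommGroup (Y i)] [∀ i, Module A (Y i)]

/-- The additive map of direct sums with components `a i (ρ i)`. -/
def hat (ρ : ℤ → ℤ) (a : ∀ i j, X i →ₗ[A] Y j) : (⨁ i, X i) →+ ⨁ i, Y i :=
  DirectSum.toAddMonoid fun i => (DirectSum.of Y (ρ i)).comp (a i (ρ i)).toAddMonoidHom

theorem hat_of {ρ : ℤ → ℤ} {a : ∀ i j, X i →ₗ[A] Y j} {i : ℤ} (j : ℤ) (h : j = ρ i) (x : X i) :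
    hat ρ a (DirectSum.of X i x) = DirectSum.of Y j (a i j x) := by
  subst h; simp [hat]

/-- The grading involution, multiplication by `(-1)^i` in degree `i`. -/
def eps {X : ℤ → Type u} [∀ i, AddCommGroup (X i)] : (⨁ i, X i) →+ ⨁ i, X i :=
  DirectSum.toAddMonoid fun i => i.negOnePow • DirectSum.of X i

theorem eps_of (i : ℤ) (x : X i) :
    eps (DirectSum.of X i x) = i.negOnePow • DirectSum.of X i x := by
  simp only [eps, toAddMonoid_of]; rfl

theorem map_usmul {G H : Type*} [AddCommGroup G] [AddCommGroup H] (f : G →+ H) (e : ℤˣ)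
    (x : G) : f (e • x) = e • f x := by
  rcases Int.units_eq_one_or e with rfl | rfl <;> simp

theorem hom_simps {G H : Type u} [AddCommGroup G] [AddCommGroup H] (f : G →+ H) : f 0 = 0 ∧
    (∀ x y, f (x + y) = f x + f y) ∧ (∀ x, f (-x) = -f x) ∧ (∀ x y, f (x - y) = f x - f y) ∧
    ∀ (e : ℤˣ) (x : G), f (e • x) = e • f x :=
  ⟨map_zero f, map_add f, map_neg f, map_sub f, map_usmul f⟩

theorem usmul_usmul {G : Type*} [AddCommGroup G] (e : ℤˣ) (x : G) : e • e • x = x := by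
  rcases Int.units_eq_one_or e with rfl | rfl <;> simp

theorem negOnePow_congr {a b : ℤ} (h : (a - b) % 2 = 0) : a.negOnePow = b.negOnePow := by
  rw [Int.negOnePow_eq_iff, Int.even_iff]; exact h

theorem negOnePow_congr' {a b : ℤ} (c : ℤ) (h : a - b = 2 * c) : a.negOnePow = b.negOnePow :=
  negOnePow_congr (by omega)

theorem eps_eps (x : ⨁ i, X i) : eps (eps x) = x := by
  revert x; refine dsum_induct fun i x => ?_
  rw [eps_of, map_usmul, eps_of, usmul_usmul]

theorem hat_eps {ρ : ℤ → ℤ} (c : ℤ) (hc : ∀ i, (ρ i - c - i) % 2 = 0) (a : ∀ i j, X i →ₗ[A] Y j)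
    (x : ⨁ i, X i) : hat ρ a (eps x) = c.negOnePow • eps (hat ρ a x) := by
  revert x; refine dsum_induct fun i x => ?_
  rw [eps_of, map_usmul, hat_of _ rfl, eps_of, smul_smul, ← negOnePow_add,
    negOnePow_congr]
  have := hc i
  omega

theorem hat_injective {ρ : ℤ → ℤ} {a b : ∀ i j, X i →ₗ[A] Y j} (h : ∀ x, hat ρ a x = hat ρ b x)
    (i : ℤ) : a i (ρ i) = b i (ρ i) := by
  ext x
  have := h (DirectSum.of X i x)
  rw [hat_of _ rfl, hat_of _ rfl] at this
  exact DirectSum.of_injective _ this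

end Hat

variable [StarRing A] {C D E : Cx A}

/-- The differential of a complex on the direct sum of its modules. -/
def opd (C : Cx A) : (⨁ i, C.X i) →+ ⨁ i, C.X i := hat (fun i => i - 1) fun i j => (C.d i j).hom

/-- The dual differential. -/
def opd' (C : Cx A) : (⨁ i, Dual A (C.X i)) →+ ⨁ i, Dual A (C.X i) :=
  hat (fun i => i + 1) fun i j => dualMap (C.d j i).hom

/-- A family of morphisms of degree `k` on direct sums. -/
def oph (k : ℤ) (h : HMap C D) : (⨁ i, C.X i) →+ ⨁ i, D.X i := hat (fun i => i + k) h

/-- The dual of a family of morphisms of degree `k` on direct sums. -/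
def oph' (k : ℤ) (h : HMap C D) : (⨁ i, Dual A (D.X i)) →+ ⨁ i, Dual A (C.X i) :=
  hat (fun i => i - k) fun i j => dualMap (h j i)

/-- A family of morphisms of degree `0` on direct sums. -/
def opg (f : GMap C D) : (⨁ i, C.X i) →+ ⨁ i, D.X i :=
  DirectSum.toAddMonoid fun i => (DirectSum.of (fun i => D.X i) i).comp (f i).toAddMonoidHom

/-- The dual of a family of morphisms of degree `0` on direct sums. -/
def opg' (f : GMap C D) : (⨁ i, Dual A (D.X i)) →+ ⨁ i, Dual A (C.X i) :=
  DirectSum.toAddMonoid fun i =>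
    (DirectSum.of (fun i => Dual A (C.X i)) i).comp (dualMap (f i)).toAddMonoidHom

/-- A family `C^p → D_q`, `p + q = m`, on direct sums. -/
def opm (m : ℤ) (θ : DMap C D) : (⨁ i, Dual A (C.X i)) →+ ⨁ i, D.X i := hat (fun p => m - p) θ

theorem opg_of (f : GMap C D) (i : ℤ) (x : C.X i) :
    opg f (DirectSum.of (fun i => C.X i) i x) = DirectSum.of (fun i => D.X i) i (f i x) := by
  simp [opg]

theorem opg'_of (f : GMap C D) (i : ℤ) (x : Dual A (D.X i)) :
    opg' f (DirectSum.of (fun i => Dual A (D.X i)) i x) =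
      DirectSum.of (fun i => Dual A (C.X i)) i (dualMap (f i) x) := by
  simp [opg']

theorem opd_eps (x) : opd C (eps x) = - eps (opd C x) := by
  rw [opd, hat_eps (-1) (by intro i; omega)]; simp

theorem opd'_eps (x) : opd' C (eps x) = - eps (opd' C x) := by
  rw [opd', hat_eps 1 (by intro i; omega)]; simp

theorem oph_eps (k : ℤ) (h : HMap C D) (x) : oph k h (eps x) = k.negOnePow • eps (oph k h x) := by
  rw [oph, hat_eps k (by intro i; omega)]

theorem oph'_eps (k : ℤ) (h : HMap C D) (x) :
    oph' k h (eps x) = k.negOnePow • eps (oph' k h x) := by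
  rw [oph', hat_eps k (by intro i; omega)]

theorem opm_eps (m : ℤ) (θ : DMap C D) (x) : opm m θ (eps x) = m.negOnePow • eps (opm m θ x) := by
  rw [opm, hat_eps m (by intro i; omega)]

theorem opg_eps (f : GMap C D) (x) : opg f (eps x) = eps (opg f x) := by
  revert x; refine dsum_induct fun i x => ?_
  rw [eps_of, map_usmul, opg_of, eps_of]

theorem opg'_eps (f : GMap C D) (x) : opg' f (eps x) = eps (opg' f x) := by
  revert x; refine dsum_induct fun i x => ?_
  rw [eps_of, map_usmul, opg'_of, eps_of]

theorem opd_opd (x) : opd C (opd C x) = 0 := by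
  revert x; refine dsum_induct fun i x => ?_
  rw [opd, hat_of _ rfl, hat_of _ rfl, ← LinearMap.comp_apply, d_comp_d_hom]; simp

theorem opd'_opd' (x) : opd' C (opd' C x) = 0 := by
  revert x; refine dsum_induct fun i x => ?_
  rw [opd', hat_of _ rfl, hat_of _ rfl, ← LinearMap.comp_apply, ← dualMap_comp, d_comp_d_hom,
    dualMap_zero]; simp

theorem opg_opd (f : C ⟶ D) (x) : opg (comps f) (opd C x) = opd D (opg (comps f) x) := by
  revert x; refine dsum_induct fun i x => ?_
  rw [opd, opd, hat_of _ rfl, opg_of, opg_of, hat_of _ rfl]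
  congr 1
  exact (LinearMap.congr_fun (congrArg ModuleCat.Hom.hom (f.comm i (i - 1))) x).symm

theorem opg'_opd' (f : C ⟶ D) (x) : opg' (comps f) (opd' D x) = opd' C (opg' (comps f) x) := by
  revert x; refine dsum_induct fun i x => ?_
  rw [opd', opd', hat_of _ rfl, opg'_of, opg'_of, hat_of _ rfl]
  congr 1
  exact LinearMap.congr_fun (congrArg (fun g => dualMap (ModuleCat.Hom.hom g))
    (f.comm (i + 1) i)) x

theorem opg_comp (f : GMap C D) (g : GMap D E) (x) :
    opg (fun i => g i ∘ₗ f i) x = opg g (opg f x) := by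
  revert x; refine dsum_induct fun i x => ?_
  simp only [opg_of, LinearMap.comp_apply]

theorem opg'_comp (f : GMap C D) (g : GMap D E) (x) :
    opg' (fun i => g i ∘ₗ f i) x = opg' f (opg' g x) := by
  revert x; refine dsum_induct fun i x => ?_
  simp only [opg'_of, dualMap_comp, LinearMap.comp_apply]

theorem oph_htpy {f g : C ⟶ D} (h : Homotopy f g) (x) :
    opd D (oph 1 (hcomps h) x) + oph 1 (hcomps h) (opd C x) =
      opg (comps f) x - opg (comps g) x := by
  induction x using DirectSum.induction_on with
  | zero => simp
  | add x y hx hy =>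
    simp only [map_add]
    rw [add_add_add_comm, hx, hy]; abel
  | of i x =>
    rw [opd, opd, oph, hat_of _ rfl, hat_of i (by ring), hat_of _ rfl, hat_of i (by ring),
      opg_of, opg_of, ← map_add, ← map_sub]
    congr 1
    have := LinearMap.congr_fun (hcomps_comm h (rfl : i = i) (sub_add_cancel i 1) rfl) x
    simp only [tot, idMap, dite_true, HomologicalComplex.XIsoOfEq_rfl, Iso.refl_hom,
      ModuleCat.hom_id, LinearMap.id_comp, LinearMap.add_apply, LinearMap.comp_apply] at this
    rw [this]; abel

theorem oph'_htpy {f g : C ⟶ D} (h : Homotopy f g) (x) :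
    opd' C (oph' 1 (hcomps h) x) + oph' 1 (hcomps h) (opd' D x) =
      opg' (comps f) x - opg' (comps g) x := by
  induction x using DirectSum.induction_on with
  | zero => simp
  | add x y hx hy =>
    simp only [map_add]
    rw [add_add_add_comm, hx, hy]; abel
  | of i x =>
    rw [opd', opd', oph', hat_of _ rfl, hat_of i (by ring), hat_of _ rfl, hat_of i (by ring),
      opg'_of, opg'_of, ← map_add, ← map_sub]
    congr 1
    have := hcomps_comm h (rfl : i = i) (sub_add_cancel i 1) rfl
    simp only [tot, idMap, dite_true, HomologicalComplex.XIsoOfEq_rfl, Iso.refl_hom,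
      ModuleCat.hom_id, LinearMap.id_comp] at this
    rw [this, dualMap_add, dualMap_add, dualMap_comp, dualMap_comp]
    simp

end Ops

section Fam

variable {C D E C' D' : Cx A}

/-- The transposition of families `C^p → D_q`. -/
def dmT (θ : DMap C D) : DMap D C := fun p q => (p * q).negOnePow • adj (θ q p)

/-- The family `a θ b^*` with `a` and `b` of degrees `u` and `v`. -/
def sand (u v : ℤ) (a : HMap D D') (θ : DMap C D) (b : HMap C C') : DMap C' D' := fun p q =>
  a (q - u) q ∘ₗ θ (p - v) (q - u) ∘ₗ dualMap (b (p - v) p)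

/-- Families concentrated in `p + q = m`. -/
def IsDeg (m : ℤ) (θ : DMap C D) : Prop := ∀ p q, p + q ≠ m → θ p q = 0

theorem famT_eq (θ : Fam C) (s : ℤ) : famT θ s = dmT (θ s) := rfl

theorem opm_add (m : ℤ) (θ θ' : DMap C D) (x) : opm m (θ + θ') x = opm m θ x + opm m θ' x := by
  revert x; refine dsum_induct fun i x => ?_
  simp only [opm, hat_of _ rfl, Pi.add_apply, LinearMap.add_apply, map_add]

theorem opm_zero (m : ℤ) (x) : opm m (0 : DMap C D) x = 0 := by
  have := opm_add m (0 : DMap C D) 0 x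
  rwa [add_zero, left_eq_add] at this

theorem opm_neg (m : ℤ) (θ : DMap C D) (x) : opm m (-θ) x = -opm m θ x := by
  rw [eq_neg_iff_add_eq_zero, ← opm_add, neg_add_cancel, opm_zero]

theorem opm_sub (m : ℤ) (θ θ' : DMap C D) (x) : opm m (θ - θ') x = opm m θ x - opm m θ' x := by
  rw [sub_eq_add_neg, opm_add, opm_neg, sub_eq_add_neg]

theorem opm_usmul (m : ℤ) (e : ℤˣ) (θ : DMap C D) (x) : opm m (e • θ) x = e • opm m θ x := by
  rcases Int.units_eq_one_or e with rfl | rfl <;> simp [opm_neg]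

theorem opm_ext {m : ℤ} {θ θ' : DMap C D} (h : IsDeg m θ) (h' : IsDeg m θ')
    (H : ∀ x, opm m θ x = opm m θ' x) : θ = θ' := by
  funext p q
  by_cases hq : p + q = m
  · obtain rfl : q = m - p := by omega
    exact hat_injective H p
  · rw [h p q hq, h' p q hq]

theorem fam_ext {n : ℤ} {θ θ' : Fam C} (h : IsHyp n θ) (h' : IsHyp n θ')
    (H : ∀ s x, opm (n + s) (θ s) x = opm (n + s) (θ' s) x) : θ = θ' :=
  funext fun s => opm_ext (h s) (h' s) (H s)

/-- `(p, q) ↦ (-1)^q θ p q`. -/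
def sgn (θ : DMap C D) : DMap C D := fun p q => q.negOnePow • θ p q

theorem opm_sgn (m : ℤ) (θ : DMap C D) (x) : opm m (sgn θ) x = eps (opm m θ x) := by
  revert x; refine dsum_induct fun i x => ?_
  simp only [opm, hat_of _ rfl, eps_of, sgn, LinearMap.smul_apply]
  exact map_usmul _ _ _

theorem opm_sand (m u v : ℤ) (a : HMap D D') (θ : DMap C D) (b : HMap C C') (x) :
    opm m (sand u v a θ b) x = oph u a (opm (m - u - v) θ (oph' v b x)) := by
  revert x; refine dsum_induct fun p x => ?_
  rw [opm, opm, oph, oph', hat_of _ rfl, hat_of _ rfl, hat_of (m - p - u) (by ring),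
    hat_of (m - p) (by ring)]
  rfl

theorem opm_comp (m : ℤ) (f : GMap D D') (θ : DMap C D) (g : GMap C C') (x) :
    opm m (fun p q => f q ∘ₗ θ p q ∘ₗ dualMap (g p)) x = opg f (opm m θ (opg' g x)) := by
  revert x; refine dsum_induct fun p x => ?_
  rw [opm, opm, hat_of _ rfl, opg'_of, hat_of _ rfl, opg_of]; rfl

theorem opm_comp_left (m : ℤ) (f : GMap D D') (θ : DMap C D) (x) :
    opm m (fun p q => f q ∘ₗ θ p q : DMap C D') x = opg f (opm m θ x) := by
  revert x; refine dsum_induct fun p x => ?_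
  rw [opm, opm, hat_of _ rfl, hat_of _ rfl, opg_of]; rfl

theorem opm_push (m : ℤ) (f : GMap C D) (θ : Fam C) (s : ℤ) (x) :
    opm m (push f θ s) x = opg f (opm m (θ s) (opg' f x)) := opm_comp m f (θ s) f x

theorem opm_famD (m : ℤ) (θ : Fam C) (s : ℤ) (x) :
    opm m (famD θ s) x =
      opd C (opm (m + 1) (θ s) x) + eps (opm (m + 1) (θ s) (opd' C x)) := by
  revert x; refine dsum_induct fun p x => ?_
  rw [opm, opm, opd, opd', hat_of _ rfl, hat_of (m - p + 1) (by ring), hat_of (m - p) (by ring),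
    hat_of _ rfl, hat_of (m - p) (by ring), eps_of, ← map_usmul, ← map_add]
  rfl

theorem dHyp_eq (n : ℤ) (θ : Fam C) (s : ℤ) : dHyp n θ s =
    famD θ s + (n + s - 1).negOnePow • (θ (s - 1) + s.negOnePow • famT θ (s - 1)) := rfl

theorem opm_dHyp (m n : ℤ) (θ : Fam C) (s : ℤ) (x) :
    opm m (dHyp n θ s) x =
      opd C (opm (m + 1) (θ s) x) + eps (opm (m + 1) (θ s) (opd' C x)) +
        (n + s - 1).negOnePow • (opm m (θ (s - 1)) x + s.negOnePow • opm m (famT θ (s - 1)) x) := by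
  simp only [dHyp_eq, opm_add, opm_usmul, opm_famD]

theorem opm_dQuad (m n : ℤ) (ψ : Fam C) (s : ℤ) (x) :
    opm m (dQuad n ψ s) x = if s < 0 then 0 else
      opd C (opm (m + 1) (ψ s) x) + eps (opm (m + 1) (ψ s) (opd' C x)) +
        (n - s - 1).negOnePow •
          (opm m (ψ (s + 1)) x + (s + 1).negOnePow • opm m (famT ψ (s + 1)) x) := by
  by_cases hs : s < 0
  · rw [if_pos hs, show dQuad n ψ s = 0 from funext fun p => funext fun q => if_pos hs, opm_zero]
  · rw [if_neg hs, show dQuad n ψ s = famD ψ s + (n - s - 1).negOnePow •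
      (ψ (s + 1) + (s + 1).negOnePow • famT ψ (s + 1)) from
        funext fun p => funext fun q => if_neg hs]
    simp only [opm_add, opm_usmul, opm_famD]

theorem opm_pushHtpy (m n : ℤ) (h : HMap C D) (f f' : GMap C D) (θ : Fam C) (s : ℤ) (x) :
    opm m (pushHtpy n h f f' θ s) x =
      oph 1 h (opm (m - 1) (θ s) (opg' f x)) + eps (opg f' (opm (m - 1) (θ s) (oph' 1 h x))) +
        (n + 1).negOnePow •
          eps (oph 1 h (opm (m - 1 - 1) (famT θ (s - 1)) (oph' 1 h x))) := by
  revert x; refine dsum_induct fun p x => ?_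
  rw [opg'_of, opm, opm, opm, oph, oph', hat_of _ rfl, hat_of (m - p - 1) (by ring),
    hat_of (m - p) (by ring), hat_of _ rfl, hat_of (m - p) (by ring),
    hat_of (m - p - 1) (by ring), hat_of (m - p) (by ring), opg_of, eps_of, eps_of, smul_smul,
    ← negOnePow_add, ← map_usmul, ← map_usmul, ← map_add, ← map_add,
    negOnePow_congr (show (n + 1 + (m - p) - (n + (m - p) + 1)) % 2 = 0 by omega)]
  rfl

/-! ### Transposition -/

theorem dmT_add (θ θ' : DMap C D) : dmT (θ + θ') = dmT θ + dmT θ' := by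
  funext p q; simp only [dmT, Pi.add_apply, adj_add, smul_add]

theorem dmT_zero : dmT (0 : DMap C D) = 0 := by
  funext p q; simp only [dmT, Pi.zero_apply, adj_zero, smul_zero]

theorem dmT_usmul (e : ℤˣ) (θ : DMap C D) : dmT (e • θ) = e • dmT θ := by
  funext p q; simp only [dmT, Pi.smul_apply, adj_usmul, smul_comm e]

theorem dmT_neg (θ : DMap C D) : dmT (-θ) = -dmT θ := by
  funext p q; simp only [dmT, Pi.neg_apply, adj_neg, smul_neg]

theorem dmT_sub (θ θ' : DMap C D) : dmT (θ - θ') = dmT θ - dmT θ' := by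
  rw [sub_eq_add_neg, dmT_add, dmT_neg, sub_eq_add_neg]

theorem dmT_dmT [FinCx C] [FinCx D] (θ : DMap C D) : dmT (dmT θ) = θ := by
  funext p q
  simp only [dmT, adj_usmul, adj_adj, smul_smul, mul_comm q p, ← negOnePow_add,
    negOnePow_even _ (Even.add_self _), one_smul]

theorem IsDeg.dmT {m : ℤ} {θ : DMap C D} (h : IsDeg m θ) : IsDeg m (dmT θ) := by
  intro p q hpq
  rw [APC.dmT, h q p (by omega), adj_zero, smul_zero]

theorem dmT_comp [FinCx C] [FinCx C'] (f : GMap D D') (θ : DMap C D) (g : GMap C C') :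
    dmT (fun p q => f q ∘ₗ θ p q ∘ₗ dualMap (g p)) =
      fun p q => g q ∘ₗ dmT θ p q ∘ₗ dualMap (f p) := by
  funext p q
  simp only [dmT, adj_comp_dualMap, smul_comp, comp_smul]

theorem famT_push [FinCx C] [FinCx D] (f : GMap C D) (θ : Fam C) :
    famT (push f θ) = push f (famT θ) := funext fun _ => dmT_comp _ _ _

theorem famT_famD [FinCx C] (θ : Fam C) : famT (famD θ) = famD (famT θ) := by
  funext s p q
  have h : adj ((C.d (p + 1) p).hom ∘ₗ θ s q (p + 1)) =
      adj (θ s q (p + 1)) ∘ₗ dualMap (C.d (p + 1) p).hom := rfl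
  simp only [famT, famD, adj_add, adj_usmul, adj_comp_dualMap', h, smul_add,
    smul_comp, comp_smul, smul_smul, ← negOnePow_add]
  rw [add_comm]
  congr 2
  · exact negOnePow_congr' 0 (by ring)
  · exact negOnePow_congr' (-q) (by ring)

theorem dmT_sand [FinCx C] [FinCx C'] (u v : ℤ) (a : HMap D D') (θ : DMap C D) (b : HMap C C')
    (p q : ℤ) : dmT (sand u v a θ b) p q =
      (p * v + u * q + u * v).negOnePow • sand v u b (dmT θ) a p q := by
  simp only [dmT, sand, adj_comp_dualMap, smul_comp, comp_smul, smul_smul,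
    ← negOnePow_add]
  congr 1
  exact negOnePow_congr' (-(u * v)) (by ring)

theorem opm_congr {m : ℤ} {θ θ' : DMap C D} (h : ∀ p, θ p (m - p) = θ' p (m - p)) (x) :
    opm m θ x = opm m θ' x := by
  revert x; refine dsum_induct fun p x => ?_
  rw [opm, opm, hat_of _ rfl, hat_of _ rfl, h]

section
variable [FinCx C] [FinCx C'] (m u v : ℤ) (a : HMap D D') (θ : DMap C D) (b : HMap C C') (x)

theorem opm_dmT_sand_ee (hu : u % 2 = 0) (hv : v % 2 = 0) : opm m (dmT (sand u v a θ b)) x =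
    oph v b (opm (m - v - u) (dmT θ) (oph' u a x)) := by
  rw [← opm_sand]
  refine opm_congr (fun p => ?_) x
  obtain ⟨c, rfl⟩ : ∃ c, u = 2 * c := ⟨u / 2, by omega⟩
  obtain ⟨d, rfl⟩ : ∃ c, v = 2 * c := ⟨v / 2, by omega⟩
  rw [dmT_sand, negOnePow_congr' (b := 0) (p * d + c * (m - p) + 2 * c * d) (by ring),
    negOnePow_zero, one_smul]

theorem opm_dmT_sand_eo (hu : u % 2 = 0) (hv : v % 2 = 1) : opm m (dmT (sand u v a θ b)) x =
    m.negOnePow • eps (oph v b (opm (m - v - u) (dmT θ) (oph' u a x))) := by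
  rw [← opm_sand, ← opm_sgn, ← opm_usmul]
  refine opm_congr (fun p => ?_) x
  obtain ⟨c, rfl⟩ : ∃ c, u = 2 * c := ⟨u / 2, by omega⟩
  obtain ⟨d, rfl⟩ : ∃ c, v = 2 * c + 1 := ⟨v / 2, by omega⟩
  rw [dmT_sand, Pi.smul_apply, Pi.smul_apply, sgn, smul_smul, ← negOnePow_add]
  congr 1
  exact negOnePow_congr' (p * d + p + c * (m - p) + c * (2 * d + 1) - m) (by ring)

theorem opm_dmT_sand_oo (hu : u % 2 = 1) (hv : v % 2 = 1) : opm m (dmT (sand u v a θ b)) x =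
    (m + 1).negOnePow • oph v b (opm (m - v - u) (dmT θ) (oph' u a x)) := by
  rw [← opm_sand, ← opm_usmul]
  refine opm_congr (fun p => ?_) x
  obtain ⟨c, rfl⟩ : ∃ c, u = 2 * c + 1 := ⟨u / 2, by omega⟩
  obtain ⟨d, rfl⟩ : ∃ c, v = 2 * c + 1 := ⟨v / 2, by omega⟩
  rw [dmT_sand, Pi.smul_apply, Pi.smul_apply]
  congr 1
  exact negOnePow_congr' (p * d + c * (m - p) + 2 * c * d + c + d) (by ring)

end

theorem famT_famT [FinCx C] (θ : Fam C) : famT (famT θ) = θ := funext fun s => dmT_dmT (θ s)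

theorem famT_add (θ θ' : Fam C) : famT (θ + θ') = famT θ + famT θ' :=
  funext fun _ => dmT_add _ _

theorem famT_sub (θ θ' : Fam C) : famT (θ - θ') = famT θ - famT θ' :=
  funext fun _ => dmT_sub _ _

theorem famT_dHyp_eq [FinCx C] (n : ℤ) (θ : Fam C) (s : ℤ) : famT (dHyp n θ) s =
    famD (famT θ) s + (n + s - 1).negOnePow • (famT θ (s - 1) + s.negOnePow • θ (s - 1)) := by
  rw [famT_eq, dHyp_eq, dmT_add, dmT_usmul, dmT_add, dmT_usmul, ← famT_eq, ← famT_eq,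
    ← famT_eq, famT_famT, famT_famD]

theorem opm_famT_dHyp [FinCx C] (m n : ℤ) (θ : Fam C) (s : ℤ) (x) :
    opm m (famT (dHyp n θ) s) x =
      opd C (opm (m + 1) (famT θ s) x) + eps (opm (m + 1) (famT θ s) (opd' C x)) +
        (n + s - 1).negOnePow • (opm m (famT θ (s - 1)) x + s.negOnePow • opm m (θ (s - 1)) x) := by
  simp only [famT_dHyp_eq, opm_add, opm_usmul, opm_famD]

theorem famT_pushHtpy [FinCx C] [FinCx D] (n : ℤ) (h : HMap C D) (f f' : GMap C D) (θ : Fam C) :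
    famT (pushHtpy n h f f' θ) = pushHtpy (n + 1) h f' f (famT θ) := by
  funext s p q
  simp only [pushHtpy, famT_famT]
  simp only [famT, pushHtpy, adj_add, adj_usmul, adj_comp_dualMap, smul_add,
    smul_comp, comp_smul, smul_smul, ← negOnePow_add, adj_adj]
  rw [add_comm (_ • _) (_ • _)]
  congr 1
  · congr 2
    · exact negOnePow_congr' p (by ring)
    · exact negOnePow_congr' 0 (by ring)
  · congr 1
    exact negOnePow_congr' (p * q - q) (by ring)

/-! ### Degrees -/

theorem IsHyp.add {n : ℤ} {θ θ' : Fam C} (h : IsHyp n θ) (h' : IsHyp n θ') :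
    IsHyp n (θ + θ') := fun s p q hpq => by
  simp only [Pi.add_apply, h s p q hpq, h' s p q hpq, add_zero]

theorem IsHyp.sub {n : ℤ} {θ θ' : Fam C} (h : IsHyp n θ) (h' : IsHyp n θ') :
    IsHyp n (θ - θ') := fun s p q hpq => by
  simp only [Pi.sub_apply, h s p q hpq, h' s p q hpq, sub_zero]

theorem IsHyp.neg {n : ℤ} {θ : Fam C} (h : IsHyp n θ) : IsHyp n (-θ) := fun s p q hpq => by
  simp only [Pi.neg_apply, h s p q hpq, neg_zero]

theorem IsHyp.zero {n : ℤ} : IsHyp n (0 : Fam C) := fun _ _ _ _ => rfl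

theorem IsHyp.units_smul {n : ℤ} (e : ℤˣ) {θ : Fam C} (h : IsHyp n θ) : IsHyp n (e • θ) :=
  fun s p q hpq => by simp only [Pi.smul_apply, h s p q hpq, smul_zero]

theorem IsHyp.push {n : ℤ} {θ : Fam C} (h : IsHyp n θ) (f : GMap C D) : IsHyp n (push f θ) :=
  fun s p q hpq => by
    simp only [APC.push, h s p q hpq, zero_comp, comp_zero]

theorem IsHyp.famT {n : ℤ} {θ : Fam C} (h : IsHyp n θ) : IsHyp n (famT θ) := fun s =>
  IsDeg.dmT (h s)

theorem IsHyp.dHyp {n m k : ℤ} {θ : Fam C} (h : IsHyp n θ) (hm : n = m + 1) :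
    IsHyp m (dHyp k θ) := fun s p q hpq => by
  simp only [APC.dHyp, famD, h s p (q + 1) (by omega), h s (p + 1) q (by omega),
    h (s - 1) p q (by omega), h.famT (s - 1) p q (by omega), zero_comp,
    comp_zero, smul_zero, add_zero]

theorem IsHyp.pushHtpy {n m k : ℤ} {θ : Fam C} (h : IsHyp n θ) (hm : m = n + 1) (H : HMap C D)
    (f f' : GMap C D) : IsHyp m (pushHtpy k H f f' θ) := fun s p q hpq => by
  simp only [APC.pushHtpy, h s p (q - 1) (by omega), h s (p - 1) q (by omega),
    h.famT (s - 1) (p - 1) (q - 1) (by omega), zero_comp,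
    comp_zero, smul_zero, add_zero]

theorem IsSym.isHyp {n : ℤ} {θ : Fam C} (h : IsSym n θ) : IsHyp n θ := fun s p q hpq =>
  h s p q (Or.inr hpq)

theorem IsSym.eq_zero {n : ℤ} {θ : Fam C} (h : IsSym n θ) {s : ℤ} (hs : s < 0) : θ s = 0 :=
  funext fun p => funext fun q => h s p q (Or.inl hs)

theorem isSym_iff {n : ℤ} {θ : Fam C} : IsSym n θ ↔ IsHyp n θ ∧ ∀ s, s < 0 → θ s = 0 :=
  ⟨fun h => ⟨h.isHyp, fun _ => h.eq_zero⟩, fun h s p q hpq => by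
    rcases hpq with hs | hs
    · rw [h.2 s hs]; rfl
    · exact h.1 s p q hs⟩

theorem IsQuad.eq_zero {n : ℤ} {θ : Fam C} (h : IsQuad n θ) {s : ℤ} (hs : s < 0) : θ s = 0 :=
  funext fun p => funext fun q => h s p q (Or.inl hs)

theorem IsQuad.isDeg {n : ℤ} {θ : Fam C} (h : IsQuad n θ) (s : ℤ) : IsDeg (n - s) (θ s) :=
  fun p q hpq => h s p q (Or.inr hpq)

theorem isQuad_iff {n : ℤ} {θ : Fam C} :
    IsQuad n θ ↔ (∀ s, IsDeg (n - s) (θ s)) ∧ ∀ s, s < 0 → θ s = 0 :=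
  ⟨fun h => ⟨h.isDeg, fun _ => h.eq_zero⟩, fun h s p q hpq => by
    rcases hpq with hs | hs
    · rw [h.2 s hs]; rfl
    · exact h.1 s p q hs⟩

/-! ### The differentials -/

theorem dHyp_dHyp [FinCx C] {n : ℤ} {θ : Fam C} (hθ : IsHyp (n + 1) θ) :
    dHyp n (dHyp (n + 1) θ) = 0 := by
  refine fam_ext (n := n - 1) ((hθ.dHyp rfl).dHyp (by ring)) IsHyp.zero fun s x => ?_
  simp only [hom_simps, opm_dHyp, opm_famT_dHyp, Pi.zero_apply, opm_zero, opd_opd, opd'_opd',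
    eps_eps, opd_eps]
  rcases sgn_cases n with hn | hn <;>
  rcases sgn_cases s with hs | hs <;>
  simp only [sign_simps, smul_simps, hn, hs] <;> abel

theorem dHyp_pushHtpy [FinCx C] [FinCx D] {n : ℤ} {f f' : C ⟶ D} (h : Homotopy f' f) {θ : Fam C}
    (hθ : IsHyp n θ) :
    dHyp (n + 1) (pushHtpy n (hcomps h) (comps f) (comps f') θ) +
      pushHtpy (n - 1) (hcomps h) (comps f) (comps f') (dHyp n θ) =
      push (comps f') θ - push (comps f) θ := by
  refine fam_ext (n := n) (((hθ.pushHtpy rfl _ _ _).dHyp rfl).add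
    ((hθ.dHyp (sub_add_cancel n 1).symm).pushHtpy (by ring) _ _ _))
    ((hθ.push _).sub (hθ.push _)) fun s x => ?_
  have hd : ∀ x, opd D (oph 1 (hcomps h) x) =
      opg (comps f') x - opg (comps f) x - oph 1 (hcomps h) (opd C x) :=
    fun x => eq_sub_of_add_eq (oph_htpy h x)
  have hd' : ∀ x, oph' 1 (hcomps h) (opd' D x) =
      opg' (comps f') x - opg' (comps f) x - opd' C (oph' 1 (hcomps h) x) :=
    fun x => eq_sub_of_add_eq' (oph'_htpy h x)
  simp only [Pi.add_apply, Pi.sub_apply, opm_add, opm_sub, opm_push, opm_dHyp, opm_pushHtpy,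
    famT_pushHtpy, famT_famT, opm_famT_dHyp, add_sub_cancel_right, sub_add_cancel]
  simp only [hom_simps, eps_eps, opd_eps, oph_eps, opg_eps, hd, hd', opg_opd, ← opg'_opd']
  rcases sgn_cases n with hn | hn <;>
  rcases sgn_cases s with hs | hs <;>
  simp only [sign_simps, smul_simps, hn, hs] <;> abel

theorem dHyp_push [FinCx C] [FinCx D] {n m : ℤ} (f : C ⟶ D) {θ : Fam C} (hθ : IsHyp m θ) :
    dHyp n (push (comps f) θ) = push (comps f) (dHyp n θ) := by
  refine fam_ext (n := m - 1) ((hθ.push _).dHyp (by ring)) ((hθ.dHyp (by ring)).push _)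
    fun s x => ?_
  simp only [opm_push, opm_dHyp, famT_push, map_add, map_usmul, opg_opd, ← opg'_opd', opg_eps]

theorem opm_famT_dQuad [FinCx C] (m n : ℤ) (ψ : Fam C) (s : ℤ) (x) :
    opm m (famT (dQuad n ψ) s) x = if s < 0 then 0 else
      opd C (opm (m + 1) (famT ψ s) x) + eps (opm (m + 1) (famT ψ s) (opd' C x)) +
        (n - s - 1).negOnePow •
          (opm m (famT ψ (s + 1)) x + (s + 1).negOnePow • opm m (ψ (s + 1)) x) := by
  by_cases hs : s < 0
  · rw [if_pos hs, famT_eq, show dQuad n ψ s = 0 from funext fun p => funext fun q => if_pos hs,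
      dmT_zero, opm_zero]
  · rw [if_neg hs, famT_eq, show dQuad n ψ s = famD ψ s + (n - s - 1).negOnePow •
      (ψ (s + 1) + (s + 1).negOnePow • famT ψ (s + 1)) from
        funext fun p => funext fun q => if_neg hs]
    rw [dmT_add, dmT_usmul, dmT_add, dmT_usmul, ← famT_eq, ← famT_eq,
      ← famT_eq, famT_famT, famT_famD]
    simp only [opm_add, opm_usmul, opm_famD]

theorem quad_ext {n : ℤ} {θ θ' : Fam C} (h : IsQuad n θ) (h' : IsQuad n θ')
    (H : ∀ s x, 0 ≤ s → opm (n - s) (θ s) x = opm (n - s) (θ' s) x) : θ = θ' :=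
  funext fun s => by
    rcases lt_or_ge s 0 with hs | hs
    · rw [h.eq_zero hs, h'.eq_zero hs]
    · exact opm_ext (h.isDeg s) (h'.isDeg s) fun x => H s x hs

theorem IsQuad.dQuad {n m k : ℤ} {ψ : Fam C} (h : IsQuad n ψ) (hm : n = m + 1) :
    IsQuad m (dQuad k ψ) := fun s p q hpq => by
  by_cases hs : s < 0
  · exact if_pos hs
  · have h1 : p + q ≠ m - s := by omega
    have h2 : famT ψ (s + 1) p q = 0 := by
      rw [famT, h (s + 1) q p (Or.inr (by omega)), adj_zero, smul_zero]
    simp only [APC.dQuad, if_neg hs, famD, h s p (q + 1) (Or.inr (by omega)), h2,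
      h s (p + 1) q (Or.inr (by omega)), h (s + 1) p q (Or.inr (by omega)), zero_comp,
      comp_zero, smul_zero, add_zero]

theorem IsQuad.sub {n : ℤ} {θ θ' : Fam C} (h : IsQuad n θ) (h' : IsQuad n θ') :
    IsQuad n (θ - θ') := fun s p q hpq => by
  simp only [Pi.sub_apply, h s p q hpq, h' s p q hpq, sub_zero]

theorem IsQuad.push {n : ℤ} {θ : Fam C} (h : IsQuad n θ) (f : GMap C D) : IsQuad n (push f θ) :=
  fun s p q hpq => by
    simp only [APC.push, h s p q hpq, zero_comp, comp_zero]

theorem IsSym.add {n : ℤ} {θ θ' : Fam C} (h : IsSym n θ) (h' : IsSym n θ') :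
    IsSym n (θ + θ') := fun s p q hpq => by
  simp only [Pi.add_apply, h s p q hpq, h' s p q hpq, add_zero]

theorem IsSym.sub {n : ℤ} {θ θ' : Fam C} (h : IsSym n θ) (h' : IsSym n θ') :
    IsSym n (θ - θ') := fun s p q hpq => by
  simp only [Pi.sub_apply, h s p q hpq, h' s p q hpq, sub_zero]

theorem IsSym.zero {n : ℤ} : IsSym n (0 : Fam C) := fun _ _ _ _ => rfl

theorem IsSym.push {n : ℤ} {θ : Fam C} (h : IsSym n θ) (f : GMap C D) : IsSym n (push f θ) :=
  fun s p q hpq => by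
    simp only [APC.push, h s p q hpq, zero_comp, comp_zero]

theorem IsSym.dHyp {n m k : ℤ} {θ : Fam C} (h : IsSym n θ) (hm : n = m + 1) :
    IsSym m (dHyp k θ) := isSym_iff.2 ⟨h.isHyp.dHyp hm, fun s hs => by
  rw [dHyp_eq, h.eq_zero (s := s - 1) (by omega), famT_eq, h.eq_zero (s := s - 1) (by omega),
    dmT_zero, smul_zero, add_zero, smul_zero, add_zero]
  funext p q
  simp only [famD, h.eq_zero hs, Pi.zero_apply, zero_comp, comp_zero,
    smul_zero, add_zero]⟩

theorem IsQuad.oneT {n : ℤ} {ψ : Fam C} (h : IsQuad n ψ) : IsSym n (oneT ψ) := fun s p q hpq => by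
  rw [APC.oneT]
  split_ifs with hs
  · subst hs
    have h1 : p + q ≠ n := by omega
    rw [h 0 p q (Or.inr (by omega)), famT, h 0 q p (Or.inr (by omega)), adj_zero, smul_zero,
      add_zero]
  · rfl

theorem IsQuad.hyp {n m : ℤ} {ψ : Fam C} (h : IsQuad n ψ) (hm : m = n + 1) : IsHyp m (hyp ψ) :=
  fun s p q hpq => h _ p q (Or.inr (by omega))

theorem oneT_apply (ψ : Fam C) (s : ℤ) : oneT ψ s = if s = 0 then ψ 0 + famT ψ 0 else 0 := by
  split_ifs with hs
  · exact funext fun p => funext fun q => if_pos hs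
  · exact funext fun p => funext fun q => if_neg hs

theorem oneT_push [FinCx C] [FinCx D] (f : GMap C D) (ψ : Fam C) :
    oneT (push f ψ) = push f (oneT ψ) := by
  funext s p q
  rw [oneT, famT_push]
  simp only [push, oneT]
  split_ifs <;> simp only [comp_add, add_comp, zero_comp,
    comp_zero]

theorem hyp_apply (ψ : Fam C) (s : ℤ) : hyp ψ s = ψ (-s - 1) := rfl

theorem famT_hyp_apply (ψ : Fam C) (s : ℤ) : famT (hyp ψ) s = famT ψ (-s - 1) := rfl

theorem hyp_push (f : GMap C D) (ψ : Fam C) : hyp (push f ψ) = push f (hyp ψ) := rfl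

theorem famT_oneT [FinCx C] (ψ : Fam C) : famT (oneT ψ) = oneT ψ := by
  funext s
  rw [famT_eq, oneT_apply]
  split_ifs
  · rw [dmT_add, famT_eq, dmT_dmT, add_comm]
  · exact dmT_zero

theorem opm_oneT (m : ℤ) (ψ : Fam C) (s : ℤ) (x) : opm m (oneT ψ s) x =
    if s = 0 then opm m (ψ 0) x + opm m (famT ψ 0) x else 0 := by
  rw [oneT_apply]
  split_ifs
  · rw [opm_add]
  · rw [opm_zero]

theorem dHyp_oneT [FinCx C] {n m : ℤ} {ψ : Fam C} (hψ : IsQuad m ψ) :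
    dHyp n (oneT ψ) = oneT (dQuad n ψ) := by
  refine fam_ext (n := m - 1) ((hψ.oneT).isHyp.dHyp (by ring))
    ((hψ.dQuad (by ring)).oneT.isHyp) fun s x => ?_
  simp only [opm_dHyp, famT_oneT, opm_oneT, opm_dQuad, opm_famT_dQuad, lt_irrefl, if_false]
  rcases eq_or_ne s 0 with rfl | h0
  · simp only [if_true, if_neg (show (0 : ℤ) - 1 ≠ 0 by norm_num), smul_zero, add_zero, map_add,
      zero_add, sub_zero, negOnePow_one, Units.neg_smul, one_smul, smul_add, smul_neg]
    abel
  · rcases eq_or_ne s 1 with rfl | h1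
    · simp
      abel
    · simp only [if_neg h0, if_neg (show s - 1 ≠ 0 by omega), map_zero, add_zero, smul_zero]

theorem dHyp_hyp [FinCx C] {n m : ℤ} (hm : m = n + 1) {ψ : Fam C} (hψ : IsQuad n ψ) :
    dHyp m (hyp ψ) = hyp (dQuad n ψ) + n.negOnePow • oneT ψ := by
  subst hm
  refine fam_ext (n := n) ((hψ.hyp rfl).dHyp rfl)
    (((hψ.dQuad (sub_add_cancel n 1).symm).hyp (by ring)).add (hψ.oneT.isHyp.units_smul _))
    fun s x => ?_
  simp only [opm_dHyp, Pi.add_apply, Pi.smul_apply, opm_add, opm_usmul, opm_oneT]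
  simp only [hyp_apply, famT_hyp_apply, opm_dQuad]
  rcases lt_trichotomy s 0 with h | h | h
  · rw [if_neg (by omega), if_neg (by omega), show -(s - 1) - 1 = -s - 1 + 1 by ring]
    rcases sgn_cases n with hn | hn <;>
    rcases sgn_cases s with hs | hs <;>
    simp only [sign_simps, smul_simps, hn, hs] <;> abel
  · subst h
    simp [hψ.eq_zero (show (-1 : ℤ) < 0 by norm_num), opm_zero,  negOnePow_add, smul_add]
  · rw [if_pos (by omega), if_neg (by omega), hψ.eq_zero (show -s - 1 < 0 by omega),
      hψ.eq_zero (show -(s - 1) - 1 < 0 by omega), famT_eq, hψ.eq_zero (show -(s - 1) - 1 < 0 by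
        omega), dmT_zero]
    simp [opm_zero]

end Fam

section Linear

variable {C D E : Cx A}

theorem push_add (f : GMap C D) (θ θ' : Fam C) : push f (θ + θ') = push f θ + push f θ' := by
  funext s p q
  simp only [push, Pi.add_apply, comp_add, add_comp]

theorem push_sub (f : GMap C D) (θ θ' : Fam C) : push f (θ - θ') = push f θ - push f θ' := by
  funext s p q
  simp only [push, Pi.sub_apply, LinearMap.comp_sub, LinearMap.sub_comp]

theorem push_zero (f : GMap C D) : push f 0 = 0 := by
  funext s p q
  simp only [push, Pi.zero_apply, comp_zero, zero_comp]

theorem push_neg (f : GMap C D) (θ : Fam C) : push f (-θ) = -push f θ := by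
  rw [← zero_sub, push_sub, push_zero, zero_sub]

theorem push_usmul (f : GMap C D) (e : ℤˣ) (θ : Fam C) : push f (e • θ) = e • push f θ := by
  rcases Int.units_eq_one_or e with rfl | rfl <;> simp [push_neg]

theorem push_push (f : GMap C D) (g : GMap D E) (θ : Fam C) :
    push g (push f θ) = push (fun i => g i ∘ₗ f i) θ := rfl

theorem push_comps_comp (f : C ⟶ D) (g : D ⟶ E) (θ : Fam C) :
    push (comps (f ≫ g)) θ = push (comps g) (push (comps f) θ) := rfl

theorem push_id (θ : Fam C) : push (comps (𝟙 C)) θ = θ := rfl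

theorem dHyp_add (n : ℤ) (θ θ' : Fam C) : dHyp n (θ + θ') = dHyp n θ + dHyp n θ' := by
  funext s p q
  simp only [dHyp, famT_add, famD, Pi.add_apply, comp_add, add_comp, smul_add]
  abel

theorem dHyp_zero (n : ℤ) : dHyp n (0 : Fam C) = 0 := by
  have := dHyp_add n (0 : Fam C) 0
  rwa [add_zero, left_eq_add] at this

theorem dHyp_neg (n : ℤ) (θ : Fam C) : dHyp n (-θ) = -dHyp n θ := by
  rw [eq_neg_iff_add_eq_zero, ← dHyp_add, neg_add_cancel, dHyp_zero]

theorem dHyp_sub (n : ℤ) (θ θ' : Fam C) : dHyp n (θ - θ') = dHyp n θ - dHyp n θ' := by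
  rw [sub_eq_add_neg, dHyp_add, dHyp_neg, sub_eq_add_neg]

theorem dHyp_usmul (n : ℤ) (e : ℤˣ) (θ : Fam C) : dHyp n (e • θ) = e • dHyp n θ := by
  rcases Int.units_eq_one_or e with rfl | rfl <;> simp [dHyp_neg]

theorem dQuad_add (n : ℤ) (θ θ' : Fam C) : dQuad n (θ + θ') = dQuad n θ + dQuad n θ' := by
  funext s p q
  simp only [dQuad, famT_add, famD, Pi.add_apply, comp_add, add_comp, smul_add]
  split_ifs
  · simp
  · abel

theorem oneT_add (θ θ' : Fam C) : oneT (θ + θ') = oneT θ + oneT θ' := by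
  funext s p q
  simp only [oneT, famT_add, Pi.add_apply]
  split_ifs
  · abel
  · simp

theorem oneT_zero : oneT (0 : Fam C) = 0 := by
  have := oneT_add (0 : Fam C) 0
  rwa [add_zero, left_eq_add] at this

theorem hyp_add (θ θ' : Fam C) : hyp (θ + θ') = hyp θ + hyp θ' := rfl

theorem hyp_zero : hyp (0 : Fam C) = 0 := rfl

theorem pushHtpy_add (n : ℤ) (h : HMap C D) (f f' : GMap C D) (θ θ' : Fam C) :
    pushHtpy n h f f' (θ + θ') = pushHtpy n h f f' θ + pushHtpy n h f f' θ' := by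
  funext s p q
  simp only [pushHtpy, famT_add, Pi.add_apply, comp_add, add_comp, smul_add]
  abel

theorem pushHtpy_zero (n : ℤ) (h : HMap C D) (f f' : GMap C D) : pushHtpy n h f f' 0 = 0 := by
  have := pushHtpy_add n h f f' 0 0
  rwa [add_zero, left_eq_add] at this

theorem pushHtpy_neg (n : ℤ) (h : HMap C D) (f f' : GMap C D) (θ : Fam C) :
    pushHtpy n h f f' (-θ) = -pushHtpy n h f f' θ := by
  rw [eq_neg_iff_add_eq_zero, ← pushHtpy_add, neg_add_cancel, pushHtpy_zero]

theorem pushHtpy_sub (n : ℤ) (h : HMap C D) (f f' : GMap C D) (θ θ' : Fam C) :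
    pushHtpy n h f f' (θ - θ') = pushHtpy n h f f' θ - pushHtpy n h f f' θ' := by
  rw [sub_eq_add_neg, pushHtpy_add, pushHtpy_neg, sub_eq_add_neg]

theorem pushHtpy_usmul (n : ℤ) (h : HMap C D) (f f' : GMap C D) (e : ℤˣ) (θ : Fam C) :
    pushHtpy n h f f' (e • θ) = e • pushHtpy n h f f' θ := by
  rcases Int.units_eq_one_or e with rfl | rfl <;> simp [pushHtpy_neg]

theorem push_pushHtpy [FinCx D] [FinCx E] (g : GMap D E) (n : ℤ) (h : HMap C D) (f f' : GMap C D)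
    (θ : Fam C) : push g (pushHtpy n h f f' θ) =
      pushHtpy n (fun i j => g j ∘ₗ h i j) (fun i => g i ∘ₗ f i) (fun i => g i ∘ₗ f' i) θ := by
  funext s p q
  simp only [push, pushHtpy, comp_add, add_comp, comp_smul,
    smul_comp]
  rfl

theorem pushHtpy_push [FinCx C] [FinCx D] (g : GMap C D) (n : ℤ) (h : HMap D E) (f f' : GMap D E)
    (θ : Fam C) : pushHtpy n h f f' (push g θ) =
      pushHtpy n (fun i j => h i j ∘ₗ g i) (fun i => f i ∘ₗ g i) (fun i => f' i ∘ₗ g i) θ := by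
  funext s p q
  simp only [pushHtpy, famT_push]
  rfl

end Linear

section Forms

variable {B C D E : Cx A}

open DirectSum

/-- Families of morphisms `C_a → D^b`. -/
abbrev FMap (C D : Cx A) : Type u := ∀ a b : ℤ, C.X a →ₗ[A] Dual A (D.X b)

/-- A family `C_a → D^b`, `a + b = k`, on direct sums. -/
def opf (k : ℤ) (γ : FMap C D) : (⨁ i, C.X i) →+ ⨁ i, Dual A (D.X i) := hat (fun a => k - a) γ

theorem opf_add (m : ℤ) (θ θ' : FMap C D) (x) : opf m (θ + θ') x = opf m θ x + opf m θ' x := by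
  revert x; refine dsum_induct fun i x => ?_
  simp only [opf, hat_of _ rfl, Pi.add_apply, LinearMap.add_apply, map_add]

theorem opf_zero (m : ℤ) (x) : opf m (0 : FMap C D) x = 0 := by
  have := opf_add m (0 : FMap C D) 0 x
  rwa [add_zero, left_eq_add] at this

theorem opf_neg (m : ℤ) (θ : FMap C D) (x) : opf m (-θ) x = -opf m θ x := by
  rw [eq_neg_iff_add_eq_zero, ← opf_add, neg_add_cancel, opf_zero]

theorem opf_sub (m : ℤ) (θ θ' : FMap C D) (x) : opf m (θ - θ') x = opf m θ x - opf m θ' x := by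
  rw [sub_eq_add_neg, opf_add, opf_neg, sub_eq_add_neg]

theorem opf_usmul (m : ℤ) (e : ℤˣ) (θ : FMap C D) (x) : opf m (e • θ) x = e • opf m θ x := by
  rcases Int.units_eq_one_or e with rfl | rfl <;> simp [opf_neg]

theorem form_ext {m : ℤ} {γ γ' : Form C} (h : IsForm m γ) (h' : IsForm m γ')
    (H : ∀ s x, opf (-(m + s)) (γ s) x = opf (-(m + s)) (γ' s) x) : γ = γ' := by
  funext s a b
  by_cases hb : -a + -b = m + s
  · obtain rfl : b = -(m + s) - a := by omega
    exact hat_injective (H s) a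
  · rw [h s a b hb, h' s a b hb]

theorem opf_pull (k : ℤ) (f : GMap C D) (γ : Form D) (s : ℤ) (x) :
    opf k (pull f γ s) x = opg' f (opf k (γ s) (opg f x)) := by
  revert x; refine dsum_induct fun p x => ?_
  rw [opf, opf, hat_of _ rfl, opg_of, hat_of _ rfl, opg'_of]; rfl

theorem opf_formD (k : ℤ) (γ : Form C) (s : ℤ) (x) :
    opf k (formD γ s) x = - eps (opd' C (opf (k - 1) (γ s) x)) +
      (k + 1).negOnePow • opf (k - 1) (γ s) (opd C x) := by
  revert x; refine dsum_induct fun a x => ?_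
  rw [opf, opf, opd, opd', hat_of _ rfl, hat_of (k - a - 1) (by ring), hat_of (k - a) (by ring),
    hat_of _ rfl, hat_of (k - a) (by ring), eps_of, ← map_usmul, ← map_usmul,
    ← map_neg, ← map_add, ← Units.neg_smul, ← negOnePow_succ,
    show (k + 1).negOnePow = (a + (k - a) + 1).negOnePow by congr 1; ring]
  rfl

theorem dForm_eq (n : ℤ) (θ : Form C) (s : ℤ) : dForm n θ s =
    formD θ s + (n + s - 1).negOnePow • (θ (s - 1) + s.negOnePow • formT θ (s - 1)) := rfl

theorem opf_dForm (k n : ℤ) (γ : Form C) (s : ℤ) (x) :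
    opf k (dForm n γ s) x = - eps (opd' C (opf (k - 1) (γ s) x)) +
      (k + 1).negOnePow • opf (k - 1) (γ s) (opd C x) +
        (n + s - 1).negOnePow • (opf k (γ (s - 1)) x + s.negOnePow • opf k (formT γ (s - 1)) x) :=
          by
  simp only [dForm_eq, opf_add, opf_usmul, opf_formD]

theorem opf_pullHtpy (k m : ℤ) (h : HMap C D) (f f' : GMap C D) (γ : Form D) (s : ℤ) (x) :
    opf k (pullHtpy m h f f' γ s) x = eps (oph' 1 h (opf (k + 1) (γ s) (opg f x))) +
      k.negOnePow • opg' f' (opf (k + 1) (γ s) (oph 1 h x)) +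
        (m + k + 1).negOnePow •
          eps (oph' 1 h (opf (k + 1 + 1) (formT γ (s - 1)) (oph 1 h x))) := by
  revert x; refine dsum_induct fun p x => ?_
  rw [opg_of, opf, opf, opf, oph, oph', hat_of _ rfl, hat_of (k - p + 1) (by ring),
    hat_of (k - p) (by ring), hat_of _ rfl, hat_of (k - p) (by ring),
    hat_of (k - p + 1) (by ring), hat_of (k - p) (by ring), opg'_of, eps_of, eps_of, smul_smul,
    ← negOnePow_add, ← map_usmul, ← map_usmul, ← map_usmul, ← map_add,
    ← map_add, negOnePow_congr (show (m + k + 1 + (k - p) - (m + p + 1)) % 2 = 0 by omega),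
    show k.negOnePow = (p + (k - p)).negOnePow by congr 1; ring]
  rfl

theorem transp_transp {M N : Type u} [AddCommGroup M] [Module A M] [AddCommGroup N] [Module A N]
    (γ : M →ₗ[A] Dual A N) : transp (transp γ) = γ := by
  ext x y
  simp [transp]

theorem transp_add {M N : Type u} [AddCommGroup M] [Module A M] [AddCommGroup N] [Module A N]
    (γ γ' : M →ₗ[A] Dual A N) : transp (γ + γ') = transp γ + transp γ' := by
  rw [transp, dualMap_add]; rfl

theorem transp_zero {M N : Type u} [AddCommGroup M] [Module A M] [AddCommGroup N] [Module A N] :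
    transp (0 : M →ₗ[A] Dual A N) = 0 := by
  rw [transp, dualMap_zero]; rfl

theorem transp_usmul {M N : Type u} [AddCommGroup M] [Module A M] [AddCommGroup N]
    [Module A N] (e : ℤˣ) (γ : M →ₗ[A] Dual A N) : transp (e • γ) = e • transp γ := by
  rw [transp, dualMap_usmul]; rfl

theorem formT_formT (γ : Form C) : formT (formT γ) = γ := by
  funext s a b
  simp only [formT, transp_usmul, transp_transp, smul_smul, ← negOnePow_add]
  rw [negOnePow_congr' (b := 0) (a * b) (by ring), negOnePow_zero, one_smul]

theorem formT_add (γ γ' : Form C) : formT (γ + γ') = formT γ + formT γ' := by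
  funext s a b
  simp only [formT, Pi.add_apply, transp_add, smul_add]

theorem transp_comp {M N M' N' : Type u} [AddCommGroup M] [Module A M] [AddCommGroup N] [Module A N]
    [AddCommGroup M'] [Module A M'] [AddCommGroup N'] [Module A N'] (g : N' →ₗ[A] N)
    (γ : M →ₗ[A] Dual A N) (f : M' →ₗ[A] M) :
    transp (dualMap g ∘ₗ γ ∘ₗ f) = dualMap f ∘ₗ transp γ ∘ₗ g := rfl

theorem transp_comp_left {M N N' : Type u} [AddCommGroup M] [Module A M] [AddCommGroup N]
    [Module A N] [AddCommGroup N'] [Module A N'] (g : N' →ₗ[A] N) (γ : M →ₗ[A] Dual A N) :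
    transp (dualMap g ∘ₗ γ) = transp γ ∘ₗ g := rfl

theorem transp_comp_right {M N M' : Type u} [AddCommGroup M] [Module A M] [AddCommGroup N]
    [Module A N] [AddCommGroup M'] [Module A M'] (γ : M →ₗ[A] Dual A N) (f : M' →ₗ[A] M) :
    transp (γ ∘ₗ f) = dualMap f ∘ₗ transp γ := rfl

theorem formT_pull (f : GMap C D) (γ : Form D) : formT (pull f γ) = pull f (formT γ) := by
  funext s a b
  simp only [formT, pull, transp_comp, smul_comp, comp_smul]

theorem formT_formD (γ : Form C) : formT (formD γ) = formD (formT γ) := by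
  funext s a b
  simp only [formT, formD, transp_add, transp_usmul, transp_comp_left, transp_comp_right,
    smul_add, smul_comp, comp_smul, smul_smul, ← negOnePow_add]
  rw [add_comm]
  congr 2
  · exact negOnePow_congr' a (by ring)
  · exact negOnePow_congr' 0 (by ring)

theorem formT_dForm (n : ℤ) (γ : Form C) (s : ℤ) : formT (dForm n γ) s =
    formD (formT γ) s + (n + s - 1).negOnePow • (formT γ (s - 1) + s.negOnePow • γ (s - 1)) := by
  have h := congrFun (formT_formD γ) s
  funext a b
  have h1 := congrFun (congrFun h a) b
  have h2 : transp (formT γ (s - 1) b a) = (a * b).negOnePow • γ (s - 1) a b := by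
    simp only [formT, transp_usmul, transp_transp, mul_comm b a]
  simp only [formT] at h1
  simp only [formT, dForm, transp_add, transp_usmul, smul_add, h1, Pi.add_apply,
    Pi.smul_apply]
  congr 2
  · rw [smul_comm]
  · rw [show (b * a).negOnePow • transp (transp (γ (s - 1) a b)) =
      (b * a).negOnePow • γ (s - 1) a b by rw [transp_transp], smul_comm,
      smul_comm (a * b).negOnePow s.negOnePow, mul_comm b a, usmul_usmul]

theorem opf_formT_dForm (k n : ℤ) (γ : Form C) (s : ℤ) (x) :
    opf k (formT (dForm n γ) s) x = - eps (opd' C (opf (k - 1) (formT γ s) x)) +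
      (k + 1).negOnePow • opf (k - 1) (formT γ s) (opd C x) +
        (n + s - 1).negOnePow • (opf k (formT γ (s - 1)) x + s.negOnePow • opf k (γ (s - 1)) x) :=
          by
  simp only [formT_dForm, opf_add, opf_usmul, opf_formD]

theorem formT_pullHtpy (m : ℤ) (h : HMap C D) (f f' : GMap C D) (γ : Form D) :
    formT (pullHtpy m h f f' γ) = pullHtpy (m + 1) h f' f (formT γ) := by
  funext s a b
  simp only [pullHtpy, formT_formT]
  simp only [formT, pullHtpy, transp_add, transp_usmul, transp_comp, smul_add,
    smul_comp, comp_smul, smul_smul, ← negOnePow_add, transp_transp]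
  rw [add_comm (_ • _) (_ • _)]
  congr 1
  · congr 2
    · exact negOnePow_congr' 0 (by ring)
    · exact negOnePow_congr' (-b) (by ring)
  · congr 1
    exact negOnePow_congr' (a * b + b) (by ring)

theorem IsForm.add {n : ℤ} {θ θ' : Form C} (h : IsForm n θ) (h' : IsForm n θ') :
    IsForm n (θ + θ') := fun s p q hpq => by
  simp only [Pi.add_apply, h s p q hpq, h' s p q hpq, add_zero]

theorem IsForm.sub {n : ℤ} {θ θ' : Form C} (h : IsForm n θ) (h' : IsForm n θ') :
    IsForm n (θ - θ') := fun s p q hpq => by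
  simp only [Pi.sub_apply, h s p q hpq, h' s p q hpq, sub_zero]

theorem IsForm.zero {n : ℤ} : IsForm n (0 : Form C) := fun _ _ _ _ => rfl

theorem IsForm.formT {n : ℤ} {θ : Form C} (h : IsForm n θ) : IsForm n (formT θ) :=
  fun s a b hab => by
    simp only [APC.formT, h s b a (by omega), transp_zero, smul_zero]

theorem IsForm.pull {n : ℤ} {θ : Form D} (h : IsForm n θ) (f : GMap C D) : IsForm n (pull f θ) :=
  fun s p q hpq => by
    simp only [APC.pull, h s p q hpq, zero_comp, comp_zero]

theorem IsForm.dForm {n m k : ℤ} {θ : Form C} (h : IsForm n θ) (hm : n = m + 1) :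
    IsForm m (dForm k θ) := fun s p q hpq => by
  simp only [APC.dForm, formD, h s p (q - 1) (by omega), h s (p - 1) q (by omega),
    h (s - 1) p q (by omega), h.formT (s - 1) p q (by omega), zero_comp,
    comp_zero, smul_zero, add_zero]

theorem IsForm.pullHtpy {n m k : ℤ} {θ : Form D} (h : IsForm n θ) (hm : m = n + 1) (H : HMap C D)
    (f f' : GMap C D) : IsForm m (pullHtpy k H f f' θ) := fun s p q hpq => by
  simp only [APC.pullHtpy, h s p (q + 1) (by omega), h s (p + 1) q (by omega),
    h.formT (s - 1) (p + 1) (q + 1) (by omega), zero_comp,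
    comp_zero, smul_zero, add_zero]

theorem dForm_add (n : ℤ) (θ θ' : Form C) : dForm n (θ + θ') = dForm n θ + dForm n θ' := by
  funext s p q
  simp only [dForm, formT_add, formD, Pi.add_apply, comp_add, add_comp,
    smul_add]
  abel

theorem dForm_zero (n : ℤ) : dForm n (0 : Form C) = 0 := by
  have := dForm_add n (0 : Form C) 0
  rwa [add_zero, left_eq_add] at this

theorem dForm_neg (n : ℤ) (θ : Form C) : dForm n (-θ) = -dForm n θ := by
  rw [eq_neg_iff_add_eq_zero, ← dForm_add, neg_add_cancel, dForm_zero]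

theorem dForm_sub (n : ℤ) (θ θ' : Form C) : dForm n (θ - θ') = dForm n θ - dForm n θ' := by
  rw [sub_eq_add_neg, dForm_add, dForm_neg, sub_eq_add_neg]

theorem pull_add (f : GMap C D) (θ θ' : Form D) : pull f (θ + θ') = pull f θ + pull f θ' := by
  funext s p q
  simp only [pull, Pi.add_apply, comp_add, add_comp]

theorem pull_sub (f : GMap C D) (θ θ' : Form D) : pull f (θ - θ') = pull f θ - pull f θ' := by
  funext s p q
  simp only [pull, Pi.sub_apply, LinearMap.comp_sub, LinearMap.sub_comp]

theorem pull_zero (f : GMap C D) : pull f (0 : Form D) = 0 := by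
  funext s p q
  simp only [pull, Pi.zero_apply, comp_zero, zero_comp]

theorem pull_neg (f : GMap C D) (θ : Form D) : pull f (-θ) = -pull f θ := by
  rw [← zero_sub, pull_sub, pull_zero, zero_sub]

theorem pullHtpy_add (n : ℤ) (h : HMap C D) (f f' : GMap C D) (θ θ' : Form D) :
    pullHtpy n h f f' (θ + θ') = pullHtpy n h f f' θ + pullHtpy n h f f' θ' := by
  funext s p q
  simp only [pullHtpy, formT_add, Pi.add_apply, comp_add, add_comp, smul_add]
  abel

theorem pullHtpy_zero (n : ℤ) (h : HMap C D) (f f' : GMap C D) :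
    pullHtpy n h f f' (0 : Form D) = 0 := by
  have := pullHtpy_add n h f f' (0 : Form D) 0
  rwa [add_zero, left_eq_add] at this

theorem pullHtpy_neg (n : ℤ) (h : HMap C D) (f f' : GMap C D) (θ : Form D) :
    pullHtpy n h f f' (-θ) = -pullHtpy n h f f' θ := by
  rw [eq_neg_iff_add_eq_zero, ← pullHtpy_add, neg_add_cancel, pullHtpy_zero]

theorem pullHtpy_sub (n : ℤ) (h : HMap C D) (f f' : GMap C D) (θ θ' : Form D) :
    pullHtpy n h f f' (θ - θ') = pullHtpy n h f f' θ - pullHtpy n h f f' θ' := by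
  rw [sub_eq_add_neg, pullHtpy_add, pullHtpy_neg, sub_eq_add_neg]

theorem pull_comp (f : C ⟶ D) (g : D ⟶ E) (γ : Form E) :
    pull (comps (f ≫ g)) γ = pull (comps f) (pull (comps g) γ) := rfl

theorem pull_id (γ : Form C) : pull (comps (𝟙 C)) γ = γ := rfl

theorem pull_pullHtpy (g : GMap B C) (m : ℤ) (h : HMap C D) (f f' : GMap C D) (γ : Form D) :
    pull g (pullHtpy m h f f' γ) = pullHtpy m (fun i j => h i j ∘ₗ g i) (fun i => f i ∘ₗ g i)
      (fun i => f' i ∘ₗ g i) γ := by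
  funext s a b
  simp only [pull, pullHtpy, comp_add, add_comp, comp_smul,
    smul_comp]
  rfl

theorem pullHtpy_pull (g : GMap D E) (m : ℤ) (h : HMap C D) (f f' : GMap C D) (γ : Form E) :
    pullHtpy m h f f' (pull g γ) = pullHtpy m (fun i j => g j ∘ₗ h i j) (fun i => g i ∘ₗ f i)
      (fun i => g i ∘ₗ f' i) γ := by
  funext s a b
  simp only [pullHtpy, formT_pull]
  rfl

theorem dForm_pull {n m : ℤ} (f : C ⟶ D) {γ : Form D} (hγ : IsForm m γ) :
    dForm n (pull (comps f) γ) = pull (comps f) (dForm n γ) := by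
  refine form_ext (m := m - 1) ((hγ.pull _).dForm (by ring)) ((hγ.dForm (by ring)).pull _)
    fun s x => ?_
  simp only [hom_simps, opf_pull, opf_dForm, formT_pull, opg_opd, ← opg'_opd', opg'_eps]

theorem dForm_pullHtpy {n : ℤ} {f f' : C ⟶ D} (h : Homotopy f' f) {γ : Form D}
    (hγ : IsForm n γ) :
    dForm (n + 1) (pullHtpy n (hcomps h) (comps f) (comps f') γ) +
      pullHtpy (n - 1) (hcomps h) (comps f) (comps f') (dForm n γ) =
      pull (comps f') γ - pull (comps f) γ := by
  refine form_ext (m := n) (((hγ.pullHtpy rfl _ _ _).dForm rfl).add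
    ((hγ.dForm (sub_add_cancel n 1).symm).pullHtpy (by ring) _ _ _))
    ((hγ.pull _).sub (hγ.pull _)) fun s x => ?_
  have hd : ∀ x, oph 1 (hcomps h) (opd C x) =
      opg (comps f') x - opg (comps f) x - opd D (oph 1 (hcomps h) x) :=
    fun x => eq_sub_of_add_eq' (oph_htpy h x)
  have hd' : ∀ x, opd' C (oph' 1 (hcomps h) x) =
      opg' (comps f') x - opg' (comps f) x - oph' 1 (hcomps h) (opd' D x) :=
    fun x => eq_sub_of_add_eq (oph'_htpy h x)
  simp only [Pi.add_apply, Pi.sub_apply, opf_add, opf_sub, opf_pull, opf_dForm, opf_pullHtpy,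
    formT_pullHtpy, formT_formT, opf_formT_dForm, add_sub_cancel_right, sub_add_cancel]
  simp only [hom_simps, eps_eps, opd'_eps, oph'_eps, opg'_eps, hd, hd', opg_opd, ← opg'_opd']
  rcases sgn_cases n with hn | hn <;>
  rcases sgn_cases s with hs | hs <;>
  simp only [sign_simps, smul_simps, hn, hs] <;> abel

end Forms

section Suspension

variable {B C C' D E : Cx A}

theorem negOnePow_congr_mul {a b : ℤ} (n c : ℤ) (h : a - b = n * (n + 1) - 2 * c) :
    a.negOnePow = b.negOnePow := by
  rw [Int.negOnePow_eq_iff, h]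
  exact (Int.even_mul_succ_self n).sub ⟨c, two_mul c⟩

instance [FinCx C] (n : ℤ) : FinCx (nDual n C) where
  finite i := inferInstanceAs (Module.Finite A (Dual A (C.X (n - i))))
  projective i := inferInstanceAs (Module.Projective A (Dual A (C.X (n - i))))

/-- The `n`-fold suspension of a form, as a family on the `n`-dual complex. -/
def suspFam (n : ℤ) (γ : Form C) : Fam (nDual n C) := fun s p q =>
  (susp n γ s p q ∘ₗ unev : Dual A (Dual A (C.X (n - p))) →ₗ[A] _)

theorem famT_suspFam [FinCx C] (n : ℤ) (γ : Form C) :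
    famT (suspFam n γ) = n.negOnePow • suspFam n (formT γ) := by
  funext s p q
  have h := adj_comp_unev (susp n γ s q p)
  change (p * q).negOnePow • adj (susp n γ s q p ∘ₗ unev) =
    n.negOnePow • (susp n (formT γ) s p q ∘ₗ unev)
  rw [h]
  simp only [susp, formT, transp_usmul, smul_comp, smul_smul, ← negOnePow_add]
  congr 1
  have h := negOnePow_congr_mul (a := n + (n * (n - q) + (n - p) * (n - q)))
    (b := p * q + n * (n - p)) n (n * q) (by ring)
  exact h.symm

theorem dHyp_suspFam [FinCx C] (n k : ℤ) (γ : Form C) :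
    dHyp k (suspFam n γ) = suspFam n (dForm (k - n) γ) := by
  funext s p q
  have hD : famD (suspFam n γ) s p q = suspFam n (formD γ) s p q := by
    have h : (unev : Dual A (Dual A (C.X (n - (p + 1)))) →ₗ[A] _) ∘ₗ
        dualMap (dualMap (C.d (n - p) (n - (p + 1))).hom) =
        (C.d (n - p) (n - (p + 1))).hom ∘ₗ unev := unev_dualMap_dualMap _
    change ((q + 1).negOnePow • dualMap (C.d (n - q) (n - (q + 1))).hom) ∘ₗ
        ((n * (n - (q + 1))).negOnePow • γ (s - n) (n - p) (n - (q + 1))) ∘ₗ unev +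
      q.negOnePow • ((((n * (n - q)).negOnePow • γ (s - n) (n - (p + 1)) (n - q)) ∘ₗ unev) ∘ₗ
        dualMap ((p + 1).negOnePow • dualMap (C.d (n - p) (n - (p + 1))).hom)) =
      ((n * (n - q)).negOnePow • formD γ (s - n) (n - p) (n - q)) ∘ₗ unev
    rw [dualMap_usmul, formD, show n - q - 1 = n - (q + 1) by ring,
      show n - p - 1 = n - (p + 1) by ring]
    simp only [comp_smul, smul_comp, comp_assoc, h, smul_add,
      add_comp, smul_smul, ← negOnePow_add]
    congr 2
    · exact negOnePow_congr' (q - n) (by ring)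
    · exact negOnePow_congr' (p + q - n) (by ring)
  have hT : famT (suspFam n γ) (s - 1) p q = n.negOnePow • suspFam n (formT γ) (s - 1) p q := by
    rw [famT_suspFam]; rfl
  rw [dHyp, hD, hT]
  change (susp n (formD γ) s p q ∘ₗ unev) +
    (k + s - 1).negOnePow • ((susp n γ (s - 1) p q ∘ₗ unev) + s.negOnePow •
      n.negOnePow • (susp n (formT γ) (s - 1) p q ∘ₗ unev)) =
    susp n (dForm (k - n) γ) s p q ∘ₗ unev
  simp only [susp, dForm, smul_add, smul_comp, add_comp, smul_smul,
    ← negOnePow_add, show s - 1 - n = s - n - 1 by ring]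
  congr 1
  congr 2
  · exact negOnePow_congr' n (by ring)
  · exact negOnePow_congr' (2 * n) (by ring)

theorem isHyp_suspFam {n m k : ℤ} {γ : Form C} (hγ : IsForm m γ) (hk : k = n + m) :
    IsHyp k (suspFam n γ) := fun s p q hpq => by
  have : susp n γ s p q = 0 := by rw [susp, hγ _ _ _ (by omega), smul_zero]
  rw [suspFam, this, zero_comp]
  rfl

theorem suspFam_sub (n : ℤ) (γ γ' : Form C) :
    suspFam n (γ - γ') = suspFam n γ - suspFam n γ' := by
  funext s p q
  simp only [suspFam, susp, Pi.sub_apply, smul_sub, LinearMap.sub_comp]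
  rfl

theorem suspFam_zero (n : ℤ) : suspFam n (0 : Form C) = 0 := by
  have := suspFam_sub n (0 : Form C) 0
  rwa [sub_self, sub_self] at this

/-- The differential of a family `C^p → D_q`. -/
def dmD (θ : DMap C D) : DMap C D := fun p q =>
  (D.d (q + 1) q).hom ∘ₗ θ p (q + 1) + q.negOnePow • (θ (p + 1) q ∘ₗ dualMap (C.d (p + 1) p).hom)

theorem famD_eq (θ : Fam C) (s : ℤ) : famD θ s = dmD (θ s) := rfl

theorem opm_dmD (m : ℤ) (θ : DMap C D) (x) :
    opm m (dmD θ) x = opd D (opm (m + 1) θ x) + eps (opm (m + 1) θ (opd' C x)) := by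
  revert x; refine dsum_induct fun p x => ?_
  rw [opm, opm, opd, opd', hat_of _ rfl, hat_of (m - p + 1) (by ring), hat_of (m - p) (by ring),
    hat_of _ rfl, hat_of (m - p) (by ring), eps_of, ← map_usmul, ← map_add]
  rfl

theorem dmD_apply (θ : DMap C D) {p p' q q' : ℤ} (hp : p' = p + 1) (hq : q' = q + 1) :
    dmD θ p q = (D.d q' q).hom ∘ₗ θ p q' + q.negOnePow • (θ p' q ∘ₗ dualMap (C.d p' p).hom) := by
  subst hp hq; rfl

/-- A family `C^p → D_q` as a family of morphisms `(C^{n-*})_r → D_r`. -/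
def dmG (n : ℤ) (G : DMap C D) : GMap (nDual n C) D := fun r =>
  (G (n - r) r : Dual A (C.X (n - r)) →ₗ[A] D.X r)

/-- A family `C^p → D_q` as a family of morphisms `(C^{n-*})_i → D_j`. -/
def dmK (n : ℤ) (K : DMap C D) : HMap (nDual n C) D := fun i j =>
  (K (n - i) j : Dual A (C.X (n - i)) →ₗ[A] D.X j)

/-- The chain map `C^{n-*} → D` given by a family of morphisms `C^p → D_q`. -/
def dmHom (n : ℤ) (G : DMap C D) (hG : dmD G = 0) : nDual n C ⟶ D where
  f r := ModuleCat.ofHom (G (n - r) r)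
  comm' i j hij := by
    simp only [ComplexShape.down_Rel] at hij
    have h1 := congrFun (congrFun hG (n - i)) j
    rw [dmD_apply G (p' := n - j) (q' := i) (by omega) (by omega)] at h1
    have h2 : i.negOnePow = -j.negOnePow := by rw [← hij, negOnePow_succ]
    refine ModuleCat.hom_ext ?_
    rw [Pi.zero_apply, Pi.zero_apply, add_eq_zero_iff_eq_neg] at h1
    simp only [ModuleCat.hom_comp, ModuleCat.hom_ofHom, nDual]
    rw [h1, h2, comp_smul, Units.neg_smul]

/-- The chain homotopy of maps `C^{n-*} → D` given by a family of morphisms. -/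
def dmHtpy {n : ℤ} {K G G' : DMap C D} (hK : IsDeg (n + 1) K) (hG : dmD G = 0) (hG' : dmD G' = 0)
    (h : dmD K = G' - G) : Homotopy (dmHom n G' hG') (dmHom n G hG) where
  hom := fun i j => ConcreteCategory.ofHom (C := ModuleCat A) (X := (nDual n C).X i) (Y := D.X j)
    (dmK n K i j)
  zero i j hij := by
    simp only [ComplexShape.down_Rel] at hij
    rw [dmK, hK _ _ (by omega)]; rfl
  comm i := by
    rw [dNext_eq _ (show (ComplexShape.down ℤ).Rel i (i - 1) by simp),
      prevD_eq _ (show (ComplexShape.down ℤ).Rel (i + 1) i by simp)]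
    have h1 := congrFun (congrFun h (n - i)) i
    rw [dmD_apply K (p' := n - (i - 1)) (q' := i + 1) (by omega) (by omega), Pi.sub_apply,
      Pi.sub_apply, eq_sub_iff_add_eq] at h1
    refine ModuleCat.hom_ext ?_
    rw [ModuleCat.hom_add, ModuleCat.hom_add, ModuleCat.hom_comp, ModuleCat.hom_comp]
    change G' (n - i) i = K (n - (i - 1)) i ∘ₗ
      (i.negOnePow • dualMap (C.d (n - (i - 1)) (n - i)).hom) +
      (D.d (i + 1) i).hom ∘ₗ K (n - i) (i + 1) + G (n - i) i
    rw [← h1, comp_smul]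
    abel

theorem pushDual_eq (n : ℤ) (G : DMap C D) (γ : Form C) :
    pushDual n G γ = push (dmG n G) (suspFam n γ) := rfl

theorem pushDualHtpy_eq [FinCx C] (n : ℤ) (K G G' : DMap C D) (γ : Form C) :
    pushDualHtpy n K G G' γ = pushHtpy n (dmK n K) (dmG n G) (dmG n G') (suspFam n γ) := by
  funext s p q
  have h : famT (suspFam n γ) (s - 1) (p - 1) (q - 1) =
    (((p - 1) * (q - 1)).negOnePow • transp (susp n γ (s - 1) (q - 1) (p - 1))) ∘ₗ unev := by
    change _ • adj (susp n γ (s - 1) (q - 1) (p - 1) ∘ₗ unev) = _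
    rw [adj_comp_unev, smul_comp]
    rfl
  unfold pushHtpy
  rw [h]
  rfl

theorem isHyp_pushDualHtpy [FinCx C] {n m k : ℤ} {γ : Form C} (hγ : IsForm m γ)
    (K G G' : DMap C D) (hk : k = n + m + 1) : IsHyp k (pushDualHtpy n K G G' γ) := by
  rw [pushDualHtpy_eq]
  exact (isHyp_suspFam hγ rfl).pushHtpy hk _ _ _

theorem dHyp_pushDualHtpy [FinCx C] [FinCx D] {n : ℤ} {K G G' : DMap C D}
    (hK : IsDeg (n + 1) K) (hG : dmD G = 0) (hG' : dmD G' = 0) (h : dmD K = G' - G)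
    {γ : Form C} (hγ : IsBundle γ) :
    dHyp (n + 1) (pushDualHtpy n K G G' γ) = pushDual n G' γ - pushDual n G γ := by
  have h1 := dHyp_pushHtpy (dmHtpy hK hG hG' h) (isHyp_suspFam (n := n) hγ.1 rfl)
  rw [add_zero, dHyp_suspFam, sub_self, hγ.2, suspFam_zero, pushHtpy_zero, add_zero] at h1
  rw [pushDualHtpy_eq]
  exact h1

theorem pushDual_sub (n : ℤ) (G : DMap C D) (γ γ' : Form C) :
    pushDual n G (γ - γ') = pushDual n G γ - pushDual n G γ' :=
  (congrArg (push (dmG n G)) (suspFam_sub n γ γ')).trans (push_sub _ _ _)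

theorem pushDual_zero (n : ℤ) (G : DMap C D) : pushDual n G (0 : Form C) = 0 :=
  (congrArg (push (dmG n G)) (suspFam_zero n)).trans (push_zero _)

theorem push_pushDual (n : ℤ) (f : GMap D E) (G : DMap C D) (γ : Form C) :
    push f (pushDual n G γ) = pushDual n (fun p q => f q ∘ₗ G p q) γ := rfl

theorem push_pushDualHtpy (n : ℤ) (f : GMap D E) (K G G' : DMap C D) (γ : Form C) :
    push f (pushDualHtpy n K G G' γ) = pushDualHtpy n (fun p q => f q ∘ₗ K p q)
      (fun p q => f q ∘ₗ G p q) (fun p q => f q ∘ₗ G' p q) γ := by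
  funext s p q
  simp only [push, pushDualHtpy, comp_add, add_comp, comp_smul,
    smul_comp]
  rfl

theorem pushDual_pull [FinCx C] [FinCx C'] (n : ℤ) (f : GMap C C') (G : DMap C D) (γ : Form C') :
    pushDual n G (pull f γ) = pushDual n (fun p q => G p q ∘ₗ dualMap (f p)) γ := by
  funext s p q
  simp only [pushDual, susp, pull, adj_comp_dualMap', comp_smul, smul_comp]
  rfl

theorem pushDual_pullHtpy [FinCx C] [FinCx C'] (n : ℤ) (h : HMap C C') (f f' : GMap C C')
    (G : DMap C D) (K : DMap C' D) (hK : ∀ q, K (n - (q - 1)) q =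
      q.negOnePow • (G (n - q) q ∘ₗ dualMap (h (n - q) (n - (q - 1))))) (γ : Form C') :
    pushDual n G (pullHtpy 0 h f f' γ) = pushDualHtpy n K
      (fun p q => G p q ∘ₗ dualMap (f p)) (fun p q => G p q ∘ₗ dualMap (f' p)) γ := by
  funext s p q
  rw [pushDual, pushDualHtpy, hK, hK]
  simp only [susp, pullHtpy, adj_usmul, adj_comp_dualMap', comp_smul,
    smul_comp, comp_add, add_comp, transp_usmul, formT,
    smul_add, smul_smul, ← negOnePow_add, comp_assoc]
  rw [show n - q + 1 = n - (q - 1) by ring, show n - p + 1 = n - (p - 1) by ring,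
    show s - n - 1 = s - 1 - n by ring]
  congr 1
  · congr 1
    · congr 1
      exact negOnePow_congr' (-q) (by ring)
    · congr 1
      exact negOnePow_congr' (n - p - q) (by ring)
  · congr 1
    exact negOnePow_congr_mul n (n * q + q + p) (by ring)

end Suspension

section OpOf

variable {C D : Cx A}

theorem opd_of {i : ℤ} (j : ℤ) (h : i = j + 1) (x : C.X i) :
    opd C (DirectSum.of (fun i => C.X i) i x) =
      DirectSum.of (fun i => C.X i) j ((C.d i j).hom x) := by
  rw [opd, hat_of j (by omega)]

theorem opd'_of {i : ℤ} (j : ℤ) (h : j = i + 1) (x : Dual A (C.X i)) :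
    opd' C (DirectSum.of (fun i => Dual A (C.X i)) i x) =
      DirectSum.of (fun i => Dual A (C.X i)) j (dualMap (C.d j i).hom x) := by
  rw [opd', hat_of j (by omega)]

theorem oph_of {k i : ℤ} (j : ℤ) (h : j = i + k) (f : HMap C D) (x : C.X i) :
    oph k f (DirectSum.of (fun i => C.X i) i x) =
      DirectSum.of (fun i => D.X i) j (f i j x) := by
  rw [oph, hat_of j (by omega)]

theorem oph'_of {k i : ℤ} (j : ℤ) (h : i = j + k) (f : HMap C D) (x : Dual A (D.X i)) :
    oph' k f (DirectSum.of (fun i => Dual A (D.X i)) i x) =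
      DirectSum.of (fun i => Dual A (C.X i)) j (dualMap (f j i) x) := by
  rw [oph', hat_of j (by omega)]

end OpOf

section Fiber

variable {A : Type u} [Ring A] {C D Y D' Y' : Cx A}

/-- A family of morphisms which is a chain map. -/
structure IsChainH (e : HMap D Y) : Prop where
  diag : ∀ i j, i ≠ j → e i j = 0
  comm : ∀ {i j i' j'}, i = i' → j = j' → (Y.d i' j').hom ∘ₗ e i i' = e j j' ∘ₗ (D.d i j).hom

/-- The desuspended mapping cone `F_r = Y_{r+1} ⊕ D_r` of a chain map `e : D → Y`, with
differential `(x, z) ↦ (d x + (-1)^r e z, d z)`. -/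
def fiberCx (e : HMap D Y) (he : IsChainH e) : Cx A where
  X r := ModuleCat.of A (Y.X (r + 1) × D.X r)
  d i j := ModuleCat.ofHom (LinearMap.prod
    ((Y.d (i + 1) (j + 1)).hom ∘ₗ LinearMap.fst A (Y.X (i + 1)) (D.X i) +
      i.negOnePow • (e i (j + 1) ∘ₗ LinearMap.snd A (Y.X (i + 1)) (D.X i)))
    ((D.d i j).hom ∘ₗ LinearMap.snd A (Y.X (i + 1)) (D.X i)))
  shape i j hij := by
    simp only [ComplexShape.down_Rel] at hij
    have h1 : Y.d (i + 1) (j + 1) = 0 := Y.shape _ _ (by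
      simp only [ComplexShape.down_Rel]; omega)
    have h2 : D.d i j = 0 := D.shape _ _ (by simp only [ComplexShape.down_Rel]; omega)
    rw [h1, h2, he.diag i (j + 1) (by omega)]
    refine ModuleCat.hom_ext (LinearMap.ext fun x => Prod.ext ?_ ?_) <;> simp
  d_comp_d' i j k hij hjk := by
    simp only [ComplexShape.down_Rel] at hij hjk
    have h1 := d_comp_d_hom Y (i + 1) (j + 1) (k + 1)
    have h2 := he.comm (show i = j + 1 by omega) (show j = k + 1 by omega)
    have h3 := d_comp_d_hom D i j k
    have h5 : i.negOnePow = -j.negOnePow := by rw [← hij, negOnePow_succ]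
    rw [← ModuleCat.ofHom_comp]
    refine ModuleCat.hom_ext (LinearMap.ext fun x => ?_)
    obtain ⟨x, y⟩ := x
    have e1 := LinearMap.congr_fun h1 x
    have e2 := LinearMap.congr_fun h2 y
    have e3 := LinearMap.congr_fun h3 y
    simp only [LinearMap.comp_apply, LinearMap.zero_apply] at e1 e2 e3
    refine Prod.ext ?_ ?_
    · simp [h5, e1, e2]
    · simp [e3]

instance (e : HMap D Y) (he : IsChainH e) [FinCx D] [FinCx Y] : FinCx (fiberCx e he) where
  finite i := inferInstanceAs (Module.Finite A (Y.X (i + 1) × D.X i))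
  projective i := inferInstanceAs (Module.Projective A (Y.X (i + 1) × D.X i))

/-- The projection of the fiber. -/
def fiberProj (e : HMap D Y) (he : IsChainH e) : fiberCx e he ⟶ D where
  f r := ModuleCat.ofHom (LinearMap.snd A (Y.X (r + 1)) (D.X r))
  comm' _ _ _ := rfl

theorem idMap_self (C : Cx A) (i : ℤ) : idMap C i i = LinearMap.id := by
  simp [idMap]

variable {e : HMap D Y} (he : IsChainH e)

/-- The inclusion `Y_{r+1} → F_r`. -/
def fiberJ : HMap Y (fiberCx e he) := fun i k =>
  (LinearMap.inl A (Y.X (k + 1)) (D.X k) ∘ₗ idMap Y i (k + 1) :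
    Y.X i →ₗ[A] Y.X (k + 1) × D.X k)

/-- The inclusion `D_r → F_r`. -/
def fiberS : HMap D (fiberCx e he) := fun i k =>
  (LinearMap.inr A (Y.X (k + 1)) (D.X k) ∘ₗ idMap D i k : D.X i →ₗ[A] Y.X (k + 1) × D.X k)

theorem fiberJ_self (k : ℤ) : fiberJ he (k + 1) k = LinearMap.inl A (Y.X (k + 1)) (D.X k) := by
  rw [fiberJ, idMap_self]; rfl

theorem fiberS_self (k : ℤ) : fiberS he k k = LinearMap.inr A (Y.X (k + 1)) (D.X k) := by
  rw [fiberS, idMap_self]; rfl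

theorem fiber_d (i j : ℤ) (x : Y.X (i + 1)) (z : D.X i) :
    ((fiberCx e he).d i j).hom ((x, z) : Y.X (i + 1) × D.X i) =
      (((Y.d (i + 1) (j + 1)).hom x + i.negOnePow • e i (j + 1) z, (D.d i j).hom z) :
        Y.X (j + 1) × D.X j) := rfl

variable [StarRing A]

theorem opd_fiberJ (x) : opd (fiberCx e he) (oph (-1) (fiberJ he) x) =
    oph (-1) (fiberJ he) (opd Y x) := by
  revert x; refine dsum_induct fun i x => ?_
  obtain ⟨k, rfl⟩ : ∃ k, i = k + 1 + 1 := ⟨i - 2, by ring⟩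
  rw [oph_of (k + 1) (by ring), opd_of k rfl, opd_of (k + 1) rfl, oph_of k (by ring),
    fiberJ_self, fiberJ_self]
  congr 1
  change ((fiberCx e he).d (k + 1) k).hom ((x, 0) : Y.X (k + 1 + 1) × D.X (k + 1)) = _
  rw [fiber_d]
  simp only [map_zero, smul_zero, add_zero]
  rfl

theorem opd_fiberS (x) : opd (fiberCx e he) (oph 0 (fiberS he) x) =
    oph 0 (fiberS he) (opd D x) - eps (oph (-1) (fiberJ he) (oph 0 e x)) := by
  revert x; refine dsum_induct fun i x => ?_
  obtain ⟨k, rfl⟩ : ∃ k, i = k + 1 := ⟨i - 1, by ring⟩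
  rw [oph_of (k + 1) (by ring), opd_of k rfl, opd_of k rfl, oph_of k (by ring),
    oph_of (k + 1) (by ring), oph_of k (by ring), fiberJ_self, fiberS_self,
    fiberS_self, eps_of, ← map_usmul, ← map_sub]
  congr 1
  change ((fiberCx e he).d (k + 1) k).hom ((0, x) : Y.X (k + 1 + 1) × D.X (k + 1)) =
    (((0, (D.d (k + 1) k).hom x) : Y.X (k + 1) × D.X k) -
      k.negOnePow • ((e (k + 1) (k + 1) x, 0) : Y.X (k + 1) × D.X k))
  rw [fiber_d, negOnePow_succ]
  simp
  rfl

theorem opg_fiberProj_J (x) : opg (comps (fiberProj e he)) (oph (-1) (fiberJ he) x) = 0 := by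
  revert x; refine dsum_induct fun i x => ?_
  obtain ⟨k, rfl⟩ : ∃ k, i = k + 1 := ⟨i - 1, by ring⟩
  rw [oph_of k (by ring), opg_of, fiberJ_self]
  exact map_zero _

theorem opg_fiberProj_S (x) : opg (comps (fiberProj e he)) (oph 0 (fiberS he) x) = x := by
  revert x; refine dsum_induct fun i x => ?_
  rw [oph_of i (by ring), opg_of, fiberS_self]; rfl

theorem opd'_fiberJ (x) : oph' (-1) (fiberJ he) (opd' (fiberCx e he) x) =
    opd' Y (oph' (-1) (fiberJ he) x) := by
  revert x; refine dsum_induct fun k x => ?_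
  rw [opd'_of (k + 1) rfl, oph'_of (k + 1 + 1) (by ring), oph'_of (k + 1) (by ring),
    opd'_of (k + 1 + 1) rfl, fiberJ_self, fiberJ_self]
  congr 1
  ext y
  change x (((fiberCx e he).d (k + 1) k).hom ((y, 0) : Y.X (k + 1 + 1) × D.X (k + 1))) = _
  rw [fiber_d]
  simp only [map_zero, smul_zero, add_zero]
  rfl

theorem opd'_fiberS (x) : oph' 0 (fiberS he) (opd' (fiberCx e he) x) =
    opd' D (oph' 0 (fiberS he) x) + eps (oph' 0 e (oph' (-1) (fiberJ he) x)) := by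
  revert x; refine dsum_induct fun k x => ?_
  rw [opd'_of (k + 1) rfl, oph'_of (k + 1) (by ring), oph'_of k (by ring),
    opd'_of (k + 1) rfl, oph'_of (k + 1) (by ring), oph'_of (k + 1) (by ring), fiberJ_self,
    fiberS_self, fiberS_self, eps_of, ← map_usmul, ← map_add]
  congr 1
  ext y
  change x (((fiberCx e he).d (k + 1) k).hom ((0, y) : Y.X (k + 1 + 1) × D.X (k + 1))) =
    (_ + ((k + 1).negOnePow • dualMap (e (k + 1) (k + 1)) (dualMap (LinearMap.inl A _ _) x))) y
  have h : ∀ (c : ℤˣ) (f : Dual A (D.X (k + 1))) y, (c • f) y = c • f y := by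
    intro c f y
    rcases Int.units_eq_one_or c with rfl | rfl
    · simp
    · simp only [Units.neg_smul, one_smul]; rfl
  rw [fiber_d, Dual.add_apply, h]
  simp only [map_zero, zero_add, dualMap_apply, LinearMap.inr_apply, LinearMap.inl_apply]
  have h2 : ∀ (c : ℤˣ) (a : Y.X (k + 1)) (b : D.X k) (x : Dual A (Y.X (k + 1) × D.X k)),
      x (c • a, b) = x (0, b) + c • x (a, 0) := by
    intro c a b x
    have h3 : ∀ a : Y.X (k + 1), x (a, b) = x (0, b) + x (a, 0) := by
      intro a
      rw [← map_add]; simp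
    rcases Int.units_eq_one_or c with rfl | rfl
    · rw [one_smul, one_smul, h3]
    · rw [Units.neg_smul, one_smul, Units.neg_smul, one_smul, h3, ← map_neg]; simp
  exact h2 _ _ _ x

theorem opg'_fiberProj_J (x) : oph' (-1) (fiberJ he) (opg' (comps (fiberProj e he)) x) = 0 := by
  revert x; refine dsum_induct fun k x => ?_
  rw [opg'_of, oph'_of (k + 1) (by ring), fiberJ_self]
  have : dualMap (LinearMap.inl A (Y.X (k + 1)) (D.X k)) (dualMap (comps (fiberProj e he) k) x) =
      0 := by
    ext y; exact map_zero x
  exact (congrArg _ this).trans (map_zero _)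

theorem opg'_fiberProj_S (x) : oph' 0 (fiberS he) (opg' (comps (fiberProj e he)) x) = x := by
  revert x; refine dsum_induct fun i x => ?_
  rw [opg'_of, oph'_of i (by ring), fiberS_self]; rfl

theorem IsChainH.opd' (he : IsChainH e) (x) : oph' 0 e (APC.opd' Y x) =
    APC.opd' D (oph' 0 e x) := by
  revert x; refine dsum_induct fun i x => ?_
  rw [opd'_of (i + 1) rfl, oph'_of (i + 1) (by ring), oph'_of i (by ring), opd'_of (i + 1) rfl]
  exact congrArg _ (LinearMap.congr_fun (congrArg dualMap (he.comm (i := i + 1) (j := i) rfl rfl))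
    x)

end Fiber

section Lam

variable {C D E Y D' Y' : Cx A}

theorem dmT_sgn (θ : DMap C D) (m : ℤ) (x) :
    opm m (dmT (sgn θ)) x = m.negOnePow • eps (opm m (dmT θ) x) := by
  rw [← opm_sgn, ← opm_usmul]
  refine opm_congr (fun p => ?_) x
  simp only [dmT, sgn, adj_usmul, Pi.smul_apply, smul_smul, ← negOnePow_add]
  congr 1
  exact negOnePow_congr' (p - m) (by ring)

variable {e : HMap D Y} (he : IsChainH e)

/-- The composite `D_i → Y_i → F_{i-1}`. -/
def fiberJE : HMap D (fiberCx e he) := fun i k => fiberJ he i k ∘ₗ e i i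

theorem oph_fiberJE (x) : oph (-1) (fiberJE he) x = oph (-1) (fiberJ he) (oph 0 e x) := by
  revert x; refine dsum_induct fun i x => ?_
  rw [oph_of (i - 1) (by ring), oph_of i (by ring), oph_of (i - 1) (by ring)]; rfl

theorem oph'_fiberJE (x) : oph' (-1) (fiberJE he) x = oph' 0 e (oph' (-1) (fiberJ he) x) := by
  revert x; refine dsum_induct fun i x => ?_
  rw [oph'_of (i + 1) (by ring), oph'_of (i + 1) (by ring), oph'_of (i + 1) (by ring)]; rfl

/-- The quadratic chain on the fiber of `e : D → Y` determined by hyperquadratic chains `θ` on `Y`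
and `α` on `D`. -/
def Lam (c : ℤˣ) (θ : Fam Y) (α : Fam D) : Fam (fiberCx e he) := fun s =>
  if s < 0 then 0 else
    c • s.negOnePow • sgn (sand (-1) (-1) (fiberJ he) (θ (-s)) (fiberJ he)) +
      s.negOnePow • sand 0 (-1) (fiberS he) (α (-s)) (fiberJE he) +
      sand 0 0 (fiberS he) (dmT (α (-s - 1))) (fiberS he)

theorem opm_Lam (m : ℤ) (c : ℤˣ) (θ : Fam Y) (α : Fam D) (s : ℤ) (hs : 0 ≤ s) (x) :
    opm m (Lam he c θ α s) x =
      c • s.negOnePow • eps (oph (-1) (fiberJ he) (opm (m + 1 + 1) (θ (-s))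
        (oph' (-1) (fiberJ he) x))) +
      s.negOnePow • oph 0 (fiberS he) (opm (m + 1) (α (-s)) (oph' 0 e (oph' (-1) (fiberJ he) x))) +
      oph 0 (fiberS he) (opm m (famT α (-s - 1)) (oph' 0 (fiberS he) x)) := by
  rw [Lam, if_neg (not_lt.2 hs)]
  simp only [opm_add, opm_usmul, opm_sgn, opm_sand, oph'_fiberJE, famT_eq, sub_neg_eq_add,
    sub_zero]

theorem opm_famT_Lam [FinCx D] [FinCx Y] (m : ℤ) (c : ℤˣ) (θ : Fam Y) (α : Fam D) (s : ℤ)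
    (hs : 0 ≤ s) (x) : opm m (famT (Lam he c θ α) s) x =
      -(c • s.negOnePow • eps (oph (-1) (fiberJ he) (opm (m + 1 + 1) (famT θ (-s))
        (oph' (-1) (fiberJ he) x)))) +
      s.negOnePow • m.negOnePow • eps (oph (-1) (fiberJ he) (oph 0 e (opm (m + 1) (famT α (-s))
        (oph' 0 (fiberS he) x)))) +
      oph 0 (fiberS he) (opm m (α (-s - 1)) (oph' 0 (fiberS he) x)) := by
  rw [famT_eq, Lam, if_neg (not_lt.2 hs)]
  simp only [dmT_add, dmT_usmul, opm_add, opm_usmul, dmT_sgn,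
    opm_dmT_sand_oo _ _ _ _ _ _ _ (show (-1 : ℤ) % 2 = 1 by norm_num)
      (show (-1 : ℤ) % 2 = 1 by norm_num),
    opm_dmT_sand_eo _ _ _ _ _ _ _ (show (0 : ℤ) % 2 = 0 by norm_num)
      (show (-1 : ℤ) % 2 = 1 by norm_num),
    opm_dmT_sand_ee _ _ _ _ _ _ _ (show (0 : ℤ) % 2 = 0 by norm_num)
      (show (0 : ℤ) % 2 = 0 by norm_num), oph_fiberJE, famT_eq, sub_neg_eq_add,
    sub_zero, dmT_dmT]
  congr 2
  rcases sgn_cases m with hm | hm <;>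
    simp [negOnePow_succ, hm, map_usmul]

theorem isQuad_Lam {n k l : ℤ} {c : ℤˣ} {θ : Fam Y} {α : Fam D} (hθ : IsHyp k θ) (hα : IsHyp l α)
    (hk : k = n + 2) (hl : l = n + 1) : IsQuad n (Lam he c θ α) := by
  rw [isQuad_iff]
  refine ⟨fun s p q hpq => ?_, fun s hs => if_pos hs⟩
  rw [Lam]
  split_ifs with hs
  · rfl
  · simp only [Pi.add_apply, Pi.smul_apply, sgn, sand, dmT]
    rw [hθ _ _ _ (by omega), hα _ _ _ (by omega), hα _ _ _ (by omega)]
    simp only [zero_comp, comp_zero, adj_zero, smul_zero, add_zero]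

theorem Lam_add (c : ℤˣ) (θ θ' : Fam Y) (α α' : Fam D) :
    Lam he c (θ + θ') (α + α') = Lam he c θ α + Lam he c θ' α' := by
  funext s p q
  simp only [Lam, Pi.add_apply]
  split_ifs
  · exact (add_zero _).symm
  · simp only [Pi.add_apply, Pi.smul_apply, sgn, sand, dmT, add_comp,
      comp_add, adj_add, smul_add]
    abel

theorem Lam_neg_left (c : ℤˣ) (θ : Fam Y) (α : Fam D) :
    Lam he c (-θ) α = Lam he (-c) θ α := by
  funext s p q
  simp only [Lam, Pi.neg_apply]
  split_ifs
  · rfl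
  · simp only [Pi.add_apply, Pi.smul_apply, Pi.neg_apply, sgn, sand, LinearMap.neg_comp,
      LinearMap.comp_neg, smul_neg, Units.neg_smul]

/-- The push-forward along a family of morphisms which is concentrated in degree `0`. -/
def dgl (e : HMap D Y) : GMap D Y := fun i => e i i

theorem opg_dgl (e : HMap D Y) (x) : opg (dgl e) x = oph 0 e x := by
  revert x; refine dsum_induct fun i x => ?_
  rw [oph_of i (by ring), opg_of]; rfl

theorem opg'_dgl (e : HMap D Y) (x) : opg' (dgl e) x = oph' 0 e x := by
  revert x; refine dsum_induct fun i x => ?_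
  rw [oph'_of i (by ring), opg'_of]; rfl

/-- The chain map with given components. -/
def IsChainH.hom {e : HMap D Y} (he : IsChainH e) : D ⟶ Y where
  f i := ConcreteCategory.ofHom (C := ModuleCat A) (X := D.X i) (Y := Y.X i) (e i i)
  comm' _ _ _ := ModuleCat.hom_ext (he.comm rfl rfl)

theorem IsChainH.comps_hom {e : HMap D Y} (he : IsChainH e) : comps he.hom = dgl e := rfl

theorem negOnePow_two : Int.negOnePow 2 = 1 := negOnePow_even _ even_two

set_option maxHeartbeats 1000000 in
theorem dQuad_Lam [FinCx D] [FinCx Y] {n : ℤ} {η : Fam Y} {χ : Fam D} (hη : IsHyp (n + 2) η)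
    (hχ : IsHyp (n + 1) χ) :
    dQuad n (Lam he (-1) η χ) = Lam he 1 (dHyp (n + 2) η - push (dgl e) χ) (dHyp (n + 1) χ) := by
  refine quad_ext (n := n - 1) ((isQuad_Lam he hη hχ rfl rfl).dQuad (by ring))
    (isQuad_Lam he (k := n + 1) (l := n) ((hη.dHyp (by ring)).sub (hχ.push _)) (hχ.dHyp (by ring))
      (by ring) (by ring)) fun s x hs => ?_
  simp only [opm_dQuad, if_neg (not_lt.2 hs), opm_Lam _ _ _ _ _ _ hs,
    opm_Lam _ _ _ _ _ (s + 1) (by omega : 0 ≤ s + 1),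
    opm_famT_Lam _ _ _ _ _ (s + 1) (by omega : 0 ≤ s + 1), Pi.sub_apply, opm_sub, opm_push,
    opg_dgl, opg'_dgl, opm_dHyp, opm_famT_dHyp]
  simp only [hom_simps, eps_eps, opd_eps, oph_eps, opd_fiberJ, opd_fiberS, opd'_fiberJ,
    opd'_fiberS, he.opd', opm_eps, oph'_eps, opd'_eps]
  rw [show -(s + 1) = -s - 1 by ring, show n - 1 - s + 1 = n - s by ring]
  rcases sgn_cases n with hn | hn <;>
  rcases sgn_cases s with hs | hs <;>
  simp only [sign_simps, smul_simps, hn, hs, negOnePow_two] <;> abel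

theorem dmap_ext {θ θ' : DMap C D} (H : ∀ m x, opm m θ x = opm m θ' x) : θ = θ' := by
  funext p q
  obtain ⟨m, rfl⟩ : ∃ m, q = m - p := ⟨p + q, by ring⟩
  exact hat_injective (H m) p

theorem fam_ext' {θ θ' : Fam C} (H : ∀ s m x, opm m (θ s) x = opm m (θ' s) x) : θ = θ' :=
  funext fun s => dmap_ext (H s)

/-- The truncation of a hyperquadratic chain to a symmetric chain. -/
def ge0 (α : Fam D) : Fam D := fun s => if s < 0 then 0 else α s

/-- The symmetric chain `α_{-1} + T α_{-1}` in index `0`. -/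
def mid (α : Fam D) : Fam D := fun s => if s = 0 then α (-1) + famT α (-1) else 0

/-- The hyperquadratic chain `α_s` for `s ≥ 0`, `T α_s` for `s < 0`. -/
def symm (α : Fam D) : Fam D := fun s => if s < 0 then famT α s else α s

/-- The equivalence between a hyperquadratic chain and its partial transposition. -/
def trunc (m : ℤ) (α : Fam D) : Fam D := fun s =>
  if s < 0 ∧ s % 2 = 0 then m.negOnePow • α (s + 1) else 0

/-- The quadratic chain given by a family `Y^p → D_q` in index `0`. -/
def Eterm (E : DMap Y D) : Fam (fiberCx e he) := fun s =>
  if s = 0 then sand 0 (-1) (fiberS he) E (fiberJ he) else 0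

theorem push_proj_Lam (c : ℤˣ) (θ : Fam Y) (α : Fam D) :
    push (comps (fiberProj e he)) (Lam he c θ α) = fun s => if s < 0 then 0 else
      famT α (-s - 1) := by
  refine fam_ext' fun s m x => ?_
  rw [opm_push]
  by_cases hs : s < 0
  · rw [if_pos hs, Lam, if_pos hs, opm_zero, opm_zero, map_zero]
  · rw [if_neg hs, opm_Lam _ _ _ _ _ _ (not_lt.1 hs)]
    simp only [hom_simps, opg_eps, opg_fiberProj_J, opg_fiberProj_S, opg'_fiberProj_J,
      opg'_fiberProj_S, smul_zero, zero_add]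

theorem push_proj_Eterm (E : DMap Y D) :
    push (comps (fiberProj e he)) (Eterm he E) = 0 := by
  refine fam_ext' fun s m x => ?_
  rw [opm_push, Eterm]
  split_ifs with hs
  · simp only [opm_sand, opg'_fiberProj_J, map_zero, Pi.zero_apply, opm_zero]
  · simp only [opm_zero, map_zero, Pi.zero_apply]

theorem push_proj_oneT_Lam [FinCx D] [FinCx Y] (c : ℤˣ) (θ : Fam Y) (α : Fam D) :
    push (comps (fiberProj e he)) (oneT (Lam he c θ α)) = mid α := by
  rw [← oneT_push, push_proj_Lam]
  funext s
  rw [oneT_apply, mid, famT_eq]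
  simp [famT_eq, dmT_dmT, add_comm]

theorem push_proj_oneT_Eterm [FinCx D] [FinCx Y] (E : DMap Y D) :
    push (comps (fiberProj e he)) (oneT (Eterm he E)) = 0 := by
  rw [← oneT_push, push_proj_Eterm, oneT_zero]

theorem push_proj_hyp_Lam [FinCx D] [FinCx Y] (c : ℤˣ) (θ : Fam Y) (α : Fam D) :
    ge0 α + push (comps (fiberProj e he)) (hyp (Lam he c θ α)) = symm α := by
  rw [← hyp_push, push_proj_Lam]
  funext s
  rw [Pi.add_apply, ge0, symm, hyp_apply]
  split_ifs
  · omega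
  · rw [show -(-s - 1) - 1 = s by ring, zero_add]
  · rw [add_zero]
  · omega

theorem push_proj_hyp_Eterm (E : DMap Y D) :
    push (comps (fiberProj e he)) (hyp (Eterm he E)) = 0 := by
  rw [← hyp_push, push_proj_Eterm, hyp_zero]

theorem isSym_ge0 {n : ℤ} {α : Fam D} (h : IsHyp n α) : IsSym n (ge0 α) :=
  isSym_iff.2 ⟨fun s p q hpq => by
    rw [ge0]; split_ifs
    · rfl
    · exact h s p q hpq, fun s hs => if_pos hs⟩

theorem isHyp_mid {n : ℤ} {α : Fam D} (h : IsHyp (n + 1) α) : IsHyp n (mid α) :=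
  fun s p q hpq => by
    rw [mid]; split_ifs
    · exact ((h.add h.famT) (-1) p q (by omega))
    · rfl

theorem isHyp_trunc {n m k : ℤ} {α : Fam D} (h : IsHyp n α) (hm : m = n + 1) :
    IsHyp m (trunc k α) := fun s p q hpq => by
  rw [trunc]; split_ifs
  · rw [Pi.smul_apply, Pi.smul_apply, h _ _ _ (by omega), smul_zero]
  · rfl

theorem isHyp_symm {n : ℤ} {α : Fam D} (h : IsHyp n α) : IsHyp n (symm α) :=
  fun s p q hpq => by
    rw [symm]; split_ifs
    · exact h.famT s p q hpq
    · exact h s p q hpq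

theorem dHyp_ge0 [FinCx D] {n : ℤ} {α : Fam D} (h : IsHyp n α) :
    dHyp n (ge0 α) = ge0 (dHyp n α) - (n - 1).negOnePow • mid α := by
  have h' : IsHyp (n - 1 + 1) α := by rwa [sub_add_cancel]
  refine fam_ext (n := n - 1) ((isSym_ge0 h).isHyp.dHyp (by ring))
    ((isSym_ge0 (h.dHyp (by ring))).isHyp.sub ((isHyp_mid h').units_smul _)) fun s x => ?_
  simp only [Pi.sub_apply, Pi.smul_apply, opm_sub, opm_usmul, opm_dHyp, famT_eq, ge0, mid]
  rcases lt_trichotomy s 0 with hs | rfl | hs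
  · simp only [if_pos hs, if_pos (show s - 1 < 0 by omega), if_neg hs.ne, opm_zero, dmT_zero,
      map_zero, smul_zero, add_zero, sub_zero]
  · simp [opm_dHyp, opm_add, famT_eq, opm_zero, dmT_zero]
  · simp only [if_neg hs.ne', if_neg (show ¬ s < 0 by omega), if_neg (show ¬ s - 1 < 0 by omega),
      opm_zero, opm_dHyp, smul_zero, sub_zero, famT_eq]

theorem symm_sub [FinCx D] {m : ℤ} {χ : Fam D} (h : IsHyp m χ) :
    symm χ - χ = dHyp (m + 1) (trunc m χ) + trunc (m - 1) (dHyp m χ) := by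
  refine fam_ext (n := m) ((isHyp_symm h).sub h) (((isHyp_trunc h rfl).dHyp rfl).add
    (isHyp_trunc (h.dHyp (sub_add_cancel m 1).symm) (by ring))) fun s x => ?_
  simp only [Pi.sub_apply, Pi.add_apply, opm_sub, opm_add, opm_dHyp, famT_eq, trunc, symm]
  rcases lt_or_ge s 0 with hs | hs
  · rcases Int.emod_two_eq_zero_or_one s with h2 | h2
    · have hs2 : s.negOnePow = 1 := negOnePow_even _ (Int.even_iff.2 h2)
      simp only [if_pos hs, if_pos (And.intro hs h2),
        if_neg (show ¬ (s - 1 < 0 ∧ (s - 1) % 2 = 0) by omega), opm_zero, dmT_zero, opm_dHyp,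
        opm_usmul, map_usmul, famT_eq, add_sub_cancel_right]
      rcases sgn_cases m with hn | hn <;>
      simp only [sign_simps, smul_simps, hn, hs2, smul_zero] <;> abel
    · have hs2 : s.negOnePow = -1 := Int.negOnePow_odd _ (Int.odd_iff.2 h2)
      simp only [if_pos hs, if_neg (show ¬ (s < 0 ∧ s % 2 = 0) by omega),
        if_pos (show (s - 1 < 0 ∧ (s - 1) % 2 = 0) by omega), opm_zero, dmT_usmul,
        opm_usmul, map_zero, sub_add_cancel]
      rcases sgn_cases m with hn | hn <;>
      simp only [sign_simps, smul_simps, hn, hs2, smul_zero] <;> abel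
  · rcases eq_or_ne s 0 with rfl | h0
    · simp [opm_zero, dmT_zero]
    · simp only [if_neg (show ¬ s < 0 by omega), if_neg (show ¬ (s < 0 ∧ s % 2 = 0) by omega),
        if_neg (show ¬ (s - 1 < 0 ∧ (s - 1) % 2 = 0) by omega), opm_zero, dmT_zero, map_zero,
        smul_zero, add_zero, sub_self]

theorem isQuad_Eterm {n : ℤ} {E : DMap Y D} (hE : IsDeg n E) :
    IsQuad (n - 1) (Eterm he E) := isQuad_iff.2 ⟨fun s p q hpq => by
    rw [Eterm]; split_ifs
    · rw [sand, hE _ _ (by omega), zero_comp, comp_zero]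
    · rfl, fun s hs => if_neg (by omega)⟩

theorem opd_opm_of_dmD {n : ℤ} {E : DMap Y D} (h : dmD E = 0) (x) :
    opd D (opm n E x) = -eps (opm n E (opd' Y x)) := by
  have := opm_dmD (n - 1) E x
  rw [h, opm_zero, sub_add_cancel] at this
  exact eq_neg_of_add_eq_zero_left this.symm

theorem dQuad_Eterm [FinCx D] [FinCx Y] {n : ℤ} {E : DMap Y D} (hE : IsDeg n E) (h : dmD E = 0) :
    dQuad (n - 1) (Eterm he E) = fun s => if s = 0 then
      -sgn (sand (-1) (-1) (fiberJ he) (fun p q => e q q ∘ₗ E p q) (fiberJ he)) else 0 := by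
  refine quad_ext (n := n - 2) ((isQuad_Eterm he hE).dQuad (by ring)) (isQuad_iff.2
    ⟨fun s p q hpq => ?_, fun s hs => if_neg (by omega)⟩) fun s x hs => ?_
  · split_ifs
    · simp only [Pi.neg_apply, sgn, sand, hE _ _ (show p - -1 + (q - -1) ≠ n by omega),
        comp_zero, zero_comp, smul_zero, neg_zero]
    · rfl
  · rw [opm_dQuad, if_neg (not_lt.2 hs)]
    simp only [Eterm, famT_eq, if_neg (show s + 1 ≠ 0 by omega), dmT_zero, opm_zero, smul_zero,
      add_zero]
    split_ifs with h0
    · subst h0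
      have h1 : ∀ m x, opm m (fun p q => e q q ∘ₗ E p q : DMap Y Y) x = oph 0 e (opm m E x) := by
        intro m x
        rw [← opg_dgl, ← opm_comp_left]; rfl
      simp only [opm_sand, opd_fiberS, opd'_fiberJ, opm_neg, opm_sgn, h1]
      rw [show n - 2 - 0 - -1 - -1 = n by ring, show n - 2 - 0 + 1 - 0 - -1 = n by ring,
        opd_opm_of_dmD h]
      simp only [map_neg, oph_eps, negOnePow_zero, one_smul]
      abel
    · simp only [opm_zero, map_zero, add_zero]

/-- The quadratic structure on the fiber. -/
def psiL (θ : Fam Y) (α : Fam D) (E : DMap Y D) : Fam (fiberCx e he) :=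
  Lam he 1 θ α - Eterm he E

theorem isQuad_psiL {n : ℤ} {θ : Fam Y} {α : Fam D} {E : DMap Y D} (hθ : IsHyp (n + 1) θ)
    (hα : IsHyp n α) (hE : IsDeg n E) : IsQuad (n - 1) (psiL he θ α E) :=
  (isQuad_Lam he hθ hα (by ring) (by ring)).sub (isQuad_Eterm he hE)

theorem dQuad_sub (n : ℤ) (ψ ψ' : Fam C) : dQuad n (ψ - ψ') = dQuad n ψ - dQuad n ψ' := by
  have h := dQuad_add n (ψ - ψ') ψ'
  rw [sub_add_cancel] at h
  exact eq_sub_of_add_eq h.symm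

theorem oneT_sub (ψ ψ' : Fam C) : oneT (ψ - ψ') = oneT ψ - oneT ψ' := by
  have h := oneT_add (ψ - ψ') ψ'
  rw [sub_add_cancel] at h
  exact eq_sub_of_add_eq h.symm

theorem dQuad_psiL [FinCx D] [FinCx Y] {n : ℤ} {φ θ : Fam Y} {α : Fam D} {E : DMap Y D}
    (hφ : IsSym n φ) (hθ : IsHyp (n + 1) θ) (hα : IsHyp n α) (hE : IsDeg n E) (h : dmD E = 0)
    (hα' : dHyp n α = 0) (h0 : φ 0 = fun p q => e q q ∘ₗ E p q)
    (hd : φ - push (dgl e) α = dHyp (n + 1) θ) : dQuad (n - 1) (psiL he θ α E) = 0 := by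
  have h1 := dQuad_Lam he (n := n - 1) (η := -θ) (χ := α) (by convert hθ.neg using 1; ring)
    (by rwa [sub_add_cancel])
  rw [show n - 1 + 2 = n + 1 by ring, sub_add_cancel, hα', dHyp_neg, ← hd, neg_sub, sub_sub,
    add_comm, ← sub_sub, sub_self, zero_sub, Lam_neg_left, neg_neg, Lam_neg_left] at h1
  rw [psiL, dQuad_sub, h1, dQuad_Eterm he hE h, ← h0, sub_eq_zero]
  funext s
  rw [Lam]
  split_ifs with h2 h3 h3
  · omega
  · rfl
  · subst h3
    funext p q
    simp [dmT_zero, sand]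
  · rw [hφ.eq_zero (show -s < 0 by omega)]
    funext p q
    simp [dmT_zero, sand, sgn]

theorem dHyp_ge0_psiL [FinCx D] [FinCx Y] {n : ℤ} {θ : Fam Y} {α : Fam D} {E : DMap Y D}
    (hα : IsHyp n α) (hα' : dHyp n α = 0) :
    dHyp n (ge0 α) + (n - 1).negOnePow • push (comps (fiberProj e he)) (oneT (psiL he θ α E)) =
      0 := by
  have h0 : ge0 (0 : Fam D) = 0 := funext fun s => ite_self _
  rw [psiL, oneT_sub, push_sub, push_proj_oneT_Lam, push_proj_oneT_Eterm, sub_zero, dHyp_ge0 hα,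
    hα', h0, zero_sub, neg_add_cancel]

end Lam

section Cone

variable {C D E Y C' D' Y' : Cx A}

/-- The inclusion `D_r → C(f)_r`. -/
def coneI (f : C ⟶ D) : HMap D (cone f) := fun i k =>
  (LinearMap.inl A (D.X k) (C.X (k - 1)) ∘ₗ idMap D i k : D.X i →ₗ[A] D.X k × C.X (k - 1))

/-- The inclusion `C_{r-1} → C(f)_r`. -/
def coneR (f : C ⟶ D) : HMap C (cone f) := fun i k =>
  (LinearMap.inr A (D.X k) (C.X (k - 1)) ∘ₗ idMap C i (k - 1) : C.X i →ₗ[A] D.X k × C.X (k - 1))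

instance (f : C ⟶ D) [FinCx C] [FinCx D] : FinCx (cone f) where
  finite i := inferInstanceAs (Module.Finite A (D.X i × C.X (i - 1)))
  projective i := inferInstanceAs (Module.Projective A (D.X i × C.X (i - 1)))

variable (f : C ⟶ D)

theorem coneI_self (k : ℤ) : coneI f k k = LinearMap.inl A (D.X k) (C.X (k - 1)) := by
  rw [coneI, idMap_self]; rfl

theorem coneR_self (k : ℤ) : coneR f (k - 1) k = LinearMap.inr A (D.X k) (C.X (k - 1)) := by
  rw [coneR, idMap_self]; rfl

theorem cone_d (i j : ℤ) (x : D.X i) (z : C.X (i - 1)) :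
    ((cone f).d i j).hom ((x, z) : D.X i × C.X (i - 1)) =
      (((D.d i j).hom x + (i - 1).negOnePow • tot f (i - 1) j z, (C.d (i - 1) (j - 1)).hom z) :
        D.X j × C.X (j - 1)) := rfl

theorem opd_coneI (x) : opd (cone f) (oph 0 (coneI f) x) = oph 0 (coneI f) (opd D x) := by
  revert x; refine dsum_induct fun i x => ?_
  rw [oph_of i (by ring), opd_of (i - 1) (by ring), opd_of (i - 1) (by ring),
    oph_of (i - 1) (by ring), coneI_self, coneI_self]
  congr 1
  change ((cone f).d i (i - 1)).hom ((x, 0) : D.X i × C.X (i - 1)) = _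
  rw [cone_d]
  simp only [map_zero, smul_zero, add_zero]
  rfl

theorem opd_coneR (x) : opd (cone f) (oph 1 (coneR f) x) = oph 1 (coneR f) (opd C x) +
    oph 0 (coneI f) (opg (comps f) (eps x)) := by
  revert x; refine dsum_induct fun i x => ?_
  obtain ⟨k, rfl⟩ : ∃ k, i = k - 1 := ⟨i + 1, by ring⟩
  rw [oph_of k (by ring), opd_of (k - 1) (by ring), opd_of (k - 1 - 1) (by ring),
    oph_of (k - 1) (by ring), eps_of, map_usmul, opg_of, map_usmul,
    oph_of (k - 1) (by ring), coneI_self, coneR_self, coneR_self, ← map_usmul, ← map_add]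
  congr 1
  change ((cone f).d k (k - 1)).hom ((0, x) : D.X k × C.X (k - 1)) =
    ((0, (C.d (k - 1) (k - 1 - 1)).hom x) : D.X (k - 1) × C.X (k - 1 - 1)) +
      (k - 1).negOnePow • ((comps f (k - 1) x, 0) : D.X (k - 1) × C.X (k - 1 - 1))
  rw [cone_d, tot, idMap_self]
  simp
  rfl

theorem opd'_coneI (x) : oph' 0 (coneI f) (opd' (cone f) x) = opd' D (oph' 0 (coneI f) x) := by
  revert x; refine dsum_induct fun i x => ?_
  rw [opd'_of (i + 1) rfl, oph'_of (i + 1) (by ring), oph'_of i (by ring), opd'_of (i + 1) rfl,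
    coneI_self, coneI_self]
  congr 1
  ext y
  change x (((cone f).d (i + 1) i).hom ((y, 0) : D.X (i + 1) × C.X (i + 1 - 1))) = _
  rw [cone_d]
  simp only [map_zero, smul_zero, add_zero]
  rfl

theorem Dual.units_smul_apply {M : Type u} [AddCommGroup M] [Module A M] (c : ℤˣ) (f : Dual A M)
    (y : M) : (c • f) y = c • f y := by
  rcases Int.units_eq_one_or c with rfl | rfl
  · simp
  · simp only [Units.neg_smul, one_smul]; rfl

theorem Dual.map_usmul {M : Type u} [AddCommGroup M] [Module A M] (f : Dual A M) (c : ℤˣ)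
    (y : M) : f (c • y) = c • f y := by
  rcases Int.units_eq_one_or c with rfl | rfl
  · simp
  · simp only [Units.neg_smul, one_smul, map_neg]

theorem opd'_coneR (x) : oph' 1 (coneR f) (opd' (cone f) x) = opd' C (oph' 1 (coneR f) x) +
    eps (opg' (comps f) (oph' 0 (coneI f) x)) := by
  revert x; refine dsum_induct fun i x => ?_
  obtain ⟨k, rfl⟩ : ∃ k, i = k - 1 := ⟨i + 1, by ring⟩
  rw [opd'_of k (by ring), oph'_of (k - 1) (by ring), oph'_of (k - 1 - 1) (by ring),
    opd'_of (k - 1) (by ring), oph'_of (k - 1) (by ring), opg'_of, eps_of, coneI_self, coneR_self,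
    coneR_self, ← APC.map_usmul, ← map_add]
  congr 1
  ext y
  change x (((cone f).d k (k - 1)).hom ((0, y) : D.X k × C.X (k - 1))) =
    x ((0, (C.d (k - 1) (k - 1 - 1)).hom y) : D.X (k - 1) × C.X (k - 1 - 1)) +
      ((k - 1).negOnePow • (dualMap (comps f (k - 1)) (dualMap (LinearMap.inl A _ _) x))) y
  rw [cone_d, tot, idMap_self, Dual.units_smul_apply]
  have h2 : ∀ (c : ℤˣ) (a : D.X (k - 1)) (b : C.X (k - 1 - 1))
      (x : Dual A (D.X (k - 1) × C.X (k - 1 - 1))),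
      x (0 + c • a, b) = x (0, b) + c • x (a, 0) := by
    intro c a b x
    rw [← Dual.map_usmul, ← map_add]; simp
  rw [map_zero]
  exact h2 _ _ _ x

theorem oph_coneNull (x) : oph 1 (coneNull f) x = eps (oph 1 (coneR f) x) := by
  revert x; refine dsum_induct fun i x => ?_
  rw [oph_of (i + 1) rfl, oph_of (i + 1) rfl, eps_of, ← map_usmul]; rfl

theorem oph'_coneNull (x) : oph' 1 (coneNull f) x = oph' 1 (coneR f) (eps x) := by
  revert x; refine dsum_induct fun i x => ?_
  rw [oph'_of (i - 1) (by ring), eps_of, map_usmul, oph'_of (i - 1) (by ring),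
    ← map_usmul]
  congr 1
  have : dualMap (coneNull f (i - 1) i) = i.negOnePow • dualMap (coneR f (i - 1) i) :=
    dualMap_usmul _ _
  rw [this]; rfl

theorem opg_coneInl (x) : opg (coneInl f) x = oph 0 (coneI f) x := by
  revert x; refine dsum_induct fun i x => ?_
  rw [oph_of i (by ring), opg_of, coneI_self]; rfl

theorem opg'_coneInl (x) : opg' (coneInl f) x = oph' 0 (coneI f) x := by
  revert x; refine dsum_induct fun i x => ?_
  rw [oph'_of i (by ring), opg'_of, coneI_self]; rfl

theorem coneDualFst_eq (p : ℤ) : coneDualFst f p = dualMap (coneI f p p) := by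
  rw [coneI_self]; rfl

theorem coneDualSnd_eq (p : ℤ) : coneDualSnd f p = dualMap (coneR f (p - 1) p) := by
  rw [coneR_self]; rfl

/-- The left composite of a family with graded morphisms. -/
theorem opm_evD (P : PairData A) (m : ℤ) (x) : opm m P.evD x =
    opm m (P.δφ 0) (oph' 0 (coneI P.f) x) +
      opg (comps P.f) (opm (m - 1) (oneT P.ψ 0) (oph' 1 (coneR P.f) x)) := by
  revert x; refine dsum_induct fun p x => ?_
  rw [oph'_of p (by ring), oph'_of (p - 1) (by ring), opm, opm, opm, hat_of _ rfl,
    hat_of (m - p) (by ring), hat_of (m - p) (by ring), opg_of, ← map_add, PairData.evD,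
    coneDualFst_eq, coneDualSnd_eq]
  rfl

theorem thomHtpy_eq (P : PairData A) :
    P.thomHtpy = sgn (sand 1 1 (coneR P.f) (oneT P.ψ 0) (coneR P.f)) := by
  funext p q
  rw [PairData.thomHtpy, coneDualSnd_eq, sgn, sand, ← coneR_self, comp_smul]

theorem prod_mk_eq {M N : Type u} [AddCommGroup M] [Module A M] [AddCommGroup N] [Module A N]
    (a : M) (b : N) (c : ℤˣ) :
    (a, c • b) = LinearMap.inl A M N a + c • LinearMap.inr A M N b := by simp

theorem thomφ_zero_apply (n : ℤ) (P : PairData A) (p q : ℤ) : P.thomφ n 0 p q =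
    coneI P.f q q ∘ₗ P.δφ 0 p q ∘ₗ dualMap (coneI P.f p p) + (n - q).negOnePow •
      (coneR P.f (q - 1) q ∘ₗ oneT P.ψ 0 p (q - 1) ∘ₗ dualMap (comps P.f p) ∘ₗ
        dualMap (coneI P.f p p)) := by
  rw [PairData.thomφ, if_pos rfl, coneDualFst_eq, coneI_self, coneI_self, coneR_self]
  exact LinearMap.ext fun x => prod_mk_eq _ _ _

theorem thomφ_one_apply (n : ℤ) (P : PairData A) (p q : ℤ) : P.thomφ n 1 p q =
    coneI P.f q q ∘ₗ P.δφ 1 p q ∘ₗ dualMap (coneI P.f p p) + (n - q + 1).negOnePow •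
      (coneR P.f (q - 1) q ∘ₗ oneT P.ψ 0 (p - 1) (q - 1) ∘ₗ dualMap (coneR P.f (p - 1) p)) := by
  rw [PairData.thomφ, if_neg one_ne_zero, if_pos rfl, coneDualFst_eq, coneDualSnd_eq, coneI_self,
    coneI_self, coneR_self, coneR_self]
  exact LinearMap.ext fun x => prod_mk_eq _ _ _

theorem thomφ_apply (n : ℤ) (P : PairData A) {s : ℤ} (h0 : s ≠ 0) (h1 : s ≠ 1) (p q : ℤ) :
    P.thomφ n s p q = coneI P.f q q ∘ₗ P.δφ s p q ∘ₗ dualMap (coneI P.f p p) := by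
  rw [PairData.thomφ, if_neg h0, if_neg h1, coneDualFst_eq, coneI_self, coneI_self]
  rfl

theorem opm_thomφ_zero (n : ℤ) (P : PairData A) (m : ℤ) (x) : opm m (P.thomφ n 0) x =
    oph 0 (coneI P.f) (opm m (P.δφ 0) (oph' 0 (coneI P.f) x)) +
      n.negOnePow • eps (oph 1 (coneR P.f) (opm (m - 1) (oneT P.ψ 0) (opg' (comps P.f)
        (oph' 0 (coneI P.f) x)))) := by
  revert x; refine dsum_induct fun p x => ?_
  rw [oph'_of p (by ring), opg'_of, opm, opm, opm, hat_of (m - p) (by ring),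
    hat_of (m - p) (by ring), hat_of (m - p - 1) (by ring), oph_of (m - p) (by ring),
    oph_of (m - p) (by ring), eps_of,  ← map_usmul,  ← map_usmul, ← map_add,
    thomφ_zero_apply, smul_smul, ← negOnePow_add,
    negOnePow_congr' (a := n + (m - p)) (b := n - (m - p)) (m - p) (by ring)]
  rfl

theorem opm_thomφ_one (n : ℤ) (P : PairData A) (m : ℤ) (x) : opm m (P.thomφ n 1) x =
    oph 0 (coneI P.f) (opm m (P.δφ 1) (oph' 0 (coneI P.f) x)) +
      (n + 1).negOnePow • eps (oph 1 (coneR P.f) (opm (m - 2) (oneT P.ψ 0)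
        (oph' 1 (coneR P.f) x))) := by
  revert x; refine dsum_induct fun p x => ?_
  rw [oph'_of p (by ring), oph'_of (p - 1) (by ring), opm, opm, opm, hat_of (m - p) (by ring),
    hat_of (m - p) (by ring), hat_of (m - p - 1) (by ring), oph_of (m - p) (by ring),
    oph_of (m - p) (by ring), eps_of,  ← map_usmul,  ← map_usmul, ← map_add,
    thomφ_one_apply, smul_smul, ← negOnePow_add,
    negOnePow_congr' (a := n + 1 + (m - p)) (b := n - (m - p) + 1) (m - p) (by ring)]
  rfl

theorem opm_thomφ (n : ℤ) (P : PairData A) {s : ℤ} (h0 : s ≠ 0) (h1 : s ≠ 1) (m : ℤ) (x) :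
    opm m (P.thomφ n s) x = oph 0 (coneI P.f) (opm m (P.δφ s) (oph' 0 (coneI P.f) x)) := by
  rw [show P.thomφ n s = push (coneInl P.f) P.δφ s by
    funext p q
    rw [thomφ_apply n P h0 h1, coneI_self, coneI_self]; rfl, opm_push, opg_coneInl, opg'_coneInl]

/-! ### The cone of the projection of a fiber -/

variable {e : HMap D Y} (he : IsChainH e)

theorem of_idMap {k i : ℤ} (h : k = i) (x : Y.X k) :
    DirectSum.of (fun i => Y.X i) i (idMap Y k i x) = DirectSum.of (fun i => Y.X i) k x := by
  subst h; rw [idMap_self]; rfl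

theorem of_dualMap_idMap {k i : ℤ} (h : k = i) (x : Dual A (Y.X i)) :
    DirectSum.of (fun i => Dual A (Y.X i)) k (dualMap (idMap Y k i) x) =
      DirectSum.of (fun i => Dual A (Y.X i)) i x := by
  subst h; rw [idMap_self]; rfl

/-- The equivalence `(e, -1, 0) : C(F → D) → Y`. -/
def retr : cone (fiberProj e he) ⟶ Y where
  f r := ConcreteCategory.ofHom (C := ModuleCat A) (X := (cone (fiberProj e he)).X r) (Y := Y.X r)
    (e r r ∘ₗ LinearMap.fst A (D.X r) (Y.X (r - 1 + 1) × D.X (r - 1)) -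
      idMap Y (r - 1 + 1) r ∘ₗ LinearMap.fst A (Y.X (r - 1 + 1)) (D.X (r - 1)) ∘ₗ
        LinearMap.snd A (D.X r) (Y.X (r - 1 + 1) × D.X (r - 1)))
  comm' i j hij := by
    simp only [ComplexShape.down_Rel] at hij
    obtain rfl : j = i - 1 := by omega
    refine ModuleCat.hom_ext (LinearMap.ext fun x => ?_)
    obtain ⟨x, y, z⟩ := x
    have e1 := LinearMap.congr_fun (he.comm (rfl : i = i) (rfl : i - 1 = i - 1)) x
    have e2 : (Y.d i (i - 1)).hom (idMap Y (i - 1 + 1) i y) = idMap Y (i - 1 - 1 + 1) (i - 1)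
        ((Y.d (i - 1 + 1) (i - 1 - 1 + 1)).hom y) := by
      generalize hk : i - 1 + 1 = k at *
      generalize hl : i - 1 - 1 + 1 = l at *
      obtain rfl : k = i := by omega
      obtain rfl : l = k - 1 := by omega
      rw [idMap_self, idMap_self]; rfl
    have e3 : idMap Y (i - 1 - 1 + 1) (i - 1) (e (i - 1) (i - 1 - 1 + 1) z) =
        e (i - 1) (i - 1) z := by
      generalize hl : i - 1 - 1 + 1 = l at *
      obtain rfl : l = i - 1 := by omega
      rw [idMap_self]; rfl
    change (Y.d i (i - 1)).hom (e i i x - idMap Y (i - 1 + 1) i y) =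
      e (i - 1) (i - 1) ((D.d i (i - 1)).hom x + (i - 1).negOnePow •
          tot (fiberProj e he) (i - 1) (i - 1) ((y, z) : Y.X (i - 1 + 1) × D.X (i - 1))) -
        idMap Y (i - 1 - 1 + 1) (i - 1) ((Y.d (i - 1 + 1) (i - 1 - 1 + 1)).hom y +
          (i - 1).negOnePow • e (i - 1) (i - 1 - 1 + 1) z)
    have e4 : tot (fiberProj e he) (i - 1) (i - 1) ((y, z) : Y.X (i - 1 + 1) × D.X (i - 1)) =
        z := by
      rw [tot, idMap_self]; rfl
    simp only [LinearMap.comp_apply] at e1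
    have e5 : ∀ (c : ℤˣ) w, idMap Y (i - 1 - 1 + 1) (i - 1) (c • w) =
        c • idMap Y (i - 1 - 1 + 1) (i - 1) w := fun c w => by
      rcases Int.units_eq_one_or c with rfl | rfl <;> simp
    rw [e4, map_sub, map_add, map_add, e1, e2, e5, e3]
    rcases sgn_cases (i - 1) with h | h <;> simp [h]

theorem retr_apply (r : ℤ) (x : D.X r) (y : Y.X (r - 1 + 1)) (z : D.X (r - 1)) :
    comps (retr he) r ((x, y, z) : D.X r × Y.X (r - 1 + 1) × D.X (r - 1)) =
      e r r x - idMap Y (r - 1 + 1) r y := rfl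

theorem opg_retr_I (x) : opg (comps (retr he)) (oph 0 (coneI (fiberProj e he)) x) =
    oph 0 e x := by
  revert x; refine dsum_induct fun i x => ?_
  rw [oph_of i (by ring), opg_of, oph_of i (by ring), coneI_self]
  congr 1
  exact (retr_apply he i x 0 0).trans (by rw [map_zero, sub_zero])

theorem opg_retr_J (x) : opg (comps (retr he)) (oph 1 (coneR (fiberProj e he))
    (oph (-1) (fiberJ he) x)) = -x := by
  revert x; refine dsum_induct fun i x => ?_
  obtain ⟨i, rfl⟩ : ∃ k, i = k - 1 + 1 := ⟨i, by ring⟩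
  rw [oph_of (i - 1) (by ring), oph_of i (by ring), opg_of, coneR_self, fiberJ_self]
  have h : comps (retr he) i ((0, x, 0) : D.X i × Y.X (i - 1 + 1) × D.X (i - 1)) =
      -idMap Y (i - 1 + 1) i x := (retr_apply he i 0 x 0).trans (by rw [map_zero, zero_sub])
  refine (congrArg _ h).trans ?_
  rw [map_neg, of_idMap (by ring)]

theorem opg_retr_S (x) : opg (comps (retr he)) (oph 1 (coneR (fiberProj e he))
    (oph 0 (fiberS he) x)) = 0 := by
  revert x; refine dsum_induct fun i x => ?_
  obtain ⟨i, rfl⟩ : ∃ k, i = k - 1 := ⟨i + 1, by ring⟩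
  rw [oph_of (i - 1) (by ring), oph_of i (by ring), opg_of, coneR_self, fiberS_self]
  have h : comps (retr he) i ((0, 0, x) : D.X i × Y.X (i - 1 + 1) × D.X (i - 1)) = 0 :=
    (retr_apply he i 0 0 x).trans (by rw [map_zero, map_zero, sub_zero])
  exact (congrArg _ h).trans (map_zero _)

theorem opg'_retr_I (x) : oph' 0 (coneI (fiberProj e he)) (opg' (comps (retr he)) x) =
    oph' 0 e x := by
  revert x; refine dsum_induct fun i x => ?_
  rw [opg'_of, oph'_of i (by ring), oph'_of i (by ring), coneI_self]
  congr 1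
  ext y
  exact congrArg x ((retr_apply he i y 0 0).trans (by rw [map_zero, sub_zero]))

theorem opg'_retr_J (x) : oph' (-1) (fiberJ he) (oph' 1 (coneR (fiberProj e he))
    (opg' (comps (retr he)) x)) = -x := by
  revert x; refine dsum_induct fun i x => ?_
  rw [opg'_of, oph'_of (i - 1) (by ring), oph'_of (i - 1 + 1) (by ring), coneR_self, fiberJ_self,
    ← of_dualMap_idMap (show i - 1 + 1 = i by ring), ← map_neg]
  congr 1
  ext y
  have h : comps (retr he) i ((0, y, 0) : D.X i × Y.X (i - 1 + 1) × D.X (i - 1)) =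
      -idMap Y (i - 1 + 1) i y := (retr_apply he i 0 y 0).trans (by rw [map_zero, zero_sub])
  exact (congrArg x h).trans (map_neg _ _)

theorem opg'_retr_S (x) : oph' 0 (fiberS he) (oph' 1 (coneR (fiberProj e he))
    (opg' (comps (retr he)) x)) = 0 := by
  revert x; refine dsum_induct fun i x => ?_
  rw [opg'_of, oph'_of (i - 1) (by ring), oph'_of (i - 1) (by ring), coneR_self, fiberS_self]
  have h0 : dualMap (LinearMap.inr A (Y.X (i - 1 + 1)) (D.X (i - 1))) (dualMap (LinearMap.inr A
      (D.X i) (Y.X (i - 1 + 1) × D.X (i - 1))) (dualMap (comps (retr he) i) x)) = 0 := by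
    ext y
    have h : comps (retr he) i ((0, 0, y) : D.X i × Y.X (i - 1 + 1) × D.X (i - 1)) = 0 :=
      (retr_apply he i 0 0 y).trans (by rw [map_zero, map_zero, sub_zero])
    exact (congrArg x h).trans (map_zero _)
  exact (congrArg _ h0).trans (map_zero _)

end Cone

section PairL

variable {C C' D E Y D' Y' : Cx A}

theorem opm_comp_right (m : ℤ) (θ : DMap C D) (g : GMap C C') (x) :
    opm m (fun p q => θ p q ∘ₗ dualMap (g p) : DMap C' D) x = opm m θ (opg' g x) := by
  revert x; refine dsum_induct fun p x => ?_
  rw [opm, opm, hat_of _ rfl, opg'_of, hat_of _ rfl]; rfl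

theorem pushDualHtpy_pull [FinCx C] [FinCx C'] (n : ℤ) (f : GMap C C') (K G G' : DMap C D)
    (γ : Form C') : pushDualHtpy n K G G' (pull f γ) = pushDualHtpy n
      (fun p q => K p q ∘ₗ dualMap (f p)) (fun p q => G p q ∘ₗ dualMap (f p))
      (fun p q => G' p q ∘ₗ dualMap (f p)) γ := by
  have h : ∀ s p q, susp n (pull f γ) s p q = dualMap (f (n - q)) ∘ₗ susp n γ s p q ∘ₗ f (n - p) :=
    fun s p q => by simp only [susp, pull, comp_smul, smul_comp]
  have h' : ∀ s p q, transp (susp n (pull f γ) s p q) =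
      dualMap (f (n - p)) ∘ₗ transp (susp n γ s p q) ∘ₗ f (n - q) := fun s p q => by
    rw [h]; rfl
  funext s p q
  simp only [pushDualHtpy, h, h', adj_comp_dualMap', comp_smul, smul_comp]
  rfl

theorem pushDualHtpy_zero_left (n : ℤ) (G G' : DMap C D) (γ : Form C) :
    pushDualHtpy n (0 : DMap C D) G G' γ = 0 := by
  funext s p q
  simp only [pushDualHtpy, Pi.zero_apply, adj_zero, comp_zero, zero_comp,
    smul_zero, add_zero]

theorem pushHtpy_zero_left (n : ℤ) (f f' : GMap C D) (θ : Fam C) :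
    pushHtpy n (0 : HMap C D) f f' θ = 0 := by
  funext s p q
  simp only [pushHtpy, Pi.zero_apply, dualMap_zero, comp_zero, zero_comp,
    smul_zero, add_zero]

variable {e : HMap D Y} (he : IsChainH e) {e' : HMap D' Y'} (he' : IsChainH e')

/-- The map of fibers induced by a commutative square. -/
def fiberMap (a : Y ⟶ Y') (b : D ⟶ D') (hab : ∀ i, comps a i ∘ₗ e i i = e' i i ∘ₗ comps b i) :
    fiberCx e he ⟶ fiberCx e' he' where
  f r := ConcreteCategory.ofHom (C := ModuleCat A) (X := (fiberCx e he).X r)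
    (Y := (fiberCx e' he').X r) (LinearMap.prodMap (comps a (r + 1)) (comps b r))
  comm' i j hij := by
    simp only [ComplexShape.down_Rel] at hij
    obtain rfl : j + 1 = i := hij
    refine ModuleCat.hom_ext (LinearMap.ext fun x => ?_)
    obtain ⟨x, z⟩ := x
    have h1 := LinearMap.congr_fun (congrArg ModuleCat.Hom.hom (a.comm (j + 1 + 1) (j + 1))) x
    have h2 := LinearMap.congr_fun (congrArg ModuleCat.Hom.hom (b.comm (j + 1) j)) z
    have h3 := LinearMap.congr_fun (hab (j + 1)) z
    refine Prod.ext ?_ h2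
    change (Y'.d (j + 1 + 1) (j + 1)).hom (comps a (j + 1 + 1) x) +
        (j + 1).negOnePow • e' (j + 1) (j + 1) (comps b (j + 1) z) =
      comps a (j + 1) ((Y.d (j + 1 + 1) (j + 1)).hom x + (j + 1).negOnePow • e (j + 1) (j + 1) z)
    have h4 : ∀ (c : ℤˣ) w, comps a (j + 1) (c • w) = c • comps a (j + 1) w := fun c w => by
      rcases Int.units_eq_one_or c with rfl | rfl <;> simp
    rw [map_add, h4]
    exact congrArg₂ (· + ·) h1 (congrArg _ h3.symm)

variable {he he'} {a : Y ⟶ Y'} {b : D ⟶ D'}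
  (hab : ∀ i, comps a i ∘ₗ e i i = e' i i ∘ₗ comps b i)

theorem opg_fiberMap_J (x) : opg (comps (fiberMap he he' a b hab)) (oph (-1) (fiberJ he) x) =
    oph (-1) (fiberJ he') (opg (comps a) x) := by
  revert x; refine dsum_induct fun i x => ?_
  obtain ⟨k, rfl⟩ : ∃ k, i = k + 1 := ⟨i - 1, by ring⟩
  rw [oph_of k (by ring), opg_of, opg_of, oph_of k (by ring), fiberJ_self, fiberJ_self]
  congr 1
  exact Prod.ext rfl (map_zero (comps b k))

theorem opg_fiberMap_S (x) : opg (comps (fiberMap he he' a b hab)) (oph 0 (fiberS he) x) =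
    oph 0 (fiberS he') (opg (comps b) x) := by
  revert x; refine dsum_induct fun k x => ?_
  rw [oph_of k (by ring), opg_of, opg_of, oph_of k (by ring), fiberS_self, fiberS_self]
  congr 1
  exact Prod.ext (map_zero (comps a (k + 1))) rfl

theorem opg'_fiberMap_J (x) : oph' (-1) (fiberJ he) (opg' (comps (fiberMap he he' a b hab)) x) =
    opg' (comps a) (oph' (-1) (fiberJ he') x) := by
  revert x; refine dsum_induct fun k x => ?_
  rw [opg'_of, oph'_of (k + 1) (by ring), oph'_of (k + 1) (by ring), opg'_of, fiberJ_self,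
    fiberJ_self]
  congr 1
  ext y
  exact congrArg x (Prod.ext rfl (map_zero (comps b k)))

theorem opg'_fiberMap_S (x) : oph' 0 (fiberS he) (opg' (comps (fiberMap he he' a b hab)) x) =
    opg' (comps b) (oph' 0 (fiberS he') x) := by
  revert x; refine dsum_induct fun k x => ?_
  rw [opg'_of, oph'_of k (by ring), oph'_of k (by ring), opg'_of, fiberS_self, fiberS_self]
  congr 1
  ext y
  exact congrArg x (Prod.ext (map_zero (comps a (k + 1))) rfl)

theorem opg'_square (hab : ∀ i, comps a i ∘ₗ e i i = e' i i ∘ₗ comps b i) (x) : oph' 0 e (opg'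
    (comps a) x) = opg' (comps b) (oph' 0 e' x) := by
  rw [← opg'_dgl, ← opg'_dgl, ← opg'_comp, ← opg'_comp]
  exact congrArg (fun h => opg' h x) (funext hab)

theorem push_fiberMap_Lam [FinCx D] [FinCx D'] (c : ℤˣ) (θ : Fam Y) (α : Fam D) :
    push (comps (fiberMap he he' a b hab)) (Lam he c θ α) =
      Lam he' c (push (comps a) θ) (push (comps b) α) := by
  refine fam_ext' fun s m x => ?_
  rw [opm_push]
  by_cases hs : s < 0
  · rw [Lam, if_pos hs, Lam, if_pos hs, opm_zero, opm_zero, map_zero]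
  · simp only [opm_Lam _ _ _ _ _ _ (not_lt.1 hs), map_add, map_usmul, opg_eps, famT_push,
      opm_push, opg_fiberMap_J, opg_fiberMap_S, opg'_fiberMap_J, opg'_fiberMap_S,
      opg'_square hab]

theorem push_fiberMap_Eterm (E : DMap Y D) :
    push (comps (fiberMap he he' a b hab)) (Eterm he E) =
      Eterm he' (fun p q => comps b q ∘ₗ E p q ∘ₗ dualMap (comps a p)) := by
  refine fam_ext' fun s m x => ?_
  rw [opm_push, Eterm, Eterm]
  split_ifs
  · simp only [opm_sand, opg_fiberMap_S, opg'_fiberMap_J, opm_comp]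
  · simp only [opm_zero, map_zero]

theorem proj_oneT_Lam_retr [FinCx D] [FinCx Y] (m : ℤ) (c : ℤˣ) (θ : Fam Y) (α : Fam D) (x) :
    opg (comps (fiberProj e he)) (opm m (oneT (Lam he c θ α) 0)
      (oph' 1 (coneR (fiberProj e he)) (opg' (comps (retr he)) x))) =
      -opm (m + 1) (α 0) (oph' 0 e x) := by
  rw [opm_oneT, if_pos rfl, opm_Lam _ _ _ _ _ _ le_rfl, opm_famT_Lam _ _ _ _ _ _ le_rfl]
  simp only [hom_simps, opg_eps, opg_fiberProj_J, opg_fiberProj_S, opg'_retr_J, opg'_retr_S,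
    smul_zero, neg_zero, negOnePow_zero, one_smul]
  abel

theorem proj_oneT_Eterm_retr [FinCx D] [FinCx Y] (m : ℤ) (E : DMap Y D) (x) :
    opg (comps (fiberProj e he)) (opm m (oneT (Eterm he E) 0)
      (oph' 1 (coneR (fiberProj e he)) (opg' (comps (retr he)) x))) = -opm (m + 1) E x := by
  rw [opm_oneT, if_pos rfl, famT_eq, Eterm, if_pos rfl,
    opm_dmT_sand_eo _ _ _ _ _ _ _ (show (0 : ℤ) % 2 = 0 by norm_num)
      (show (-1 : ℤ) % 2 = 1 by norm_num), opm_sand]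
  simp only [hom_simps, opg_eps, opg_fiberProj_J, opg_fiberProj_S, opg'_retr_J, opg'_retr_S,
    smul_zero, sub_zero, sub_neg_eq_add, add_zero]

/-- The pair of a complex `D` with a hyperquadratic structure mapping to a symmetric complex. -/
abbrev fiberPair (he : IsChainH e) (θ : Fam Y) (α : Fam D) (E : DMap Y D) : PairData A where
  C := fiberCx e he
  D := D
  f := fiberProj e he
  δφ := ge0 α
  ψ := psiL he θ α E

theorem evD_retr [FinCx D] [FinCx Y] (θ : Fam Y) (α : Fam D) (E : DMap Y D) :
    (fun p q => (fiberPair he θ α E).evD p q ∘ₗ dualMap (comps (retr he) p)) = E := by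
  refine dmap_ext fun m x => ?_
  rw [opm_comp_right, opm_evD]
  change opm m (ge0 α 0) (oph' 0 (coneI (fiberProj e he)) _) + opg (comps (fiberProj e he))
    (opm (m - 1) (oneT (psiL he θ α E) 0) (oph' 1 (coneR (fiberProj e he)) _)) = _
  rw [psiL, oneT_sub, Pi.sub_apply, opm_sub, map_sub, proj_oneT_Lam_retr, proj_oneT_Eterm_retr,
    opg'_retr_I, ge0, if_neg (lt_irrefl _), sub_add_cancel]
  abel

theorem fiberPair_α [FinCx D] [FinCx Y] (θ : Fam Y) (α : Fam D) (E : DMap Y D) :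
    (fiberPair he θ α E).α = symm α := by
  have h : hyp (psiL he θ α E) = hyp (Lam he 1 θ α) - hyp (Eterm he E) := rfl
  change ge0 α + push (comps (fiberProj e he)) (hyp (psiL he θ α E)) = _
  rw [h, push_sub, push_proj_hyp_Eterm, sub_zero, push_proj_hyp_Lam]

theorem fiberPair_normal [FinCx D] [FinCx Y] {n : ℤ} {θ : Fam Y} {α ω : Fam D} {E : DMap Y D}
    {γ : Form Y} (hα : IsHyp n α) (hα' : dHyp n α = 0) (hγ : IsBundle γ) (hω : IsHyp (n + 1) ω)
    (h : α - pushDual n E γ = dHyp (n + 1) ω) :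
    (fiberPair he θ α E).IsNormalStr n (pull (comps (retr he)) γ) (trunc n α + ω) := by
  refine ⟨⟨hγ.1.pull _, by rw [dForm_pull _ hγ.1, hγ.2, pull_zero]⟩, (isHyp_trunc hα rfl).add hω,
    ?_⟩
  have h2 := symm_sub hα
  have h0 : trunc (n - 1) (0 : Fam D) = 0 := by
    funext s p q; rw [trunc]; split_ifs <;> simp
  rw [hα', h0, add_zero] at h2
  have h3 := pushDual_pull n (comps (retr he)) (fiberPair he θ α E).evD γ
  rw [evD_retr] at h3
  change _ - pushDual n (fiberPair he θ α E).evD (pull (comps (retr he)) γ) = _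
  rw [h3]
  change _ = dHyp (n + 1) (trunc n α + ω)
  rw [dHyp_add, ← h, ← h2, fiberPair_α]
  exact (sub_add_sub_cancel _ _ _).symm

end PairL

section LData

variable {B C C' D E Y D' Y' : Cx A}

/-- A symmetric complex `(Y, φ)` with a chain map `e : D → Y` from a complex with hyperquadratic
structure `α`, an equivalence `θ` from `e α e^*` to `φ`, a lift `E : Y^{n-*} → D` of `φ_0`, a bundle
`γ` over `Y`, an equivalence `ω` from the bundle induced by `E` to `α`, and a map `(g, χ)` of chain
bundles. -/
structure LData (B : Cx A) where
  Y : Cx A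
  D : Cx A
  e : HMap D Y
  he : IsChainH e
  E : DMap Y D
  φ : Fam Y
  θ : Fam Y
  α : Fam D
  ω : Fam D
  γ : Form Y
  g : Y ⟶ B
  χ : Form Y

/-- The fiber of `e`. -/
abbrev LData.F {B : Cx A} (L : LData B) : Cx A := fiberCx L.e L.he

/-- The conditions on the structures of a lifted normal complex. -/
structure LData.IsL (n : ℤ) {B : Cx A} (β : Form B) (L : LData B) : Prop where
  dimY : IsDim n L.Y
  dimD : IsDim n L.D
  dimF : IsDim (n - 1) L.F
  degE : IsDeg n L.E
  dE : dmD L.E = 0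
  eqE : IsChainEquiv (dmHom n L.E dE)
  sym : IsSymStructure n L.φ
  φ0 : L.φ 0 = fun p q => L.e q q ∘ₗ L.E p q
  hypα : IsHyp n L.α
  dα : dHyp n L.α = 0
  hypθ : IsHyp (n + 1) L.θ
  dθ : L.φ - push (dgl L.e) L.α = dHyp (n + 1) L.θ
  bundle : IsBundle L.γ
  hypω : IsHyp (n + 1) L.ω
  dω : L.α - pushDual n L.E L.γ = dHyp (n + 1) L.ω
  bundle_map : IsBundleEquiv L.χ L.γ (pull (comps L.g) β)

theorem IsDim.finCx {n : ℤ} {C : Cx A} (h : IsDim n C) : FinCx C :=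
  ⟨fun i => (h.1.1 i).1, fun i => (h.1.1 i).2⟩

/-- The `(B, β)`-normal pair of a lifted normal complex. -/
abbrev LData.pair (n : ℤ) {B : Cx A} (L : LData B) : BPairData B where
  toPairData := fiberPair L.he L.θ L.α L.E
  γ := pull (comps (retr L.he)) L.γ
  θ := trunc n L.α + L.ω
  g := retr L.he ≫ L.g
  χ := pull (comps (retr L.he)) L.χ

theorem LData.IsL.pair_isPair {n : ℤ} {B : Cx A} {β : Form B} {L : LData B} (h : L.IsL n β) :
    (L.pair n).IsPair n := by
  have := h.dimY.finCx
  have := h.dimD.finCx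
  exact ⟨h.dimF, h.dimD, isSym_ge0 h.hypα, ⟨isQuad_psiL L.he h.hypθ h.hypα h.degE,
    dQuad_psiL L.he h.sym.1 h.hypθ h.hypα h.degE h.dE h.dα h.φ0 h.dθ⟩,
    dHyp_ge0_psiL L.he h.hypα h.dα⟩

theorem LData.IsL.pair_normal {n : ℤ} {B : Cx A} {β : Form B} {L : LData B} (h : L.IsL n β) :
    (L.pair n).IsNormalStr n (L.pair n).γ (L.pair n).θ := by
  have := h.dimY.finCx
  have := h.dimD.finCx
  exact fiberPair_normal h.hypα h.dα h.bundle h.hypω h.dω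

theorem LData.IsL.pair_bundle_map {n : ℤ} {B : Cx A} {β : Form B} {L : LData B} (h : L.IsL n β) :
    IsBundleEquiv (L.pair n).χ (L.pair n).γ (pull (comps (L.pair n).g) β) :=
  ⟨h.bundle_map.1.pull _, by rw [dForm_pull _ h.bundle_map.1, h.bundle_map.2, pull_sub]; rfl⟩

/-- Transport of a homotopy along equalities of chain maps. -/
def htpyCongr {f f' g g' : C ⟶ D} (hf : f' = f) (hg : g' = g) (h : Homotopy f g) :
    Homotopy f' g' where
  hom := h.hom
  zero := h.zero
  comm := by subst hf hg; exact h.comm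

theorem hcomps_htpyCongr {f f' g g' : C ⟶ D} (hf : f' = f) (hg : g' = g) (h : Homotopy f g) :
    hcomps (htpyCongr hf hg h) = hcomps h := rfl

theorem hcomps_compLeft {f g : C ⟶ D} (h : Homotopy f g) (k : B ⟶ C) (i j : ℤ) :
    hcomps (h.compLeft k) i j = hcomps h i j ∘ₗ comps k i := rfl

theorem hcomps_compRight {f g : C ⟶ D} (h : Homotopy f g) (k : D ⟶ E) (i j : ℤ) :
    hcomps (h.compRight k) i j = comps k j ∘ₗ hcomps h i j := rfl

theorem hcomps_refl {f : C ⟶ D} : hcomps (Homotopy.refl f) = 0 := rfl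

/-- Two chain maps with equal components are equal. -/
theorem hom_ext_comps {f g : C ⟶ D} (h : ∀ i, comps f i = comps g i) : f = g :=
  HomologicalComplex.hom_ext _ _ fun i => ModuleCat.hom_ext (h i)

section
variable {e : HMap D Y} {he : IsChainH e} {e' : HMap D' Y'} {he' : IsChainH e'}
  {a : Y ⟶ Y'} {b : D ⟶ D'} (hab : ∀ i, comps a i ∘ₗ e i i = e' i i ∘ₗ comps b i)

theorem fiberMap_proj : fiberMap he he' a b hab ≫ fiberProj e' he' = fiberProj e he ≫ b := rfl

theorem coneMap_retr (k : Homotopy (fiberMap he he' a b hab ≫ fiberProj e' he')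
    (fiberProj e he ≫ b)) (hk : hcomps k = 0) :
    coneMap (fiberMap he he' a b hab) b k ≫ retr he' = retr he ≫ a := by
  refine hom_ext_comps fun i => LinearMap.ext fun x => ?_
  obtain ⟨x, y, z⟩ := x
  have h1 := LinearMap.congr_fun (hab i) x
  have h2 : idMap Y' (i - 1 + 1) i (comps a (i - 1 + 1) y) =
      comps a i (idMap Y (i - 1 + 1) i y) := by
    generalize hj : i - 1 + 1 = j at y
    obtain rfl : j = i := by omega
    rw [idMap_self, idMap_self]; rfl
  have h3 : ∀ (c : ℤˣ) (w : Y.X (i - 1 + 1) × D.X (i - 1)),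
      comps b i x + c • hcomps k (i - 1) i w = comps b i x := by
    intro c w
    rw [hk]
    change _ + c • (0 : D'.X i) = _
    rw [smul_zero, add_zero]
  change e' i i (comps b i x + i.negOnePow • hcomps k (i - 1) i (y, z)) -
    idMap Y' (i - 1 + 1) i (comps a (i - 1 + 1) y) = comps a i (e i i x - idMap Y (i - 1 + 1) i y)
  rw [h2, map_sub, h3]
  congr 1
  exact h1.symm

end

theorem opm_pairMapHtpy {P P' : PairData A} {g : P.C ⟶ P'.C} {h : P.D ⟶ P'.D}
    (k : Homotopy (g ≫ P'.f) (P.f ≫ h)) (δξ : Fam P'.D) (ξ : Fam P'.C) (m : ℤ) (x) :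
    opm m (pairMapHtpy k δξ ξ) x = opm m (δξ 0) (oph' 0 (coneI P'.f) x) +
      oph 1 (hcomps k) (opm (m - 2) (oneT P.ψ 0) (oph' 1 (hcomps k)
        (eps (oph' 0 (coneI P'.f) x)))) +
      (oph 1 (hcomps k) (opm (m - 2) (oneT P.ψ 0) (opg' (comps g) (oph' 1 (coneR P'.f) x))) +
      opg (comps P'.f) (opm (m - 1) (oneT ξ 0) (oph' 1 (coneR P'.f) x))) := by
  revert x; refine dsum_induct fun p x => ?_
  rw [oph'_of p (by ring), oph'_of (p - 1) (by ring), opg'_of, eps_of, map_usmul,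
    oph'_of (p - 1) (by ring), opm, opm, opm, opm, hat_of (m - p) (by ring),
    hat_of (m - p) (by ring), map_usmul, hat_of (m - p - 1) (by ring), map_usmul,
    oph_of (m - p) (by ring), hat_of (m - p - 1) (by ring), oph_of (m - p) (by ring),
    hat_of (m - p) (by ring), opg_of, ← map_usmul, ← map_add, ← map_add, ← map_add,
    pairMapHtpy, coneDualFst_eq, coneDualSnd_eq]
  rfl

/-- The homotopy equivalence of pairs induced by a map of lifted normal complexes. -/
theorem LData.pair_map {n : ℤ} {B : Cx A} {β : Form B} {L L' : LData B} (h : L.IsL n β)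
    (h' : L'.IsL n β) (a : L.Y ⟶ L'.Y) (b : L.D ⟶ L'.D)
    (hab : ∀ i, comps a i ∘ₗ L.e i i = L'.e i i ∘ₗ comps b i) (hb : IsChainEquiv b)
    (hF : IsChainEquiv (fiberMap L.he L'.he a b hab))
    (hE : L'.E = fun p q => comps b q ∘ₗ L.E p q ∘ₗ dualMap (comps a p))
    {ch η : Fam L'.D} {et : Fam L'.Y} {χ₀ : Form L.Y} (hch : IsHyp (n + 1) ch)
    (hη : IsHyp (n + 2) η) (het : IsHyp (n + 2) et)
    (hα : L'.α = push (comps b) L.α + dHyp (n + 1) ch)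
    (hθ : L'.θ = push (comps a) L.θ - push (dgl L'.e) ch + dHyp (n + 2) et)
    (hχ₀ : IsBundleEquiv χ₀ L.γ (pull (comps a) L'.γ))
    (hω : L'.ω = push (comps b) L.ω + ch - pushDual n (fun p q => comps b q ∘ₗ L.E p q) χ₀ +
      dHyp (n + 2) η)
    (l : Homotopy (a ≫ L'.g) L.g) (μ : Form L.Y)
    (hμ : IsBundleHtpy β L.g L.χ (a ≫ L'.g) (χ₀ + pull (comps a) L'.χ) l μ) :
    BPairHE n β (L.pair n) (L'.pair n) := by
  have := h.dimY.finCx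
  have := h.dimD.finCx
  have := h'.dimY.finCx
  have := h'.dimD.finCx
  let k : Homotopy (fiberMap L.he L'.he a b hab ≫ fiberProj L'.e L'.he)
    (fiberProj L.e L.he ≫ b) := Homotopy.ofEq (fiberMap_proj hab)
  have hk : hcomps k = 0 := rfl
  have hc := coneMap_retr hab k hk
  have hpull : ∀ γ : Form L'.Y, pull (comps (coneMap (fiberMap L.he L'.he a b hab) b k))
      (pull (comps (retr L'.he)) γ) = pull (comps (retr L.he)) (pull (comps a) γ) := fun γ => by
    rw [← pull_comp, ← pull_comp, hc]
  have hcχ : trunc n (dHyp (n + 1) ch) - symm ch + ch = -dHyp (n + 2) (trunc (n + 1) ch) := by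
    have := symm_sub hch
    rw [add_sub_cancel_right] at this
    rw [show n + 2 = n + 1 + 1 by ring, ← add_sub_cancel_right (dHyp (n + 1 + 1) _)
      (trunc n (dHyp (n + 1) ch)), ← this]
    abel
  have hmapα : pairMapα n (P := (L.pair n).toPairData) (P' := (L'.pair n).toPairData)
      (g := fiberMap L.he L'.he a b hab) (h := b) k (ge0 ch) (Lam L'.he (-1) et ch) =
      symm ch := by
    rw [pairMapα, hk, pushHtpy_zero_left, add_zero]
    exact push_proj_hyp_Lam _ _ _ _
  have hmapK : (fun p q => pairMapHtpy (P := (L.pair n).toPairData) (P' := (L'.pair n).toPairData)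
      (g := fiberMap L.he L'.he a b hab) (h := b) k (ge0 ch) (Lam L'.he (-1) et ch) p q ∘ₗ
        dualMap (comps (retr L'.he) p)) = (0 : DMap L'.Y L'.D) := by
    refine dmap_ext fun m x => ?_
    rw [opm_comp_right, opm_pairMapHtpy, hk]
    have h0 : ∀ x, oph 1 (0 : HMap (fiberCx L.e L.he) L'.D) x = 0 := fun x => by
      revert x; refine dsum_induct fun i x => ?_
      rw [oph_of (i + 1) rfl]; simp
    have h1 := proj_oneT_Lam_retr (he := L'.he) (m - 1) (-1) et ch x
    rw [h0, h0, h1, opg'_retr_I, ge0, if_neg (lt_irrefl _), sub_add_cancel, opm_zero]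
    abel
  refine ⟨fiberMap L.he L'.he a b hab, b, k, ge0 ch, Lam L'.he (-1) et ch,
    pull (comps (retr L.he)) χ₀, η - trunc (n + 1) ch,
    htpyCongr (by rw [← Category.assoc, hc, Category.assoc]) rfl (l.compLeft (retr L.he)),
    pull (comps (retr L.he)) μ, hF, hb, ⟨⟨isSym_ge0 hch, isQuad_Lam _ het hch rfl rfl, ?_, ?_⟩,
      ⟨hχ₀.1.pull _, ?_⟩, hη.sub (isHyp_trunc hch (by ring)), ?_⟩, hμ.1.pull _, ?_⟩
  · change psiL L'.he L'.θ L'.α L'.E - push _ (psiL L.he L.θ L.α L.E) = _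
    rw [psiL, psiL, push_sub, push_fiberMap_Lam, push_fiberMap_Eterm, ← hE, dQuad_Lam _ het hch, hα,
      hθ, sub_sub_sub_cancel_right, sub_eq_iff_eq_add, ← Lam_add]
    congr 1 <;> abel
  · rw [hk, pushHtpy_zero_left, smul_zero, add_zero]
    change ge0 L'.α - push (comps b) (ge0 L.α) = dHyp (n + 1) (ge0 ch) +
      n.negOnePow • push (comps (fiberProj L'.e L'.he)) (oneT (Lam L'.he (-1) et ch))
    have h2 : push (comps b) (ge0 L.α) = ge0 (push (comps b) L.α) := by
      funext s
      rw [ge0]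
      split_ifs with hs
      · funext p q; simp [push, ge0, if_pos hs]
      · funext p q; simp [push, ge0, if_neg hs]
    have h3 : ge0 (push (comps b) L.α + dHyp (n + 1) ch) = ge0 (push (comps b) L.α) +
        ge0 (dHyp (n + 1) ch) := by
      funext s
      simp only [ge0, Pi.add_apply]
      split_ifs <;> simp
    rw [push_proj_oneT_Lam, dHyp_ge0 hch, hα, h2, h3, add_sub_cancel_right]
    abel
  · rw [dForm_pull _ hχ₀.1, hχ₀.2, pull_sub, hpull]
  · have hz := pushDualHtpy_pull n (comps (retr L'.he))
      (pairMapHtpy (P := (L.pair n).toPairData) (P' := (L'.pair n).toPairData)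
        (g := fiberMap L.he L'.he a b hab) (h := b) k (ge0 ch) (Lam L'.he (-1) et ch))
      (fun p q => comps b q ∘ₗ (L.pair n).evD p q ∘ₗ
        dualMap (comps (coneMap (fiberMap L.he L'.he a b hab) b k) p)) (L'.pair n).evD L'.γ
    rw [hmapK, pushDualHtpy_zero_left] at hz
    have hp := pushDual_pull n (comps (retr L.he))
      (fun p q => comps b q ∘ₗ (L.pair n).evD p q) χ₀
    have hev : (fun p q => (comps b q ∘ₗ (L.pair n).evD p q) ∘ₗ dualMap (comps (retr L.he) p)) =
        fun p q => comps b q ∘ₗ L.E p q := by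
      have := evD_retr (he := L.he) L.θ L.α L.E
      funext p q
      rw [comp_assoc]
      exact congrArg _ (congrFun (congrFun this p) q)
    rw [hev] at hp
    have htr : trunc n L'.α - push (comps b) (trunc n L.α) = trunc n (dHyp (n + 1) ch) := by
      rw [hα]
      funext s p q
      simp only [trunc, Pi.sub_apply, Pi.add_apply, push]
      split_ifs
      · simp only [Pi.smul_apply, Pi.add_apply, push, smul_add, smul_comp,
          comp_smul]
        abel
      · simp
    have hpθ : (L'.pair n).θ = trunc n L'.α + L'.ω := rfl
    rw [hmapα]
    refine (congrArg₂ (fun x y => _ + x + y) hz hp).trans ?_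
    rw [dHyp_sub, ← neg_eq_iff_eq_neg.2 hcχ, push_add, add_zero, ← htr, hpθ, hω]
    abel
  · have h1 : dForm 2 (pull (comps (retr L.he)) μ) = _ :=
      (dForm_pull _ hμ.1).trans (congrArg _ (neg_eq_iff_eq_neg.2 hμ.2).symm)
    have hg : coneMap (fiberMap L.he L'.he a b hab) b k ≫ (L'.pair n).g =
        retr L.he ≫ a ≫ L'.g := by
      rw [← Category.assoc, hc, Category.assoc]
    rw [h1, pull_neg, neg_neg, pull_add, pull_sub, pull_add, pull_pullHtpy]
    exact congrArg₂ (· + ·) (congrArg₂ (· - ·) rfl (congrArg₂ (· + ·) rfl (hpull _)))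
      (congrArg (fun w : _ ⟶ B => pullHtpy 0 _ _ (comps w) β) hg)

end LData

section Quasi

variable {M N P M₁ M₂ N₁ N₂ : Type*} [AddCommGroup M] [AddCommGroup N] [AddCommGroup P]
  [AddCommGroup M₁] [AddCommGroup M₂] [AddCommGroup N₁] [AddCommGroup N₂]
  {d : M →+ M} {d' : N →+ N} {d'' : P →+ P} {f : M →+ N} {g : N →+ P}

/-- An additive map of groups with differentials induces an isomorphism in homology. -/
structure QIh (d : M →+ M) (d' : N →+ N) (f : M →+ N) : Prop where
  inj : ∀ x z, d x = 0 → f x = d' z → ∃ w, x = d w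
  surj : ∀ y, d' y = 0 → ∃ x z, d x = 0 ∧ y = f x + d' z

theorem QIh.comp (hf : QIh d d' f) (hg : QIh d' d'' g) (cf : ∀ x, d' (f x) = f (d x))
    (cg : ∀ x, d'' (g x) = g (d' x)) : QIh d d'' (g.comp f) where
  inj x z hx hz := by
    obtain ⟨w, hw⟩ := hg.inj (f x) z (by rw [cf, hx, map_zero]) hz
    exact hf.inj x w hx hw
  surj y hy := by
    obtain ⟨x, z, hx, rfl⟩ := hg.surj y hy
    obtain ⟨x, w, hx', rfl⟩ := hf.surj x hx
    exact ⟨x, z + g w, hx', by simp only [AddMonoidHom.comp_apply, map_add, cg]; abel⟩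

theorem QIh.of_comp_left (hf : QIh d d' f) (hgf : QIh d d'' (g.comp f))
    (cf : ∀ x, d' (f x) = f (d x)) (cg : ∀ x, d'' (g x) = g (d' x)) : QIh d' d'' g where
  inj y z hy hz := by
    obtain ⟨x, w, hx, rfl⟩ := hf.surj y hy
    obtain ⟨v, rfl⟩ := hgf.inj x (z - g w) hx (by
      rw [AddMonoidHom.comp_apply, map_sub, ← hz, map_add, cg]; abel)
    exact ⟨f v + w, by rw [map_add, cf]⟩
  surj y hy := by
    obtain ⟨x, z, hx, rfl⟩ := hgf.surj y hy
    exact ⟨f x, z, by rw [cf, hx, map_zero], rfl⟩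

theorem QIh.of_comp_right (hg : QIh d' d'' g) (hgf : QIh d d'' (g.comp f))
    (cf : ∀ x, d' (f x) = f (d x)) (cg : ∀ x, d'' (g x) = g (d' x)) : QIh d d' f where
  inj x z hx hz := hgf.inj x (g z) hx (by rw [AddMonoidHom.comp_apply, hz, cg])
  surj y hy := by
    obtain ⟨x, z, hx, hz⟩ := hgf.surj (g y) (by rw [cg, hy, map_zero])
    obtain ⟨w, hw⟩ := hg.inj (y - f x) z (by rw [map_sub, cf, hx, hy, map_zero, sub_zero])
      (by rw [map_sub, hz]; simp)
    exact ⟨x, w, hx, by rw [← hw]; abel⟩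

theorem QIh.of_htpy {f' : M →+ N} (hf : QIh d d' f) (h : M →+ N)
    (H : ∀ x, d' (h x) + h (d x) = f' x - f x) : QIh d d' f' where
  inj x z hx hz := hf.inj x (z - d' 0 - h x) hx (by
    have := H x
    rw [hx, map_zero, add_zero, hz] at this
    rw [map_sub, this, map_zero, sub_zero]; abel)
  surj y hy := by
    obtain ⟨x, z, hx, rfl⟩ := hf.surj y hy
    refine ⟨x, z - h x, hx, ?_⟩
    have := H x
    rw [hx, map_zero, add_zero] at this
    rw [map_sub, this]; abel

theorem QIh.congr_htpy {k : M →+ N} {l : N →+ M} (kl : M →+ M) (lk : N →+ N)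
    (cl : ∀ x, d (l x) = l (d' x))
    (h₁ : ∀ x, d (kl x) + kl (d x) = x - l (k x))
    (h₂ : ∀ y, d' (lk y) + lk (d' y) = y - k (l y)) : QIh d d' k where
  inj x z hx hz := by
    have := h₁ x
    rw [hx, map_zero, add_zero, hz, ← cl] at this
    exact ⟨kl x + l z, by rw [map_add, this]; abel⟩
  surj y hy := by
    have := h₂ y
    rw [hy, map_zero, add_zero] at this
    exact ⟨l y, lk y, by rw [cl, hy, map_zero], by rw [this]; abel⟩

/-- The five lemma. -/
theorem QIh.five {d₁ : M₁ →+ M₁} {d₂ : M₂ →+ M₂} {d₁' : N₁ →+ N₁} {d₂' : N₂ →+ N₂}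
    {i : M₁ →+ M} {p : M →+ M₂} {j : N₁ →+ N} {q : N →+ N₂} {f₁ : M₁ →+ N₁} {f₂ : M₂ →+ N₂}
    (h₁ : QIh d₁ d₁' f₁) (h₂ : QIh d₂ d₂' f₂)
    (ci : ∀ x, d (i x) = i (d₁ x)) (cp : ∀ x, d₂ (p x) = p (d x))
    (cj : ∀ x, d' (j x) = j (d₁' x)) (cq : ∀ x, d₂' (q x) = q (d' x))
    (cf : ∀ x, d' (f x) = f (d x)) (cf₁ : ∀ x, d₁' (f₁ x) = f₁ (d₁ x))
    (dd : ∀ x, d (d x) = 0) (dd' : ∀ x, d' (d' x) = 0)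
    (hfi : ∀ x, f (i x) = j (f₁ x)) (hqf : ∀ x, q (f x) = f₂ (p x))
    (hi : Function.Injective i) (hj : Function.Injective j)
    (hp : Function.Surjective p) (hq : Function.Surjective q)
    (hip : ∀ x, p x = 0 → ∃ y, x = i y) (hjq : ∀ x, q x = 0 → ∃ y, x = j y)
    (hqj : ∀ x, q (j x) = 0) : QIh d d' f where
  inj x z hx hz := by
    obtain ⟨w, hw⟩ := h₂.inj (p x) (q z) (by rw [cp, hx, map_zero]) (by rw [← hqf, hz, cq])
    obtain ⟨w, rfl⟩ := hp w
    obtain ⟨u, hu⟩ := hip (x - d w) (by rw [map_sub, ← cp, ← hw, sub_self])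
    have hdu : d₁ u = 0 := hi (by rw [← ci, ← hu, map_sub, hx, dd, sub_zero, map_zero])
    have hq0 : d₂' (q (z - f w)) = 0 := by
      rw [cq, map_sub, ← hz, cf, ← map_sub, hu, hfi, hqj]
    obtain ⟨s, t, hs, hst⟩ := h₂.surj _ hq0
    obtain ⟨s, rfl⟩ := hp s
    obtain ⟨t, rfl⟩ := hq t
    obtain ⟨v, hv⟩ := hjq (z - f w - f s - d' t) (by
      rw [map_sub, map_sub, hst, hqf s, ← cq]; abel)
    obtain ⟨r, hr⟩ := hip (d s) (by rw [← cp, hs])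
    have hdr : d₁ r = 0 := hi (by rw [← ci, ← hr, dd, map_zero])
    obtain ⟨y, hy⟩ := h₁.inj (u - r) v (by rw [map_sub, hdu, hdr, sub_zero]) (hj (by
      rw [map_sub, map_sub, ← hfi, ← hfi, ← hu, ← hr, ← cj, ← hv, map_sub, map_sub, map_sub, dd',
        map_sub, ← hz, cf, cf, sub_zero]))
    refine ⟨w + s + i y, ?_⟩
    rw [map_add, map_add, ci, ← hy, map_sub, ← hu, ← hr]
    abel
  surj y hy := by
    obtain ⟨x, z, hx, hxz⟩ := h₂.surj (q y) (by rw [cq, hy, map_zero])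
    obtain ⟨x, rfl⟩ := hp x
    obtain ⟨z, rfl⟩ := hq z
    obtain ⟨u, hu⟩ := hip (d x) (by rw [← cp, hx])
    obtain ⟨v, hv⟩ := hjq (y - f x - d' z) (by rw [map_sub, map_sub, hxz, hqf, cq]; abel)
    have hdu : d₁ u = 0 := hi (by rw [← ci, ← hu, dd, map_zero])
    have hfu : f₁ u = d₁' (-v) := hj (by
      rw [← hfi, ← hu, map_neg, map_neg, ← cj, ← hv, map_sub, map_sub, hy, dd', cf]; abel)
    obtain ⟨w, rfl⟩ := h₁.inj u (-v) hdu hfu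
    obtain ⟨s, t, hs, hst⟩ := h₁.surj (v + f₁ w) (by
      rw [map_add, cf₁, hfu, map_neg, add_neg_cancel])
    refine ⟨x - i w + i s, z + j t, ?_, ?_⟩
    · rw [map_add, map_sub, ci, ci, hu, hs, map_zero, add_zero, sub_self]
    · have h3 : j v = j (f₁ s) + j (d₁' t) - j (f₁ w) := by
        rw [← map_add, ← hst, map_add]; abel
      have h4 : y = j v + f x + d' z := by rw [← hv]; abel
      rw [h4, h3, map_add, map_sub, hfi, hfi, map_add, cj]
      abel

end Quasi

section Graded

variable {B C C' D E Y D' Y' : Cx A}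

/-- Homology isomorphisms. -/
def QI (f : C ⟶ D) : Prop := QIh (opd C) (opd D) (opg (comps f))

/-- Acyclic complexes. -/
def Acyclic (C : Cx A) : Prop := ∀ x, opd C x = 0 → ∃ y, x = opd C y

theorem opg_comps_comp (f : C ⟶ D) (g : D ⟶ E) :
    opg (comps (f ≫ g)) = (opg (comps g)).comp (opg (comps f)) :=
  AddMonoidHom.ext fun x => opg_comp _ _ x

theorem opg_comps_id (x) : opg (comps (𝟙 C)) x = x := by
  revert x; refine dsum_induct fun i x => ?_
  rw [opg_of]; rfl

theorem QI.of_htpyEquiv (e : HomotopyEquiv C D) : QI e.hom := by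
  refine QIh.congr_htpy (l := opg (comps e.inv)) (oph 1 (hcomps e.homotopyHomInvId.symm))
    (oph 1 (hcomps e.homotopyInvHomId.symm)) (fun x => (opg_opd _ x).symm) (fun x => ?_)
    fun x => ?_
  · rw [oph_htpy, opg_comps_id, opg_comps_comp]; rfl
  · rw [oph_htpy, opg_comps_id, opg_comps_comp]; rfl

theorem IsChainEquiv.qi {f : C ⟶ D} (h : IsChainEquiv f) : QI f := by
  obtain ⟨e, rfl⟩ := h
  exact QI.of_htpyEquiv e

theorem opd_apply (x) (i : ℤ) : (opd C x) i = (C.d (i + 1) i).hom (x (i + 1)) := by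
  induction x using DirectSum.induction_on with
  | zero => simp
  | add x y hx hy => simp only [map_add, DirectSum.add_apply, hx, hy]
  | of k x =>
    obtain ⟨k, rfl⟩ : ∃ l, k = l + 1 := ⟨k - 1, by ring⟩
    rw [opd_of k rfl]
    by_cases h : k = i
    · subst h
      rw [DirectSum.of_eq_same, DirectSum.of_eq_same]
    · rw [DirectSum.of_eq_of_ne _ _ _ (by omega), DirectSum.of_eq_of_ne _ _ _ (by omega), map_zero]

/-- Exactness in degrees `i < m`. -/
def ExBelow (m : ℤ) (C : Cx A) : Prop := ∀ i, i < m → ∀ x : C.X i,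
  (C.d i (i - 1)).hom x = 0 → ∃ y : C.X (i + 1), x = (C.d (i + 1) i).hom y

theorem Acyclic.exBelow (h : Acyclic C) (m : ℤ) : ExBelow m C := fun i _ x hx => by
  obtain ⟨y, hy⟩ := h (DirectSum.of (fun i => C.X i) i x) (by
    rw [opd_of (i - 1) (by ring), hx, map_zero])
  refine ⟨y (i + 1), ?_⟩
  rw [← opd_apply, ← hy, DirectSum.of_eq_same]

/-- A partial contraction of a complex of projective modules which is exact in low degrees. -/
theorem ExBelow.exists_contraction {m N : ℤ} (h : ExBelow m C)
    (hp : ∀ i, Module.Projective A (C.X i)) (hN : ∀ i, i < N → Subsingleton (C.X i)) :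
    ∃ H : HMap C C, ∀ i, i < m →
      (C.d (i + 1) i).hom ∘ₗ H i (i + 1) + H (i - 1) i ∘ₗ (C.d i (i - 1)).hom = LinearMap.id := by
  have key : ∀ k : ℕ, ∃ H : HMap C C, ∀ i, i < m → i < N + k →
      (C.d (i + 1) i).hom ∘ₗ H i (i + 1) + H (i - 1) i ∘ₗ (C.d i (i - 1)).hom =
        LinearMap.id := by
    intro k
    induction k with
    | zero =>
      refine ⟨0, fun i _ hi => LinearMap.ext fun x => ?_⟩
      have := hN i (by simpa using hi)
      exact Subsingleton.elim _ _
    | succ k ih =>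
      obtain ⟨H, hH⟩ := ih
      by_cases hkm : N + k < m
      · set j := N + (k : ℤ) with hj
        let π : C.X j →ₗ[A] C.X j := LinearMap.id - H (j - 1) j ∘ₗ (C.d j (j - 1)).hom
        have hπ : (C.d j (j - 1)).hom ∘ₗ π = 0 := by
          have h1 := hH (j - 1) (by omega) (by omega)
          have h2 := d_comp_d_hom C j (j - 1) (j - 1 - 1)
          rw [sub_add_cancel] at h1
          change (C.d j (j - 1)).hom ∘ₗ (LinearMap.id - H (j - 1) j ∘ₗ (C.d j (j - 1)).hom) = 0
          rw [LinearMap.comp_sub, ← comp_assoc, eq_sub_of_add_eq h1, LinearMap.sub_comp,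
            comp_assoc, h2]
          simp
        have hr : ∀ x, π x ∈ LinearMap.range (C.d (j + 1) j).hom := fun x => by
          obtain ⟨y, hy⟩ := h j hkm (π x) (LinearMap.congr_fun hπ x)
          exact ⟨y, hy.symm⟩
        have := hp j
        obtain ⟨K, hK⟩ := Module.projective_lifting_property (C.d (j + 1) j).hom.rangeRestrict
          (π.codRestrict _ hr) (C.d (j + 1) j).hom.surjective_rangeRestrict
        refine ⟨Function.update H j (Function.update (H j) (j + 1) K), fun i hi hik => ?_⟩
        rcases (show i ≤ j by push_cast at hik; omega).lt_or_eq with hlt | heq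
        · rw [Function.update_of_ne hlt.ne, Function.update_of_ne (by omega)]
          exact hH i hi hlt
        · rw [heq, Function.update_self, Function.update_self, Function.update_of_ne (by omega)]
          have h3 : (C.d (j + 1) j).hom ∘ₗ K = π := LinearMap.ext fun x =>
            congrArg Subtype.val (LinearMap.congr_fun hK x)
          rw [h3]
          exact sub_add_cancel _ _
      · exact ⟨H, fun i hi hik => hH i hi (by omega)⟩
  obtain ⟨H, hH⟩ := key (m - N).toNat
  exact ⟨H, fun i hi => hH i hi (by omega)⟩

/-- The chain map with given components. -/
def homOf (g : GMap C D) (h : ∀ x, opd D (opg g x) = opg g (opd C x)) : C ⟶ D where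
  f i := ConcreteCategory.ofHom (C := ModuleCat A) (X := C.X i) (Y := D.X i) (g i)
  comm' i j hij := by
    refine ModuleCat.hom_ext (LinearMap.ext fun x => ?_)
    have h1 := h (DirectSum.of (fun i => C.X i) i x)
    rw [opg_of, opd_of j hij.symm, opd_of j hij.symm, opg_of] at h1
    exact DirectSum.of_injective (β := fun i => D.X i) j h1

theorem comps_homOf (g : GMap C D) (h : ∀ x, opd D (opg g x) = opg g (opd C x)) :
    comps (homOf g h) = g := rfl

/-- The chain homotopy with given components. -/
def htpyOf {f g : C ⟶ D} (a : HMap C D) (h : ∀ x, opd D (oph 1 a x) + oph 1 a (opd C x) =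
    opg (comps f) x - opg (comps g) x) : Homotopy f g where
  hom i j := if j = i + 1 then
    ConcreteCategory.ofHom (C := ModuleCat A) (X := C.X i) (Y := D.X j) (a i j) else 0
  zero i j hij := if_neg fun h => hij h.symm
  comm i := by
    rw [dNext_eq _ (show (ComplexShape.down ℤ).Rel i (i - 1) by simp),
      prevD_eq _ (show (ComplexShape.down ℤ).Rel (i + 1) i by simp), if_pos rfl,
      if_pos (by ring)]
    refine ModuleCat.hom_ext (LinearMap.ext fun x => ?_)
    have h1 := h (DirectSum.of (fun i => C.X i) i x)
    rw [opg_of, opg_of, opd_of (i - 1) (by ring), oph_of (i + 1) rfl, oph_of i (by ring),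
      opd_of i rfl, ← map_add, ← map_sub] at h1
    have h2 := DirectSum.of_injective _ h1
    change comps f i x = a (i - 1) i ((C.d i (i - 1)).hom x) + (D.d (i + 1) i).hom (a i (i + 1) x) +
      comps g i x
    rw [add_comm (a (i - 1) i _), h2]
    abel

variable (f : C ⟶ D)

/-- The graded projection `C(f)_i → D_i`. -/
def coneFst : GMap (cone f) D := fun i => LinearMap.fst A (D.X i) (C.X (i - 1))

/-- The projection `C(f)_i → C_{i-1}`. -/
def coneSnd : HMap (cone f) C := fun i j =>
  (idMap C (i - 1) j ∘ₗ LinearMap.snd A (D.X i) (C.X (i - 1)) : D.X i × C.X (i - 1) →ₗ[A] C.X j)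

theorem cone_induction {p : (DirectSum ℤ fun i => (cone f).X i) → Prop}
    (hI : ∀ x, p (oph 0 (coneI f) x)) (hR : ∀ x, p (oph 1 (coneR f) x))
    (hadd : ∀ x y, p x → p y → p (x + y)) (z) : p z := by
  induction z using DirectSum.induction_on with
  | zero => simpa using hI 0
  | add x y hx hy => exact hadd x y hx hy
  | of i z =>
    have h1 := hI (DirectSum.of (fun i => D.X i) i (LinearMap.fst A (D.X i) (C.X (i - 1)) z))
    have h2 := hR (DirectSum.of (fun i => C.X i) (i - 1)
      (LinearMap.snd A (D.X i) (C.X (i - 1)) z))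
    have h3 := hadd _ _ h1 h2
    rw [oph_of i (by ring), oph_of i (by ring), ← map_add, coneI_self, coneR_self] at h3
    convert h3 using 2
    exact Prod.ext (add_zero _).symm (zero_add _).symm

theorem coneFst_coneI (x) : opg (coneFst f) (oph 0 (coneI f) x) = x := by
  revert x; refine dsum_induct fun i x => ?_
  rw [oph_of i (by ring), opg_of, coneI_self]; rfl

theorem coneFst_coneR (x) : opg (coneFst f) (oph 1 (coneR f) x) = 0 := by
  revert x; refine dsum_induct fun i x => ?_
  rw [oph_of (i + 1) (by ring), opg_of]
  exact map_zero _

theorem coneSnd_coneI (x) : oph (-1) (coneSnd f) (oph 0 (coneI f) x) = 0 := by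
  revert x; refine dsum_induct fun i x => ?_
  rw [oph_of i (by ring), oph_of (i - 1) (by ring), coneI_self]
  refine (congrArg _ (?_ : _ = (0 : C.X (i - 1)))).trans (map_zero _)
  exact map_zero (idMap C (i - 1) (i - 1))

theorem coneSnd_coneR (x) : oph (-1) (coneSnd f) (oph 1 (coneR f) x) = x := by
  revert x; refine dsum_induct fun i x => ?_
  obtain ⟨i, rfl⟩ : ∃ k, i = k - 1 := ⟨i + 1, by ring⟩
  rw [oph_of i (by ring), oph_of (i - 1) (by ring), coneR_self]
  congr 1
  change idMap C (i - 1) (i - 1) x = x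
  rw [idMap_self]; rfl

theorem cone_decomp (z) : oph 0 (coneI f) (opg (coneFst f) z) +
    oph 1 (coneR f) (oph (-1) (coneSnd f) z) = z := by
  induction z using cone_induction f with
  | hI x => rw [coneFst_coneI, coneSnd_coneI, map_zero, add_zero]
  | hR x => rw [coneFst_coneR, coneSnd_coneR, map_zero, zero_add]
  | hadd x y hx hy => simp only [map_add]; nth_rw 3 [← hx]; nth_rw 3 [← hy]; abel

theorem opd_coneSnd (z) : opd C (oph (-1) (coneSnd f) z) =
    oph (-1) (coneSnd f) (opd (cone f) z) := by
  induction z using cone_induction f with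
  | hI x => rw [opd_coneI, coneSnd_coneI, coneSnd_coneI, map_zero]
  | hR x => rw [opd_coneR, map_add, coneSnd_coneI, coneSnd_coneR, coneSnd_coneR, add_zero]
  | hadd x y hx hy => simp only [map_add, hx, hy]

theorem opg_coneFst_opd (z) : opg (coneFst f) (opd (cone f) z) =
    opd D (opg (coneFst f) z) + opg (comps f) (eps (oph (-1) (coneSnd f) z)) := by
  induction z using cone_induction f with
  | hI x => rw [opd_coneI, coneFst_coneI, coneFst_coneI, coneSnd_coneI]; simp
  | hR x => rw [opd_coneR, map_add, coneFst_coneI, coneFst_coneR, coneFst_coneR, coneSnd_coneR]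
            simp
  | hadd x y hx hy => simp only [map_add, hx, hy]; abel

variable {f}

theorem QI.acyclic_cone (hf : QI f) : Acyclic (cone f) := fun z hz => by
  obtain ⟨w, hw⟩ := hf.inj (eps (oph (-1) (coneSnd f) z)) (-opg (coneFst f) z)
    (by rw [opd_eps, opd_coneSnd, hz]; simp)
    (by rw [map_neg, eq_neg_iff_add_eq_zero, add_comm, ← opg_coneFst_opd, hz, map_zero])
  obtain ⟨x, t, hx, ht⟩ := hf.surj (opg (coneFst f) z + opg (comps f) w) (by
    rw [map_add, ← opg_opd, ← hw, ← opg_coneFst_opd, hz, map_zero])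
  refine ⟨oph 1 (coneR f) (eps x - eps w) + oph 0 (coneI f) t, ?_⟩
  have h1 : oph (-1) (coneSnd f) z = opd C (-eps w) := by
    rw [map_neg, opd_eps, neg_neg, ← hw, eps_eps]
  conv_lhs => rw [← cone_decomp f z, eq_sub_of_add_eq ht, h1]
  rw [map_add, opd_coneR, opd_coneI]
  simp only [map_sub, map_add, map_neg, opd_eps, hx, eps_eps, map_zero]
  abel

theorem Acyclic.exists_contraction (h : Acyclic C) (hC : IsFinite C) :
    ∃ H : HMap C C, ∀ x, opd C (oph 1 H x) + oph 1 H (opd C x) = x := by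
  obtain ⟨N, hN⟩ := hC.2
  obtain ⟨H, hH⟩ := (h.exBelow (N + 1)).exists_contraction (fun i => (hC.1 i).2)
    (N := -N) (fun i hi => hN i (Or.inl hi))
  refine ⟨H, fun x => ?_⟩
  induction x using DirectSum.induction_on with
  | zero => simp
  | add x y hx hy => simp only [map_add]; nth_rw 3 [← hx]; nth_rw 3 [← hy]; abel
  | of i x =>
    by_cases hi : i < N + 1
    · rw [opd_of (i - 1) (by ring), oph_of (i + 1) rfl, oph_of i (by ring), opd_of i rfl, ← map_add]
      exact congrArg _ (LinearMap.congr_fun (hH i hi) x)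
    · have := hN i (Or.inr (by omega))
      rw [Subsingleton.elim x 0]
      simp

theorem IsFinite.cone (hC : IsFinite C) (hD : IsFinite D) (f : C ⟶ D) : IsFinite (cone f) := by
  obtain ⟨h1, N, hN⟩ := hC
  obtain ⟨h2, M, hM⟩ := hD
  refine ⟨fun i => ?_, max N M + 1, fun i hi => ?_⟩
  · have := (h1 (i - 1)).1; have := (h1 (i - 1)).2; have := (h2 i).1; have := (h2 i).2
    exact ⟨inferInstanceAs (Module.Finite A (D.X i × C.X (i - 1))),
      inferInstanceAs (Module.Projective A (D.X i × C.X (i - 1)))⟩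
  · have := hN (i - 1) (by omega)
    have := hM i (by omega)
    exact inferInstanceAs (Subsingleton (D.X i × C.X (i - 1)))

/-- A homology isomorphism of finite complexes is a chain equivalence. -/
theorem QI.isChainEquiv (hf : QI f) (hC : IsFinite C) (hD : IsFinite D) : IsChainEquiv f := by
  obtain ⟨H, hH⟩ := hf.acyclic_cone.exists_contraction (hC.cone hD f)
  let G : GMap D C := fun i => i.negOnePow • (coneSnd f (i + 1) i ∘ₗ H i (i + 1) ∘ₗ coneI f i i)
  let a : HMap D D := fun i j => coneFst f j ∘ₗ H i j ∘ₗ coneI f i i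
  let c : HMap C C := fun i j => coneSnd f (j + 1) j ∘ₗ H (i + 1) (j + 1) ∘ₗ coneR f i (i + 1)
  have hG : ∀ x, opg G x = oph (-1) (coneSnd f) (oph 1 H (oph 0 (coneI f) (eps x))) := fun x => by
    revert x; refine dsum_induct fun i x => ?_
    rw [opg_of, eps_of, map_usmul, map_usmul, map_usmul, oph_of i (by ring),
      oph_of (i + 1) rfl, oph_of i (by ring), ← map_usmul]
    rfl
  have ha : ∀ x, oph 1 a x = opg (coneFst f) (oph 1 H (oph 0 (coneI f) x)) := fun x => by
    revert x; refine dsum_induct fun i x => ?_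
    rw [oph_of (i + 1) rfl, oph_of i (by ring), oph_of (i + 1) rfl, opg_of]
    rfl
  have hc : ∀ x, oph 1 c x = oph (-1) (coneSnd f) (oph 1 H (oph 1 (coneR f) x)) := fun x => by
    revert x; refine dsum_induct fun i x => ?_
    rw [oph_of (i + 1) rfl, oph_of (i + 1) rfl, oph_of (i + 1 + 1) rfl, oph_of (i + 1) (by ring)]
    rfl
  have hH' := fun x => eq_sub_of_add_eq (hH x)
  have h1 : ∀ x, opd C (opg G x) = opg G (opd D x) := fun x => by
    rw [hG, hG, opd_coneSnd, hH', opd_coneI, map_sub, coneSnd_coneI, opd_eps]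
    simp
  have e1 : ∀ x, eps (oph (-1) (coneSnd f) (oph 1 H (oph 0 (coneI f) x))) = opg G x := fun x => by
    rw [hG, oph_eps 0, negOnePow_zero, one_smul, oph_eps, map_usmul, oph_eps]
    simp [negOnePow_neg, negOnePow_one]
  refine ⟨⟨f, homOf G h1, ?_, ?_⟩, rfl⟩
  · refine (htpyOf c fun x => ?_).symm
    rw [hc, hc, opd_coneSnd, hH', opd_coneR, opg_comps_id, opg_comps_comp, comps_homOf,
      AddMonoidHom.comp_apply, hG, ← opg_eps]
    simp only [map_sub, map_add, coneSnd_coneR]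
    abel
  · refine (htpyOf a fun x => ?_).symm
    have h3 := opg_coneFst_opd f (oph 1 H (oph 0 (coneI f) x))
    rw [hH', map_sub, coneFst_coneI, opd_coneI, e1] at h3
    rw [ha, ha, opg_comps_id, opg_comps_comp, comps_homOf, AddMonoidHom.comp_apply,
      ← add_sub_cancel_right (opd D _) (opg (comps f) (opg G x)), ← h3]
    abel

theorem isChainEquiv_iff (hC : IsFinite C) (hD : IsFinite D) : IsChainEquiv f ↔ QI f :=
  ⟨IsChainEquiv.qi, fun h => h.isChainEquiv hC hD⟩

end Graded

section DualQuasi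

variable {B C C' D E Y D' Y' : Cx A}

/-- The differential of `C^{n-*}` on the sum of the dual modules. -/
def opdn (n : ℤ) (C : Cx A) :
    (DirectSum ℤ fun i => Dual A (C.X i)) →+ DirectSum ℤ fun i => Dual A (C.X i) :=
  n.negOnePow • (opd' C).comp eps

theorem opdn_apply (n : ℤ) (x) : opdn n C x = n.negOnePow • opd' C (eps x) := rfl

theorem opdn_opdn (n : ℤ) (x) : opdn n C (opdn n C x) = 0 := by
  rw [opdn_apply, opdn_apply, map_usmul, map_usmul, opd'_eps, opd'_eps, map_neg,
    opd'_eps, opd'_opd']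
  simp

theorem opg'_opdn (n : ℤ) (f : C ⟶ D) (x) :
    opdn n C (opg' (comps f) x) = opg' (comps f) (opdn n D x) := by
  rw [opdn_apply, opdn_apply, map_usmul, opg'_opd', opg'_eps]

theorem opm_opdn {n : ℤ} {G : DMap C D} (hG : dmD G = 0) (x) :
    opd D (opm n G x) = opm n G (opdn n C x) := by
  rw [opd_opm_of_dmD hG, opdn_apply, opd'_eps, map_usmul, map_neg, opm_eps, smul_neg,
    usmul_usmul]

/-- The isomorphism of the sums of the modules `C^{n-r}` and of the modules `C^p`. -/
def und (n : ℤ) (C : Cx A) :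
    (DirectSum ℤ fun r => (nDual n C).X r) →+ DirectSum ℤ fun p => Dual A (C.X p) :=
  DirectSum.toAddMonoid fun r => DirectSum.of (fun p => Dual A (C.X p)) (n - r)

theorem nDual_induction {n : ℤ} {p : (DirectSum ℤ fun r => (nDual n C).X r) → Prop} (h0 : p 0)
    (hadd : ∀ x y, p x → p y → p (x + y))
    (hof : ∀ r (x : Dual A (C.X (n - r))), p (DirectSum.of (fun r => (nDual n C).X r) r x)) (x) :
    p x :=
  DirectSum.induction_on x h0 hof hadd

theorem und_of (n r : ℤ) (x : Dual A (C.X (n - r))) :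
    und n C (DirectSum.of (fun r => (nDual n C).X r) r x) =
      DirectSum.of (fun p => Dual A (C.X p)) (n - r) x :=
  DirectSum.toAddMonoid_of _ _ _

theorem und_bijective (n : ℤ) (C : Cx A) : Function.Bijective (und n C) := by
  have key : ∀ x r, (und n C x) (n - r) = x r := fun x r => by
    induction x using nDual_induction with
    | h0 => rw [map_zero]; rfl
    | hadd x y hx hy => rw [map_add, DirectSum.add_apply, DirectSum.add_apply, hx, hy]; rfl
    | hof i x =>
      rw [und_of]
      by_cases h : i = r
      · subst h
        rw [DirectSum.of_eq_same]
        exact (DirectSum.of_eq_same (β := fun r => (nDual n C).X r) _ _).symm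
      · rw [DirectSum.of_eq_of_ne _ _ _ (by omega)]
        exact (DirectSum.of_eq_of_ne (β := fun r => (nDual n C).X r) _ _ _ (Ne.symm h)).symm
  refine ⟨fun x y h => ?_, fun y => ?_⟩
  · refine DFinsupp.ext fun r => ?_
    rw [← key x r, ← key y r, h]
  · induction y using DirectSum.induction_on with
    | zero => exact ⟨0, map_zero _⟩
    | add x y hx hy =>
      obtain ⟨a, rfl⟩ := hx
      obtain ⟨b, rfl⟩ := hy
      exact ⟨a + b, map_add _ _ _⟩
    | of p y =>
      obtain ⟨r, rfl⟩ : ∃ r, p = n - r := ⟨n - p, by ring⟩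
      exact ⟨_, und_of n r y⟩

theorem opd_nDual_of (n r : ℤ) (x : Dual A (C.X (n - r))) :
    opd (nDual n C) (DirectSum.of (fun r => (nDual n C).X r) r x) =
      DirectSum.of (fun r => (nDual n C).X r) (r - 1)
        (r.negOnePow • dualMap (C.d (n - (r - 1)) (n - r)).hom x : Dual A (C.X (n - (r - 1)))) :=
  opd_of (r - 1) (by ring) _

theorem und_opd (n : ℤ) (x) : opdn n C (und n C x) = und n C (opd (nDual n C) x) := by
  induction x using nDual_induction with
  | h0 => simp
  | hadd x y hx hy => simp only [map_add, hx, hy]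
  | hof r x =>
    rw [opd_nDual_of, und_of, und_of, opdn_apply, eps_of, map_usmul,
      opd'_of (n - (r - 1)) (by ring), smul_smul, ← negOnePow_add,
      negOnePow_congr' (b := r) (n - r) (by ring), ← map_usmul]

theorem opg_dmHom {n : ℤ} {G : DMap C D} (hG : dmD G = 0) (x) :
    opg (comps (dmHom n G hG)) x = opm n G (und n C x) := by
  induction x using nDual_induction with
  | h0 => simp
  | hadd x y hx hy => simp only [map_add, hx, hy]
  | hof r x =>
    refine (opg_of (comps (dmHom n G hG)) r x).trans ?_
    rw [und_of, opm, hat_of r (by simp)]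
    rfl

theorem QIh.of_bijective {M N : Type*} [AddCommGroup M] [AddCommGroup N] {d : M →+ M} {d' : N →+ N}
    {f : M →+ N} (hf : Function.Bijective f) (cf : ∀ x, d' (f x) = f (d x)) : QIh d d' f where
  inj x z _ hz := by
    obtain ⟨w, rfl⟩ := hf.2 z
    exact ⟨w, hf.1 (by rw [hz, cf])⟩
  surj y hy := by
    obtain ⟨x, rfl⟩ := hf.2 y
    exact ⟨x, 0, hf.1 (by rw [← cf, hy, map_zero]), by simp⟩

/-- `G` induces isomorphisms from the homology of `C^{n-*}` to the homology of `D`. -/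
def DQI (n : ℤ) (G : DMap C D) : Prop := QIh (opdn n C) (opd D) (opm n G)

theorem qi_dmHom_iff {n : ℤ} {G : DMap C D} (hG : dmD G = 0) : QI (dmHom n G hG) ↔ DQI n G := by
  have h1 : opg (comps (dmHom n G hG)) = (opm n G).comp (und n C) :=
    AddMonoidHom.ext fun x => opg_dmHom hG x
  have h2 : QIh (opd (nDual n C)) (opdn n C) (und n C) :=
    QIh.of_bijective (und_bijective n C) (und_opd n)
  rw [QI, h1]
  exact ⟨fun h => QIh.of_comp_left h2 h (und_opd n) (opm_opdn hG),
    fun h => QIh.comp h2 h (und_opd n) (opm_opdn hG)⟩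

theorem subsingleton_dual {M : Type u} [AddCommGroup M] [Module A M] [Subsingleton M] :
    Subsingleton (Dual A M) :=
  ⟨fun f g => Dual.ext fun x => by rw [Subsingleton.elim x 0, map_zero, map_zero]⟩

theorem IsFinite.nDual (hC : IsFinite C) (n : ℤ) : IsFinite (nDual n C) := by
  obtain ⟨h1, N, hN⟩ := hC
  refine ⟨fun i => ?_, N + |n|, fun i hi => ?_⟩
  · have := (h1 (n - i)).1; have := (h1 (n - i)).2
    exact ⟨inferInstanceAs (Module.Finite A (Dual A (C.X (n - i)))),
      inferInstanceAs (Module.Projective A (Dual A (C.X (n - i))))⟩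
  · have h3 := le_abs_self n
    have h4 := neg_abs_le n
    have := hN (n - i) (by omega)
    exact subsingleton_dual

theorem IsFinite.finCx (h : IsFinite C) : FinCx C := ⟨fun i => (h.1 i).1, fun i => (h.1 i).2⟩

theorem isChainEquiv_dmHom_iff (hC : IsFinite C) (hD : IsFinite D) {n : ℤ} {G : DMap C D}
    (hG : dmD G = 0) : IsChainEquiv (dmHom n G hG) ↔ DQI n G :=
  (isChainEquiv_iff (hC.nDual n) hD).trans (qi_dmHom_iff hG)

theorem oph'_opdn {f g : C ⟶ D} (h : Homotopy f g) (n : ℤ) (x) :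
    opdn n C (-n.negOnePow • oph' 1 (hcomps h) (eps x)) +
      -n.negOnePow • oph' 1 (hcomps h) (eps (opdn n D x)) =
      opg' (comps f) x - opg' (comps g) x := by
  rw [← oph'_htpy h]
  simp only [opdn_apply, opd'_eps, oph'_eps, map_usmul, map_neg, smul_neg, Units.neg_smul,
    usmul_usmul, eps_eps, negOnePow_one, neg_neg, one_smul]

theorem IsChainEquiv.qih_opg' {f : C ⟶ D} (hf : IsChainEquiv f) (n : ℤ) :
    QIh (opdn n D) (opdn n C) (opg' (comps f)) := by
  obtain ⟨e, rfl⟩ := hf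
  have id' : ∀ {C : Cx A} (x), opg' (comps (𝟙 C)) x = x := fun {C} x => by
    revert x; refine dsum_induct fun i x => ?_
    rw [opg'_of]; rfl
  have comp' : ∀ {C D E : Cx A} (f : C ⟶ D) (g : D ⟶ E) (x), opg' (comps (f ≫ g)) x =
      opg' (comps f) (opg' (comps g) x) := fun f g x => opg'_comp _ _ x
  refine QIh.congr_htpy (l := opg' (comps e.inv))
    ((-n.negOnePow • oph' 1 (hcomps e.homotopyInvHomId.symm)).comp eps)
    ((-n.negOnePow • oph' 1 (hcomps e.homotopyHomInvId.symm)).comp eps)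
    (opg'_opdn n _) (fun x => ?_) fun x => ?_
  · refine (oph'_opdn e.homotopyInvHomId.symm n x).trans ?_
    rw [id', comp']
  · refine (oph'_opdn e.homotopyHomInvId.symm n x).trans ?_
    rw [id', comp']

theorem dmD_comp (b : D ⟶ D') (G : DMap C D) (a : C ⟶ C') :
    dmD (fun p q => comps b q ∘ₗ G p q ∘ₗ dualMap (comps a p)) =
      fun p q => comps b q ∘ₗ dmD G p q ∘ₗ dualMap (comps a p) := by
  refine dmap_ext fun m x => ?_
  rw [opm_dmD, opm_comp, opm_comp, opm_comp, opm_dmD, opg'_opd', ← opg_opd, ← opg_eps, ← map_add]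

theorem IsDeg.comp {n : ℤ} {G : DMap C D} (h : IsDeg n G) (b : GMap D D') (a : GMap C C') :
    IsDeg n (fun p q => b q ∘ₗ G p q ∘ₗ dualMap (a p)) := fun p q hpq => by
  change b q ∘ₗ G p q ∘ₗ dualMap (a p) = 0
  rw [h p q hpq]; simp

theorem dmD_comp_eq_zero {G : DMap C D} (hG : dmD G = 0) (b : D ⟶ D') (a : C ⟶ C') :
    dmD (fun p q => comps b q ∘ₗ G p q ∘ₗ dualMap (comps a p)) = 0 := by
  rw [dmD_comp, hG]
  refine dmap_ext fun m x => ?_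
  rw [opm_comp, opm_zero, opm_zero, map_zero]

theorem DQI.comp {n : ℤ} {G : DMap C D} (h : DQI n G) (hG : dmD G = 0) {b : D ⟶ D'} (hb : QI b)
    {a : C ⟶ C'} (ha : IsChainEquiv a) :
    DQI n (fun p q => comps b q ∘ₗ G p q ∘ₗ dualMap (comps a p)) := by
  have h1 : opm n (fun p q => comps b q ∘ₗ G p q ∘ₗ dualMap (comps a p)) =
      (opg (comps b)).comp ((opm n G).comp (opg' (comps a))) :=
    AddMonoidHom.ext fun x => opm_comp n _ _ _ x
  rw [DQI, h1]
  exact QIh.comp (QIh.comp (ha.qih_opg' n) h (opg'_opdn n a) (opm_opdn hG)) hb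
    (fun x => by rw [AddMonoidHom.comp_apply, opm_opdn hG, opg'_opdn]; rfl)
    (fun x => (opg_opd b x).symm)

theorem DQI.of_htpy {n : ℤ} {K G G' : DMap C D} (h : DQI n G)
    (hK : dmD K = G' - G) : DQI n G' := by
  refine QIh.of_htpy h (opm (n + 1) K) fun x => ?_
  have h1 := opm_dmD n K x
  rw [hK, opm_sub] at h1
  rw [h1, opdn_apply, opd'_eps, map_usmul, map_neg, opm_eps, smul_neg, smul_smul,
    ← negOnePow_add, negOnePow_congr (a := n + (n + 1)) (b := 1) (by omega)]
  simp

/-- The identity `C^p → C^{n-q}`, `p + q = n`. -/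
def idD (n : ℤ) (C : Cx A) : DMap C (nDual n C) := fun p q =>
  (dualMap (idMap C (n - q) p) : Dual A (C.X p) →ₗ[A] Dual A (C.X (n - q)))

theorem isDeg_idD (n : ℤ) (C : Cx A) : IsDeg n (idD n C) := fun p q h => by
  rw [idD, idMap, dif_neg (by omega)]
  exact dualMap_zero

theorem opm_idD_und (n : ℤ) (x) : opm n (idD n C) (und n C x) = x := by
  induction x using nDual_induction with
  | h0 => simp
  | hadd x y hx hy => simp only [map_add, hx, hy]
  | hof r x =>
    rw [und_of, opm, hat_of r (by simp), idD, idMap_self]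
    rfl

theorem dmD_idD (n : ℤ) (C : Cx A) : dmD (idD n C) = 0 := by
  refine opm_ext (m := n - 1) (fun p q h => ?_) (fun _ _ _ => rfl) fun x => ?_
  · rw [dmD, isDeg_idD n C _ _ (by omega), isDeg_idD n C _ _ (by omega)]
    simp
  · obtain ⟨y, rfl⟩ := (und_bijective n C).2 x
    have h1 := und_opd n y
    rw [opdn_apply, opd'_eps] at h1
    have h2 := congrArg (fun z => opm n (idD n C) z) h1
    simp only [map_usmul, map_neg, opm_eps, opm_idD_und] at h2
    rw [opm_dmD, sub_add_cancel, opm_idD_und, opm_zero, ← h2, smul_neg, usmul_usmul,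
      neg_add_cancel]

theorem dqi_idD (n : ℤ) (C : Cx A) : DQI n (idD n C) := by
  have h1 : Function.Bijective (opm n (idD n C)) := by
    refine ⟨fun x y h => ?_, fun y => ⟨_, opm_idD_und n y⟩⟩
    obtain ⟨x, rfl⟩ := (und_bijective n C).2 x
    obtain ⟨y, rfl⟩ := (und_bijective n C).2 y
    rw [opm_idD_und, opm_idD_und] at h
    rw [h]
  exact QIh.of_bijective h1 (opm_opdn (dmD_idD n C))

theorem dmT_dmD [FinCx C] (θ : DMap C D) : dmT (dmD θ) = dmD (dmT θ) := by
  funext p q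
  have h : adj ((D.d (p + 1) p).hom ∘ₗ θ q (p + 1)) =
      adj (θ q (p + 1)) ∘ₗ dualMap (D.d (p + 1) p).hom := rfl
  simp only [dmT, dmD, adj_add, adj_usmul, adj_comp_dualMap', h, smul_add,
    smul_comp, comp_smul, smul_smul, ← negOnePow_add]
  rw [add_comm]
  congr 2
  · exact negOnePow_congr' 0 (by ring)
  · exact negOnePow_congr' (-q) (by ring)

theorem dmD_dmT [FinCx C] {G : DMap C D} (h : dmD G = 0) : dmD (dmT G) = 0 := by
  rw [← dmT_dmD, h, dmT_zero]

theorem unev_bijective {M : Type u} [AddCommGroup M] [Module A M] [Module.Finite A M]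
    [Module.Projective A M] : Function.Bijective (unev : Dual A (Dual A M) →ₗ[A] M) :=
  ⟨fun x y h => by rw [← ev_unev x, h, ev_unev], fun x => ⟨ev x, unev_ev x⟩⟩

theorem dqi_dmT_idD [FinCx C] (n : ℤ) : DQI n (dmT (idD n C)) := by
  refine QIh.of_bijective ?_ (opm_opdn (dmD_dmT (dmD_idD n C)))
  have h1 : Function.Bijective ((opm n (dmT (idD n C))).comp (und n (nDual n C))) := by
    let b : ∀ r, (nDual n (nDual n C)).X r →+ C.X r := fun r =>
      ((dmT (idD n C) (n - r) r : Dual A (Dual A (C.X (n - (n - r)))) →ₗ[A] C.X r)).toAddMonoidHom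
    have hb : ∀ r, Function.Bijective (b r) := fun r => by
      have e1 : ((n - r) * r).negOnePow • (unev : Dual A (Dual A (C.X r)) →ₗ[A] C.X r) ∘ₗ
          dualMap (dualMap (idMap C (n - (n - r)) r)) = dmT (idD n C) (n - r) r := rfl
      have e2 : Function.Bijective (dualMap (dualMap (idMap C (n - (n - r)) r))) := by
        generalize hk : n - (n - r) = k
        obtain rfl : k = r := by omega
        rw [idMap_self, dualMap_id, dualMap_id]
        exact Function.bijective_id
      have e3 : Function.Bijective ((unev : Dual A (Dual A (C.X r)) →ₗ[A] C.X r) ∘ₗ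
          dualMap (dualMap (idMap C (n - (n - r)) r))) := unev_bijective.comp e2
      change Function.Bijective (dmT (idD n C) (n - r) r)
      rw [← e1]
      rcases sgn_cases ((n - r) * r) with h | h
      · rw [h, one_smul]; exact e3
      · rw [h, Units.neg_smul, one_smul]
        exact (Equiv.neg (C.X r)).bijective.comp e3
    have h2 : ∀ x, ((opm n (dmT (idD n C))).comp (und n (nDual n C))) x =
        DFinsupp.mapRange.addMonoidHom b x := fun x => by
      induction x using nDual_induction with
      | h0 => simp
      | hadd x y hx hy => rw [map_add, map_add, hx, hy]
      | hof r x =>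
        rw [AddMonoidHom.comp_apply, und_of, opm, hat_of r (by simp)]
        exact (DFinsupp.mapRange_single (f := fun r => b r) (hf := fun r => map_zero (b r))).symm
    have h3 : Function.Bijective (DFinsupp.mapRange.addMonoidHom b) :=
      ⟨(DFinsupp.mapRange_injective _ (fun r => map_zero (b r))).2 fun r => (hb r).1,
        (DFinsupp.mapRange_surjective _ (fun r => map_zero (b r))).2 fun r => (hb r).2⟩
    exact (congrArg Function.Bijective (funext h2 : ⇑((opm n (dmT (idD n C))).comp _) = _)).mpr h3
  exact (Function.Bijective.of_comp_iff _ (und_bijective n _)).1 h1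

theorem dmT_eq [FinCx C] {n : ℤ} {G : DMap C D} (hG : IsDeg n G) (h : dmD G = 0) :
    dmT G = fun p q => dmT (idD n C) p q ∘ₗ dualMap (comps (dmHom n G h) p) := by
  have h1 : G = fun p q => comps (dmHom n G h) q ∘ₗ idD n C p q := by
    funext p q
    by_cases hpq : p + q = n
    · obtain rfl : p = n - q := by omega
      rw [idD, idMap_self]; rfl
    · rw [hG p q hpq, isDeg_idD n C p q hpq, comp_zero]
  funext p q
  conv_lhs => rw [h1]
  simp only [dmT, adj_comp, smul_comp]

theorem DQI.dmT [FinCx C] {n : ℤ} {G : DMap C D} (hG : IsDeg n G) (h : dmD G = 0)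
    (he : IsChainEquiv (dmHom n G h)) : DQI n (dmT G) := by
  rw [dmT_eq hG h]
  have h1 : opm n (fun p q => APC.dmT (idD n C) p q ∘ₗ dualMap (comps (dmHom n G h) p) :
      DMap D C) = (opm n (APC.dmT (idD n C))).comp (opg' (comps (dmHom n G h))) :=
    AddMonoidHom.ext fun x => opm_comp_right n _ _ x
  rw [DQI, h1]
  exact QIh.comp (he.qih_opg' n) (dqi_dmT_idD n) (opg'_opdn n _)
    (opm_opdn (dmD_dmT (dmD_idD n C)))

end DualQuasi

section Fibers

variable {B C C' D E Y D' Y' : Cx A}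
  {e : HMap D Y} (he : IsChainH e)

/-- The projection `F(e)_i → Y_{i+1}`. -/
def fiberFst : HMap (fiberCx e he) Y := fun i j =>
  (idMap Y (i + 1) j ∘ₗ LinearMap.fst A (Y.X (i + 1)) (D.X i) : Y.X (i + 1) × D.X i →ₗ[A] Y.X j)

theorem fiber_induction {p : (DirectSum ℤ fun i => (fiberCx e he).X i) → Prop}
    (hJ : ∀ x, p (oph (-1) (fiberJ he) x)) (hS : ∀ x, p (oph 0 (fiberS he) x))
    (hadd : ∀ x y, p x → p y → p (x + y)) (z) : p z := by
  induction z using DirectSum.induction_on with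
  | zero => simpa using hJ 0
  | add x y hx hy => exact hadd x y hx hy
  | of i z =>
    have h1 := hJ (DirectSum.of (fun i => Y.X i) (i + 1) (LinearMap.fst A (Y.X (i + 1)) (D.X i) z))
    have h2 := hS (DirectSum.of (fun i => D.X i) i (LinearMap.snd A (Y.X (i + 1)) (D.X i) z))
    have h3 := hadd _ _ h1 h2
    rw [oph_of i (by ring), oph_of i (by ring), ← map_add, fiberJ_self, fiberS_self] at h3
    convert h3 using 2
    exact Prod.ext (add_zero _).symm (zero_add _).symm

theorem fiberFst_fiberJ (x) : oph 1 (fiberFst he) (oph (-1) (fiberJ he) x) = x := by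
  revert x; refine dsum_induct fun i x => ?_
  obtain ⟨i, rfl⟩ : ∃ k, i = k + 1 := ⟨i - 1, by ring⟩
  rw [oph_of i (by ring), oph_of (i + 1) (by ring), fiberJ_self]
  congr 1
  change idMap Y (i + 1) (i + 1) x = x
  rw [idMap_self]; rfl

theorem fiberFst_fiberS (x) : oph 1 (fiberFst he) (oph 0 (fiberS he) x) = 0 := by
  revert x; refine dsum_induct fun i x => ?_
  rw [oph_of i (by ring), oph_of (i + 1) (by ring), fiberS_self]
  refine (congrArg _ (?_ : _ = (0 : Y.X (i + 1)))).trans (map_zero _)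
  exact map_zero (idMap Y (i + 1) (i + 1))

theorem fiber_decomp (z) : oph (-1) (fiberJ he) (oph 1 (fiberFst he) z) +
    oph 0 (fiberS he) (opg (comps (fiberProj e he)) z) = z := by
  induction z using fiber_induction he with
  | hJ x => rw [fiberFst_fiberJ, opg_fiberProj_J, map_zero, add_zero]
  | hS x => rw [fiberFst_fiberS, opg_fiberProj_S, map_zero, zero_add]
  | hadd x y hx hy => simp only [map_add]; nth_rw 3 [← hx]; nth_rw 3 [← hy]; abel

theorem QI.fiberMap {he : IsChainH e} {e' : HMap D' Y'} {he' : IsChainH e'} {a : Y ⟶ Y'}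
    {b : D ⟶ D'} (hab : ∀ i, comps a i ∘ₗ e i i = e' i i ∘ₗ comps b i) (ha : QI a) (hb : QI b) :
    QI (fiberMap he he' a b hab) :=
  QIh.five (i := oph (-1) (fiberJ he)) (p := opg (comps (fiberProj e he)))
    (j := oph (-1) (fiberJ he')) (q := opg (comps (fiberProj e' he'))) ha hb
    (opd_fiberJ he) (fun x => (opg_opd _ x).symm) (opd_fiberJ he') (fun x => (opg_opd _ x).symm)
    (fun x => (opg_opd _ x).symm) (fun x => (opg_opd _ x).symm)
    opd_opd opd_opd
    (opg_fiberMap_J hab) (fun x => by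
      induction x using fiber_induction he with
      | hJ x => rw [opg_fiberMap_J, opg_fiberProj_J, opg_fiberProj_J, map_zero]
      | hS x => rw [opg_fiberMap_S, opg_fiberProj_S, opg_fiberProj_S]
      | hadd x y hx hy => simp only [map_add, hx, hy])
    (Function.LeftInverse.injective (fiberFst_fiberJ he))
    (Function.LeftInverse.injective (fiberFst_fiberJ he'))
    (Function.RightInverse.surjective (opg_fiberProj_S he))
    (Function.RightInverse.surjective (opg_fiberProj_S he'))
    (fun x hx => ⟨oph 1 (fiberFst he) x, by conv_lhs => rw [← fiber_decomp he x, hx, map_zero,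
      add_zero]⟩)
    (fun x hx => ⟨oph 1 (fiberFst he') x, by conv_lhs => rw [← fiber_decomp he' x, hx, map_zero,
      add_zero]⟩)
    (opg_fiberProj_J he')

theorem qi_retr : QI (retr he) where
  inj x z hx hz := by
    set a := opg (coneFst (fiberProj e he)) x with ha
    set w := oph (-1) (coneSnd (fiberProj e he)) x with hw
    set b := oph 1 (fiberFst he) w with hb
    set c := opg (comps (fiberProj e he)) w with hc
    have hxd : oph 0 (coneI (fiberProj e he)) a + oph 1 (coneR (fiberProj e he))
        (oph (-1) (fiberJ he) b + oph 0 (fiberS he) c) = x := by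
      rw [fiber_decomp, cone_decomp]
    have h1 : opd D a = -eps c := by
      have := opg_coneFst_opd (fiberProj e he) x
      rw [hx, map_zero, opg_eps] at this
      exact eq_neg_of_add_eq_zero_left this.symm
    have h2 : b = oph 0 e a - opd Y z := by
      rw [← hz, ← hxd]
      simp only [map_add, opg_retr_I, opg_retr_J, opg_retr_S]
      abel
    refine ⟨oph 1 (coneR (fiberProj e he)) (oph 0 (fiberS he) (eps a) - oph (-1) (fiberJ he) z), ?_⟩
    conv_lhs => rw [← hxd, h2]
    rw [opd_coneR]
    simp only [sign_simps, smul_simps, map_add, map_sub, opd_fiberS, opd_fiberJ, opd_eps, h1,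
      map_neg,
      eps_eps, opg_fiberProj_J, opg_fiberProj_S, oph_eps, opg_eps, map_zero]
    abel
  surj y hy := ⟨oph 1 (coneR (fiberProj e he)) (-oph (-1) (fiberJ he) y), 0, by
    rw [opd_coneR]
    simp only [map_neg, opd_fiberJ, hy, map_zero, opg_eps, opg_fiberProj_J, neg_zero, add_zero], by
    rw [map_neg, map_neg, opg_retr_J]; simp⟩

theorem coneSnd_coneMap {f : C ⟶ D} {f' : C' ⟶ D'} (g : C ⟶ C') (h : D ⟶ D')
    (k : Homotopy (g ≫ f') (f ≫ h)) (x) :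
    oph (-1) (coneSnd f') (opg (comps (coneMap g h k)) x) =
      opg (comps g) (oph (-1) (coneSnd f) x) := by
  revert x; refine dsum_induct fun i x => ?_
  rw [oph_of (i - 1) (by ring), opg_of, opg_of, oph_of (i - 1) (by ring)]
  congr 1
  change idMap C' (i - 1) (i - 1) (comps g (i - 1) (LinearMap.snd A (D.X i) (C.X (i - 1)) x)) =
    comps g (i - 1) (idMap C (i - 1) (i - 1) (LinearMap.snd A (D.X i) (C.X (i - 1)) x))
  rw [idMap_self, idMap_self]; rfl

theorem opg_coneMap_I {f : C ⟶ D} {f' : C' ⟶ D'} (g : C ⟶ C') (h : D ⟶ D')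
    (k : Homotopy (g ≫ f') (f ≫ h)) (x) : opg (comps (coneMap g h k)) (oph 0 (coneI f) x) =
      oph 0 (coneI f') (opg (comps h) x) := by
  revert x; refine dsum_induct fun i x => ?_
  rw [oph_of i (by ring), opg_of, opg_of, oph_of i (by ring), coneI_self, coneI_self]
  congr 1
  refine Prod.ext ?_ (map_zero (comps g (i - 1)))
  change comps h i x + i.negOnePow • hcomps k (i - 1) i 0 = comps h i x
  rw [map_zero, smul_zero, add_zero]

theorem opg_coneMap_R {f : C ⟶ D} {f' : C' ⟶ D'} (g : C ⟶ C') (h : D ⟶ D')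
    (k : Homotopy (g ≫ f') (f ≫ h)) (x) : opg (comps (coneMap g h k)) (oph 1 (coneR f) x) =
      oph 1 (coneR f') (opg (comps g) x) + eps (oph 0 (coneI f') (oph 1 (hcomps k) x)) := by
  revert x; refine dsum_induct fun i x => ?_
  obtain ⟨i, rfl⟩ : ∃ k, i = k - 1 := ⟨i + 1, by ring⟩
  rw [oph_of i (by ring), opg_of, opg_of, oph_of i (by ring), oph_of i (by ring),
    oph_of i (by ring), coneR_self, coneR_self, coneI_self, eps_of, ← map_usmul, ← map_add]
  congr 1
  refine Prod.ext ?_ ?_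
  · change comps h i 0 + i.negOnePow • hcomps k (i - 1) i x =
      0 + (i.negOnePow • LinearMap.inl A (D'.X i) (C'.X (i - 1)) (hcomps k (i - 1) i x)).1
    rw [map_zero, Prod.smul_fst]; rfl
  · change comps g (i - 1) x = comps g (i - 1) x +
      (i.negOnePow • LinearMap.inl A (D'.X i) (C'.X (i - 1)) (hcomps k (i - 1) i x)).2
    rw [Prod.smul_snd]
    change _ = _ + i.negOnePow • (0 : C'.X (i - 1))
    rw [smul_zero, add_zero]

theorem QI.coneMap {f : C ⟶ D} {f' : C' ⟶ D'} {g : C ⟶ C'} {h : D ⟶ D'}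
    (k : Homotopy (g ≫ f') (f ≫ h)) (hg : QI g) (hh : QI h) : QI (coneMap g h k) :=
  QIh.five (i := oph 0 (coneI f)) (p := oph (-1) (coneSnd f))
    (j := oph 0 (coneI f')) (q := oph (-1) (coneSnd f')) hh hg
    (opd_coneI f) (opd_coneSnd f) (opd_coneI f') (opd_coneSnd f')
    (fun x => (opg_opd _ x).symm) (fun x => (opg_opd _ x).symm)
    opd_opd opd_opd
    (opg_coneMap_I g h k) (coneSnd_coneMap g h k)
    (Function.LeftInverse.injective (coneFst_coneI f))
    (Function.LeftInverse.injective (coneFst_coneI f'))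
    (Function.RightInverse.surjective (coneSnd_coneR f))
    (Function.RightInverse.surjective (coneSnd_coneR f'))
    (fun x hx => ⟨opg (coneFst f) x, by conv_lhs => rw [← cone_decomp f x, hx, map_zero, add_zero]⟩)
    (fun x hx => ⟨opg (coneFst f') x, by conv_lhs => rw [← cone_decomp f' x, hx, map_zero,
      add_zero]⟩)
    (coneSnd_coneI f')

end Fibers

section Dimension

variable {B C C' D E Y D' Y' : Cx A}

theorem exBelow_iff {m : ℤ} : ExBelow m C ↔ ∀ i, i < m → ∀ x : C.X i,
    opd C (DirectSum.of (fun i => C.X i) i x) = 0 →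
      ∃ y, DirectSum.of (fun i => C.X i) i x = opd C y := by
  refine forall_congr' fun i => forall_congr' fun _ => forall_congr' fun x => ?_
  rw [opd_of (i - 1) (by ring)]
  refine imp_congr ⟨fun h => by rw [h, map_zero],
    fun h => DirectSum.of_injective (β := fun i => C.X i) (i - 1) (by rw [h, map_zero])⟩
    ⟨fun ⟨y, hy⟩ => ⟨DirectSum.of (fun i => C.X i) (i + 1) y, by rw [opd_of i rfl, hy]⟩,
      fun ⟨y, hy⟩ => ⟨y (i + 1), ?_⟩⟩
  rw [← opd_apply, ← hy, DirectSum.of_eq_same]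

theorem ExBelow.of_qi {m : ℤ} {f : C ⟶ D} (h : ExBelow m D) (hf : QI f) : ExBelow m C := by
  rw [exBelow_iff] at h ⊢
  intro i hi x hx
  obtain ⟨y, hy⟩ := h i hi (comps f i x) (by rw [← opg_of, ← opg_opd, hx, map_zero])
  exact hf.inj _ y hx (by rw [opg_of, hy])

theorem IsChainEquiv.symm {f : C ⟶ D} (hf : IsChainEquiv f) : ∃ g : D ⟶ C, IsChainEquiv g := by
  obtain ⟨e, _⟩ := hf
  exact ⟨e.inv, e.symm, rfl⟩

theorem ExBelow.of_equiv {m : ℤ} {f : C ⟶ D} (h : ExBelow m C) (hf : IsChainEquiv f) :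
    ExBelow m D := by
  obtain ⟨g, hg⟩ := hf.symm
  exact h.of_qi hg.qi

theorem IsDim.exBelow {n : ℤ} (h : IsDim n C) : ExBelow 0 C := by
  obtain ⟨_, P, _, h2, ⟨e⟩⟩ := h
  refine ExBelow.of_qi (D := P) (fun i hi x _ => ?_) (QI.of_htpyEquiv e)
  have := h2 i (Or.inl hi)
  exact ⟨0, Subsingleton.elim _ _⟩

theorem IsDim.of_equiv {n : ℤ} (h : IsDim n C) {f : C ⟶ D} (hf : IsChainEquiv f)
    (hD : IsFinite D) : IsDim n D := by
  obtain ⟨_, P, h1, h2, ⟨e⟩⟩ := h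
  obtain ⟨e', -⟩ := hf
  exact ⟨hD, P, h1, h2, ⟨e'.symm.trans e⟩⟩

theorem IsDim.of_equiv' {n : ℤ} (h : IsDim n D) {f : C ⟶ D} (hf : IsChainEquiv f)
    (hC : IsFinite C) : IsDim n C := by
  obtain ⟨g, hg⟩ := hf.symm
  exact h.of_equiv hg hC

/-- The map `C^{n-*} → D^{n-*}` induced by a chain map `f : D → C`. -/
theorem IsChainEquiv.nDual {f : D ⟶ C} (hf : IsChainEquiv f) (hC : IsFinite C) (hD : IsFinite D)
    (n : ℤ) : ∃ g : nDual n C ⟶ nDual n D, IsChainEquiv g := by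
  have h1 : QI (𝟙 (APC.nDual n D)) := QI.of_htpyEquiv (HomotopyEquiv.refl _)
  have h2 := (dqi_idD n D).comp (dmD_idD n D) h1 hf
  exact ⟨_, (isChainEquiv_dmHom_iff hC (hD.nDual n)
    (dmD_comp_eq_zero (dmD_idD n D) (𝟙 _) f)).2 h2⟩

theorem IsDim.nDual {n : ℤ} (h : IsDim n C) : IsDim n (nDual n C) := by
  obtain ⟨h0, P, h1, h2, ⟨e⟩⟩ := h
  obtain ⟨g, e', hg⟩ := IsChainEquiv.nDual (f := e.inv) ⟨e.symm, rfl⟩ h0 h1 n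
  refine ⟨h0.nDual n, _, h1.nDual n, fun i hi => ?_, ⟨e'⟩⟩
  have := h2 (n - i) (by omega)
  exact subsingleton_dual

/-- A finite complex which is exact in negative degrees is chain equivalent to its truncation. -/
theorem ExBelow.exists_truncation (h : ExBelow 0 C) (hC : IsFinite C) :
    ∃ (T : Cx A) (f : T ⟶ C), IsFinite T ∧ IsChainEquiv f ∧ (∀ i, i < 0 → Subsingleton (T.X i)) ∧
      ∀ i, Subsingleton (C.X i) → Subsingleton (T.X i) := by
  obtain ⟨N, hN⟩ := hC.2
  obtain ⟨H₀, hH₀⟩ := h.exists_contraction (fun i => (hC.1 i).2)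
    (N := -N) (fun i hi => hN i (Or.inl hi))
  let H : HMap C C := fun i j => if i < 0 then H₀ i j else 0
  let π : GMap C C := fun i => LinearMap.id - (C.d (i + 1) i).hom ∘ₗ H i (i + 1) -
    H (i - 1) i ∘ₗ (C.d i (i - 1)).hom
  let S : ∀ i, Submodule A (C.X i) := fun i => LinearMap.range (π i)
  have hπ : ∀ x, opg π x = x - opd C (oph 1 H x) - oph 1 H (opd C x) := fun x => by
    revert x; refine dsum_induct fun i x => ?_
    rw [opg_of, opd_of (i - 1) (by ring), oph_of (i + 1) rfl, oph_of i (by ring), opd_of i rfl,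
      ← map_sub, ← map_sub]
    rfl
  have hπd : ∀ x, opd C (opg π x) = opg π (opd C x) := fun x => by
    rw [hπ, hπ, map_sub, map_sub, opd_opd, opd_opd, map_zero]
    abel
  let p : C ⟶ C := homOf π hπd
  have hneg : ∀ i, i < 0 → π i = 0 := fun i hi => by
    have h1 := hH₀ i hi
    simp only [π, H, if_pos hi, if_pos (show i - 1 < 0 by omega)]
    rw [← h1]; abel
  have hidem : ∀ i, π i ∘ₗ π i = π i := fun i => by
    rcases lt_or_ge i 0 with hi | hi
    · rw [hneg i hi, comp_zero]
    have e1 : π i = LinearMap.id - H (i - 1) i ∘ₗ (C.d i (i - 1)).hom := by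
      simp only [π, H, if_neg (show ¬ i < 0 by omega), comp_zero, sub_zero]
    have e2 : (C.d i (i - 1)).hom ∘ₗ H (i - 1) i ∘ₗ (C.d i (i - 1)).hom = 
        if i - 1 < 0 then (C.d i (i - 1)).hom else 0 := by
      by_cases hi' : i - 1 < 0
      · have h1 := hH₀ (i - 1) hi'
        rw [sub_add_cancel] at h1
        simp only [H, if_pos hi']
        rw [← comp_assoc, eq_sub_of_add_eq h1, LinearMap.sub_comp, comp_assoc,
          d_comp_d_hom]
        simp
      · simp only [H, if_neg hi']; simp
    have e3 : H (i - 1) i ∘ₗ (C.d i (i - 1)).hom ∘ₗ H (i - 1) i ∘ₗ (C.d i (i - 1)).hom =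
        H (i - 1) i ∘ₗ (C.d i (i - 1)).hom := by
      rw [e2]
      by_cases hi' : i - 1 < 0
      · rw [if_pos hi']
      · simp only [H, if_neg hi']; simp
    rw [e1, LinearMap.sub_comp, LinearMap.id_comp, LinearMap.comp_sub, LinearMap.comp_id,
      comp_assoc, e3, sub_self, sub_zero]
  have hd : ∀ i j (x : C.X i), x ∈ S i → (C.d i j).hom x ∈ S j := by
    rintro i j _ ⟨y, rfl⟩
    have := congrArg ModuleCat.Hom.hom (p.comm i j)
    exact ⟨_, (LinearMap.congr_fun this y).symm⟩
  let T : Cx A :=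
    { X := fun i => ModuleCat.of A (S i)
      d := fun i j => ModuleCat.ofHom ((C.d i j).hom.restrict (hd i j))
      shape := fun i j hij => by
        refine ModuleCat.hom_ext (LinearMap.ext fun x => Subtype.ext ?_)
        change (C.d i j).hom x.1 = 0
        rw [C.shape i j hij]; rfl
      d_comp_d' := fun i j k _ _ => by
        refine ModuleCat.hom_ext (LinearMap.ext fun x => Subtype.ext ?_)
        exact LinearMap.congr_fun (d_comp_d_hom C i j k) x.1 }
  let f : T ⟶ C :=
    { f := fun i => ModuleCat.ofHom (S i).subtype
      comm' := fun _ _ _ => rfl }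
  let r : C ⟶ T :=
    { f := fun i => ModuleCat.ofHom (π i).rangeRestrict
      comm' := fun i j _ => by
        refine ModuleCat.hom_ext (LinearMap.ext fun x => Subtype.ext ?_)
        exact LinearMap.congr_fun (congrArg ModuleCat.Hom.hom (p.comm i j)) x }
  have hrf : f ≫ r = 𝟙 T := by
    refine hom_ext_comps fun i => LinearMap.ext fun x => Subtype.ext ?_
    obtain ⟨_, y, rfl⟩ := x
    exact LinearMap.congr_fun (hidem i) y
  have hfr : r ≫ f = p := hom_ext_comps fun i => rfl
  refine ⟨T, f, ⟨fun i => ?_, N, fun i hi => ?_⟩, ⟨⟨f, r, Homotopy.ofEq hrf, ?_⟩, rfl⟩,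
    fun i hi => ?_, fun i hi => ?_⟩
  · have := (hC.1 i).1
    have := (hC.1 i).2
    exact ⟨Module.Finite.of_surjective _ (π i).surjective_rangeRestrict,
      Module.Projective.of_split (S i).subtype (π i).rangeRestrict
        (congrArg ModuleCat.Hom.hom (congrArg (fun q => q.f i) hrf))⟩
  · have := hN i hi
    exact inferInstanceAs (Subsingleton (S i))
  · rw [hfr]
    refine (htpyOf H fun x => ?_).symm
    rw [comps_homOf, hπ, opg_comps_id]
    abel
  · refine ⟨fun x y => Subtype.ext ?_⟩
    obtain ⟨_, x, rfl⟩ := x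
    obtain ⟨_, y, rfl⟩ := y
    change π i x = π i y
    rw [hneg i hi]; rfl
  · exact inferInstanceAs (Subsingleton (S i))

/-- A finite complex `C` is `m`-dimensional if `C` and `C^{m-*}` are exact in negative degrees. -/
theorem IsDim.of_exBelow {m : ℤ} (hC : IsFinite C) (h : ExBelow 0 C)
    (h' : ExBelow 0 (APC.nDual m C)) : IsDim m C := by
  obtain ⟨T, f, hT, hf, hT0, -⟩ := h.exists_truncation hC
  obtain ⟨g, hg⟩ := hf.nDual hC hT m
  obtain ⟨T', f', hT', hf', hT'0, hT'1⟩ := (h'.of_equiv hg).exists_truncation (hT.nDual m)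
  have hz : ∀ i, m < i → Subsingleton (T'.X i) := fun i hi => by
    have := hT0 (m - i) (by omega)
    exact hT'1 i subsingleton_dual
  have := hT.finCx
  have hdd : IsChainEquiv (dmHom m (dmT (idD m T)) (dmD_dmT (dmD_idD m T))) :=
    (isChainEquiv_dmHom_iff (hT.nDual m) hT _).2 (dqi_dmT_idD m)
  obtain ⟨k, hk⟩ := hf'.nDual (hT.nDual m) hT' m
  obtain ⟨e1, -⟩ := hf
  obtain ⟨e2, -⟩ := hdd
  obtain ⟨e3, -⟩ := hk
  refine ⟨hC, APC.nDual m T', hT'.nDual m, fun i hi => ?_, ⟨(e1.symm.trans e2.symm).trans e3⟩⟩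
  have : Subsingleton (T'.X (m - i)) := by
    rcases hi with hi | hi
    · exact hz _ (by omega)
    · exact hT'0 _ (by omega)
  exact subsingleton_dual

end Dimension

section Duality

variable {B C C' D E Y D' Y' : Cx A}
  {e : HMap D Y} (he : IsChainH e)

theorem fiberFst_fiberJ' (y) : oph' (-1) (fiberJ he) (oph' 1 (fiberFst he) y) = y := by
  revert y; refine dsum_induct fun i x => ?_
  obtain ⟨i, rfl⟩ : ∃ k, i = k + 1 := ⟨i - 1, by ring⟩
  rw [oph'_of i (by ring), oph'_of (i + 1) (by ring), fiberJ_self]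
  congr 1
  refine Dual.ext fun z => ?_
  change x (idMap Y (i + 1) (i + 1) z) = x z
  rw [idMap_self]; rfl

theorem fiber_decomp' (x) : oph' 1 (fiberFst he) (oph' (-1) (fiberJ he) x) +
    opg' (comps (fiberProj e he)) (oph' 0 (fiberS he) x) = x := by
  induction x using DirectSum.induction_on with
  | zero => simp
  | add x y hx hy => simp only [map_add]; nth_rw 3 [← hx]; nth_rw 3 [← hy]; abel
  | of i x =>
    rw [oph'_of (i + 1) (by ring), oph'_of i (by ring), oph'_of i (by ring), opg'_of, ← map_add,
      fiberJ_self, fiberS_self]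
    congr 1
    refine Dual.ext fun z => ?_
    obtain ⟨y, z⟩ := z
    let x' : Dual A (Y.X (i + 1) × D.X i) := x
    change x' (LinearMap.inl A (Y.X (i + 1)) (D.X i) (idMap Y (i + 1) (i + 1) y)) +
      x' (LinearMap.inr A (Y.X (i + 1)) (D.X i) z) = x' ((y, z) : Y.X (i + 1) × D.X i)
    rw [idMap_self, ← map_add]
    exact congrArg x' (Prod.ext (add_zero _) (zero_add _))

theorem dmD_oneT [FinCx C] {n : ℤ} {ψ : Fam C} (h : IsQuadStructure n ψ) : dmD (oneT ψ 0) = 0 := by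
  have h1 := congrFun (dHyp_oneT (n := n) h.1) 0
  rw [h.2, oneT_zero, dHyp_eq, famD_eq] at h1
  have h2 : oneT ψ (0 - 1) = 0 := by rw [oneT_apply, if_neg (by norm_num)]
  have h3 : famT (oneT ψ) (0 - 1) = 0 := by rw [famT_oneT, h2]
  rw [h2, h3] at h1
  simpa using h1

theorem dHyp_zero_index {n : ℤ} {α : Fam D} (h : dHyp n α = 0) (s : ℤ) : dmD (α s) =
    (n + s).negOnePow • (α (s - 1) + s.negOnePow • famT α (s - 1)) := by
  have h1 := congrFun h s
  rw [dHyp_eq, famD_eq] at h1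
  rw [eq_neg_of_add_eq_zero_left h1, negOnePow_sub, negOnePow_one, mul_neg, mul_one,
    Units.neg_smul, neg_neg]

variable {n : ℤ} {θ : Fam Y} {α : Fam D} {E : DMap Y D} [FinCx D] [FinCx Y]

theorem opm_oneT_psiL (x) : opm (n - 1) (oneT (psiL he θ α E) 0) x =
    eps (oph (-1) (fiberJ he) (opm (n + 1) (θ 0) (oph' (-1) (fiberJ he) x))) -
      eps (oph (-1) (fiberJ he) (opm (n + 1) (famT θ 0) (oph' (-1) (fiberJ he) x))) +
      oph 0 (fiberS he) (opm n (α 0) (oph' 0 e (oph' (-1) (fiberJ he) x))) -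
      n.negOnePow • eps (oph (-1) (fiberJ he) (oph 0 e (opm n (famT α 0)
        (oph' 0 (fiberS he) x)))) +
      oph 0 (fiberS he) (opm (n - 1) (α (-1)) (oph' 0 (fiberS he) x)) +
      oph 0 (fiberS he) (opm (n - 1) (famT α (-1)) (oph' 0 (fiberS he) x)) -
      oph 0 (fiberS he) (opm n E (oph' (-1) (fiberJ he) x)) +
      n.negOnePow • eps (oph (-1) (fiberJ he) (opm n (dmT E) (oph' 0 (fiberS he) x))) := by
  have h1 : famT (Eterm he E) 0 = dmT (sand 0 (-1) (fiberS he) E (fiberJ he)) := by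
    rw [famT_eq, Eterm, if_pos rfl]
  have h2 : Eterm he E 0 = sand 0 (-1) (fiberS he) E (fiberJ he) := if_pos rfl
  rw [psiL, oneT_sub, Pi.sub_apply, opm_sub, opm_oneT, opm_oneT, if_pos rfl, if_pos rfl,
    opm_Lam _ _ _ _ _ _ (le_refl 0), opm_famT_Lam _ _ _ _ _ _ (le_refl 0), h1, h2, opm_sand,
    opm_dmT_sand_eo _ _ _ _ _ _ _ (by norm_num) (by norm_num)]
  have e1 : n - 1 + 1 + 1 = n + 1 := by ring
  have e2 : n - 1 - 0 - -1 = n := by ring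
  have e3 : n - 1 - -1 - 0 = n := by ring
  rw [e1, e2, e3, sub_add_cancel, negOnePow_sub, negOnePow_one, neg_zero, zero_sub,
    negOnePow_zero]
  simp only [one_smul, mul_neg, mul_one, Units.neg_smul]
  abel

theorem dmD_dmD (K : DMap C D) : dmD (dmD K) = 0 := by
  refine dmap_ext fun m x => ?_
  rw [opm_dmD, opm_dmD, opm_dmD, map_add, opd_opd, opd'_opd', map_zero, opd_eps, opm_zero]
  simp

theorem dmD_add (K K' : DMap C D) : dmD (K + K') = dmD K + dmD K' := by
  refine dmap_ext fun m x => ?_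
  simp only [opm_dmD, opm_add, map_add]
  abel

theorem dual_E_htpy {e : HMap D Y} (he : IsChainH e) (hα : dHyp n α = 0) :
    dmD (n.negOnePow • -fun p q => comps he.hom q ∘ₗ α 1 p q) =
      (fun p q => dgl e q ∘ₗ (α 0 p q - famT α 0 p q) : DMap D Y) := by
  refine dmap_ext fun m x => ?_
  have h1 := congrArg (fun f => opm m f x) (dHyp_zero_index hα 1)
  rw [show (1 : ℤ) - 1 = 0 by norm_num] at h1
  simp only [opm_add, opm_usmul, opm_dmD] at h1
  have h2 : opm m (fun p q => dgl e q ∘ₗ (α 0 p q - famT α 0 p q) : DMap D Y) x =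
      opg (dgl e) (opm m (α 0 - famT α 0) x) := opm_comp_left _ _ _ _
  rw [opm_dmD, h2, opm_usmul, opm_usmul, opm_neg, opm_neg,
    opm_comp_left, opm_comp_left, he.comps_hom, opm_sub]
  have h3 : ∀ y, opd Y (opg (dgl e) y) = opg (dgl e) (opd D y) := fun y =>
    (opg_opd he.hom y).symm
  have h4 := eq_sub_of_add_eq h1
  simp only [map_usmul, map_neg, h3, ← opg_eps]
  rw [h4]
  simp only [hom_simps, smul_smul, ← negOnePow_add, smul_neg, smul_sub, smul_add]
  rw [negOnePow_congr (a := n + (n + 1)) (b := 1) (by omega),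
    negOnePow_congr (a := n + (n + 1 + 1)) (b := 0) (by omega)]
  simp only [negOnePow_one, negOnePow_zero, Units.neg_smul, one_smul]
  abel

/-- The dual of `E`, up to homotopy. -/
def dualE (e : HMap D Y) (E : DMap Y D) (α : Fam D) : DMap D Y :=
  dmT E + fun p q => dgl e q ∘ₗ (α 0 p q - famT α 0 p q)

theorem opm_dualE (m : ℤ) (x) : opm m (dualE e E α) x = opm m (dmT E) x +
    oph 0 e (opm m (α 0) x - opm m (famT α 0) x) := by
  have h2 : opm m (fun p q => dgl e q ∘ₗ (α 0 p q - famT α 0 p q) : DMap D Y) x =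
      opg (dgl e) (opm m (α 0 - famT α 0) x) := opm_comp_left _ _ _ _
  rw [dualE, opm_add, h2, opm_sub, opg_dgl]

theorem dmD_dualE {e : HMap D Y} (he : IsChainH e) (hα : dHyp n α = 0) (dE : dmD E = 0) :
    dmD (dualE e E α) = 0 := by
  rw [dualE, dmD_add, ← dual_E_htpy he hα, dmD_dmD, dmD_dmT dE, add_zero]

theorem dqi_dualE {e : HMap D Y} (he : IsChainH e) (hα : dHyp n α = 0) (hE : IsDeg n E)
    (dE : dmD E = 0) (eqE : IsChainEquiv (dmHom n E dE)) : DQI n (dualE e E α) :=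
  (DQI.dmT hE dE eqE).of_htpy (by rw [dual_E_htpy he hα, dualE, add_sub_cancel_left])

theorem QIh.neg {M N : Type*} [AddCommGroup M] [AddCommGroup N] {d : M →+ M} {d' : N →+ N}
    {f : M →+ N} (h : QIh d d' f) : QIh d d' (-f) where
  inj x z hx hz := h.inj x (-z) hx (by rw [map_neg, ← hz]; simp)
  surj y hy := by
    obtain ⟨x, z, hx, rfl⟩ := h.surj y hy
    exact ⟨-x, z, by rw [map_neg, hx, neg_zero], by simp⟩

theorem opdn_eps (n : ℤ) (x) : opdn n C (eps x) = eps (opdn (n - 1) C x) := by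
  simp only [sign_simps, smul_simps, opdn_apply, map_usmul, opd'_eps, map_neg, eps_eps]

theorem qih_eps (n : ℤ) (C : Cx A) : QIh (opdn (n - 1) C) (opdn n C) eps :=
  QIh.of_bijective (Function.Involutive.bijective eps_eps) (opdn_eps n)

variable (hα : dHyp n α = 0) (hE : IsDeg n E) (dE : dmD E = 0)
  (eqE : IsChainEquiv (dmHom n E dE))

include hα hE eqE in
theorem dqi_psiL (h : IsQuadStructure (n - 1) (psiL he θ α E)) :
    DQI (n - 1) (oneT (psiL he θ α E) 0) := by
  set W : DMap (fiberCx e he) (fiberCx e he) := sand 0 0 (fiberS he) (α 0) (fiberS he) with hW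
  have hdα := fun x => congrArg (fun f => opm (n - 1) f x) (dHyp_zero_index hα 0)
  rw [show (0 : ℤ) - 1 = -1 by norm_num] at hdα
  simp only [opm_add, opm_usmul, opm_dmD, add_zero, sub_add_cancel, negOnePow_zero,
    one_smul] at hdα
  have hdW : ∀ x, opm (n - 1) (dmD W) x = n.negOnePow • (
      oph 0 (fiberS he) (opm (n - 1) (α (-1)) (oph' 0 (fiberS he) x)) +
      oph 0 (fiberS he) (opm (n - 1) (famT α (-1)) (oph' 0 (fiberS he) x)) +
      oph 0 (fiberS he) (opm n (α 0) (oph' 0 e (oph' (-1) (fiberJ he) x)))) -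
      eps (oph (-1) (fiberJ he) (oph 0 e (opm n (α 0) (oph' 0 (fiberS he) x)))) := fun x => by
    have h1 := eq_sub_of_add_eq (hdα (oph' 0 (fiberS he) x))
    rw [opm_dmD, sub_add_cancel, hW, opm_sand, opm_sand, sub_zero, sub_zero, opd_fiberS,
      opd'_fiberS, h1]
    simp only [hom_simps, opm_eps, oph_eps, eps_eps, smul_add, negOnePow_zero, one_smul]
    abel
  set Ψ : DMap (fiberCx e he) (fiberCx e he) := oneT (psiL he θ α E) 0 - n.negOnePow • dmD W
    with hΨ
  have hΨ' : ∀ x, opm (n - 1) Ψ x =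
      eps (oph (-1) (fiberJ he) (opm (n + 1) (θ 0) (oph' (-1) (fiberJ he) x))) -
      eps (oph (-1) (fiberJ he) (opm (n + 1) (famT θ 0) (oph' (-1) (fiberJ he) x))) -
      oph 0 (fiberS he) (opm n E (oph' (-1) (fiberJ he) x)) +
      n.negOnePow • eps (oph (-1) (fiberJ he) (opm n (dualE e E α) (oph' 0 (fiberS he) x))) := fun
        x => by
    rw [hΨ, opm_sub, opm_usmul, hdW, opm_oneT_psiL, opm_dualE]
    simp only [map_add, map_sub, smul_sub, usmul_usmul, smul_add]
    abel
  have hdΨ : dmD Ψ = 0 := by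
    refine dmap_ext fun m x => ?_
    rw [hΨ, opm_dmD, opm_sub, opm_sub, opm_usmul, opm_usmul, opm_dmD, opm_dmD]
    have h1 := congrArg (fun f => opm m f x) (dmD_oneT h)
    rw [opm_dmD, opm_zero] at h1
    simp only [hom_simps, opd_opd, opd'_opd', opd_eps, zero_add, add_zero]
    rw [opm_zero, ← h1]
    simp only [map_add, smul_neg]
    abel
  have key : DQI (n - 1) Ψ := by
    have h1 : QIh (opdn (n - 1) D) (opd Y) (-((opm n (dualE e E α)).comp eps)) :=
      QIh.neg (QIh.comp (qih_eps n D) (dqi_dualE he hα hE dE eqE)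
        (opdn_eps n) (opm_opdn (dmD_dualE he hα dE)))
    have h2 : QIh (opdn n Y) (opd D) (-(opm n E)) :=
      QIh.neg ((qi_dmHom_iff dE).1 eqE.qi)
    refine QIh.five (i := opg' (comps (fiberProj e he))) (p := oph' (-1) (fiberJ he))
      (j := oph (-1) (fiberJ he)) (q := opg (comps (fiberProj e he))) h1 h2
      (opg'_opdn _ _) (fun x => ?_) (opd_fiberJ he) (fun x => (opg_opd _ x).symm) (opm_opdn hdΨ)
      (fun x => ?_) (opdn_opdn _) opd_opd (fun x => ?_) (fun x => ?_)
      (Function.LeftInverse.injective (opg'_fiberProj_S he))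
      (Function.LeftInverse.injective (fiberFst_fiberJ he))
      (Function.RightInverse.surjective (fiberFst_fiberJ' he))
      (Function.RightInverse.surjective (opg_fiberProj_S he))
      (fun x hx => ⟨oph' 0 (fiberS he) x, by
        conv_lhs => rw [← fiber_decomp' he x, hx, map_zero, zero_add]⟩)
      (fun x hx => ⟨oph 1 (fiberFst he) x, by
        conv_lhs => rw [← fiber_decomp he x, hx, map_zero, add_zero]⟩)
      (opg_fiberProj_J he)
    · rw [opdn_apply, opdn_apply, map_usmul, opd'_fiberJ, oph'_eps, negOnePow_sub,
        negOnePow_neg]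
      simp
    · simp only [AddMonoidHom.neg_apply, AddMonoidHom.comp_apply, map_neg,
        opm_opdn (dmD_dualE he hα dE), opdn_eps]
    · rw [hΨ', opg'_fiberProj_J, opg'_fiberProj_S]
      simp only [hom_simps, sign_simps, smul_simps, sub_zero, zero_add, AddMonoidHom.neg_apply,
        AddMonoidHom.comp_apply, opm_eps, oph_eps]
    · rw [hΨ']
      simp only [hom_simps, opg_fiberProj_S, opg_eps, opg_fiberProj_J, smul_zero, sub_zero,
        add_zero, zero_sub, AddMonoidHom.neg_apply]
  refine key.of_htpy (K := n.negOnePow • W) ?_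
  rw [hΨ, sub_sub_cancel]
  refine dmap_ext fun m x => ?_
  simp only [opm_dmD, opm_usmul, map_usmul, smul_add]

end Duality

section PairDuality

variable {B C C' D E Y D' Y' : Cx A}

/-- The inclusion `D → C(f)` as a chain map. -/
def coneInlHom (f : C ⟶ D) : D ⟶ cone f :=
  homOf (coneInl f) fun x => by rw [opg_coneInl, opg_coneInl, opd_coneI]

theorem comps_coneInlHom (f : C ⟶ D) : comps (coneInlHom f) = coneInl f := rfl

/-- The morphisms of the duality map `D^{n-*} → C(f)`. -/
def dualDM (n : ℤ) (P : PairData A) : DMap P.D (cone P.f) := fun p q =>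
  coneI P.f q q ∘ₗ P.δφ 0 p q + (n - q).negOnePow •
    (coneR P.f (q - 1) q ∘ₗ oneT P.ψ 0 p (q - 1) ∘ₗ dualMap (comps P.f p))

theorem opm_dualDM (n : ℤ) (P : PairData A) (m : ℤ) (x) : opm m (dualDM n P) x =
    oph 0 (coneI P.f) (opm m (P.δφ 0) x) + n.negOnePow • eps (oph 1 (coneR P.f)
      (opm (m - 1) (oneT P.ψ 0) (opg' (comps P.f) x))) := by
  have h : dualDM n P = (fun p q => coneInl P.f q ∘ₗ P.δφ 0 p q) + n.negOnePow •
      sgn (sand 1 0 (coneR P.f) (fun p q => oneT P.ψ 0 p q ∘ₗ dualMap (comps P.f p))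
        (idMap P.D)) := by
    funext p q
    have h1 : ∀ k, k = p → (oneT P.ψ 0 k (q - 1) ∘ₗ dualMap (comps P.f k)) ∘ₗ
        dualMap (idMap P.D k p) = oneT P.ψ 0 p (q - 1) ∘ₗ dualMap (comps P.f p) := by
      rintro k rfl
      rw [idMap_self, dualMap_id, LinearMap.comp_id]
    simp only [dualDM, Pi.add_apply, Pi.smul_apply, sgn, sand, smul_smul, ← negOnePow_add,
      coneI_self]
    rw [h1 _ (sub_zero p), negOnePow_congr' (a := n - q) (b := n + q) (-q) (by ring)]
    rfl
  have hid : ∀ y, oph' 0 (idMap P.D) y = y := fun y => by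
    revert y; refine dsum_induct fun i y => ?_
    rw [oph'_of i (by ring), idMap_self, dualMap_id]; rfl
  rw [h, opm_add, opm_usmul, opm_sgn, opm_sand, opm_comp_left, opm_comp_right, opg_coneInl,
    hid, sub_zero]

theorem PairData.IsPair.isDeg_oneT {n : ℤ} {P : PairData A} (h : P.IsPair n) :
    IsDeg (n - 1) (oneT P.ψ 0) := fun p q hpq => h.quad.1.oneT 0 p q (Or.inr (by simpa using hpq))

theorem PairData.IsPair.isDeg_δφ {n : ℤ} {P : PairData A} (h : P.IsPair n) :
    IsDeg n (P.δφ 0) := fun p q hpq => h.sym_chain 0 p q (Or.inr (by simpa using hpq))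

theorem PairData.IsPair.isDeg_dualDM {n : ℤ} {P : PairData A} (h : P.IsPair n) :
    IsDeg n (dualDM n P) := fun p q hpq => by
  rw [dualDM, h.isDeg_δφ p q hpq, h.isDeg_oneT p (q - 1) (by omega)]
  simp

theorem PairData.IsPair.isDeg_evD {n : ℤ} {P : PairData A} (h : P.IsPair n) :
    IsDeg n P.evD := fun p q hpq => by
  rw [PairData.evD, h.isDeg_δφ p q hpq, h.isDeg_oneT (p - 1) q (by omega)]
  simp

theorem PairData.IsPair.cycle_zero {n : ℤ} {P : PairData A} (h : P.IsPair n) (x) :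
    opd P.D (opm n (P.δφ 0) x) + eps (opm n (P.δφ 0) (opd' P.D x)) =
      n.negOnePow • opg (comps P.f) (opm (n - 1) (oneT P.ψ 0) (opg' (comps P.f) x)) := by
  have h1 := congrArg (fun φ => opm (n - 1) φ x) (congrFun h.cycle 0)
  have h2 : P.δφ (0 - 1) = 0 := h.sym_chain.eq_zero (by norm_num)
  simp only [Pi.add_apply, Pi.smul_apply, opm_add, opm_usmul, opm_push, Pi.zero_apply,
    opm_zero, opm_dHyp, h2, famT_eq, dmT_zero, smul_zero, add_zero, sub_add_cancel] at h1
  rw [eq_neg_of_add_eq_zero_left h1, negOnePow_sub, negOnePow_one]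
  simp


theorem PairData.IsPair.dmD_δφ_one {n : ℤ} {P : PairData A} (h : P.IsPair n) :
    dmD (P.δφ 1) = (n + 1).negOnePow • (P.δφ 0 - famT P.δφ 0) := by
  have h1 := congrFun h.cycle 1
  refine dmap_ext fun m x => ?_
  have h2 := congrArg (fun φ => opm m φ x) h1
  simp only [Pi.add_apply, Pi.smul_apply, opm_add, opm_usmul, opm_push, Pi.zero_apply,
    opm_zero, opm_dHyp, oneT_apply, one_ne_zero, if_false, map_zero, smul_zero, add_zero,
    sub_self, add_sub_cancel_right, negOnePow_one, Units.neg_smul, one_smul] at h2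
  rw [opm_dmD, opm_usmul, opm_sub, eq_neg_of_add_eq_zero_left h2, negOnePow_add,
    negOnePow_one]
  simp only [sign_simps, smul_simps]
  abel

variable {n : ℤ} {P : PairData A}

theorem PairData.IsPair.finC (h : P.IsPair n) : FinCx P.C := h.dimC.finCx

theorem PairData.IsPair.finD (h : P.IsPair n) : FinCx P.D := h.dimD.finCx

theorem PairData.IsPair.dmD_dualDM (h : P.IsPair n) : dmD (dualDM n P) = 0 := by
  have := h.finC
  refine opm_ext (m := n - 1) (fun p q hpq => ?_) (fun _ _ _ => rfl) fun x => ?_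
  · rw [dmD, h.isDeg_dualDM _ _ (by omega), h.isDeg_dualDM _ _ (by omega)]
    simp
  · have h1 : ∀ y, opd P.C (opm (n - 1) (oneT P.ψ 0) y) +
        eps (opm (n - 1) (oneT P.ψ 0) (opd' P.C y)) = 0 := fun y => by
      have := opm_dmD (n - 1 - 1) (oneT P.ψ 0) y
      rw [dmD_oneT h.quad, opm_zero, sub_add_cancel] at this
      exact this.symm
    have h2 := h1 (opg' (comps P.f) x)
    have h3 := eq_neg_of_add_eq_zero_left h2
    have h4 := eq_sub_of_add_eq (h.cycle_zero x)
    rw [opm_dmD, opm_zero, sub_add_cancel, opm_dualDM, opm_dualDM, opg'_opd']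
    simp only [hom_simps, sign_simps, smul_simps, opd_eps, opd_coneI, opd_coneR, h3, h4, eps_eps,
      oph_eps, opg_eps]
    abel

theorem PairData.IsPair.dmD_evD (h : P.IsPair n) : dmD P.evD = 0 := by
  have := h.finC
  refine opm_ext (m := n - 1) (fun p q hpq => ?_) (fun _ _ _ => rfl) fun x => ?_
  · rw [dmD, h.isDeg_evD _ _ (by omega), h.isDeg_evD _ _ (by omega)]
    simp
  · have h1 : ∀ y, opd P.C (opm (n - 1) (oneT P.ψ 0) y) +
        eps (opm (n - 1) (oneT P.ψ 0) (opd' P.C y)) = 0 := fun y => by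
      have := opm_dmD (n - 1 - 1) (oneT P.ψ 0) y
      rw [dmD_oneT h.quad, opm_zero, sub_add_cancel] at this
      exact this.symm
    have h3 := eq_neg_of_add_eq_zero_left (h1 (oph' 1 (coneR P.f) x))
    have h4 := eq_sub_of_add_eq (h.cycle_zero (oph' 0 (coneI P.f) x))
    rw [opm_dmD, opm_zero, sub_add_cancel, opm_evD, opm_evD, opd'_coneI, opd'_coneR]
    simp only [hom_simps, ← opg_opd, h3, h4, opg_eps, opm_eps, eps_eps, negOnePow_sub,
      negOnePow_one, mul_neg, mul_one, Units.neg_smul]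
    abel

theorem PairData.IsPair.dmT_dualDM (h : P.IsPair n) :
    dmT (dualDM n P) = P.evD - fun p q => (P.δφ 0 p q - famT P.δφ 0 p q) ∘ₗ
      dualMap (coneInl P.f p) := by
  have := h.finC
  have := h.finD
  funext p q
  have e0 : famT (oneT P.ψ) 0 (p - 1) q = oneT P.ψ 0 (p - 1) q := by rw [famT_oneT]
  have e1 : ((p - 1) * q).negOnePow • adj (oneT P.ψ 0 q (p - 1)) = oneT P.ψ 0 (p - 1) q := by
    rw [← e0]; rfl
  have e2 : adj (oneT P.ψ 0 q (p - 1)) = ((p - 1) * q).negOnePow • oneT P.ψ 0 (p - 1) q := by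
    rw [← e1, usmul_usmul]
  rw [Pi.sub_apply, Pi.sub_apply, PairData.evD, coneDualFst_eq, coneDualSnd_eq, coneI_self]
  simp only [dmT, dualDM, adj_add, adj_usmul, famT]
  rw [adj_comp, adj_comp_dualMap, e2, coneI_self]
  by_cases hpq : p + q = n
  · subst hpq
    simp only [smul_add, comp_smul, smul_comp, smul_smul,
      ← negOnePow_add, LinearMap.sub_comp]
    rw [negOnePow_congr' (a := p * q + (p + q - p + (p - 1) * q)) (b := 0) (p * q) (by ring),
      negOnePow_zero, one_smul]
    simp only [coneInl]
    abel
  · rw [h.isDeg_oneT (p - 1) q (by omega)]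
    simp only [comp_zero, zero_comp, smul_zero, add_zero,
      LinearMap.sub_comp, smul_comp, coneInl]
    abel

theorem PairData.IsPair.evD_htpy (h : P.IsPair n) :
    dmD ((n + 1).negOnePow • fun p q => P.δφ 1 p q ∘ₗ dualMap (coneInl P.f p)) =
      P.evD - dmT (dualDM n P) := by
  rw [h.dmT_dualDM, sub_sub_cancel]
  refine dmap_ext fun m x => ?_
  have e1 : ∀ θ : DMap P.D P.D, opm m (fun p q => θ p q ∘ₗ dualMap (coneInl P.f p)) x =
      opm m θ (oph' 0 (coneI P.f) x) := fun θ => by rw [opm_comp_right, opg'_coneInl]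
  have e2 := e1 (P.δφ 0 - famT P.δφ 0)
  have e3 := congrArg (fun φ => opm m φ (oph' 0 (coneI P.f) x)) h.dmD_δφ_one
  simp only [opm_dmD, opm_usmul] at e3
  refine Eq.trans ?_ e2.symm
  rw [opm_dmD, opm_usmul, opm_usmul, opm_comp_right, opm_comp_right, opg'_coneInl,
    opg'_coneInl, opd'_coneI, map_usmul, map_usmul, ← smul_add, e3,
    usmul_usmul]

theorem PairData.IsPair.isPoincare_iff (h : P.IsPair n) :
    P.IsPoincare n ↔ IsChainEquiv (dmHom n (dualDM n P) h.dmD_dualDM) := by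
  have key : ∀ r, comps (dmHom n (dualDM n P) h.dmD_dualDM) r = P.dualityComp n r := fun r => by
    change dualDM n P (n - r) r = _
    rw [dualDM, PairData.dualityComp, coneI_self, coneR_self]
    exact LinearMap.ext fun x => (prod_mk_eq _ _ _).symm
  constructor
  · rintro ⟨-, e, he⟩
    exact ⟨e, hom_ext_comps fun r => (he r).trans (key r).symm⟩
  · rintro ⟨e, he⟩
    exact ⟨h, e, fun r => by rw [he]; exact key r⟩

theorem PairData.IsPoincare.eqv_evD (h : P.IsPoincare n) :
    IsChainEquiv (dmHom n P.evD h.toIsPair.dmD_evD) := by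
  have h' := h.toIsPair
  have := h'.finC
  have := h'.finD
  refine (isChainEquiv_dmHom_iff (h'.dimC.1.cone h'.dimD.1 P.f) h'.dimD.1 _).2 ?_
  exact (DQI.dmT h'.isDeg_dualDM h'.dmD_dualDM (h'.isPoincare_iff.1 h)).of_htpy h'.evD_htpy

variable {e : HMap D Y} (he : IsChainH e) {θ : Fam Y} {α : Fam D} {E : DMap Y D}
  [FinCx D] [FinCx Y]

theorem retr_dualDM (x) :
    opg (comps (retr he)) (opm n (dualDM n (fiberPair he θ α E)) x) = opm n (dualE e E α) x := by
  have h1 : (fiberPair he θ α E).δφ 0 = α 0 := by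
    change (if (0 : ℤ) < 0 then (0 : DMap D D) else α 0) = α 0
    exact if_neg (lt_irrefl _)
  rw [opm_dualDM, h1, opm_dualE]
  change opg _ (oph 0 (coneI (fiberProj e he)) _ + n.negOnePow • eps (oph 1
    (coneR (fiberProj e he)) (opm (n - 1) (oneT (psiL he θ α E) 0)
      (opg' (comps (fiberProj e he)) x)))) = _
  rw [opm_oneT_psiL, opg'_fiberProj_J, opg'_fiberProj_S]
  simp only [hom_simps, sign_simps, smul_simps, sub_zero, zero_add, opg_eps, opg_retr_I, oph_eps,
    opg_retr_S, opg_retr_J, eps_eps, smul_zero, add_zero, usmul_usmul]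
  abel

theorem dqi_dualDM (hα : dHyp n α = 0) (hE : IsDeg n E) (dE : dmD E = 0)
    (eqE : IsChainEquiv (dmHom n E dE)) (h : (fiberPair he θ α E).IsPair n) :
    DQI n (dualDM n (fiberPair he θ α E)) := by
  have h1 : opm n (dualE e E α) =
      (opg (comps (retr he))).comp (opm n (dualDM n (fiberPair he θ α E))) :=
    AddMonoidHom.ext fun x => (retr_dualDM he x).symm
  have h2 := dqi_dualE he hα hE dE eqE
  rw [DQI, h1] at h2
  exact QIh.of_comp_right (qi_retr he) h2 (opm_opdn h.dmD_dualDM) fun x => (opg_opd _ x).symm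

end PairDuality

section LData

variable {B C D Y : Cx A}

theorem IsFinite.fiberCx {e : HMap D Y} (he : IsChainH e) (hD : IsFinite D) (hY : IsFinite Y) :
    IsFinite (fiberCx e he) := by
  obtain ⟨h1, N, hN⟩ := hD
  obtain ⟨h2, M, hM⟩ := hY
  refine ⟨fun i => ?_, max N M + 1, fun i hi => ?_⟩
  · have := (h1 i).1; have := (h1 i).2; have := (h2 (i + 1)).1; have := (h2 (i + 1)).2
    exact ⟨inferInstanceAs (Module.Finite A (Y.X (i + 1) × D.X i)),
      inferInstanceAs (Module.Projective A (Y.X (i + 1) × D.X i))⟩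
  · have := hN i (by omega)
    have := hM (i + 1) (by omega)
    exact inferInstanceAs (Subsingleton (Y.X (i + 1) × D.X i))

/-- The quadratic structure on the homotopy fiber is a Poincaré structure. -/
theorem isQuadPoincare_psiL {n : ℤ} {e : HMap D Y} (he : IsChainH e) {φ θ : Fam Y} {α : Fam D}
    {E : DMap Y D} (hD : IsFinite D) (hY : IsFinite Y) (hF : ExBelow 0 (fiberCx e he))
    (hφ : IsSym n φ) (hθ : IsHyp (n + 1) θ) (hα : IsHyp n α) (hE : IsDeg n E) (dE : dmD E = 0)
    (eqE : IsChainEquiv (dmHom n E dE)) (hα' : dHyp n α = 0)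
    (h0 : φ 0 = fun p q => e q q ∘ₗ E p q) (hd : φ - push (dgl e) α = dHyp (n + 1) θ) :
    IsQuadPoincare (n - 1) (fiberCx e he) (psiL he θ α E) := by
  have := hD.finCx
  have := hY.finCx
  have hFin := IsFinite.fiberCx he hD hY
  have hq : IsQuadStructure (n - 1) (psiL he θ α E) :=
    ⟨isQuad_psiL he hθ hα hE, dQuad_psiL he hφ hθ hα hE dE hα' h0 hd⟩
  obtain ⟨e', he'⟩ := (isChainEquiv_dmHom_iff hFin hFin (dmD_oneT hq)).2
    (dqi_psiL he hα' hE dE eqE hq)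
  refine ⟨IsDim.of_exBelow hFin hF (hF.of_qi (QI.of_htpyEquiv e')), hq, e', fun r => ?_⟩
  rw [he']
  rfl

theorem LData.IsL.pair_isPoincare {n : ℤ} {β : Form B} {L : LData B} (h : L.IsL n β) :
    (L.pair n).IsPoincare n β := by
  have := h.dimD.finCx
  have := h.dimY.finCx
  refine ⟨h.pair_isPair.isPoincare_iff.2 ?_, h.pair_normal, h.pair_bundle_map⟩
  exact (isChainEquiv_dmHom_iff h.dimD.1 (h.dimF.1.cone h.dimD.1 _) _).2
    (dqi_dualDM L.he h.dα h.degE h.dE h.eqE h.pair_isPair)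

end LData

section Connected

variable {B C C' D E Y D' Y' : Cx A}

theorem exactAt_iff (C : Cx A) (i : ℤ) : C.ExactAt i ↔ ∀ x : C.X i,
    (C.d i (i - 1)).hom x = 0 → ∃ y : C.X (i + 1), x = (C.d (i + 1) i).hom y := by
  rw [HomologicalComplex.exactAt_iff' C (i + 1) i (i - 1) (by simp) (by simp),
    ShortComplex.moduleCat_exact_iff]
  exact forall_congr' fun x => imp_congr_right fun _ => exists_congr fun _ => eq_comm

theorem of_eq_opd {i j : ℤ} (h : j = i + 1) {x : C.X i} {y}
    (hy : DirectSum.of (fun i => C.X i) i x = opd C y) :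
    DirectSum.of (fun i => C.X i) i x = opd C (DirectSum.of (fun i => C.X i) j (y j)) := by
  subst h
  rw [opd_of i rfl, ← opd_apply, ← hy, DirectSum.of_eq_same]

/-- Surjectivity of the induced map of homology modules in degree `0`. -/
def SurjZero (f : C ⟶ D) : Prop := ∀ y : D.X 0, opd D (DirectSum.of (fun i => D.X i) 0 y) = 0 →
  ∃ a b, opd C a = 0 ∧ DirectSum.of (fun i => D.X i) 0 y = opg (comps f) a + opd D b

theorem of_cone (f : C ⟶ D) (i : ℤ) (y : D.X i) (z : C.X (i - 1)) :
    DirectSum.of (fun i => (cone f).X i) i ((y, z) : D.X i × C.X (i - 1)) =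
      oph 0 (coneI f) (DirectSum.of (fun i => D.X i) i y) +
        oph 1 (coneR f) (DirectSum.of (fun i => C.X i) (i - 1) z) := by
  rw [oph_of i (by ring), oph_of i (by ring), ← map_add, coneI_self, coneR_self]
  exact congrArg _ (Prod.ext (add_zero _).symm (zero_add _).symm)

theorem surjZero_of_exactAt {f : C ⟶ D} (h : (cone f).ExactAt 0) : SurjZero f := fun y hy => by
  have h0 : (D.d 0 (0 - 1)).hom y = 0 :=
    DirectSum.of_injective (β := fun i => D.X i) (0 - 1) (by rw [← opd_of _ (by ring), hy,
      map_zero])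
  obtain ⟨w, hw⟩ := (exactAt_iff _ _).1 h ((y, 0) : D.X 0 × C.X (0 - 1)) (by
    refine (cone_d f 0 (0 - 1) y 0).trans ?_
    rw [h0, map_zero, map_zero, smul_zero, add_zero]; rfl)
  have h1 : oph 0 (coneI f) (DirectSum.of (fun i => D.X i) 0 y) =
      opd (cone f) (DirectSum.of (fun i => (cone f).X i) (0 + 1) w) := by
    rw [opd_of 0 rfl, ← hw, of_cone]; simp
  refine ⟨eps (oph (-1) (coneSnd f) (DirectSum.of (fun i => (cone f).X i) (0 + 1) w)),
    opg (coneFst f) (DirectSum.of (fun i => (cone f).X i) (0 + 1) w), ?_, ?_⟩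
  · rw [opd_eps, opd_coneSnd, ← h1, coneSnd_coneI]; simp
  · rw [add_comm, ← opg_coneFst_opd, ← h1, coneFst_coneI]

theorem exists_d_of_eq_opd {i : ℤ} {x : C.X i} {w} (h : DirectSum.of (fun i => C.X i) i x = opd C
    w) :
    ∃ y : C.X (i + 1), x = (C.d (i + 1) i).hom y :=
  ⟨w (i + 1), DirectSum.of_injective (β := fun i => C.X i) i (by
    rw [← opd_of _ rfl]; exact of_eq_opd rfl h)⟩

theorem SurjZero.exactAt {f : C ⟶ D} (h : SurjZero f) (hC : ExBelow 0 C) :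
    (cone f).ExactAt 0 := by
  rw [exactAt_iff]
  rintro ⟨y, z⟩ hx
  have hx' : opd (cone f) (DirectSum.of (fun i => (cone f).X i) 0
      ((y, z) : D.X 0 × C.X (0 - 1))) = 0 :=
    (opd_of (0 - 1) (by ring) _).trans ((congrArg _ hx).trans (map_zero _))
  rw [of_cone] at hx'
  have h1 : opd C (DirectSum.of (fun i => C.X i) (0 - 1) z) = 0 := by
    have := congrArg (oph (-1) (coneSnd f)) hx'
    rwa [← opd_coneSnd, map_add, coneSnd_coneI, coneSnd_coneR, zero_add, map_zero] at this
  obtain ⟨w, hw⟩ := exBelow_iff.1 hC (0 - 1) (by norm_num) z h1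
  have hu := of_eq_opd (j := 0) (by norm_num) hw
  have h2 : eps (DirectSum.of (fun i => C.X i) 0 (w 0)) = DirectSum.of (fun i => C.X i) 0 (w 0) :=
    by
    rw [eps_of, negOnePow_zero, one_smul]
  have h3 := congrArg (opg (coneFst f)) hx'
  rw [opg_coneFst_opd, map_add, coneFst_coneI, coneFst_coneR, add_zero, map_add, coneSnd_coneI,
    coneSnd_coneR, map_zero, hu, ← h2, opd_eps, zero_add, map_neg, eps_eps, map_neg,
    opg_opd, ← sub_eq_add_neg, ← map_sub] at h3
  obtain ⟨a, b, ha, hb⟩ := h (y - comps f 0 (w 0)) (by rw [map_sub, ← opg_of]; exact h3)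
  rw [map_sub, ← opg_of, sub_eq_iff_eq_add] at hb
  refine exists_d_of_eq_opd (w := oph 1 (coneR f) (DirectSum.of (fun i => C.X i) 0 (w 0) + eps a) +
    oph 0 (coneI f) b) ((of_cone f 0 y z).trans ?_)
  rw [hb, hu, map_add (opd _), opd_coneR, opd_coneI, map_add (opd _), opd_eps, ha,
    map_add eps, eps_eps, h2, map_zero, neg_zero, add_zero]
  simp only [map_add]
  abel

variable {e : HMap D Y}

theorem exBelow_fiber (he : IsChainH e) (hD : ExBelow 0 D) (hY : ExBelow 0 Y)
    (h : SurjZero he.hom) : ExBelow 0 (fiberCx e he) := by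
  rw [exBelow_iff] at *
  intro i hi x hx
  set W := DirectSum.of (fun i => (fiberCx e he).X i) i x with hW
  obtain ⟨z', hz'⟩ : ∃ z' : D.X (i + 1), opg (comps (fiberProj e he)) W =
      opd D (DirectSum.of (fun i => D.X i) (i + 1) z') := by
    rw [hW, opg_of]
    obtain ⟨v, hv⟩ := hD i hi (comps (fiberProj e he) i x) (by
      rw [← opg_of, ← opg_opd, ← hW, hx, map_zero])
    exact ⟨_, of_eq_opd rfl hv⟩
  obtain ⟨y, hy⟩ : ∃ y : Y.X (i + 1), oph 1 (fiberFst he) W -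
      eps (oph 0 e (DirectSum.of (fun i => D.X i) (i + 1) z')) =
      DirectSum.of (fun i => Y.X i) (i + 1) y := by
    rw [hW, oph_of (i + 1) rfl, oph_of (i + 1) (by ring), eps_of, ← map_usmul, ← map_sub]
    exact ⟨_, rfl⟩
  set Z := DirectSum.of (fun i => D.X i) (i + 1) z'
  have hWy : W = opd _ (oph 0 (fiberS he) Z) +
      oph (-1) (fiberJ he) (DirectSum.of (fun i => Y.X i) (i + 1) y) := by
    conv_lhs => rw [← fiber_decomp he W, hz']
    rw [← hy, opd_fiberS, map_sub, oph_eps, negOnePow_neg, negOnePow_one,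
      Units.neg_smul, one_smul, sub_neg_eq_add, add_comm]
    abel
  have h1 : opd Y (DirectSum.of (fun i => Y.X i) (i + 1) y) = 0 := by
    have := congrArg (oph 1 (fiberFst he)) (congrArg (opd _) hWy)
    rwa [hx, map_add, opd_opd, zero_add, opd_fiberJ, fiberFst_fiberJ, map_zero, eq_comm] at this
  by_cases hi' : i + 1 < 0
  · obtain ⟨v, hv⟩ := hY (i + 1) hi' y h1
    exact ⟨oph 0 (fiberS he) Z + oph (-1) (fiberJ he) v, by rw [hWy, hv, map_add, opd_fiberJ]⟩
  · obtain ⟨a, b, ha, hb⟩ : ∃ a b, opd D a = 0 ∧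
        DirectSum.of (fun i => Y.X i) (i + 1) y = oph 0 e a + opd Y b := by
      obtain rfl : i = -1 := by omega
      obtain ⟨a, b, ha, hb⟩ := h y h1
      refine ⟨a, b, ha, hb.trans ?_⟩
      rw [IsChainH.comps_hom, opg_dgl]
    refine ⟨oph 0 (fiberS he) Z + oph 0 (fiberS he) (eps a) + oph (-1) (fiberJ he) b, ?_⟩
    rw [hWy, hb]
    have h2 : opd (fiberCx e he) (oph 0 (fiberS he) (eps a)) =
        oph (-1) (fiberJ he) (oph 0 e a) := by
      rw [opd_fiberS, opd_eps, ha, oph_eps, negOnePow_zero, one_smul, oph_eps]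
      simp [eps_eps]
    rw [map_add, map_add, map_add, h2, opd_fiberJ]
    abel

theorem isChainH_dmK {n : ℤ} {G : DMap C D} (hG : IsDeg n G) (dG : dmD G = 0) :
    IsChainH (dmK n G) where
  diag i j h := hG _ _ (by omega)
  comm := by
    rintro i j _ _ rfl rfl
    by_cases h : i = j + 1
    · have := (dmHom n G dG).comm i j
      exact congrArg ModuleCat.Hom.hom this
    · rw [(nDual n C).shape i j (by simpa using fun h' => h h'.symm), D.shape i j (by
        simpa using fun h' => h h'.symm), ModuleCat.hom_zero, ModuleCat.hom_zero,
        zero_comp, comp_zero]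

end Connected

section Boundary

variable {B : Cx A} {n : ℤ} {β : Form B}

theorem dmD_zero_of_sym {C : Cx A} {φ : Fam C} (h : IsSymStructure n φ) : dmD (φ 0) = 0 := by
  funext p q
  exact symStructure_comm h p (p + 1) q (q + 1) rfl rfl

theorem isDeg_zero_of_sym {C : Cx A} {φ : Fam C} (h : IsSym n φ) : IsDeg n (φ 0) :=
  fun p q hpq => h 0 p q (Or.inr (by omega))

/-- The lift `E = 1 : C^{n-*} → C^{n-*}` of the duality map of a connected normal complex. -/
def BNormalData.lift (n : ℤ) (X : BNormalData B) (h : IsSymStructure n X.φ) : LData B where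
  Y := X.C
  D := nDual n X.C
  e := dmK n (X.φ 0)
  he := isChainH_dmK (isDeg_zero_of_sym h.1) (dmD_zero_of_sym h)
  E := idD n X.C
  φ := X.φ
  θ := X.θ
  α := suspFam n X.γ
  ω := 0
  γ := X.γ
  g := X.g
  χ := X.χ

theorem pushDual_idD {C : Cx A} [FinCx C] (n : ℤ) (γ : Form C) :
    pushDual n (idD n C) γ = suspFam n γ := by
  rw [pushDual_eq, show dmG n (idD n C) = comps (𝟙 (nDual n C)) from ?_, push_id]
  funext r
  refine LinearMap.ext fun x => ?_
  change dualMap (idMap C (n - r) (n - r)) x = x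
  rw [idMap_self, dualMap_id]; rfl

theorem isChainEquiv_idD {C : Cx A} (hC : IsFinite C) (n : ℤ) :
    IsChainEquiv (dmHom n (idD n C) (dmD_idD n C)) :=
  (isChainEquiv_dmHom_iff hC (hC.nDual n) _).2 (dqi_idD n C)

theorem dmK_idD {C : Cx A} (n : ℤ) {G : DMap C C} (hG : IsDeg n G) :
    G = fun p q => dmK n G q q ∘ₗ idD n C p q := by
  funext p q
  by_cases h : p + q = n
  · obtain rfl : p = n - q := by omega
    change G _ q = G (n - q) q ∘ₗ dualMap (idMap C (n - q) (n - q))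
    rw [idMap_self, dualMap_id, LinearMap.comp_id]
  · rw [hG p q h, isDeg_idD n C p q h, comp_zero]

theorem isL_lift {X : BNormalData B} (hX : X.IsConnNormal n β) :
    (X.lift n hX.conn_normal.sym).IsL n β := by
  have hS := hX.conn_normal.sym
  have hd := hX.conn_normal.dim
  have := hd.finCx
  obtain ⟨hγ, hθ, hn⟩ := hX.conn_normal.normal
  have hα : IsHyp n (suspFam n X.γ) := isHyp_suspFam hγ.1 (by ring)
  have dα : dHyp n (suspFam n X.γ) = 0 := by
    rw [dHyp_suspFam, sub_self, hγ.2, suspFam_zero]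
  have hφ : X.φ 0 = fun p q => dmK n (X.φ 0) q q ∘ₗ idD n X.C p q :=
    dmK_idD n (isDeg_zero_of_sym hS.1)
  have he := isChainH_dmK (isDeg_zero_of_sym hS.1) (dmD_zero_of_sym hS)
  have hF : ExBelow 0 (fiberCx _ he) := exBelow_fiber _ hd.nDual.exBelow hd.exBelow
    (surjZero_of_exactAt hX.conn_normal.conn)
  exact {
    dimY := hd
    dimD := hd.nDual
    dimF := (isQuadPoincare_psiL he hd.nDual.1 hd.1 hF hS.1 hθ hα (isDeg_idD n _) (dmD_idD n _)
      (isChainEquiv_idD hd.1 n) dα hφ hn).1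
    degE := isDeg_idD n _
    dE := dmD_idD n _
    eqE := isChainEquiv_idD hd.1 n
    sym := hS
    φ0 := hφ
    hypα := hα
    dα := dα
    hypθ := hθ
    dθ := hn
    bundle := hγ
    hypω := IsHyp.zero
    dω := by
      change suspFam n X.γ - pushDual n (idD n X.C) X.γ = dHyp (n + 1) 0
      rw [pushDual_idD, sub_self, dHyp_zero]
    bundle_map := hX.bundle_map }

theorem bdryδφ_eq {C : Cx A} (n : ℤ) (γ : Form C) : bdryδφ n γ = ge0 (suspFam n γ) := by
  funext s
  by_cases hs : s < 0
  · rw [ge0, if_pos hs]; funext p q; exact if_pos hs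
  · rw [ge0, if_neg hs]; funext p q; exact if_neg hs

theorem sand_apply {C D C' D' : Cx A} {u v p q p' q' : ℤ} (hp : p = p' + v) (hq : q = q' + u)
    (a : HMap D D') (θ : DMap C D) (b : HMap C C') :
    sand u v a θ b p q = a q' q ∘ₗ θ p' q' ∘ₗ dualMap (b p' p) := by
  obtain rfl : p' = p - v := by omega
  obtain rfl : q' = q - u := by omega
  rfl

theorem isQuad_bdryψ {C : Cx A} {φ : Fam C} (h : IsSymStructure n φ) {γ : Form C}
    (hγ : IsForm 0 γ) {θ : Fam C} (hθ : IsHyp (n + 1) θ) : IsQuad (n - 1) (bdryψ h γ θ) := by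
  intro s p q hs
  by_cases hs' : s < 0
  · exact if_pos hs'
  have hs := hs.resolve_left hs'
  refine (if_neg hs').trans ?_
  rw [hθ _ _ _ (by omega), hγ _ _ _ (by omega), hγ _ _ _ (by omega)]
  refine LinearMap.ext fun x => Prod.ext ?_ ?_
  · simp; rfl
  · by_cases h0 : s = 0
    · have : dualMap (idMap C (n - q) (p + 1)) = 0 := by
        rw [idMap, dif_neg (by omega), dualMap_zero]
      simp [h0, this, transp_zero]; rfl
    · simp [h0, transp_zero]; rfl

theorem bdryψ_eq {C : Cx A} [FinCx C] {φ : Fam C} (h : IsSymStructure n φ) {γ : Form C}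
    (hγ : IsForm 0 γ) {θ : Fam C} (hθ : IsHyp (n + 1) θ) (he : IsChainH (dmK n (φ 0))) :
    bdryψ h γ θ = psiL he θ (suspFam n γ) (idD n C) := by
  funext s p q
  by_cases hs : ¬ (s < 0 ∨ p + q ≠ n - 1 - s)
  swap
  · rw [not_not] at hs
    rw [isQuad_bdryψ h hγ hθ s p q hs,
      isQuad_psiL he hθ (isHyp_suspFam hγ (by ring)) (isDeg_idD n C) s p q hs]
    rfl
  rw [not_or, not_not] at hs
  have hE : Eterm he (idD n C) s p q = LinearMap.inr A (C.X (q + 1)) (Dual A (C.X (n - q))) ∘ₗ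
      (if s = 0 then dualMap (idMap C (n - q) (p + 1)) else 0) ∘ₗ bdryDualFst h p := by
    by_cases h0 : s = 0
    · rw [Eterm, if_pos h0, if_pos h0, sand_apply (p' := p + 1) (q' := q) (by ring) (by ring),
        fiberJ_self, fiberS_self]; rfl
    · rw [Eterm, if_neg h0, if_neg h0]; rfl
  have h1 : (s.negOnePow * q.negOnePow) = (n + p + 1).negOnePow := by
    rw [← negOnePow_add]
    exact negOnePow_congr (by omega)
  have h2 : s.negOnePow * (n * (n - q)).negOnePow =
      ((n + 1) * s + n * (p + 1)).negOnePow := by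
    rw [← negOnePow_add]
    congr 1
    obtain rfl : q = n - 1 - s - p := by omega
    ring
  have h3 : n.negOnePow * ((n * (n - q)).negOnePow * ((n - p) * (n - q)).negOnePow) =
      (n + s * p).negOnePow := by
    rw [← negOnePow_add, ← negOnePow_add]
    obtain rfl : q = n - 1 - s - p := by omega
    rw [negOnePow_congr' (b := n + s * p + p * (p + 1)) (n * (p + s + 1) - p * (p + 1) - s * p)
      (by ring), negOnePow_add, negOnePow_even _ (Int.even_mul_succ_self p), mul_one]
  rw [psiL, Pi.sub_apply, Pi.sub_apply, Pi.sub_apply, hE, Lam, if_neg hs.1]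
  simp only [Pi.add_apply, Pi.smul_apply, one_smul, sgn]
  rw [sand_apply (p' := p + 1) (q' := q + 1) (by ring) (by ring),
    sand_apply (p' := p + 1) (q' := q) (by ring) (by ring),
    sand_apply (p' := p) (q' := q) (by ring) (by ring), fiberJ_self, fiberJ_self, fiberS_self,
    fiberS_self, ← famT_eq, famT_suspFam]
  refine (if_neg hs.1).trans (LinearMap.ext fun x => ?_)
  have h4 : suspFam n γ (-s) (p + 1) q =
      (n * (n - q)).negOnePow • (γ (-n - s) (n - (p + 1)) (n - q) ∘ₗ unev) := by
    rw [← show -s - n = -n - s by ring]; rfl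
  have h5 : suspFam n (formT γ) (-s - 1) p q = (n * (n - q)).negOnePow •
      ((n - p) * (n - q)).negOnePow • (transp (γ (-n - s - 1) (n - q) (n - p)) ∘ₗ unev) := by
    rw [← show -s - 1 - n = -n - s - 1 by ring]; rfl
  have h6 : fiberJE he (p + 1) p = LinearMap.inl A (C.X (p + 1)) (Dual A (C.X (n - p))) ∘ₗ
      φ 0 (n - (p + 1)) (p + 1) := by
    rw [fiberJE, fiberJ_self]; rfl
  rw [h6, Pi.smul_apply, Pi.smul_apply, Pi.smul_apply, h4, h5, ← h1, ← h2, ← h3]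
  simp only [mul_smul]
  refine Prod.ext ?_ ?_
  · change _ = s.negOnePow • q.negOnePow • θ (-s) (p + 1) (q + 1) (bdryDualFst h p x) +
      s.negOnePow • (0 : C.X (q + 1)) + 0 - 0
    rw [smul_zero, add_zero, add_zero, sub_zero]; rfl
  · set ι := (if s = 0 then dualMap (idMap C (n - q) (p + 1)) else 0 :
      Dual A (C.X (p + 1)) →ₗ[A] Dual A (C.X (n - q)))
    change s.negOnePow • (n * (n - q)).negOnePow • γ (-n - s) (n - (p + 1)) (n - q)
        (adj (φ 0 (n - (p + 1)) (p + 1)) (bdryDualFst h p x)) - ι (bdryDualFst h p x) +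
      n.negOnePow • (n * (n - q)).negOnePow • ((n - p) * (n - q)).negOnePow •
        transp (γ (-n - s - 1) (n - q) (n - p)) (bdryDualSnd h p x) =
      s.negOnePow • q.negOnePow • (0 : Dual A (C.X (n - q))) +
      s.negOnePow • (n * (n - q)).negOnePow • γ (-n - s) (n - (p + 1)) (n - q)
        (adj (φ 0 (n - (p + 1)) (p + 1)) (bdryDualFst h p x)) +
      n.negOnePow • (n * (n - q)).negOnePow • ((n - p) * (n - q)).negOnePow •
        transp (γ (-n - s - 1) (n - q) (n - p)) (bdryDualSnd h p x) - ι (bdryDualFst h p x)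
    rw [smul_zero, smul_zero, zero_add]
    abel

theorem bdryPair_eq {X : BNormalData B} (hX : X.IsConnNormal n β) :
    X.bdryPair hX.conn_normal.sym =
      ((X.lift n hX.conn_normal.sym).pair n).toPairData := by
  have := hX.conn_normal.dim.finCx
  have h1 := bdryδφ_eq n X.γ
  have h2 := bdryψ_eq hX.conn_normal.sym hX.conn_normal.normal.1.1 hX.conn_normal.normal.2.1
    (isChainH_dmK (isDeg_zero_of_sym hX.conn_normal.sym.1) (dmD_zero_of_sym hX.conn_normal.sym))
  refine (congrArg₂ (fun a b => PairData.mk (bdryCx hX.conn_normal.sym) (nDual n X.C)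
    (bdryProj hX.conn_normal.sym) a b) h1 h2).trans rfl

/-- A normal complex is a `(B, β)`-normal complex for `B` its underlying chain bundle. -/
def NormalData.toSelf (X : NormalData A) : BNormalData X.C where
  toNormalData := X
  g := 𝟙 X.C
  χ := 0

theorem isConnNormal_toSelf {X : NormalData A} (hX : X.IsConnNormal n) :
    X.toSelf.IsConnNormal n X.γ where
  conn_normal := hX
  bundle_map := ⟨IsForm.zero, by
    change dForm 1 0 = pull (comps (𝟙 X.C)) X.γ - X.γ
    rw [pull_id, sub_self, dForm_zero]⟩

theorem bdryPair_isPoincare {X : NormalData A} (hX : X.IsConnNormal n) :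
    (X.bdryPair hX.sym).IsPoincare n := by
  have h := bdryPair_eq (isConnNormal_toSelf hX)
  exact (show X.bdryPair hX.sym = _ from h) ▸
    (isL_lift (isConnNormal_toSelf hX)).pair_isPoincare.poincare

theorem isQuadPoincare_bdryψ {X : NormalData A} (hX : X.IsConnNormal n) :
    IsQuadPoincare (n - 1) (bdryCx hX.sym) (bdryψ hX.sym X.γ X.θ) := by
  have h := isL_lift (isConnNormal_toSelf hX)
  have := hX.dim.finCx
  rw [bdryψ_eq hX.sym hX.normal.1.1 hX.normal.2.1
    (isChainH_dmK (isDeg_zero_of_sym hX.sym.1) (dmD_zero_of_sym hX.sym))]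
  exact isQuadPoincare_psiL _ h.dimD.1 h.dimY.1 h.dimF.exBelow h.sym.1 h.hypθ h.hypα h.degE h.dE
    h.eqE h.dα h.φ0 h.dθ

end Boundary

section Thom

variable {B C D E : Cx A} {n : ℤ}

theorem hcomps_htpyOf {f g : C ⟶ D} {a : HMap C D}
    {h : ∀ x, opd D (oph 1 a x) + oph 1 a (opd C x) = opg (comps f) x - opg (comps g) x}
    (ha : ∀ i j, j ≠ i + 1 → a i j = 0) : hcomps (htpyOf a h) = a := by
  funext i j
  by_cases hj : j = i + 1
  · simp only [hcomps, htpyOf, if_pos hj]; rfl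
  · simp only [hcomps, htpyOf, if_neg hj]; rw [ha i j hj]; rfl

theorem opg_zero' (x) : opg (comps (0 : C ⟶ D)) x = 0 := by
  induction x using DirectSum.induction_on with
  | zero => exact map_zero _
  | of i x => rw [opg_of]; exact map_zero _
  | add x y hx hy => rw [map_add, hx, hy, add_zero]

/-- The null-homotopy of `C → D → C(f)`. -/
def nullHtpy (f : C ⟶ D) : Homotopy (0 : C ⟶ cone f) (f ≫ coneInlHom f) :=
  htpyOf (coneNull f) fun x => by
    rw [oph_coneNull, oph_coneNull, opd_eps, opd_coneR, opg_zero', opg_comps_comp,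
      AddMonoidHom.comp_apply, comps_coneInlHom, opg_coneInl, opg_eps, oph_eps, map_add eps]
    simp [eps_eps]

theorem hcomps_nullHtpy (f : C ⟶ D) : hcomps (nullHtpy f) = coneNull f :=
  hcomps_htpyOf fun i j hj => by
    rw [coneNull, idMap, dif_neg (by omega), comp_zero, smul_zero]; rfl

theorem isChainH_coneI (f : C ⟶ D) : IsChainH (coneI f) where
  diag i j h := by rw [coneI, idMap, dif_neg h, comp_zero]; rfl
  comm := by
    rintro i j _ _ rfl rfl
    rw [coneI_self, coneI_self]
    exact congrArg ModuleCat.Hom.hom ((coneInlHom f).comm i j)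

theorem dgl_coneI (f : C ⟶ D) : dgl (coneI f) = coneInl f := by
  funext i; exact coneI_self f i

theorem comps_zero : comps (0 : C ⟶ D) = 0 := rfl

theorem comps_comp_coneInl (f : C ⟶ D) :
    comps (f ≫ coneInlHom f) = fun i => coneInl f i ∘ₗ comps f i := rfl

theorem push_zero_left (θ : Fam C) : push (0 : GMap C D) θ = 0 := by
  funext s p q
  exact zero_comp _

variable {P : PairData A}

theorem isSym_thomφ (hδ : IsSym n P.δφ) (hψ : IsQuad (n - 1) P.ψ) : IsSym n (P.thomφ n) := by
  have ho := hψ.oneT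
  intro s p q hs
  by_cases h0 : s = 0
  · subst h0
    rw [thomφ_zero_apply, hδ 0 p q hs, ho 0 p (q - 1) (Or.inr (by omega)), zero_comp,
      zero_comp, comp_zero, comp_zero, smul_zero, add_zero]
  · by_cases h1 : s = 1
    · subst h1
      rw [thomφ_one_apply, hδ 1 p q hs, ho 0 (p - 1) (q - 1) (Or.inr (by omega)),
        zero_comp, zero_comp, comp_zero, comp_zero,
        smul_zero, add_zero]
    · rw [thomφ_apply n P h0 h1, hδ s p q hs, zero_comp, comp_zero]

theorem thomφ_eq [FinCx P.C] (hδ : IsSym n P.δφ) (hψ : IsQuad (n - 1) P.ψ) :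
    P.thomφ n = push (coneInl P.f) P.δφ + n.negOnePow • pushHtpy (n - 1) (coneNull P.f)
      (fun i => coneInl P.f i ∘ₗ comps P.f i) 0 (oneT P.ψ) := by
  refine fam_ext (isSym_thomφ hδ hψ).isHyp ((hδ.isHyp.push _).add
    ((hψ.oneT.isHyp.pushHtpy (by ring) _ _ _).units_smul _)) fun s x => ?_
  have h0 : ∀ x, opg (fun i => coneInl P.f i ∘ₗ comps P.f i) x =
      opg (coneInl P.f) (opg (comps P.f) x) := fun x => by
    rw [← comps_comp_coneInl, opg_comps_comp]; rfl
  have h0' : ∀ x, opg' (fun i => coneInl P.f i ∘ₗ comps P.f i) x =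
      opg' (comps P.f) (opg' (coneInl P.f) x) := fun x => (opg'_comp _ _ x)
  have hz : ∀ x, opg (0 : GMap P.C (cone P.f)) x = 0 := fun x => opg_zero' x
  rw [Pi.add_apply, opm_add, opm_push, Pi.smul_apply, opm_usmul, opm_pushHtpy, famT_oneT,
    h0', hz, map_zero, add_zero, opg_coneInl, opg'_coneInl, sub_add_cancel]
  by_cases hs : s = 0
  · subst hs
    have : oneT P.ψ (0 - 1) = 0 := by rw [oneT_apply, if_neg (by omega)]
    rw [opm_thomφ_zero, this, opm_zero, map_zero, map_zero, smul_zero, add_zero, add_zero,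
      oph_coneNull]
  · have h1 : oneT P.ψ s = 0 := by rw [oneT_apply, if_neg hs]
    rw [h1, opm_zero, map_zero, zero_add]
    by_cases hs1 : s = 1
    · subst hs1
      rw [opm_thomφ_one, oph_coneNull, oph'_coneNull, oph'_eps, map_usmul, opm_eps,
        show n + 1 - 1 - 1 = n + 1 - 2 by ring, show (1 : ℤ) - 1 = 0 by ring]
      simp only [map_usmul, oph_eps, eps_eps]
      rw [show (n + 1 - 2).negOnePow = (n + 1).negOnePow from negOnePow_congr (by omega)]
      rcases sgn_cases n with hn | hn <;>
        simp [negOnePow_add, hn]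
    · have h2 : oneT P.ψ (s - 1) = 0 := by rw [oneT_apply, if_neg (by omega)]
      rw [opm_thomφ n P hs hs1, h2, opm_zero]
      simp

variable (h : P.IsPair n)

theorem PairData.IsPair.isSymStructure_thomφ (h : P.IsPair n) : IsSymStructure n (P.thomφ n) := by
  have := h.finC
  have := h.finD
  refine ⟨isSym_thomφ h.sym_chain h.quad.1, ?_⟩
  have h1 := dHyp_pushHtpy (nullHtpy P.f) h.quad.1.oneT.isHyp
  rw [hcomps_nullHtpy, comps_comp_coneInl, comps_zero, dHyp_oneT h.quad.1, h.quad.2, oneT_zero,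
    pushHtpy_zero, add_zero, sub_add_cancel] at h1
  have h2 := congrArg (push (comps (coneInlHom P.f))) h.cycle
  rw [push_add, push_usmul, ← push_comps_comp, push_zero, comps_comp_coneInl,
    ← dHyp_push (m := n) _ h.sym_chain.isHyp] at h2
  rw [thomφ_eq h.sym_chain h.quad.1, dHyp_add, dHyp_usmul, h1, ← comps_coneInlHom,
    eq_neg_of_add_eq_zero_left h2, push_zero_left, negOnePow_sub, negOnePow_one]
  simp only [mul_neg, mul_one, Units.neg_smul, neg_neg, zero_sub, smul_neg]
  exact add_neg_cancel _

theorem PairData.IsPair.isHyp_α (h : P.IsPair n) : IsHyp n P.α :=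
  h.sym_chain.isHyp.add ((h.quad.1.hyp (by ring)).push _)

theorem PairData.IsPair.dHyp_α (h : P.IsPair n) : dHyp n P.α = 0 := by
  have := h.finC
  have := h.finD
  rw [PairData.α, dHyp_add, dHyp_push _ (h.quad.1.hyp (m := n) (by ring)),
    dHyp_hyp (by ring) h.quad.1, h.quad.2, hyp_zero, zero_add, push_usmul]
  exact h.cycle

/-- The equivalence from `e α e^*` to the symmetric structure of the mapping cone. -/
def PairData.nullθ (n : ℤ) (P : PairData A) : Fam (cone P.f) :=
  pushHtpy n (coneNull P.f) (fun i => coneInl P.f i ∘ₗ comps P.f i) 0 (hyp P.ψ)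

theorem PairData.IsPair.isHyp_nullθ (h : P.IsPair n) : IsHyp (n + 1) (P.nullθ n) :=
  (h.quad.1.hyp (by ring)).pushHtpy rfl _ _ _

theorem PairData.IsPair.dHyp_nullθ (h : P.IsPair n) :
    P.thomφ n - push (coneInl P.f) P.α = dHyp (n + 1) (P.nullθ n) := by
  have := h.finC
  have := h.finD
  have h1 := dHyp_pushHtpy (nullHtpy P.f) (h.quad.1.hyp (m := n) (by ring))
  rw [hcomps_nullHtpy, comps_comp_coneInl, comps_zero, dHyp_hyp (by ring) h.quad.1, h.quad.2,
    hyp_zero, zero_add, pushHtpy_usmul] at h1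
  rw [PairData.nullθ, eq_sub_of_add_eq h1, thomφ_eq h.sym_chain h.quad.1, PairData.α, push_add,
    push_push, push_zero_left, negOnePow_sub, negOnePow_one]
  simp only [mul_neg, mul_one, Units.neg_smul, zero_sub]
  abel

theorem isDeg_thomHtpy (h : P.IsPair n) : IsDeg (n + 1) P.thomHtpy := fun p q hpq => by
  rw [thomHtpy_eq, sgn, sand_apply (p' := p - 1) (q' := q - 1) (by ring) (by ring),
    h.isDeg_oneT _ _ (by omega), zero_comp, comp_zero, smul_zero]

theorem opm_thomHtpy (m : ℤ) (x) : opm m P.thomHtpy x = eps (oph 1 (coneR P.f)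
    (opm (m - 1 - 1) (oneT P.ψ 0) (oph' 1 (coneR P.f) x))) := by
  rw [thomHtpy_eq, opm_sgn, opm_sand]

/-- The composite `e E` of the inclusion `e : D → C(f)` and the chain equivalence
`E : C(f)^{n-*} → D`. -/
abbrev PairData.inlEvD (P : PairData A) : DMap (cone P.f) (cone P.f) :=
  fun p q => coneInl P.f q ∘ₗ P.evD p q

theorem dmD_thomHtpy (h : P.IsPair n) : dmD P.thomHtpy = P.thomφ n 0 - P.inlEvD := by
  have := h.finC
  have hs := isDeg_zero_of_sym (isSym_thomφ h.sym_chain h.quad.1)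
  refine opm_ext (m := n) ?_ ?_ fun x => ?_
  · intro p q hpq
    rw [dmD_apply _ rfl rfl, isDeg_thomHtpy h _ _ (by omega), isDeg_thomHtpy h _ _ (by omega),
      comp_zero, zero_comp, smul_zero, add_zero]
  · intro p q hpq
    rw [Pi.sub_apply, Pi.sub_apply, hs p q hpq, PairData.inlEvD, h.isDeg_evD p q hpq,
      comp_zero, sub_zero]
  have h1 : ∀ m x, opd P.C (opm m (oneT P.ψ 0) x) = -eps (opm m (oneT P.ψ 0) (opd' P.C x)) := by
    intro m x
    have := opm_dmD (m - 1) (oneT P.ψ 0) x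
    rw [dmD_oneT h.quad, opm_zero, sub_add_cancel] at this
    exact eq_neg_of_add_eq_zero_left this.symm
  rw [opm_dmD, opm_sub, opm_thomφ_zero, opm_comp_left, opm_evD, opm_thomHtpy, opm_thomHtpy,
    add_sub_cancel_right, opd_eps, opd_coneR, h1, opd'_coneR, map_add (opm _ _), opg_coneInl]
  simp only [hom_simps, sign_simps, smul_simps, opg'_eps, opg_eps, opm_eps, oph_eps, eps_eps,
    neg_add]
  rcases sgn_cases n with hn | hn <;>
    simp only [sign_simps, smul_simps, hn] <;> abel

theorem dmD_comp_left {G : DMap C D} (b : D ⟶ E) :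
    dmD (fun p q => comps b q ∘ₗ G p q : DMap C E) = fun p q => comps b q ∘ₗ dmD G p q := by
  have := dmD_comp b G (𝟙 C)
  have h1 : ∀ p, dualMap (comps (𝟙 C) p) = LinearMap.id := fun _ => dualMap_id
  simpa only [h1, LinearMap.comp_id] using this

theorem PairData.IsPair.dmD_inlEvD (h : P.IsPair n) : dmD P.inlEvD = 0 := by
  refine (dmD_comp_left (coneInlHom P.f)).trans ?_
  rw [h.dmD_evD]
  funext p q
  exact comp_zero _

theorem SurjZero.of_htpy {f g : C ⟶ D} (hf : SurjZero f) (k : Homotopy f g) : SurjZero g := by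
  intro y hy
  obtain ⟨a, b, ha, hb⟩ := hf y hy
  refine ⟨a, b + oph 1 (hcomps k) a, ha, ?_⟩
  have := oph_htpy k a
  rw [ha, map_zero, add_zero] at this
  rw [hb, map_add, this]
  abel

theorem surjZero_coneInl {f : C ⟶ D} (hC : ExBelow 0 C) {G : E ⟶ D} (hG : QI G) :
    SurjZero (G ≫ coneInlHom f) := by
  rintro ⟨y, z⟩ hx
  rw [show DirectSum.of (fun i => (cone f).X i) 0 (y, z) = _ from of_cone f 0 y z] at hx ⊢
  have h1 : opd C (DirectSum.of (fun i => C.X i) (0 - 1) z) = 0 := by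
    have := congrArg (oph (-1) (coneSnd f)) hx
    rwa [← opd_coneSnd, map_add, coneSnd_coneI, coneSnd_coneR, zero_add, map_zero] at this
  obtain ⟨w, hw⟩ := exBelow_iff.1 hC (0 - 1) (by norm_num) z h1
  have h3 := congrArg (opg (coneFst f)) hx
  rw [opg_coneFst_opd, map_add, coneFst_coneI, coneFst_coneR, add_zero, map_add, coneSnd_coneI,
    coneSnd_coneR, map_zero, hw, zero_add, ← neg_eq_iff_eq_neg.2 (opd_eps (C := C) w), map_neg,
    opg_opd, ← sub_eq_add_neg, ← map_sub] at h3
  obtain ⟨a, b, ha, hb⟩ := hG.surj _ h3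
  refine ⟨a, oph 0 (coneI f) b + oph 1 (coneR f) w, ha, ?_⟩
  rw [opg_comps_comp, AddMonoidHom.comp_apply, comps_coneInlHom, opg_coneInl, map_add (opd _),
    opd_coneI, opd_coneR, sub_eq_iff_eq_add.1 hb, hw]
  simp only [map_add]
  abel

theorem PairData.IsPoincare.surjZero (h : P.IsPoincare n) :
    SurjZero (dualityMap h.isSymStructure_thomφ) := by
  have h1 := surjZero_coneInl (f := P.f) h.dimC.exBelow h.eqv_evD.qi
  exact h1.of_htpy (dmHtpy (isDeg_thomHtpy h.toIsPair)
    h.dmD_inlEvD (dmD_zero_of_sym h.isSymStructure_thomφ) (dmD_thomHtpy h.toIsPair)).symm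

theorem PairData.IsPoincare.isDim_cone (h : P.IsPoincare n) : IsDim n (cone P.f) :=
  h.dimD.nDual.of_equiv (h.isPoincare_iff.1 h) (h.dimC.1.cone h.dimD.1 P.f)

theorem PairData.IsPoincare.isConnNormal_thom (h : P.IsPoincare n) {γ : Form (cone P.f)}
    {θ : Fam P.D} (hn : P.IsNormalStr n γ θ) : (P.thom n γ θ).IsConnNormal n := by
  have := h.finC
  have := h.finD
  obtain ⟨hγ, hθ, hd⟩ := hn
  have hs := h.isSymStructure_thomφ
  exact {
    dim := h.isDim_cone
    sym := hs
    normal := by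
      refine ⟨hγ, (h.isHyp_nullθ.add (hθ.push _)).sub (isHyp_pushDualHtpy hγ.1 _ _ _ (by ring)),
        ?_⟩
      change P.thomφ n - pushDual n (P.thomφ n 0) γ = dHyp (n + 1) (P.nullθ n +
        push (coneInl P.f) θ - pushDualHtpy n P.thomHtpy P.inlEvD (P.thomφ n 0) γ)
      rw [dHyp_sub, dHyp_add, ← h.dHyp_nullθ, ← comps_coneInlHom, dHyp_push _ hθ, ← hd, push_sub,
        push_pushDual, dHyp_pushDualHtpy (isDeg_thomHtpy h.toIsPair) h.dmD_inlEvD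
          (dmD_zero_of_sym hs) (dmD_thomHtpy h.toIsPair) hγ]
      change _ = _ + (_ - pushDual n P.inlEvD γ) - _
      abel
    conn := h.surjZero.exactAt h.isDim_cone.nDual.exBelow }

end Thom

section PairLift

variable {B C D E : Cx A} {n : ℤ}

/-- The components of the chain equivalence from `C` to the fiber of `D → C(f)`. -/
def fiberInclMap (f : C ⟶ D) : GMap C (fiberCx (coneI f) (isChainH_coneI f)) := fun i =>
  fiberS (isChainH_coneI f) i i ∘ₗ comps f i -
    fiberJ (isChainH_coneI f) (i + 1) i ∘ₗ coneR f i (i + 1)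

theorem opg_fiberInclMap (f : C ⟶ D) (x) : opg (fiberInclMap f) x =
    oph 0 (fiberS (isChainH_coneI f)) (opg (comps f) x) -
      oph (-1) (fiberJ (isChainH_coneI f)) (oph 1 (coneR f) x) := by
  revert x; refine dsum_induct fun i x => ?_
  rw [opg_of, opg_of, oph_of i (by ring), oph_of (i + 1) rfl, oph_of i (by ring),
    ← map_sub]; rfl

theorem opg'_fiberInclMap (f : C ⟶ D) (x) : opg' (fiberInclMap f) x =
    opg' (comps f) (oph' 0 (fiberS (isChainH_coneI f)) x) -
      oph' 1 (coneR f) (oph' (-1) (fiberJ (isChainH_coneI f)) x) := by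
  revert x; refine dsum_induct fun i x => ?_
  rw [opg'_of, oph'_of i (by ring), oph'_of (i + 1) (by ring), opg'_of, oph'_of i (by ring),
    ← map_sub, fiberInclMap, dualMap_sub]; rfl

/-- The chain equivalence from `C` to the fiber of `D → C(f)`. -/
def fiberIncl (f : C ⟶ D) : C ⟶ fiberCx (coneI f) (isChainH_coneI f) :=
  homOf (fiberInclMap f) fun x => by
    rw [opg_fiberInclMap, opg_fiberInclMap, map_sub, opd_fiberS, opd_fiberJ, opd_coneR, opg_opd,
      map_add, opg_eps, oph_eps (k := 0), negOnePow_zero, one_smul,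
      oph_eps (k := -1), negOnePow_neg, negOnePow_one, Units.neg_smul, one_smul]
    abel

theorem comps_fiberIncl (f : C ⟶ D) : comps (fiberIncl f) = fiberInclMap f := rfl

theorem qi_fiberIncl (f : C ⟶ D) : QI (fiberIncl f) where
  inj x z hx h := by
    rw [comps_fiberIncl, opg_fiberInclMap, ← fiber_decomp (isChainH_coneI f) z,
      map_add, opd_fiberJ, opd_fiberS, ← cone_decomp f (oph 1 (fiberFst _) z), map_add,
      opd_coneI, opd_coneR] at h
    have h1 := congrArg (oph (-1) (coneSnd f)) (congrArg (oph 1 (fiberFst (isChainH_coneI f))) h)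
    refine ⟨-oph (-1) (coneSnd f) (oph 1 (fiberFst (isChainH_coneI f)) z), ?_⟩
    have h2 : ∀ y, eps (oph (-1) (fiberJ (isChainH_coneI f)) y) =
        oph (-1) (fiberJ (isChainH_coneI f)) (-eps y) := fun y => by rw [map_neg, oph_eps]; simp
    simp only [h2, map_add, map_sub, map_neg, fiberFst_fiberJ, fiberFst_fiberS, coneSnd_coneI,
      coneSnd_coneR, zero_sub, zero_add, add_zero, sub_zero, ← oph_eps (k := 0)] at h1
    rw [show eps (oph 0 (coneI f) (opg (comps (fiberProj (coneI f) (isChainH_coneI f))) z)) =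
      oph 0 (coneI f) (eps (opg (comps (fiberProj (coneI f) (isChainH_coneI f))) z)) by
        rw [oph_eps]; simp, coneSnd_coneI] at h1
    rw [map_neg, ← neg_eq_iff_eq_neg]
    simpa using h1
  surj W hW := by
    set y := oph 1 (fiberFst (isChainH_coneI f)) W with hy
    set w := opg (comps (fiberProj (coneI f) (isChainH_coneI f))) W with hw
    have h0 := fiber_decomp (isChainH_coneI f) W
    rw [← hy, ← hw] at h0
    set y1 := opg (coneFst f) y
    set y2 := oph (-1) (coneSnd f) y
    have hyd : oph 0 (coneI f) y1 + oph 1 (coneR f) y2 = y := cone_decomp f y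
    have h2 : ∀ y, eps (oph (-1) (fiberJ (isChainH_coneI f)) y) =
        oph (-1) (fiberJ (isChainH_coneI f)) (-eps y) := fun y => by rw [map_neg, oph_eps]; simp
    have h3 : ∀ y, eps (oph 0 (coneI f) y) = oph 0 (coneI f) (eps y) := fun y => by
      rw [oph_eps]; simp
    have h1 : opd (cone f) y + oph 0 (coneI f) (eps w) = 0 := by
      have := congrArg (opd _) h0
      rw [hW, map_add, opd_fiberJ, opd_fiberS, h2, map_neg, h3] at this
      have := congrArg (oph 1 (fiberFst (isChainH_coneI f))) this
      simpa only [map_add, map_sub, map_neg, sub_neg_eq_add, fiberFst_fiberJ, fiberFst_fiberS,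
        map_zero, zero_add] using this
    rw [← hyd, map_add, opd_coneI, opd_coneR] at h1
    have h4 : opd C y2 = 0 := by
      have := congrArg (oph (-1) (coneSnd f)) h1
      simpa only [map_add, coneSnd_coneI, coneSnd_coneR, map_zero, zero_add, add_zero] using this
    have h5 : opd D y1 + opg (comps f) (eps y2) + eps w = 0 := by
      have := congrArg (opg (coneFst f)) h1
      simpa only [map_add, coneFst_coneI, coneFst_coneR, map_zero, zero_add, add_zero] using this
    have h6 : w = opd D (eps y1) - opg (comps f) y2 := by
      have := congrArg eps h5
      rw [map_add, map_add, opg_eps, eps_eps, eps_eps, map_zero, ← neg_eq_iff_eq_neg.2 (opd_eps y1),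
        ] at this
      rw [eq_sub_iff_add_eq, ← sub_eq_zero, ← this]
      abel
    refine ⟨-y2, oph 0 (fiberS _) (eps y1), by rw [map_neg, h4, neg_zero], ?_⟩
    rw [comps_fiberIncl, opg_fiberInclMap, opd_fiberS, h2, h3, ← h3, h3, eps_eps]
    rw [← h0, h6, ← hyd]
    simp only [map_add, map_sub, map_neg]
    abel

/-- The homotopy from `e E` to `φ_0` as a chain of `W^%`. -/
def PairData.thomK (P : PairData A) : Fam (cone P.f) := fun s => if s = 0 then P.thomHtpy else 0

/-- The symmetric structure on the mapping cone, homotopic to that of the normal complex of the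
pair, with duality map `e E`. -/
def PairData.liftφ (n : ℤ) (P : PairData A) : Fam (cone P.f) :=
  P.thomφ n - dHyp (n + 1) P.thomK

variable {P : PairData A}

theorem PairData.IsPair.isSym_thomK (h : P.IsPair n) : IsSym (n + 1) P.thomK := by
  intro s p q hs
  by_cases h0 : s = 0
  · subst h0
    rw [PairData.thomK, if_pos rfl]
    exact isDeg_thomHtpy h p q (by omega)
  · rw [PairData.thomK, if_neg h0]; rfl

theorem dHyp_apply_zero {ξ : Fam C} {m : ℤ} (h : ξ (-1) = 0) : dHyp m ξ 0 = dmD (ξ 0) := by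
  have h0 : ξ (0 - 1) = 0 := h
  rw [dHyp_eq, famT_eq, h0, dmT_zero, famD_eq]
  simp

theorem PairData.IsPair.liftφ_zero (h : P.IsPair n) : P.liftφ n 0 = P.inlEvD := by
  rw [PairData.liftφ, Pi.sub_apply, dHyp_apply_zero (h.isSym_thomK.eq_zero (by norm_num)),
    PairData.thomK, if_pos rfl, dmD_thomHtpy h, sub_sub_cancel]

/-- The lifted normal complex of a pair with normal structure. -/
def BPairData.lift (n : ℤ) (P : BPairData B) : LData B where
  Y := cone P.f
  D := P.D
  e := coneI P.f
  he := isChainH_coneI P.f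
  E := P.evD
  φ := P.toPairData.liftφ n
  θ := P.toPairData.nullθ n - P.toPairData.thomK
  α := P.toPairData.α
  ω := P.θ
  γ := P.γ
  g := P.g
  χ := P.χ

theorem PairData.IsPair.isSymStructure_liftφ (h : P.IsPair n) :
    IsSymStructure n (P.liftφ n) := by
  have := h.finC
  have := h.finD
  refine ⟨h.isSymStructure_thomφ.1.sub (h.isSym_thomK.dHyp rfl), ?_⟩
  rw [PairData.liftφ, dHyp_sub, h.isSymStructure_thomφ.2, dHyp_dHyp h.isSym_thomK.isHyp, sub_zero]

theorem PairData.IsPair.dHyp_liftθ (h : P.IsPair n) :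
    P.liftφ n - push (coneInl P.f) P.α = dHyp (n + 1) (P.nullθ n - P.thomK) := by
  rw [dHyp_sub, ← h.dHyp_nullθ, PairData.liftφ]
  abel

theorem isChainEquiv_fiberIncl (f : C ⟶ D) (hC : IsFinite C) (hD : IsFinite D) :
    IsChainEquiv (fiberIncl f) :=
  (qi_fiberIncl f).isChainEquiv hC (IsFinite.fiberCx _ hD (hC.cone hD f))

theorem BPairData.IsPoincare.isL_lift {β : Form B} {P : BPairData B} (h : P.IsPoincare n β) :
    (P.lift n).IsL n β := by
  have hP := h.poincare.toIsPair
  exact {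
    dimY := h.poincare.isDim_cone
    dimD := hP.dimD
    dimF := hP.dimC.of_equiv (isChainEquiv_fiberIncl P.f hP.dimC.1 hP.dimD.1)
      (IsFinite.fiberCx _ hP.dimD.1 (hP.dimC.1.cone hP.dimD.1 P.f))
    degE := hP.isDeg_evD
    dE := hP.dmD_evD
    eqE := h.poincare.eqv_evD
    sym := hP.isSymStructure_liftφ
    φ0 := by
      refine hP.liftφ_zero.trans ?_
      funext p q
      change coneInl P.f q ∘ₗ _ = coneI P.f q q ∘ₗ _
      rw [coneI_self]; rfl
    hypα := hP.isHyp_α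
    dα := hP.dHyp_α
    hypθ := hP.isHyp_nullθ.sub hP.isSym_thomK.isHyp
    dθ := by
      change _ - push (dgl (coneI P.f)) _ = _
      rw [dgl_coneI]
      exact hP.dHyp_liftθ
    bundle := h.normal.1
    hypω := h.normal.2.1
    dω := h.normal.2.2
    bundle_map := h.bundle_map }

end PairLift

section PairUnit

variable {B C D E : Cx A} {n : ℤ} {P : PairData A}

/-- The component `S f` of the chain equivalence from `C` to the fiber of `D → C(f)`. -/
def fiberInclS (f : C ⟶ D) : GMap C (fiberCx (coneI f) (isChainH_coneI f)) := fun i =>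
  fiberS (isChainH_coneI f) i i ∘ₗ comps f i

/-- The component `J R` of the chain equivalence from `C` to the fiber of `D → C(f)`. -/
def fiberInclJ (f : C ⟶ D) : GMap C (fiberCx (coneI f) (isChainH_coneI f)) := fun i =>
  fiberJ (isChainH_coneI f) (i + 1) i ∘ₗ coneR f i (i + 1)

theorem opg_fiberInclS (f : C ⟶ D) (x) : opg (fiberInclS f) x =
    oph 0 (fiberS (isChainH_coneI f)) (opg (comps f) x) := by
  revert x; refine dsum_induct fun i x => ?_
  rw [opg_of, opg_of, oph_of i (by ring)]; rfl

theorem opg'_fiberInclS (f : C ⟶ D) (x) : opg' (fiberInclS f) x =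
    opg' (comps f) (oph' 0 (fiberS (isChainH_coneI f)) x) := by
  revert x; refine dsum_induct fun i x => ?_
  rw [opg'_of, oph'_of i (by ring), opg'_of]; rfl

theorem opg_fiberInclJ (f : C ⟶ D) (x) : opg (fiberInclJ f) x =
    oph (-1) (fiberJ (isChainH_coneI f)) (oph 1 (coneR f) x) := by
  revert x; refine dsum_induct fun i x => ?_
  rw [opg_of, oph_of (i + 1) rfl, oph_of i (by ring)]; rfl

theorem opg'_fiberInclJ (f : C ⟶ D) (x) : opg' (fiberInclJ f) x =
    oph' 1 (coneR f) (oph' (-1) (fiberJ (isChainH_coneI f)) x) := by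
  revert x; refine dsum_induct fun i x => ?_
  rw [opg'_of, oph'_of (i + 1) (by ring), oph'_of i (by ring)]; rfl

/-- The chain which relates the quadratic structure of a pair to that of the fiber pair. -/
def PairData.unitξ (n : ℤ) (P : PairData A) : Fam (fiberCx (coneI P.f) (isChainH_coneI P.f)) :=
  fun s => if s % 2 = 0 then n.negOnePow • fun p q =>
      fiberInclMap P.f q ∘ₗ P.ψ (s - 1) p q ∘ₗ dualMap (fiberInclJ P.f p)
    else n.negOnePow • fun p q =>
      fiberInclMap P.f q ∘ₗ P.ψ (s - 1) p q ∘ₗ dualMap (fiberInclS P.f p)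

theorem opm_unitξ_even {s : ℤ} (hs : s % 2 = 0) (m : ℤ) (x) : opm m (P.unitξ n s) x =
    n.negOnePow • opg (fiberInclMap P.f) (opm m (P.ψ (s - 1)) (opg' (fiberInclJ P.f) x)) := by
  rw [PairData.unitξ, if_pos hs, opm_usmul, opm_comp]

theorem opm_unitξ_odd {s : ℤ} (hs : ¬ s % 2 = 0) (m : ℤ) (x) : opm m (P.unitξ n s) x =
    n.negOnePow • opg (fiberInclMap P.f) (opm m (P.ψ (s - 1)) (opg' (fiberInclS P.f) x)) := by
  rw [PairData.unitξ, if_neg hs, opm_usmul, opm_comp]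

theorem opm_famT_unitξ_even [FinCx P.C] [FinCx P.D] {s : ℤ} (hs : s % 2 = 0) (m : ℤ) (x) :
    opm m (famT (P.unitξ n) s) x =
    n.negOnePow • opg (fiberInclJ P.f) (opm m (famT P.ψ (s - 1)) (opg' (fiberInclMap P.f) x)) := by
  rw [famT_eq, PairData.unitξ, if_pos hs, dmT_usmul, dmT_comp, opm_usmul, opm_comp]; rfl

theorem opm_famT_unitξ_odd [FinCx P.C] [FinCx P.D] {s : ℤ} (hs : ¬ s % 2 = 0) (m : ℤ) (x) :
    opm m (famT (P.unitξ n) s) x =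
    n.negOnePow • opg (fiberInclS P.f) (opm m (famT P.ψ (s - 1)) (opg' (fiberInclMap P.f) x)) := by
  rw [famT_eq, PairData.unitξ, if_neg hs, dmT_usmul, dmT_comp, opm_usmul, opm_comp]; rfl

theorem isQuad_unitξ (h : IsQuad (n - 1) P.ψ) : IsQuad n (P.unitξ n) := by
  intro s p q hs
  have h0 := h (s - 1) p q (by omega)
  by_cases hs' : s % 2 = 0
  · rw [PairData.unitξ, if_pos hs', Pi.smul_apply, Pi.smul_apply, h0, zero_comp,
      comp_zero, smul_zero]
  · rw [PairData.unitξ, if_neg hs', Pi.smul_apply, Pi.smul_apply, h0, zero_comp,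
      comp_zero, smul_zero]

theorem opd_opm_of_quad {m s : ℤ} {ψ : Fam C} (h : IsQuadStructure m ψ) (k : ℤ) (hs : 0 ≤ s) (x) :
    opd C (opm (k + 1) (ψ s) x) = -eps (opm (k + 1) (ψ s) (opd' C x)) -
      (m - s - 1).negOnePow •
        (opm k (ψ (s + 1)) x + (s + 1).negOnePow • opm k (famT ψ (s + 1)) x) := by
  have := opm_dQuad k m ψ s x
  rw [h.2, Pi.zero_apply, opm_zero, if_neg (not_lt.2 hs)] at this
  rw [eq_sub_iff_add_eq, eq_neg_iff_add_eq_zero, this]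
  abel

theorem opm_nullθ [FinCx P.C] (m s : ℤ) (x) : opm m (P.nullθ n s) x =
    eps (oph 1 (coneR P.f) (opm (m - 1) (P.ψ (-s - 1))
      (opg' (comps P.f) (oph' 0 (coneI P.f) x)))) +
    (n + 1).negOnePow • m.negOnePow • eps (oph 1 (coneR P.f) (opm (m - 1 - 1)
      (famT P.ψ (-s)) (oph' 1 (coneR P.f) x))) := by
  rw [PairData.nullθ, opm_pushHtpy, opg'_comp, opg'_coneInl, hyp_apply, famT_hyp_apply,
    show -(s - 1) - 1 = -s by ring, oph_coneNull, oph_coneNull, oph'_coneNull, oph'_eps,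
    map_usmul, opm_eps, show opg (0 : GMap P.C (cone P.f)) _ = 0 from opg_zero' _, map_zero,
    add_zero]
  simp only [map_usmul, oph_eps, eps_eps]
  rcases sgn_cases n with hn | hn <;>
  rcases sgn_cases m with hm | hm <;>
    simp [negOnePow_add, negOnePow_sub, hn, hm, opm_eps, oph_eps]

theorem opm_psiL {Y : Cx A} {e : HMap D Y} (he : IsChainH e) (θ : Fam Y) (α : Fam D)
    (E : DMap Y D) (m s : ℤ) (hs : 0 ≤ s) (x) : opm m (psiL he θ α E s) x =
      s.negOnePow • eps (oph (-1) (fiberJ he) (opm (m + 1 + 1) (θ (-s))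
        (oph' (-1) (fiberJ he) x))) +
      s.negOnePow • oph 0 (fiberS he) (opm (m + 1) (α (-s)) (oph' 0 e (oph' (-1) (fiberJ he) x))) +
      oph 0 (fiberS he) (opm m (famT α (-s - 1)) (oph' 0 (fiberS he) x)) -
      if s = 0 then oph 0 (fiberS he) (opm (m + 1) E (oph' (-1) (fiberJ he) x)) else 0 := by
  rw [psiL, Pi.sub_apply, opm_sub, opm_Lam _ _ _ _ _ _ hs, one_smul, Eterm]
  split_ifs
  · rw [opm_sand, sub_zero, sub_neg_eq_add]
  · rw [opm_zero]

theorem opm_α_neg {s t : ℤ} (hδ : IsSym n P.δφ) (hs : s < 0) (ht : t = -s - 1) (m : ℤ) (x) :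
    opm m (P.α s) x = opg (comps P.f) (opm m (P.ψ t) (opg' (comps P.f) x)) := by
  rw [PairData.α, Pi.add_apply, hδ.eq_zero hs, zero_add, opm_push, hyp_apply, ht]

theorem opm_famT_α_neg [FinCx P.C] [FinCx P.D] {s t : ℤ} (hδ : IsSym n P.δφ) (hs : s < 0)
    (ht : t = -s - 1) (m : ℤ) (x) : opm m (famT P.α s) x =
      opg (comps P.f) (opm m (famT P.ψ t) (opg' (comps P.f) x)) := by
  rw [PairData.α, famT_add, Pi.add_apply, famT_eq P.δφ, hδ.eq_zero hs, dmT_zero, zero_add,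
    famT_push, opm_push, famT_hyp_apply, ht]

theorem α_nonneg {s : ℤ} (hψ : IsQuad (n - 1) P.ψ) (hs : 0 ≤ s) : P.α s = P.δφ s := by
  have : push (comps P.f) (hyp P.ψ) s = 0 := by
    funext p q
    rw [push, hyp_apply, hψ.eq_zero (by omega)]
    exact comp_zero _
  rw [PairData.α, Pi.add_apply, this, add_zero]

set_option maxHeartbeats 1000000 in
theorem psiL_unit [FinCx P.C] [FinCx P.D] (h : P.IsPair n) :
    psiL (isChainH_coneI P.f) (P.nullθ n - P.thomK) P.α P.evD -
      push (comps (fiberIncl P.f)) P.ψ = dQuad n (P.unitξ n) := by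
  refine quad_ext (n := n - 1) ((isQuad_psiL _ (h.isHyp_nullθ.sub h.isSym_thomK.isHyp) h.isHyp_α
    h.isDeg_evD).sub (h.quad.1.push _)) ((isQuad_unitξ h.quad.1).dQuad (by ring))
    fun s x hs => ?_
  have hg : ∀ x, opd _ (opg (fiberInclMap P.f) x) = opg (fiberInclMap P.f) (opd P.C x) :=
    fun x => (opg_opd (fiberIncl P.f) x).symm
  have hS : ∀ x, opg' (fiberInclS P.f) (opd' _ x) = opd' P.C (opg' (fiberInclS P.f) x) +
      eps (opg' (comps P.f) (oph' 0 (coneI P.f) (oph' (-1) (fiberJ (isChainH_coneI P.f)) x))) := by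
    intro x
    rw [opg'_fiberInclS, opg'_fiberInclS, opd'_fiberS, map_add, opg'_opd', opg'_eps]
  have hJ : ∀ x, opg' (fiberInclJ P.f) (opd' _ x) = opd' P.C (opg' (fiberInclJ P.f) x) +
      eps (opg' (comps P.f) (oph' 0 (coneI P.f) (oph' (-1) (fiberJ (isChainH_coneI P.f)) x))) := by
    intro x
    rw [opg'_fiberInclJ, opg'_fiberInclJ, opd'_fiberJ, opd'_coneR]
  rw [Pi.sub_apply, opm_sub, opm_push, comps_fiberIncl, opm_psiL _ _ _ _ _ _ hs, opm_dQuad,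
    if_neg (not_lt.2 hs), Pi.sub_apply, opm_sub, opm_nullθ, neg_neg,
    opm_famT_α_neg h.sym_chain (t := s) (by omega) (by ring)]
  simp only [add_sub_cancel_right]
  have hev : ∀ s : ℤ, s % 2 = 0 → s.negOnePow = 1 := fun s hs =>
    negOnePow_even s (Int.even_iff.2 hs)
  have hodd : ∀ s : ℤ, ¬ s % 2 = 0 → s.negOnePow = -1 := fun s hs =>
    Int.negOnePow_odd s (Int.odd_iff.2 (by omega))
  by_cases h0 : s = 0
  · subst h0
    have hψ : P.ψ (0 - 1) = 0 := h.quad.1.eq_zero (by norm_num)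
    rw [opm_unitξ_even rfl, opm_unitξ_even rfl, opm_unitξ_odd (by norm_num),
      opm_famT_unitξ_odd (by norm_num), if_pos rfl, hψ, PairData.thomK, if_pos neg_zero,
      opm_thomHtpy, neg_zero, α_nonneg h.quad.1 le_rfl, opm_evD]
    simp only [oneT_apply, opm_add, if_true, opm_zero, map_zero, smul_zero, zero_add,
      add_sub_cancel_right, sub_zero]
    simp only [opg_fiberInclMap, opg'_fiberInclMap, opg_fiberInclS, opg'_fiberInclS]
    have hr := negOnePow_zero
    rcases sgn_cases n with hn | hn <;>
      simp only [hom_simps, sign_simps, smul_simps, add_zero, opm_eps, opg_eps, oph_eps, eps_eps,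
        hn, hr, neg_add, neg_sub] <;> abel
  · obtain ⟨r, rfl⟩ : ∃ r, s = r + 1 := ⟨s - 1, by ring⟩
    have hK : P.thomK (-(r + 1)) = 0 := by rw [PairData.thomK, if_neg (by omega)]
    rw [if_neg h0, hK, opm_zero, sub_zero, opm_α_neg h.sym_chain (t := r) (by omega) (by ring)]
    simp only [add_sub_cancel_right]
    by_cases h2 : r % 2 = 0
    · rw [opm_unitξ_odd (by omega), opm_unitξ_odd (by omega), opm_unitξ_even (by omega),
        opm_famT_unitξ_even (by omega)]
      simp only [add_sub_cancel_right]
      rw [map_usmul, hg, opd_opm_of_quad h.quad _ (by omega), hS]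
      have hr := hev r h2
      simp only [opg_fiberInclMap, opg'_fiberInclMap, opg_fiberInclS, opg'_fiberInclS,
        opg_fiberInclJ, opg'_fiberInclJ]
      rcases sgn_cases n with hn | hn <;>
      simp only [hom_simps, sign_simps, smul_simps, add_zero, opm_eps, opg_eps, oph_eps, eps_eps,
        hn, hr, neg_add, neg_sub] <;> abel
    · rw [opm_unitξ_even (by omega), opm_unitξ_even (by omega), opm_unitξ_odd (by omega),
        opm_famT_unitξ_odd (by omega)]
      simp only [add_sub_cancel_right]
      rw [map_usmul, hg, opd_opm_of_quad h.quad _ (by omega), hJ]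
      have hr := hodd r h2
      simp only [opg_fiberInclMap, opg'_fiberInclMap, opg_fiberInclS, opg'_fiberInclS,
        opg_fiberInclJ, opg'_fiberInclJ]
      rcases sgn_cases n with hn | hn <;>
      simp only [hom_simps, sign_simps, smul_simps, add_zero, opm_eps, opg_eps, oph_eps, eps_eps,
        hn, hr, neg_add, neg_sub] <;> abel

end PairUnit

section Comparison

variable {B C D E : Cx A} {n : ℤ} {β : Form B}

theorem pullHtpy_zero_left (m : ℤ) (f f' : GMap C D) (γ : Form D) :
    pullHtpy m (0 : HMap C D) f f' γ = 0 := by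
  funext s a b
  have h0 : ∀ i j, dualMap ((0 : HMap C D) i j) = 0 := fun _ _ => dualMap_zero
  simp only [pullHtpy, h0, zero_comp, smul_zero, zero_add, add_zero]
  rw [show (0 : HMap C D) a (a + 1) = 0 from rfl, comp_zero, comp_zero,
    smul_zero]
  rfl

theorem isBundleHtpy_of_eq {g g' : C ⟶ B} (hg : g' = g) (χ : Form C) :
    IsBundleHtpy β g χ g' χ (htpyCongr hg rfl (Homotopy.refl g)) 0 :=
  ⟨IsForm.zero, by
    rw [sub_self, hcomps_htpyCongr, hcomps_refl, pullHtpy_zero_left, dForm_zero, add_zero,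
      neg_zero]⟩

theorem isBundleHtpy_id_comp (g : C ⟶ B) (χ : Form C) :
    IsBundleHtpy β g χ (𝟙 C ≫ g) ((0 : Form C) + pull (comps (𝟙 C)) χ)
      (htpyCongr (Category.id_comp _) rfl (Homotopy.refl g)) 0 := by
  rw [pull_id, zero_add]
  exact isBundleHtpy_of_eq _ _

/-- The normal complex underlying a lifted normal complex. -/
def LData.cplx (L : LData B) : BNormalData B where
  C := L.Y
  φ := L.φ
  γ := L.γ
  θ := L.θ + push (dgl L.e) L.ω
  g := L.g
  χ := L.χ

theorem surjZero_of_fiber {e : HMap D E} (he : IsChainH e) (h : ExBelow 0 (fiberCx e he)) :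
    SurjZero he.hom := by
  intro y hy
  rw [IsChainH.comps_hom]
  simp only [opg_dgl]
  rw [exBelow_iff] at h
  have h0 := oph_of (k := -1) (-1) (by norm_num) (fiberJ he) y
  obtain ⟨w, hw⟩ := h (-1) (by norm_num) (fiberJ he 0 (-1) y) (by
    rw [← h0, opd_fiberJ, hy, map_zero])
  rw [← h0, ← fiber_decomp he w, map_add, opd_fiberJ, opd_fiberS] at hw
  set v := oph 1 (fiberFst he) w
  set z := opg (comps (fiberProj e he)) w
  have h2 : eps (oph (-1) (fiberJ he) (oph 0 e z)) = oph (-1) (fiberJ he) (-oph 0 e (eps z)) := by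
    rw [map_neg, oph_eps (k := 0), negOnePow_zero, one_smul, oph_eps]
    simp
  rw [h2] at hw
  refine ⟨eps z, v, ?_, ?_⟩
  · have := congrArg (opg (comps (fiberProj e he))) hw
    simp only [map_add, map_sub, opg_fiberProj_J, opg_fiberProj_S, sub_zero, zero_add] at this
    rw [opd_eps, ← this, map_zero, neg_zero]
  · have := congrArg (oph 1 (fiberFst he)) hw
    simp only [map_add, map_sub, fiberFst_fiberJ, fiberFst_fiberS] at this
    rw [this]
    abel

theorem SurjZero.comp_qi {f : D ⟶ E} (hf : SurjZero f) {G : C ⟶ D} (hG : QI G) :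
    SurjZero (G ≫ f) := by
  intro y hy
  obtain ⟨a, b, ha, hb⟩ := hf y hy
  obtain ⟨a', b', ha', hb'⟩ := hG.surj a ha
  refine ⟨a', opg (comps f) b' + b, ha', ?_⟩
  rw [hb, hb', opg_comps_comp, AddMonoidHom.comp_apply, map_add, map_add, opg_opd, add_assoc]

theorem LData.IsL.dualityMap_eq {L : LData B} (h : L.IsL n β) :
    dualityMap h.sym = dmHom n L.E h.dE ≫ L.he.hom :=
  hom_ext_comps fun i => by
    change L.φ 0 (n - i) i = _
    rw [h.φ0]
    rfl

theorem LData.IsL.isConnNormal_cplx {L : LData B} (h : L.IsL n β) :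
    L.cplx.IsConnNormal n β := by
  have := h.dimY.finCx
  have := h.dimD.finCx
  have hφ : L.φ 0 = fun p q => dgl L.e q ∘ₗ L.E p q := h.φ0
  exact {
    conn_normal := {
      dim := h.dimY
      sym := h.sym
      normal := by
        refine ⟨h.bundle, h.hypθ.add (h.hypω.push _), ?_⟩
        change L.φ - pushDual n (L.φ 0) L.γ = dHyp (n + 1) (L.θ + push (dgl L.e) L.ω)
        rw [dHyp_add, ← h.dθ, ← L.he.comps_hom, dHyp_push _ h.hypω, ← h.dω, push_sub,
          push_pushDual, L.he.comps_hom, hφ]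
        abel
      conn := by
        refine SurjZero.exactAt ?_ h.dimY.nDual.exBelow
        change SurjZero (dualityMap h.sym)
        rw [h.dualityMap_eq]
        exact (surjZero_of_fiber L.he h.dimF.exBelow).comp_qi h.eqE.qi }
    bundle_map := h.bundle_map }

theorem LData.IsL.pair_lift_cplx {L : LData B} (h : L.IsL n β) :
    BPairHE n β ((L.cplx.lift n h.sym).pair n) (L.pair n) := by
  have := h.dimY.finCx
  have := h.dimD.finCx
  have h' : (L.cplx.lift n h.sym).IsL n β := APC.isL_lift h.isConnNormal_cplx
  have hab : ∀ i, comps (𝟙 L.Y) i ∘ₗ dmK n (L.φ 0) i i = L.e i i ∘ₗ comps (dmHom n L.E h.dE) i :=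
    fun i => by
      rw [h.φ0]; rfl
  have hE : L.E = fun p q => comps (dmHom n L.E h.dE) q ∘ₗ idD n L.Y p q :=
    funext fun p => funext fun q => by
      by_cases hp : p + q = n
      · obtain rfl : p = n - q := by omega
        change L.E _ q = L.E (n - q) q ∘ₗ dualMap (idMap L.Y (n - q) (n - q))
        rw [idMap_self, dualMap_id, LinearMap.comp_id]
      · rw [h.degE p q hp, isDeg_idD n L.Y p q hp, comp_zero]
  refine LData.pair_map h' h (𝟙 L.Y) (dmHom n L.E h.dE) hab h.eqE
    ((QI.fiberMap hab (IsChainEquiv.qi (f := 𝟙 L.Y) ⟨HomotopyEquiv.refl _, rfl⟩)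
      h.eqE.qi).isChainEquiv h'.dimF.1 h.dimF.1)
    hE (ch := L.ω) (η := 0) (et := 0) (χ₀ := 0) h.hypω IsHyp.zero IsHyp.zero ?_ ?_ ?_ ?_
    (htpyCongr (Category.id_comp _) rfl (Homotopy.refl L.g)) 0 ?_
  · rw [← h.dω]
    change L.α = pushDual n L.E L.γ + _
    abel
  · change L.θ = push (comps (𝟙 L.Y)) (L.θ + push (dgl L.e) L.ω) - _ + _
    rw [push_id, dHyp_zero]
    abel
  · refine ⟨IsForm.zero, ?_⟩
    change dForm 1 0 = pull (comps (𝟙 L.Y)) L.γ - L.γ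
    rw [pull_id, sub_self, dForm_zero]
  · change L.ω = push (comps (dmHom n L.E h.dE)) 0 + _ - _ + _
    rw [push_zero, pushDual_zero, dHyp_zero]
    abel
  · exact isBundleHtpy_id_comp L.g L.χ

theorem BPairData.IsPoincare.cplx_lift {P : BPairData B} (h : P.IsPoincare n β) :
    BNormalHE n β (P.lift n).cplx (P.thom n) := by
  have hP := h.poincare.toIsPair
  have key : ((P.nullθ n + push (coneInl P.f) P.θ -
        pushDualHtpy n P.thomHtpy P.inlEvD (P.thomφ n 0) P.γ) -
      push (comps (𝟙 (cone P.f))) (P.nullθ n - P.thomK + push (dgl (coneI P.f)) P.θ) - P.thomK +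
      pushDualHtpy n (P.thomK 0) (compLR (comps (𝟙 (cone P.f))) (P.liftφ n 0)) (P.thomφ n 0) P.γ +
      pushDual n (fun p q => comps (𝟙 (cone P.f)) q ∘ₗ P.liftφ n 0 p q) 0 : Fam (cone P.f)) =
      dHyp (n + 2) 0 := by
    rw [push_id, pushDual_zero, dHyp_zero, dgl_coneI, hP.liftφ_zero,
      show compLR (comps (𝟙 (cone P.f))) P.inlEvD = P.inlEvD from rfl,
      show P.thomK 0 = P.thomHtpy from if_pos rfl]
    abel
  refine ⟨𝟙 (cone P.f), P.toPairData.thomK, 0, 0, htpyCongr (Category.id_comp _) rfl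
    (Homotopy.refl P.g), 0, ⟨HomotopyEquiv.refl _, rfl⟩, ⟨hP.isSym_thomK, ?_,
      ⟨IsForm.zero, ?_⟩, IsHyp.zero, ?_⟩, ?_⟩
  · change P.thomφ n - push (comps (𝟙 (cone P.f))) (P.liftφ n) = _
    rw [push_id, PairData.liftφ, sub_sub_cancel]
    rfl
  · change dForm 1 0 = pull (comps (𝟙 (cone P.f))) P.γ - P.γ
    rw [pull_id, sub_self, dForm_zero]
  · exact key
  · exact isBundleHtpy_id_comp P.g P.χ

theorem hom_ext_opg {f g : C ⟶ D} (h : ∀ x, opg (comps f) x = opg (comps g) x) : f = g :=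
  hom_ext_comps fun i => LinearMap.ext fun x => by
    have := h (DirectSum.of (fun i => C.X i) i x)
    rw [opg_of, opg_of] at this
    exact DirectSum.of_injective (β := fun i => D.X i) i this

theorem oph_zero_left (k : ℤ) (x) : oph k (0 : HMap C D) x = 0 := by
  revert x; refine dsum_induct fun i x => ?_
  rw [oph_of (i + k) rfl]; simp

theorem fiberIncl_proj (f : C ⟶ D) :
    fiberIncl f ≫ fiberProj (coneI f) (isChainH_coneI f) = f :=
  hom_ext_opg fun x => by
    rw [opg_comps_comp, AddMonoidHom.comp_apply, comps_fiberIncl, opg_fiberInclMap, map_sub,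
      opg_fiberProj_S, opg_fiberProj_J, sub_zero]

/-- The commutative square of `fiberIncl` and the identity as a homotopy. -/
def fiberInclHtpy (f : C ⟶ D) :
    Homotopy (fiberIncl f ≫ fiberProj (coneI f) (isChainH_coneI f)) (f ≫ 𝟙 D) :=
  Homotopy.ofEq ((fiberIncl_proj f).trans (Category.comp_id f).symm)

theorem coneMap_fiberIncl (f : C ⟶ D) :
    coneMap (fiberIncl f) (𝟙 D) (fiberInclHtpy f) ≫ retr (isChainH_coneI f) = 𝟙 (cone f) :=
  hom_ext_opg fun x => by
    rw [opg_comps_id, opg_comps_comp, AddMonoidHom.comp_apply]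
    induction x using cone_induction with
    | hI x => rw [opg_coneMap_I, opg_comps_id, opg_retr_I]
    | hR x =>
      rw [opg_coneMap_R, show hcomps (fiberInclHtpy f) = 0 from rfl, oph_zero_left, map_zero,
        map_zero, add_zero, comps_fiberIncl, opg_fiberInclMap, map_sub, map_sub, opg_retr_S,
        opg_retr_J, zero_sub, neg_neg]
    | hadd x y hx hy => rw [map_add, map_add, hx, hy]

variable {P : PairData A}

theorem oneT_unitξ [FinCx P.C] [FinCx P.D] (h : IsQuad (n - 1) P.ψ) : oneT (P.unitξ n) = 0 := by
  have h0 : P.unitξ n 0 = 0 := dmap_ext fun m x => by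
    rw [opm_unitξ_even (by norm_num), h.eq_zero (by norm_num), opm_zero, opm_zero, map_zero,
      smul_zero]
  funext s
  rw [oneT_apply, famT_eq, h0, dmT_zero, add_zero, ite_self]
  rfl

theorem push_proj_unitξ (hδ : IsSym n P.δφ) (h : IsQuad (n - 1) P.ψ) :
    push (comps (fiberProj (coneI P.f) (isChainH_coneI P.f))) (hyp (P.unitξ n)) =
      trunc n P.α := by
  refine fam_ext' fun s m x => ?_
  rw [opm_push, hyp_apply]
  have hI : ∀ x, opg (comps (fiberProj (coneI P.f) (isChainH_coneI P.f)))
      (opg (fiberInclMap P.f) x) = opg (comps P.f) x := fun x => by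
    rw [opg_fiberInclMap, map_sub, opg_fiberProj_S, opg_fiberProj_J, sub_zero]
  by_cases hs : s % 2 = 0
  · rw [opm_unitξ_odd (by omega), map_usmul, hI, opg'_fiberInclS, opg'_fiberProj_S]
    by_cases hs' : s < 0
    · rw [trunc, if_pos ⟨hs', hs⟩, opm_usmul,
        opm_α_neg (t := -s - 1 - 1) hδ (by omega) (by ring)]
    · rw [trunc, if_neg (fun h => hs' h.1), h.eq_zero (by omega), opm_zero, opm_zero, map_zero,
        smul_zero]
  · rw [opm_unitξ_even (by omega), map_usmul, hI, opg'_fiberInclJ, opg'_fiberProj_J,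
      map_zero, map_zero, map_zero, smul_zero, trunc, if_neg (fun h => hs h.2), opm_zero]

theorem ge0_α (hδ : IsSym n P.δφ) (h : IsQuad (n - 1) P.ψ) : ge0 P.α = P.δφ := by
  funext s
  rw [ge0]
  split_ifs with hs
  · exact (hδ.eq_zero hs).symm
  · exact α_nonneg h (not_lt.1 hs)

theorem pairMapHtpy_eq_zero {P P' : PairData A} {g : P.C ⟶ P'.C} {h : P.D ⟶ P'.D}
    (k : Homotopy (g ≫ P'.f) (P.f ≫ h)) (hk : hcomps k = 0) {ξ : Fam P'.C} (hξ : oneT ξ = 0) :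
    pairMapHtpy k 0 ξ = 0 := by
  refine dmap_ext fun m x => ?_
  rw [opm_pairMapHtpy, hk, oph_zero_left, oph_zero_left, hξ,
    show (0 : Fam P'.D) 0 = 0 from rfl, show (0 : Fam P'.C) 0 = 0 from rfl, opm_zero, opm_zero,
    opm_zero, map_zero]
  simp

theorem isNormalPairMap_of_oneT_eq_zero {P P' : PairData A} {γ : Form (cone P.f)} {θ : Fam P.D}
    {γ' : Form (cone P'.f)} {θ' : Fam P'.D} {g : P.C ⟶ P'.C} {h : P.D ⟶ P'.D}
    {k : Homotopy (g ≫ P'.f) (P.f ≫ h)} (hk : hcomps k = 0) {ξ : Fam P'.C} (hξ : IsQuad n ξ)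
    (hξ' : oneT ξ = 0) (hψ : P'.ψ - push (comps g) P.ψ = dQuad n ξ)
    (hδ : P'.δφ = push (comps h) P.δφ) (hγ : pull (comps (coneMap g h k)) γ' = γ)
    (hθ : θ' = push (comps h) θ + push (comps P'.f) (hyp ξ)) :
    IsNormalPairMap n P P' γ θ γ' θ' g h k 0 ξ 0 0 where
  pair_map := by
    refine ⟨IsSym.zero, hξ, hψ, ?_⟩
    rw [hk, pushHtpy_zero_left, hξ', push_zero, smul_zero, add_zero, dHyp_zero, hδ]
    simp
  bundle_equiv := ⟨IsForm.zero, by rw [dForm_zero, hγ, sub_self]⟩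
  hyp_chain := IsHyp.zero
  hyp_equiv := by
    rw [pairMapHtpy_eq_zero k hk hξ', pushDualHtpy_zero_left, pushDual_zero, pairMapα, hk,
      pushHtpy_zero_left, dHyp_zero, hθ]
    abel

theorem BPairData.IsPoincare.pair_lift {P : BPairData B} (h : P.IsPoincare n β) :
    BPairHE n β P ((P.lift n).pair n) := by
  have hP := h.poincare.toIsPair
  have := hP.finC
  have := hP.finD
  have hq := hP.quad.1
  have hc := coneMap_fiberIncl P.f
  have hpull : ∀ γ, pull (comps (coneMap (fiberIncl P.f) (𝟙 P.D) (fiberInclHtpy P.f)))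
      (pull (comps (retr (isChainH_coneI P.f))) γ) = γ := fun γ => by
    rw [← pull_comp, hc, pull_id]
  have hg : coneMap (fiberIncl P.f) (𝟙 P.D) (fiberInclHtpy P.f) ≫
      retr (isChainH_coneI P.f) ≫ P.g = P.g := by
    rw [← Category.assoc, hc, Category.id_comp]
  refine ⟨fiberIncl P.f, 𝟙 P.D, fiberInclHtpy P.f, 0, P.unitξ n, 0, 0,
    htpyCongr hg rfl (Homotopy.refl P.g), 0, isChainEquiv_fiberIncl P.f hP.dimC.1 hP.dimD.1,
    ⟨HomotopyEquiv.refl _, rfl⟩, isNormalPairMap_of_oneT_eq_zero rfl (isQuad_unitξ hq)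
      (oneT_unitξ hq) (psiL_unit hP) ?_ (hpull P.γ) ?_, ?_⟩
  · exact (ge0_α hP.sym_chain hq).trans (push_id _).symm
  · refine (add_comm (trunc n P.α) P.θ).trans (congrArg₂ (· + ·) (push_id _).symm ?_)
    exact (push_proj_unitξ hP.sym_chain hq).symm
  · have := isBundleHtpy_of_eq (β := β) hg P.χ
    refine ⟨this.1, Eq.trans ?_ this.2⟩
    refine congrArg₂ (· + ·) (congrArg₂ (· - ·) rfl ?_) rfl
    exact (zero_add _).trans (hpull P.χ)

end Comparison

section Counit

variable {B D Y : Cx A} {n : ℤ} {β : Form B}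
  {e : HMap D Y} (he : IsChainH e) {φ θ : Fam Y} {α : Fam D} {E : DMap Y D}

/-- The part of a hyperquadratic structure of positive index. -/
def gt0 (θ : Fam Y) : Fam Y := fun s => if s ≤ 0 then 0 else θ s

theorem isSym_gt0 {m : ℤ} (h : IsHyp m θ) : IsSym m (gt0 θ) := fun s p q hs => by
  rw [gt0]
  split_ifs with h0
  · rfl
  · exact h s p q (hs.resolve_left (by omega))

theorem opm_famT_psiL [FinCx D] [FinCx Y] (m s : ℤ) (hs : 0 ≤ s) (x) :
    opm m (famT (psiL he θ α E) s) x =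
      -(s.negOnePow • eps (oph (-1) (fiberJ he) (opm (m + 1 + 1) (famT θ (-s))
        (oph' (-1) (fiberJ he) x)))) +
      s.negOnePow • m.negOnePow • eps (oph (-1) (fiberJ he) (oph 0 e (opm (m + 1) (famT α (-s))
        (oph' 0 (fiberS he) x)))) +
      oph 0 (fiberS he) (opm m (α (-s - 1)) (oph' 0 (fiberS he) x)) -
      if s = 0 then m.negOnePow • eps (oph (-1) (fiberJ he) (opm (m + 1) (dmT E)
        (oph' 0 (fiberS he) x))) else 0 := by
  rw [psiL, famT_sub, Pi.sub_apply, opm_sub, opm_famT_Lam he m 1 θ α s hs, one_smul]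
  congr 1
  rw [famT_eq, Eterm]
  split_ifs with h
  · rw [opm_dmT_sand_eo _ _ _ _ _ _ _ (by norm_num) (by norm_num)]
    rw [show m - -1 - 0 = m + 1 by ring]
  · rw [dmT_zero, opm_zero]

theorem retr_R_J (x) : opg (comps (retr he)) (oph 1 (coneR (fiberProj e he))
    (eps (oph (-1) (fiberJ he) x))) = eps x := by
  rw [oph_eps, map_usmul, opg_eps, opg_retr_J]
  simp

variable [FinCx D] [FinCx Y]

theorem retr_counit (hφ : IsSym n φ) (hα : IsHyp n α) (hθ : IsHyp (n + 1) θ) (hE : IsDeg n E)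
    (hd : φ - push (dgl e) α = dHyp (n + 1) θ) (hP : (fiberPair he θ α E).IsPair n) :
    θ - push (comps (retr he)) ((fiberPair he θ α E).nullθ n - (fiberPair he θ α E).thomK) -
      push (dgl e) (trunc n α) - gt0 θ = dHyp (n + 2) (trunc n θ) := by
  have hq : IsQuad (n - 1) (psiL he θ α E) := isQuad_psiL he hθ hα hE
  have : FinCx (fiberPair he θ α E).C := inferInstanceAs (FinCx (fiberCx e he))
  have hnull : ∀ m s x, opm m (push (comps (retr he)) ((fiberPair he θ α E).nullθ n) s) x =
      (n + 1).negOnePow • m.negOnePow • eps (opg (comps (retr he)) (oph 1 (coneR (fiberProj e he))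
        (opm (m - 1 - 1) (famT (psiL he θ α E) (-s)) (oph' 1 (coneR (fiberProj e he))
          (opg' (comps (retr he)) x))))) := fun m s x => by
    rw [opm_push]
    refine (congrArg _ (opm_nullθ m s _)).trans ?_
    rw [map_add, opg_eps, map_usmul, map_usmul, opg_eps]
    refine (congrArg₂ (· + ·) ?_ rfl).trans (zero_add _)
    change eps (opg (comps (retr he)) (oph 1 (coneR (fiberProj e he))
      (opm (m - 1) (psiL he θ α E (-s - 1)) (opg' (comps (fiberProj e he))
        (oph' 0 (coneI (fiberProj e he)) (opg' (comps (retr he)) x)))))) = 0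
    by_cases hs : 0 ≤ -s - 1
    · rw [opm_psiL he θ α E _ _ hs, opg'_fiberProj_J]
      simp only [map_zero, smul_zero, map_add, map_sub, add_zero, ite_self, sub_zero,
        opg_retr_S, zero_add]
    · rw [hq.eq_zero (by omega), opm_zero]
      simp only [map_zero]
  have hK : ∀ m s x, opm m (push (comps (retr he)) (fiberPair he θ α E).thomK s) x =
      if s = 0 then eps (opg (comps (retr he)) (oph 1 (coneR (fiberProj e he))
        (opm (m - 1 - 1) (oneT (psiL he θ α E) 0) (oph' 1 (coneR (fiberProj e he))
          (opg' (comps (retr he)) x))))) else 0 := fun m s x => by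
    rw [opm_push, PairData.thomK]
    split_ifs
    · rw [← opg_eps]
      exact congrArg _ (opm_thomHtpy m _)
    · rw [opm_zero, map_zero]
  have hN : ∀ s, 0 ≤ -s → ∀ x, opm (n + 1 + s)
      (push (comps (retr he)) ((fiberPair he θ α E).nullθ n) s) x =
      opm (n + 1 + s) (famT θ s) x := fun s hs x => by
    rw [hnull, opm_famT_psiL he _ _ hs]
    simp only [hom_simps, smul_zero, add_zero, ite_self, sub_zero, opg_retr_S, zero_add,
      opg'_retr_S, opg'_retr_J, retr_R_J, eps_eps, neg_neg]
    rw [show n + 1 + s - 1 - 1 + 1 + 1 = n + 1 + s by ring]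
    rcases sgn_cases n with hn | hn <;>
    rcases sgn_cases s with hr | hr <;>
    simp [negOnePow_add, negOnePow_neg, hn, hr]
  have hy : IsHyp (n + 1) ((fiberPair he θ α E).nullθ n - (fiberPair he θ α E).thomK) :=
    hP.isHyp_nullθ.sub hP.isSym_thomK.isHyp
  have hN' : ∀ s, ¬ 0 ≤ -s → ∀ m x, opm m
      (push (comps (retr he)) ((fiberPair he θ α E).nullθ n) s) x = 0 := fun s hs m x => by
    rw [hnull, famT_eq, hq.eq_zero (by omega), dmT_zero, opm_zero]
    simp only [map_zero, smul_zero]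
  refine fam_ext (((hθ.sub (hy.push _)).sub ((isHyp_trunc hα rfl).push _)).sub
    (isSym_gt0 hθ).isHyp) ((isHyp_trunc hθ rfl).dHyp (by ring)) fun s x => ?_
  rw [push_sub]
  simp only [Pi.sub_apply, opm_sub, hK]
  rw [opm_dHyp, trunc, trunc, gt0, opm_push _ _ (trunc n α), trunc]
  by_cases hs : s ≤ 0
  · rw [hN s (by omega), if_pos hs, opm_zero]
    by_cases h0 : s = 0
    · subst h0
      have := opm_oneT_psiL he (θ := θ) (α := α) (E := E) (n := n)
        (oph' 1 (coneR (fiberProj e he)) (opg' (comps (retr he)) x))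
      rw [if_pos rfl, show n + 1 + 0 - 1 - 1 = n - 1 by ring, this, if_neg (by norm_num),
        if_neg (by norm_num), if_neg (by norm_num), famT_eq (trunc n θ), trunc,
          if_neg (by norm_num), dmT_zero]
      simp only [hom_simps, smul_zero, add_zero, opm_zero, sub_zero, opg_retr_S, zero_add,
        opg'_retr_S, opg'_retr_J, retr_R_J, eps_eps, neg_neg]
      abel
    · by_cases h2 : s % 2 = 0
      · have h4 := congrArg (fun w => opm (n + 1 + s) w x) (congrFun hd (s + 1))
        simp only [Pi.sub_apply, opm_sub, opm_dHyp, add_sub_cancel_right] at h4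
        rw [hφ.eq_zero (by omega), opm_zero] at h4
        have h5 : s < 0 ∧ s % 2 = 0 := ⟨by omega, h2⟩
        have h6 : ¬ (s - 1 < 0 ∧ (s - 1) % 2 = 0) := by omega
        rw [if_neg h0, if_pos h5, if_pos h5, if_neg h6, famT_eq (trunc n θ), trunc, if_neg h6,
          dmT_zero]
        rw [opm_push, zero_sub, neg_eq_iff_eq_neg] at h4
        have h7 : s.negOnePow = 1 := negOnePow_even _ (Int.even_iff.2 h2)
        simp only [opm_usmul, map_usmul, h4, opm_zero]
        rcases sgn_cases n with hn | hn <;>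
        simp only [sign_simps, smul_simps, hn, h7, smul_zero, add_zero, neg_add, sub_zero] <;>
        abel
      · have h5 : ¬ (s < 0 ∧ s % 2 = 0) := by omega
        have h6 : s - 1 < 0 ∧ (s - 1) % 2 = 0 := ⟨by omega, by omega⟩
        have h7 : s.negOnePow = -1 := Int.negOnePow_odd _ (Int.odd_iff.2 (by omega))
        rw [if_neg h0, if_neg h5, if_neg h5, if_pos h6, famT_eq (trunc n θ), trunc, if_pos h6,
          dmT_usmul, sub_add_cancel, ← famT_eq θ]
        simp only [opm_usmul, opm_zero, map_zero]
        rcases sgn_cases n with hn | hn <;>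
        simp only [sign_simps, smul_simps, hn, h7, negOnePow_two, smul_zero, zero_add, sub_zero,
          neg_add] <;>
        abel
  · rw [hN' s (by omega), if_neg (by omega), if_neg (by omega), if_neg (by omega),
      if_neg (by omega), if_neg (by omega), opm_zero, famT_eq (trunc n θ), trunc,
        if_neg (by omega), dmT_zero]
    simp only [opm_zero, map_zero, smul_zero, sub_zero, add_zero, sub_self]

theorem retr_lift_sub (hφ : IsSym n φ) (hα : IsHyp n α) (hα' : dHyp n α = 0)
    (hθ : IsHyp (n + 1) θ) (hE : IsDeg n E) (hd : φ - push (dgl e) α = dHyp (n + 1) θ)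
    (hP : (fiberPair he θ α E).IsPair n) :
    φ - push (comps (retr he)) ((fiberPair he θ α E).liftφ n) = dHyp (n + 1) (gt0 θ) := by
  have key := retr_counit he hφ hα hθ hE hd hP
  have : FinCx (fiberPair he θ α E).C := hP.finC
  have : FinCx (fiberPair he θ α E).D := hP.finD
  have : FinCx (cone (fiberProj e he)) :=
    inferInstanceAs (FinCx (cone (fiberPair he θ α E).f))
  have hy : IsHyp (n + 1) ((fiberPair he θ α E).nullθ n - (fiberPair he θ α E).thomK) :=
    hP.isHyp_nullθ.sub hP.isSym_thomK.isHyp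
  have hN := hP.dHyp_liftθ
  have h1 := congrArg (dHyp (n + 1)) key
  have h2 := symm_sub hα
  rw [hα', show trunc (n - 1) (0 : Fam D) = 0 from funext fun s => by
    rw [trunc]; split_ifs <;> simp, add_zero] at h2
  have h3 : push (comps (retr he)) (push (coneInl (fiberProj e he)) (symm α)) =
      push (dgl e) (symm α) := fam_ext' fun s m x => by
    rw [opm_push, opm_push, opm_push, opg_coneInl, opg'_coneInl, opg_retr_I, opg'_retr_I,
      opg_dgl, opg'_dgl]
  rw [show n + 2 = n + 1 + 1 by ring, dHyp_dHyp (isHyp_trunc hθ rfl), dHyp_sub, dHyp_sub,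
    dHyp_sub, dHyp_push _ hy, ← he.comps_hom, dHyp_push _ (isHyp_trunc hα rfl), ← h2, ← hN,
    fiberPair_α, push_sub, push_sub, he.comps_hom, ← hd] at h1
  rw [← sub_eq_zero, ← h1]
  have h4 : push (comps (retr he)) (push (coneInl (fiberPair he θ α E).f) (symm α)) =
      push (dgl e) (symm α) := h3
  rw [h4]
  abel

end Counit

section

variable {B D Y : Cx A} {n : ℤ} {β : Form B}

theorem isNormalMap_of_zero {X X' : NormalData A} {f : X.C ⟶ X'.C} {ξ : Fam X'.C} {η : Fam X'.C}
    (hξ : IsSym (n + 1) ξ) (h0 : ξ 0 = 0) (hφ : X'.φ - push (comps f) X.φ = dHyp (n + 1) ξ)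
    (hγ : pull (comps f) X'.γ = X.γ) (hη : IsHyp (n + 2) η)
    (hθ : X'.θ - push (comps f) X.θ - ξ = dHyp (n + 2) η) :
    IsNormalMap n X X' f ξ 0 η where
  sym_chain := hξ
  sym_equiv := hφ
  bundle_equiv := ⟨IsForm.zero, by rw [dForm_zero, hγ, sub_self]⟩
  hyp_chain := hη
  hyp_equiv := by
    rw [h0, pushDualHtpy_zero_left, pushDual_zero, hθ, add_zero, add_zero]

theorem isBundleHtpy_comp {C D : Cx A} (f : C ⟶ D) (g : D ⟶ B) (χ : Form D) :
    IsBundleHtpy β (f ≫ g) (pull (comps f) χ) (f ≫ g) (0 + pull (comps f) χ)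
      (Homotopy.refl _) 0 := by
  rw [zero_add]
  exact isBundleHtpy_of_eq rfl _

theorem LData.IsL.cplx_lift_pair {L : LData B} (h : L.IsL n β) :
    BNormalHE n β ((L.pair n).lift n).cplx L.cplx := by
  have := h.dimY.finCx
  have := h.dimD.finCx
  have hP := h.pair_isPair
  have key := retr_counit L.he h.sym.1 h.hypα h.hypθ h.degE h.dθ hP
  have hc : IsFinite (cone (fiberProj L.e L.he)) := h.dimF.1.cone h.dimD.1 _
  have h3 : push (comps (retr L.he)) (push (dgl (coneI (fiberProj L.e L.he)))
      (trunc n L.α + L.ω)) = push (dgl L.e) (trunc n L.α + L.ω) := fam_ext' fun s m x => by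
    rw [opm_push, opm_push, opm_push, opg_dgl, opg'_dgl, opg_retr_I, opg'_retr_I,
      opg_dgl, opg'_dgl]
  refine ⟨retr L.he, gt0 L.θ, 0, trunc n L.θ, Homotopy.refl _, 0,
    (qi_retr L.he).isChainEquiv hc h.dimY.1,
    isNormalMap_of_zero (isSym_gt0 h.hypθ) (if_pos le_rfl)
      (retr_lift_sub L.he h.sym.1 h.hypα h.dα h.hypθ h.degE h.dθ hP) rfl
      (isHyp_trunc h.hypθ (by ring)) ?_, isBundleHtpy_comp _ _ _⟩
  refine Eq.trans ?_ key
  change L.θ + push (dgl L.e) L.ω - push (comps (retr L.he))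
    ((fiberPair L.he L.θ L.α L.E).nullθ n - (fiberPair L.he L.θ L.α L.E).thomK +
      push (dgl (coneI (fiberProj L.e L.he))) (trunc n L.α + L.ω)) - gt0 L.θ = _
  rw [push_add, h3, push_add]
  abel

end

section PairMaps

variable {B C D C' D' : Cx A} {n : ℤ}

theorem opg'_coneMap_I {f : C ⟶ D} {f' : C' ⟶ D'} (g : C ⟶ C') (h : D ⟶ D')
    (k : Homotopy (g ≫ f') (f ≫ h)) (x) : oph' 0 (coneI f) (opg' (comps (coneMap g h k)) x) =
      opg' (comps h) (oph' 0 (coneI f') x) := by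
  revert x; refine dsum_induct fun i x => ?_
  rw [opg'_of, oph'_of i (by ring), oph'_of i (by ring), opg'_of]
  congr 1
  refine Dual.ext fun y => ?_
  rw [dualMap_apply, dualMap_apply, dualMap_apply, dualMap_apply, coneI_self, coneI_self]
  change x ((comps h i y + i.negOnePow • hcomps k (i - 1) i 0, comps g (i - 1) 0) :
    D'.X i × C'.X (i - 1)) = x ((comps h i y, 0) : D'.X i × C'.X (i - 1))
  rw [map_zero, map_zero, smul_zero, add_zero]

theorem opg'_coneMap_R {f : C ⟶ D} {f' : C' ⟶ D'} (g : C ⟶ C') (h : D ⟶ D')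
    (k : Homotopy (g ≫ f') (f ≫ h)) (x) : oph' 1 (coneR f) (opg' (comps (coneMap g h k)) x) =
      opg' (comps g) (oph' 1 (coneR f') x) + oph' 1 (hcomps k) (eps (oph' 0 (coneI f') x)) := by
  revert x; refine dsum_induct fun i x => ?_
  rw [opg'_of, oph'_of (i - 1) (by ring), oph'_of (i - 1) (by ring), opg'_of,
    oph'_of i (by ring), eps_of, map_usmul, oph'_of (i - 1) (by ring),
    ← map_usmul, ← map_add]
  congr 1
  refine Dual.ext fun y => ?_
  rw [Dual.add_apply, Dual.units_smul_apply, dualMap_apply, dualMap_apply, dualMap_apply,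
    dualMap_apply, dualMap_apply, dualMap_apply, coneR_self, coneR_self, coneI_self]
  change x ((comps h i 0 + i.negOnePow • hcomps k (i - 1) i y, comps g (i - 1) y) :
    D'.X i × C'.X (i - 1)) = x ((0, comps g (i - 1) y) : D'.X i × C'.X (i - 1)) +
    i.negOnePow • x ((hcomps k (i - 1) i y, 0) : D'.X i × C'.X (i - 1))
  rw [map_zero, zero_add]
  refine Eq.trans (Eq.trans (congrArg x ?_) (map_add x _ _)) (congrArg₂ (· + ·) rfl
    (Dual.map_usmul (M := (cone f').X i) x i.negOnePow
      ((hcomps k (i - 1) i y, 0) : D'.X i × C'.X (i - 1))))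
  refine Prod.ext ?_ ?_
  · exact (zero_add _).symm
  · change _ = comps g (i - 1) y + i.negOnePow • (0 : C'.X (i - 1))
    rw [smul_zero, add_zero]

variable {P P' : PairData A} {g : P.C ⟶ P'.C} {h : P.D ⟶ P'.D}
  {k : Homotopy (g ≫ P'.f) (P.f ≫ h)} {δξ : Fam P'.D} {ξ : Fam P'.C}

theorem IsPairMap.dHyp_pairMapα (hP : P.IsPair n) (hP' : P'.IsPair n)
    (hm : IsPairMap n P P' g h k δξ ξ) :
    dHyp (n + 1) (pairMapα n k δξ ξ) = P'.α - push (comps h) P.α := by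
  have := hP.finC
  have := hP.finD
  have := hP'.finC
  have := hP'.finD
  have h1 := dHyp_pushHtpy k (hP.quad.1.hyp (m := n) (by ring))
  rw [dHyp_hyp (n := n - 1) (by ring) hP.quad.1, hP.quad.2, hyp_zero, zero_add,
    pushHtpy_usmul, ← eq_sub_iff_add_eq] at h1
  have h2 := hm.sym_equiv
  rw [sub_eq_iff_eq_add] at h2
  have h3 := hm.quad_equiv
  rw [sub_eq_iff_eq_add] at h3
  rw [pairMapα, dHyp_add, dHyp_add, h1, dHyp_push _ (hm.quad_chain.hyp rfl),
    dHyp_hyp rfl hm.quad_chain, PairData.α, PairData.α, h2, h3, hyp_add, push_add, push_add,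
    push_add, push_usmul, hyp_push, push_comps_comp, push_comps_comp]
  rcases sgn_cases n with hn | hn <;>
  simp only [sign_simps, smul_simps, hn] <;>
  abel

theorem IsPairMap.isHyp_pairMapα (hP : P.IsPair n) (hm : IsPairMap n P P' g h k δξ ξ) :
    IsHyp (n + 1) (pairMapα n k δξ ξ) :=
  (hm.sym_chain.isHyp.add ((hm.quad_chain.hyp rfl).push _)).add
    ((hP.quad.1.hyp (m := n) (by ring)).pushHtpy rfl _ _ _)

/-- The composite of the duality equivalence of a pair with a map of pairs. -/
abbrev mapEvD (g : P.C ⟶ P'.C) (h : P.D ⟶ P'.D) (k : Homotopy (g ≫ P'.f) (P.f ≫ h)) :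
    DMap (cone P'.f) P'.D :=
  fun p q => comps h q ∘ₗ P.evD p q ∘ₗ dualMap (comps (coneMap g h k) p)

theorem IsPairMap.isDeg_pairMapHtpy (hP : P.IsPair n) (hm : IsPairMap n P P' g h k δξ ξ) :
    IsDeg (n + 1) (pairMapHtpy k δξ ξ) := fun p q hpq => by
  have h1 := hP.isDeg_oneT (p - 1) (q - 1) (by omega)
  have h2 := hm.quad_chain.oneT 0 (p - 1) q (by omega)
  have h3 := hm.sym_chain 0 p q (by omega)
  rw [pairMapHtpy, h1, h2, h3]
  simp

theorem IsPairMap.opm_oneT_opd' (hP : P.IsPair n) (hP' : P'.IsPair n)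
    (hm : IsPairMap n P P' g h k δξ ξ) (y) :
    opm n (oneT ξ 0) (opd' P'.C y) = eps (opm (n - 1) (oneT P'.ψ 0) y -
      opg (comps g) (opm (n - 1) (oneT P.ψ 0) (opg' (comps g) y)) -
        opd P'.C (opm n (oneT ξ 0) y)) := by
  have := hP.finC
  have := hP'.finC
  have h1 := congrArg oneT hm.quad_equiv
  rw [oneT_sub, oneT_push, ← dHyp_oneT hm.quad_chain] at h1
  have h1 := congrArg (fun φ => opm (n - 1) φ y) (congrFun h1 0)
  have h2 : oneT ξ (0 - 1) = 0 := hm.quad_chain.oneT.eq_zero (by norm_num)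
  simp only [Pi.sub_apply, opm_sub, opm_push, opm_dHyp, h2, famT_eq, dmT_zero, smul_zero,
    add_zero, opm_zero, sub_add_cancel] at h1
  rw [h1]
  rw [add_sub_cancel_left, eps_eps]

theorem IsPairMap.dmD_pairMapHtpy (hP : P.IsPair n) (hP' : P'.IsPair n)
    (hm : IsPairMap n P P' g h k δξ ξ) :
    dmD (pairMapHtpy k δξ ξ) = P'.evD - mapEvD g h k := by
  have := hP.finC
  have := hP.finD
  have := hP'.finC
  have := hP'.finD
  refine opm_ext (m := n) (fun p q hpq => ?_) (fun p q hpq => ?_) fun x => ?_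
  · rw [dmD, hm.isDeg_pairMapHtpy hP _ _ (by omega), hm.isDeg_pairMapHtpy hP _ _ (by omega)]
    simp
  · rw [Pi.sub_apply, Pi.sub_apply, hP'.isDeg_evD _ _ hpq, mapEvD, hP.isDeg_evD _ _ hpq]
    simp
  have h3 : ∀ y, opm (n - 1) (oneT P.ψ 0) (opd' P.C y) =
      -eps (opd P.C (opm (n - 1) (oneT P.ψ 0) y)) := fun y => by
    have := opm_dmD (n - 1 - 1) (oneT P.ψ 0) y
    rw [dmD_oneT hP.quad, opm_zero, sub_add_cancel] at this
    rw [eq_neg_of_add_eq_zero_left this.symm, map_neg, eps_eps, neg_neg]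
  have h4 : ∀ y, oph 1 (hcomps k) (opd P.C y) = opg (comps P'.f) (opg (comps g) y) -
      opg (comps h) (opg (comps P.f) y) - opd P'.D (oph 1 (hcomps k) y) := fun y => by
    have := oph_htpy k y
    rw [opg_comps_comp, opg_comps_comp, AddMonoidHom.comp_apply, AddMonoidHom.comp_apply] at this
    rw [← this]
    abel
  have h5 : ∀ y, oph' 1 (hcomps k) (opd' P'.D y) = opg' (comps g) (opg' (comps P'.f) y) -
      opg' (comps P.f) (opg' (comps h) y) - opd' P.C (oph' 1 (hcomps k) y) := fun y => by
    have := oph'_htpy k y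
    rw [← opg'_comp, ← opg'_comp]
    change _ = opg' (comps (g ≫ P'.f)) y - opg' (comps (P.f ≫ h)) y - _
    rw [← this]
    abel
  have h6 : ∀ y, opm (n + 1) (δξ 0) (opd' P'.D y) = eps (opm n (P'.δφ 0) y -
      opg (comps h) (opm n (P.δφ 0) (opg' (comps h) y)) -
      n.negOnePow • (oph 1 (hcomps k) (opm (n - 1) (oneT P.ψ 0) (opg' (comps P.f)
        (opg' (comps h) y))) + eps (opg (comps P'.f) (opg (comps g) (opm (n - 1) (oneT P.ψ 0)
          (oph' 1 (hcomps k) y))))) - n.negOnePow • opg (comps P'.f) (opm n (oneT ξ 0)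
            (opg' (comps P'.f) y)) - opd P'.D (opm (n + 1) (δξ 0) y)) := fun y => by
    have h1 := congrArg (fun φ => opm n φ y) (congrFun hm.sym_equiv 0)
    have h2 : δξ (0 - 1) = 0 := hm.sym_chain.eq_zero (by norm_num)
    simp only [Pi.add_apply, Pi.sub_apply, Pi.smul_apply, opm_add, opm_sub, opm_usmul,
      opm_push, opm_dHyp, h2, famT_eq, dmT_zero, smul_zero, add_zero, opm_pushHtpy, opm_zero,
      hP.quad.1.oneT.eq_zero (show (0 : ℤ) - 1 < 0 by norm_num), map_zero, opg_comps_comp,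
      AddMonoidHom.comp_apply] at h1
    rw [show opg' (comps (P.f ≫ h)) y = opg' (comps P.f) (opg' (comps h) y) from
      opg'_comp (comps P.f) (comps h) y] at h1
    apply_fun eps using fun a b hab => by rw [← eps_eps a, hab, eps_eps]
    rw [eps_eps]
    rw [eq_sub_of_add_eq' (eq_sub_of_add_eq h1.symm)]
    abel
  have h7 := hm.opm_oneT_opd' hP hP'
  rw [opm_dmD, opm_sub, opm_comp, opm_evD, opm_evD, opm_pairMapHtpy, opm_pairMapHtpy, opd'_coneI,
    opd'_coneR, opg'_coneMap_I, opg'_coneMap_R]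
  simp only [hom_simps, add_sub_cancel_right, show n + 1 - 2 = n - 1 by ring, opd'_eps, oph'_eps,
    opm_eps, h5, h3, h4, h6, h7, ← opg'_opd', ← opg_opd, opg'_opd', eps_eps, opg'_eps, oph_eps,
    opg_eps, opd_eps, negOnePow_one]
  rcases sgn_cases n with hn | hn <;>
  simp only [sign_simps, smul_simps, hn, neg_add, neg_sub, map_add, map_neg, map_sub, eps_eps] <;>
  abel

end PairMaps

section NormalStructures

variable {B C D C' D' : Cx A} {n m : ℤ}

theorem exists_push_of_cycle [FinCx C] [FinCx D] {f : C ⟶ D} (hf : IsChainEquiv f) {α : Fam D}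
    (hα : IsHyp m α) (hα' : dHyp m α = 0) :
    ∃ (a : Fam C) (w : Fam D), IsHyp m a ∧ dHyp m a = 0 ∧ IsHyp (m + 1) w ∧
      α - push (comps f) a = dHyp (m + 1) w := by
  obtain ⟨e, rfl⟩ := hf
  have h1 := dHyp_pushHtpy e.homotopyInvHomId.symm hα
  rw [hα', pushHtpy_zero, add_zero, push_id, push_comps_comp] at h1
  exact ⟨push (comps e.inv) α, _, hα.push _, by rw [dHyp_push _ hα, hα', push_zero],
    hα.pushHtpy rfl _ _ _, h1.symm⟩

theorem exists_of_push_eq [FinCx C] [FinCx D] {f : C ⟶ D} (hf : IsChainEquiv f) {z : Fam C}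
    {w : Fam D} (hz : IsHyp m z) (hz' : dHyp m z = 0) (hw : IsHyp (m + 1) w)
    (hw' : dHyp (m + 1) w = -push (comps f) z) :
    ∃ (c : Fam C) (v : Fam D), IsHyp (m + 1) c ∧ dHyp (m + 1) c = z ∧ IsHyp (m + 2) v ∧
      w + push (comps f) c = dHyp (m + 2) v := by
  obtain ⟨e, rfl⟩ := hf
  have h1 := dHyp_pushHtpy e.homotopyHomInvId.symm hz
  rw [hz', pushHtpy_zero, add_zero, push_id, push_comps_comp] at h1
  set c₀ := pushHtpy m (hcomps e.homotopyHomInvId.symm) (comps (e.hom ≫ e.inv)) (comps (𝟙 C)) z -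
    push (comps e.inv) w with hc₀
  have h2 : IsHyp (m + 1) c₀ := (hz.pushHtpy rfl _ _ _).sub (hw.push _)
  have h3 : dHyp (m + 1) c₀ = z := by
    rw [hc₀, dHyp_sub, h1, dHyp_push _ hw, hw', push_neg]
    abel
  obtain ⟨a, v, ha, ha', hv, hav⟩ := exists_push_of_cycle ⟨e, rfl⟩
    (hw.add (h2.push (comps e.hom)))
    (by rw [dHyp_add, hw', dHyp_push _ h2, h3, neg_add_cancel])
  refine ⟨c₀ - a, v, h2.sub ha, by rw [dHyp_sub, h3, ha', sub_zero], by rwa [add_assoc] at hv, ?_⟩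
  rw [show m + 2 = m + 1 + 1 by ring, ← hav, push_sub]
  abel

/-- The inverse of the suspension. -/
def unsusp (n : ℤ) (θ : Fam (nDual n C)) : Form C := fun s a b =>
  (n * b).negOnePow • (dualMap (idMap C b (n - (n - b))) ∘ₗ
    (θ (s + n) (n - a) (n - b) : Dual A (Dual A (C.X (n - (n - a)))) →ₗ[A] _) ∘ₗ ev ∘ₗ
      idMap C a (n - (n - a)))

theorem suspFam_unsusp [FinCx C] (n : ℤ) (θ : Fam (nDual n C)) : suspFam n (unsusp n θ) = θ := by
  have key : ∀ s s' p p' q q' : ℤ, s' = s → p' = p → q' = q →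
      (dualMap (idMap C (n - q) (n - q')) ∘ₗ (θ s' p' q' : Dual A (Dual A (C.X (n - p'))) →ₗ[A]
        Dual A (C.X (n - q'))) ∘ₗ ev ∘ₗ idMap C (n - p) (n - p')) ∘ₗ unev = θ s p q := by
    rintro s _ p _ q _ rfl rfl rfl
    refine LinearMap.ext fun x => ?_
    rw [idMap_self, idMap_self, dualMap_id]
    exact congrArg _ (ev_unev x)
  funext s p q
  have h1 := key s (s - n + n) p (n - (n - p)) q (n - (n - q)) (by ring) (by ring) (by ring)
  refine Eq.trans (LinearMap.ext fun x => ?_) h1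
  exact usmul_usmul (G := Dual A (C.X (n - q))) (n * (n - q)).negOnePow _

theorem form_eq_zero_of_suspFam [FinCx C] {γ : Form C} {s a b : ℤ}
    (h : suspFam n γ (s + n) (n - a) (n - b) = 0) : γ s a b = 0 := by
  have key : ∀ s' a' b', s' = s → a' = a → b' = b → γ s' a' b' = 0 → γ s a b = 0 := by
    rintro _ _ _ rfl rfl rfl h; exact h
  refine key (s + n - n) (n - (n - a)) (n - (n - b)) (by ring) (by ring) (by ring)
    (LinearMap.ext fun x => ?_)
  have h1 := LinearMap.congr_fun h (ev x)
  change (n * (n - (n - b))).negOnePow • γ (s + n - n) (n - (n - a)) (n - (n - b))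
    (unev (ev x)) = 0 at h1
  rw [unev_ev] at h1
  rw [← usmul_usmul (n * (n - (n - b))).negOnePow
    (γ (s + n - n) (n - (n - a)) (n - (n - b)) x), h1, smul_zero]
  rfl

theorem suspFam_injective [FinCx C] {γ γ' : Form C} (h : suspFam n γ = suspFam n γ') : γ = γ' := by
  rw [← sub_eq_zero]
  funext s a b
  refine form_eq_zero_of_suspFam (n := n) ?_
  rw [suspFam_sub, h, sub_self]
  rfl

theorem isForm_unsusp [FinCx C] {θ : Fam (nDual n C)} (h : IsHyp m θ) :
    IsForm (m - n) (unsusp n θ) := fun s a b hs =>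
  form_eq_zero_of_suspFam (n := n) (by rw [suspFam_unsusp]; exact h _ _ _ (by omega))

variable [FinCx C] [FinCx D] {G : DMap C D}

theorem exists_bundle (hG : dmD G = 0) (eG : IsChainEquiv (dmHom n G hG))
    {α : Fam D} (hα : IsHyp n α) (hα' : dHyp n α = 0) :
    ∃ (γ : Form C) (θ : Fam D), IsBundle γ ∧ IsHyp (n + 1) θ ∧
      α - pushDual n G γ = dHyp (n + 1) θ := by
  obtain ⟨a, w, ha, ha', hw, h⟩ := exists_push_of_cycle eG hα hα'
  refine ⟨unsusp n a, w, ⟨by simpa using isForm_unsusp ha, suspFam_injective (n := n) ?_⟩, hw, ?_⟩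
  · have := dHyp_suspFam n n (unsusp n a)
    rw [sub_self, suspFam_unsusp, ha'] at this
    rw [← this, suspFam_zero]
  · rw [pushDual_eq, suspFam_unsusp]
    exact h

theorem exists_bundleEquiv (hG : dmD G = 0) (eG : IsChainEquiv (dmHom n G hG))
    {z : Form C} {w : Fam D} (hz : IsBundle z) (hw : IsHyp (n + 1) w)
    (hw' : dHyp (n + 1) w = -pushDual n G z) :
    ∃ (χ : Form C) (η : Fam D), IsForm 1 χ ∧ dForm 1 χ = z ∧ IsHyp (n + 2) η ∧
      w + pushDual n G χ = dHyp (n + 2) η := by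
  obtain ⟨c, v, hc, hc', hv, h⟩ := exists_of_push_eq eG
    (isHyp_suspFam (n := n) (k := n) hz.1 (by ring))
    (by rw [dHyp_suspFam, sub_self, hz.2, suspFam_zero]) hw (by rw [hw', pushDual_eq]; rfl)
  refine ⟨unsusp n c, v, by simpa using isForm_unsusp hc, suspFam_injective (n := n) ?_, hv, ?_⟩
  · have := dHyp_suspFam n (n + 1) (unsusp n c)
    rw [add_sub_cancel_left, suspFam_unsusp, hc'] at this
    exact this.symm
  · rw [pushDual_eq, suspFam_unsusp]
    exact h

end NormalStructures

section Pairs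

variable {n : ℤ} {P P' : PairData A}

theorem IsBundle.sub {C : Cx A} {γ γ' : Form C} (h : IsBundle γ) (h' : IsBundle γ') :
    IsBundle (γ - γ') := ⟨h.1.sub h'.1, by rw [dForm_sub, h.2, h'.2, sub_zero]⟩

theorem IsBundle.pull {C D : Cx A} {γ : Form D} (h : IsBundle γ) (f : C ⟶ D) :
    IsBundle (pull (comps f) γ) :=
  ⟨h.1.pull _, by rw [dForm_pull _ h.1, h.2, pull_zero]⟩

theorem PairData.IsPoincare.exists_normalStr (h : P.IsPoincare n) :
    ∃ γ θ, P.IsNormalStr n γ θ := by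
  have := h.finC
  have := h.finD
  exact exists_bundle _ h.eqv_evD h.toIsPair.isHyp_α h.toIsPair.dHyp_α

theorem PairData.IsPoincare.normalStrEquiv (h : P.IsPoincare n) {γ γ' : Form (cone P.f)}
    {θ θ' : Fam P.D} (hn : P.IsNormalStr n γ θ) (hn' : P.IsNormalStr n γ' θ') :
    P.NormalStrEquiv n γ θ γ' θ' := by
  have := h.finC
  have := h.finD
  obtain ⟨χ, η, h1, h2, h3, h4⟩ := exists_bundleEquiv _ h.eqv_evD (z := γ' - γ) (w := θ' - θ)
    (hn'.1.sub hn.1) (hn'.2.1.sub hn.2.1) (by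
      rw [dHyp_sub, ← hn'.2.2, ← hn.2.2, pushDual_sub]; abel)
  refine ⟨χ, -η, ⟨h1, h2⟩, h3.neg, ?_⟩
  rw [dHyp_neg, ← h4]
  abel

theorem IsPairMap.exists_normalPairMap (h : P.IsPoincare n) (h' : P'.IsPoincare n)
    {g : P.C ⟶ P'.C} {b : P.D ⟶ P'.D} {k : Homotopy (g ≫ P'.f) (P.f ≫ b)} {δξ : Fam P'.D}
    {ξ : Fam P'.C} (hm : IsPairMap n P P' g b k δξ ξ) (hb : IsChainEquiv b)
    {γ : Form (cone P.f)} {θ : Fam P.D} {γ' : Form (cone P'.f)} {θ' : Fam P'.D}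
    (hn : P.IsNormalStr n γ θ) (hn' : P'.IsNormalStr n γ' θ') :
    ∃ ζ η, IsNormalPairMap n P P' γ θ γ' θ' g b k δξ ξ ζ η := by
  have := h.finC
  have := h.finD
  have := h'.finC
  have := h'.finD
  have hP := h.toIsPair
  have hP' := h'.toIsPair
  have hG : dmD (fun p q => comps b q ∘ₗ P.evD p q : DMap (cone P.f) P'.D) = 0 := by
    rw [dmD_comp_left, hP.dmD_evD]; funext p q; exact comp_zero _
  have eG : IsChainEquiv (dmHom n _ hG) := by
    have h1 : dmHom n _ hG = dmHom n _ hP.dmD_evD ≫ b := hom_ext_comps fun i => rfl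
    obtain ⟨e, he⟩ := h.eqv_evD
    obtain ⟨e', he'⟩ := hb
    exact ⟨e.trans e', by rw [h1, ← he, ← he']; rfl⟩
  have hE' : dmD (mapEvD g b k) = 0 := dmD_comp_eq_zero hP.dmD_evD _ _
  obtain ⟨ζ, η, h1, h2, h3, h4⟩ := exists_bundleEquiv hG eG
    (z := pull (comps (coneMap g b k)) γ' - γ)
    (w := θ' - push (comps b) θ - pairMapα n k δξ ξ +
      pushDualHtpy n (pairMapHtpy k δξ ξ) (mapEvD g b k) P'.evD γ')
    ((hn'.1.pull _).sub hn.1)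
    (((hn'.2.1.sub (hn.2.1.push _)).sub (hm.isHyp_pairMapα hP)).add
      (isHyp_pushDualHtpy hn'.1.1 _ _ _ (by ring))) (by
      rw [dHyp_add, dHyp_sub, dHyp_sub, dHyp_push _ hn.2.1, ← hn'.2.2, ← hn.2.2,
        hm.dHyp_pairMapα hP hP', dHyp_pushDualHtpy (hm.isDeg_pairMapHtpy hP) hE' hP'.dmD_evD
          (hm.dmD_pairMapHtpy hP hP') hn'.1, pushDual_sub, pushDual_pull, push_sub, push_pushDual]
      change _ = -(pushDual n (mapEvD g b k) γ' - _)
      abel)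
  exact ⟨ζ, η, hm, ⟨h1, h2⟩, h3, h4⟩

end Pairs

section Cross

variable {B C D C' D' : Cx A} {n : ℤ}

theorem oph_add (k : ℤ) (a b : HMap C D) (x) : oph k (a + b) x = oph k a x + oph k b x := by
  revert x; refine dsum_induct fun i x => ?_
  rw [oph_of (i + k) rfl, oph_of (i + k) rfl, oph_of (i + k) rfl, ← map_add]; rfl

theorem oph'_add (k : ℤ) (a b : HMap C D) (x) : oph' k (a + b) x = oph' k a x + oph' k b x := by
  revert x; refine dsum_induct fun i x => ?_
  rw [oph'_of (i - k) (by ring), oph'_of (i - k) (by ring), oph'_of (i - k) (by ring),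
    ← map_add, Pi.add_apply, Pi.add_apply, dualMap_add]
  rfl

/-- The second order homotopy `(-1)^q b θ_s a^*` between the composite of the homotopies induced by
`a` and `b` and the homotopy induced by `a + b`. -/
def cross (b a : HMap C D) (θ : Fam C) : Fam D := fun s => sgn (sand 1 1 b (θ s) a)

theorem opm_cross (b a : HMap C D) (θ : Fam C) (m s : ℤ) (x) : opm m (cross b a θ s) x =
    eps (oph 1 b (opm (m - 1 - 1) (θ s) (oph' 1 a x))) := by
  rw [cross, opm_sgn, opm_sand]

theorem opm_famT_cross [FinCx C] [FinCx D] (b a : HMap C D) (θ : Fam C) (m s : ℤ) (x) :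
    opm m (famT (cross b a θ) s) x =
      -eps (oph 1 a (opm (m - 1 - 1) (famT θ s) (oph' 1 b x))) := by
  rw [famT_eq, cross, dmT_sgn, opm_dmT_sand_oo _ _ _ _ _ _ _ (by norm_num) (by norm_num),
    map_usmul, negOnePow_add, negOnePow_one, mul_neg, mul_one, Units.neg_smul,
    smul_neg, usmul_usmul]
  rfl

theorem IsHyp.cross {θ : Fam C} {m k : ℤ} (h : IsHyp m θ) (hk : k = m + 2) (b a : HMap C D) :
    IsHyp k (cross b a θ) := fun s p q hpq => by
  rw [APC.cross, sgn, sand, h s (p - 1) (q - 1) (by omega)]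
  simp

theorem pushHtpy_add_htpy [FinCx C] [FinCx D] {f f' f'' : C ⟶ D} (a : Homotopy f' f)
    (b : Homotopy f'' f') {θ : Fam C} (hθ : IsHyp n θ) :
    pushHtpy n (hcomps a + hcomps b) (comps f) (comps f'') θ =
      pushHtpy n (hcomps a) (comps f) (comps f') θ +
      pushHtpy n (hcomps b) (comps f') (comps f'') θ -
      dHyp (n + 2) (cross (hcomps b) (hcomps a) θ) +
      cross (hcomps b) (hcomps a) (dHyp n θ) := by
  have hc : ∀ {g g' : C ⟶ D} (h : Homotopy g' g) (y), oph' 1 (hcomps h) (opd' D y) =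
      opg' (comps g') y - opg' (comps g) y - opd' C (oph' 1 (hcomps h) y) := fun h y => by
    rw [← oph'_htpy h y]; abel
  have hc' : ∀ {g g' : C ⟶ D} (h : Homotopy g' g) (y), opd D (oph 1 (hcomps h) y) =
      opg (comps g') y - opg (comps g) y - oph 1 (hcomps h) (opd C y) := fun h y => by
    rw [← oph_htpy h y]; abel
  refine fam_ext (n := n + 1) (hθ.pushHtpy rfl _ _ _) ((((hθ.pushHtpy rfl _ _ _).add
    (hθ.pushHtpy rfl _ _ _)).sub ((hθ.cross rfl _ _).dHyp (by ring))).add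
      ((hθ.dHyp (m := n - 1) (by ring)).cross (by ring) _ _)) fun s x => ?_
  simp only [hom_simps, Pi.add_apply, Pi.sub_apply, opm_add, opm_sub, opm_pushHtpy, opm_dHyp,
    opm_cross, opm_famT_cross, oph_add, oph'_add, hc, hc', opd_eps, show n + 1 + s + 1 - 1 - 1 = n
    + 1 + s - 1 by ring, show n + 1 + s - 1 - 1 + 1 = n + 1 + s - 1 by ring]
  rcases sgn_cases n with hn | hn <;>
  rcases sgn_cases s with hr | hr <;>
  simp only [sign_simps, smul_simps, hn, hr, neg_add, neg_sub, map_add, map_neg, map_sub, eps_eps,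
    oph_eps,
    negOnePow_two] <;>
  abel

end Cross

section LiftMap

variable {B : Cx A} {n : ℤ}
  {P P' : PairData A} {g : P.C ⟶ P'.C} {h : P.D ⟶ P'.D}
  (k : Homotopy (g ≫ P'.f) (P.f ≫ h)) (δξ : Fam P'.D) (ξ : Fam P'.C)

/-- The image of a homotopy of pair maps in the cone. -/
abbrev inlHtpy : Homotopy ((g ≫ P'.f) ≫ coneInlHom P'.f) ((P.f ≫ h) ≫ coneInlHom P'.f) :=
  k.compRight (coneInlHom P'.f)

/-- The null-homotopy of the restriction of the inclusion into the cone. -/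
abbrev mapNull : Homotopy (0 : P.C ⟶ cone P'.f) ((g ≫ P'.f) ≫ coneInlHom P'.f) :=
  htpyCongr Limits.comp_zero.symm (Category.assoc _ _ _) ((nullHtpy P'.f).compLeft g)

theorem oph_inlHtpy (x) : oph 1 (hcomps (inlHtpy k)) x =
    oph 0 (coneI P'.f) (oph 1 (hcomps k) x) := by
  revert x; refine dsum_induct fun i x => ?_
  rw [oph_of (i + 1) rfl, oph_of (i + 1) rfl, oph_of (i + 1) (by ring), hcomps_compRight,
    comps_coneInlHom, coneI_self]
  rfl

theorem oph'_inlHtpy (x) : oph' 1 (hcomps (inlHtpy k)) x =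
    oph' 1 (hcomps k) (oph' 0 (coneI P'.f) x) := by
  revert x; refine dsum_induct fun i x => ?_
  rw [oph'_of (i - 1) (by ring), oph'_of i (by ring), oph'_of (i - 1) (by ring),
    hcomps_compRight, comps_coneInlHom, coneI_self]
  rfl

theorem oph_mapNull (x) : oph 1 (hcomps (mapNull (P' := P') (g := g))) x =
    eps (oph 1 (coneR P'.f) (opg (comps g) x)) := by
  rw [← oph_coneNull]
  revert x; refine dsum_induct fun i x => ?_
  rw [oph_of (i + 1) rfl, opg_of, oph_of (i + 1) (by ring), hcomps_htpyCongr, hcomps_compLeft,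
    hcomps_nullHtpy]
  rfl

theorem oph'_mapNull (x) : oph' 1 (hcomps (mapNull (P' := P') (g := g))) x =
    opg' (comps g) (oph' 1 (coneR P'.f) (eps x)) := by
  rw [← oph'_coneNull]
  revert x; refine dsum_induct fun i x => ?_
  rw [oph'_of (i - 1) (by ring), oph'_of (i - 1) (by ring), opg'_of, hcomps_htpyCongr,
    hcomps_compLeft, hcomps_nullHtpy]
  rfl

/-- The second order homotopy of the null-homotopy with itself, applied to `(1 + T) ξ`. -/
def nullCross : Fam (cone P'.f) := cross (coneR P'.f) (coneR P'.f) (oneT ξ)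

/-- The symmetric chain of the normal map induced by a map of pairs. -/
def liftξ (n : ℤ) : Fam (cone P'.f) := fun s =>
  if s = 0 then fun p q => coneInl P'.f q ∘ₗ pairMapHtpy k δξ ξ p q
  else push (coneInl P'.f) δξ s - if s = 1 then n.negOnePow • nullCross ξ 0 else 0

variable {k δξ ξ}

theorem opm_compLeftI {C D : Cx A} {E : Cx A} (f : C ⟶ D) (m : ℤ) (G : DMap E D) (x) :
    opm m (fun p q => coneInl f q ∘ₗ G p q : DMap E (cone f)) x = oph 0 (coneI f) (opm m G x) := by
  rw [← opg_coneInl]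
  revert x; refine dsum_induct fun p x => ?_
  rw [opm, opm, hat_of _ rfl, hat_of _ rfl, opg_of]; rfl

theorem opm_pushHtpy_null (m s : ℤ) {j : ℤ} (θ : Fam P'.C) (x) :
    opm m (pushHtpy j (coneNull P'.f) (fun i => coneInl P'.f i ∘ₗ comps P'.f i) 0 θ s) x =
      eps (oph 1 (coneR P'.f) (opm (m - 1) (θ s) (opg' (comps P'.f) (oph' 0 (coneI P'.f) x)))) +
      (j + 1).negOnePow • m.negOnePow • eps (oph 1 (coneR P'.f) (opm (m - 1 - 1)
        (famT θ (s - 1)) (oph' 1 (coneR P'.f) x))) := by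
  have h0 : ∀ y, opg (0 : GMap P'.C (cone P'.f)) y = 0 := opg_zero'
  rw [opm_pushHtpy, oph_coneNull, oph_coneNull, oph'_coneNull, h0, map_zero, add_zero,
    opg'_comp, opg'_coneInl, eps_eps, oph'_eps, map_usmul, map_usmul, opm_eps,
    map_usmul, oph_eps]
  rcases sgn_cases m with hm | hm <;>
  simp [negOnePow_sub, hm]

theorem IsPairMap.isSym_liftξ (hP : P.IsPair n) (hm : IsPairMap n P P' g h k δξ ξ) :
    IsSym (n + 1) (liftξ k δξ ξ n) := fun s p q hs => by
  rw [liftξ]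
  split_ifs with h0 h1
  · change coneInl P'.f q ∘ₗ pairMapHtpy k δξ ξ p q = 0
    rw [hm.isDeg_pairMapHtpy hP p q (by omega), comp_zero]
  · rw [Pi.sub_apply, Pi.sub_apply, push, hm.sym_chain _ _ _ hs, Pi.smul_apply, Pi.smul_apply,
      nullCross, (hm.quad_chain.oneT.isHyp.cross rfl _ _) 0 p q (by omega)]
    simp
  · rw [sub_zero, push, hm.sym_chain _ _ _ hs]
    simp

theorem IsPairMap.isHyp_nullCross (hm : IsPairMap n P P' g h k δξ ξ) :
    IsHyp (n + 2) (nullCross ξ) := hm.quad_chain.oneT.isHyp.cross rfl _ _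

theorem IsPairMap.lift_comparison (hP : P.IsPair n) (hP' : P'.IsPair n)
    (hm : IsPairMap n P P' g h k δξ ξ) :
    push (coneInl P'.f) δξ - n.negOnePow • pushHtpy n (coneNull P'.f)
        (fun i => coneInl P'.f i ∘ₗ comps P'.f i) 0 (oneT ξ) -
      (n - 1).negOnePow • cross (hcomps (mapNull (P' := P') (g := g))) (hcomps (inlHtpy k))
        (oneT P.ψ) - P'.thomK + push (comps (coneMap g h k)) P.thomK - liftξ k δξ ξ n =
      dHyp (n + 2) (nullCross ξ) := by
  have := hP.finC
  have := hP.finD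
  have := hP'.finC
  have := hP'.finD
  have h7 := hm.opm_oneT_opd' hP hP'
  have hξ := hm.quad_chain.oneT
  have hψ := hP.quad.1.oneT
  have h0 : ∀ (r m : ℤ) (y), r ≠ 0 → opm m (oneT ξ r) y = 0 := fun r m y hr => by
    rw [oneT_apply, if_neg hr, opm_zero]
  have h0' : ∀ (r m : ℤ) (y), r ≠ 0 → opm m (oneT P.ψ r) y = 0 := fun r m y hr => by
    rw [oneT_apply, if_neg hr, opm_zero]
  refine fam_ext (n := n + 1) ?_ (((hξ.isHyp).cross rfl _ _).dHyp (by ring)) fun s x => ?_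
  · exact ((((hm.sym_chain.isHyp.push _).sub ((hξ.isHyp.pushHtpy rfl _ _ _).units_smul _)).sub
      ((hψ.isHyp.cross (by ring) _ _).units_smul _)).sub hP'.isSym_thomK.isHyp).add
        (hP.isSym_thomK.isHyp.push _) |>.sub (hm.isSym_liftξ hP).isHyp
  simp only [Pi.add_apply, Pi.sub_apply, Pi.smul_apply, opm_add, opm_sub, opm_usmul, opm_push,
    opm_pushHtpy_null, opm_cross, opm_dHyp, nullCross, liftξ, PairData.thomK, famT_oneT,
    opm_famT_cross, opg_coneInl, opg'_coneInl, oph_inlHtpy, oph'_inlHtpy, oph_mapNull,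
    oph'_mapNull]
  rcases eq_or_ne s 0 with rfl | hs0
  · simp only [hom_simps, if_true, opm_zero, h0 (0 - 1) _ _ (by norm_num), opm_thomHtpy,
    opm_compLeftI, opm_pairMapHtpy, opg'_coneMap_R, opg_coneMap_R, opm_cross, show n + 1 + 0 - 1 -
    1 = n - 1 by ring, show n + 1 + 0 - 2 = n - 1 by ring, show n + 1 + 0 - 1 = n by ring, show n +
    1 + 0 + 1 - 1 - 1 = n by ring, opd'_coneR, opd_coneR, opd_eps, oph'_eps, opm_eps, h7, opg_eps,
    oph_eps]
    rcases sgn_cases n with hn | hn <;>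
    simp only [sign_simps, smul_simps, hn, neg_add, neg_sub, map_add, map_neg, map_sub, eps_eps,
      oph_eps,
      negOnePow_two, map_zero, add_zero, smul_zero] <;>
    abel
  rcases eq_or_ne s 1 with rfl | hs1
  · simp only [if_true, opm_zero, h0 1 _ _ (by norm_num), h0' 1 _ _ (by norm_num), if_neg hs0,
      opm_sub,
      opm_push, opm_usmul, opm_cross, opg_coneInl, opg'_coneInl, famT_oneT, sub_self,
      if_neg one_ne_zero, map_zero]
    rcases sgn_cases n with hn | hn <;>
    simp only [sign_simps, smul_simps, hn, neg_add, neg_sub, map_add, map_neg, map_sub, eps_eps,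
      oph_eps,
      negOnePow_two, map_zero, add_zero, smul_zero] <;>
    abel
  simp only [if_neg hs0, if_neg hs1, opm_zero, h0 s _ _ hs0, h0' s _ _ hs0,
    h0 (s - 1) _ _ (by omega), map_zero, smul_zero, add_zero, sub_zero, opm_sub, opm_push,
    opg_coneInl, opg'_coneInl, sub_self, neg_zero]

end LiftMap

section LiftMap

variable {B : Cx A} {n : ℤ}
  {P P' : PairData A} {g : P.C ⟶ P'.C} {h : P.D ⟶ P'.D}
  {k : Homotopy (g ≫ P'.f) (P.f ≫ h)} {δξ : Fam P'.D} {ξ : Fam P'.C}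

theorem push_coneMap_nullθ (hP : P.IsPair n) (hP' : P'.IsPair n) :
    push (comps (coneMap g h k)) (P.nullθ n) =
      pushHtpy n (hcomps (inlHtpy k) + hcomps (mapNull (P' := P') (g := g)))
        (comps ((P.f ≫ h) ≫ coneInlHom P'.f)) (comps 0) (hyp P.ψ) := by
  have := hP.finC
  have := hP.finD
  have := hP'.finC
  have := hP'.finD
  refine fam_ext' fun s m x => ?_
  have h1 : ∀ r m y, opm m (famT (hyp P.ψ) r) y = opm m (famT P.ψ (-r - 1)) y := fun _ _ _ => rfl
  have h2 : ∀ y, opg' (comps ((P.f ≫ h) ≫ coneInlHom P'.f)) y =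
      opg' (comps P.f) (opg' (comps h) (oph' 0 (coneI P'.f) y)) := fun y => by
    rw [← opg'_coneInl]
    exact (opg'_comp (comps (P.f ≫ h)) (comps (coneInlHom P'.f)) y).trans
      (opg'_comp (comps P.f) (comps h) _)
  rw [opm_push, opm_nullθ, opm_pushHtpy, opg_zero', opg'_coneMap_I, opg'_coneMap_R, h1,
    show -(s - 1) - 1 = -s by ring, h2]
  simp only [hom_simps, oph_add, oph'_add, oph_inlHtpy, oph'_inlHtpy, oph_mapNull, oph'_mapNull,
    opg_eps, opg_coneMap_R, hyp_apply, opm_eps, oph'_eps, opg'_eps, oph_eps, eps_eps, smul_add]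
  rcases sgn_cases n with hn | hn <;>
  rcases sgn_cases m with hr | hr <;>
  simp only [sign_simps, smul_simps, hn, hr, neg_add, map_neg, eps_eps, add_zero] <;>
  abel

theorem pushHtpy_inlHtpy [FinCx P'.C] [FinCx P'.D] (θ : Fam P.C) :
    pushHtpy n (hcomps (inlHtpy k)) (comps ((P.f ≫ h) ≫ coneInlHom P'.f))
      (comps ((g ≫ P'.f) ≫ coneInlHom P'.f)) θ = push (coneInl P'.f)
        (pushHtpy n (hcomps k) (comps (P.f ≫ h)) (comps (g ≫ P'.f)) θ) := by
  rw [push_pushHtpy]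
  congr 1

theorem pushHtpy_mapNull [FinCx P.C] [FinCx P'.C] (θ : Fam P.C) :
    pushHtpy n (hcomps (mapNull (P' := P') (g := g))) (comps ((g ≫ P'.f) ≫ coneInlHom P'.f))
      (comps 0) θ = pushHtpy n (coneNull P'.f) (fun i => coneInl P'.f i ∘ₗ comps P'.f i) 0
        (push (comps g) θ) := by
  rw [pushHtpy_push]
  refine congrArg₂ (fun a b => pushHtpy n a _ b θ) (funext fun i => funext fun j => ?_)
    (funext fun i => ?_)
  · rw [hcomps_htpyCongr, hcomps_compLeft, hcomps_nullHtpy]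
  · rw [comps_zero]
    exact (zero_comp _).symm

theorem cross_usmul {C D : Cx A} (b a : HMap C D) (c : ℤˣ) (θ : Fam C) :
    cross b a (c • θ) = c • cross b a θ :=
  fam_ext' fun s m x => by
    simp only [opm_cross, Pi.smul_apply, opm_usmul, map_usmul]

/-- The hyperquadratic chain of the normal map induced by a map of pairs. -/
def liftη (n : ℤ) (k : Homotopy (g ≫ P'.f) (P.f ≫ h)) (ξ : Fam P'.C) : Fam (cone P'.f) :=
  nullCross ξ + cross (hcomps (mapNull (P' := P') (g := g))) (hcomps (inlHtpy k)) (hyp P.ψ) -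
    pushHtpy (n + 1) (coneNull P'.f) (fun i => coneInl P'.f i ∘ₗ comps P'.f i) 0 (hyp ξ)

theorem IsPairMap.lift_equiv (hP : P.IsPair n) (hP' : P'.IsPair n)
    (hm : IsPairMap n P P' g h k δξ ξ) :
    P'.nullθ n - P'.thomK - push (comps (coneMap g h k)) (P.nullθ n - P.thomK) +
      push (coneInl P'.f) (pairMapα n k δξ ξ) - liftξ k δξ ξ n = dHyp (n + 2) (liftη n k ξ) := by
  have := hP.finC
  have := hP.finD
  have := hP'.finC
  have := hP'.finD
  have h1 := hm.lift_comparison hP hP'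
  have h2 := pushHtpy_add_htpy (inlHtpy k) (mapNull (P' := P') (g := g))
    (hP.quad.1.hyp (m := n) (by ring))
  rw [← push_coneMap_nullθ hP hP', dHyp_hyp (n := n - 1) (by ring) hP.quad.1, hP.quad.2, hyp_zero,
    pushHtpy_inlHtpy, pushHtpy_mapNull] at h2
  have h3 := dHyp_pushHtpy (nullHtpy P'.f) (hm.quad_chain.hyp (m := n + 1) rfl)
  rw [hcomps_nullHtpy, comps_comp_coneInl, comps_zero] at h3
  rw [dHyp_hyp rfl hm.quad_chain, add_sub_cancel_right, pushHtpy_add, pushHtpy_usmul,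
    ← hm.quad_equiv, show hyp (P'.ψ - push (comps g) P.ψ) = hyp P'.ψ - push (comps g) (hyp P.ψ)
      from rfl, pushHtpy_sub, push_zero_left, zero_sub] at h3
  rw [push_sub, h2, pairMapα, push_add, push_add, liftη, dHyp_sub, dHyp_add, ← h1]
  rw [← sub_eq_zero] at h3 ⊢
  refine Eq.trans ?_ h3
  have h5 : push (coneInl P'.f) (push (comps P'.f) (hyp ξ)) =
    push (fun i => coneInl P'.f i ∘ₗ comps P'.f i) (hyp ξ) := rfl
  rw [PairData.nullθ, zero_add, cross_usmul, h5, show n + 1 + 1 = n + 2 by ring]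
  abel

theorem comps_coneMap_coneInl (i : ℤ) : comps (coneMap g h k) i ∘ₗ coneInl P.f i =
    coneInl P'.f i ∘ₗ comps h i := LinearMap.ext fun y => by
  change ((comps h i y + i.negOnePow • hcomps k (i - 1) i 0, comps g (i - 1) 0) :
    P'.D.X i × P'.C.X (i - 1)) = (comps h i y, 0)
  rw [map_zero, map_zero, smul_zero, add_zero]

theorem push_coneMap_coneInl (θ : Fam P.D) :
    push (comps (coneMap g h k)) (push (coneInl P.f) θ) =
      push (coneInl P'.f) (push (comps h) θ) := by
  have key : ∀ a b : GMap P.D (cone P'.f), a = b → push a θ = push b θ :=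
    fun a b hab => by rw [hab]
  exact key _ _ (funext comps_coneMap_coneInl)

theorem IsPairMap.isHyp_liftη (hP : P.IsPair n) (hm : IsPairMap n P P' g h k δξ ξ) :
    IsHyp (n + 2) (liftη n k ξ) :=
  (hm.isHyp_nullCross.add ((hP.quad.1.hyp (m := n) (by ring)).cross rfl _ _)).sub
    ((hm.quad_chain.hyp (m := n + 1) rfl).pushHtpy (by ring) _ _ _)

theorem IsPairMap.lift_sym_equiv (hP : P.IsPair n) (hP' : P'.IsPair n)
    (hm : IsPairMap n P P' g h k δξ ξ) :
    P'.liftφ n - push (comps (coneMap g h k)) (P.liftφ n) = dHyp (n + 1) (liftξ k δξ ξ n) := by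
  have := hP.finC
  have := hP.finD
  have := hP'.finC
  have := hP'.finD
  have h1 := congrArg (dHyp (n + 1)) (hm.lift_equiv hP hP')
  have h2 : dHyp (n + 1) (dHyp (n + 2) (liftη n k ξ)) = 0 := by
    rw [show n + 2 = n + 1 + 1 by ring]
    exact dHyp_dHyp (by simpa [add_assoc] using hm.isHyp_liftη hP)
  rw [h2, dHyp_sub, dHyp_add, dHyp_sub, dHyp_push _ (hP.isHyp_nullθ.sub hP.isSym_thomK.isHyp),
    ← comps_coneInlHom, dHyp_push _ (hm.isHyp_pairMapα hP), hm.dHyp_pairMapα hP hP',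
    ← hP.dHyp_liftθ, ← hP'.dHyp_liftθ, push_sub, push_sub, push_coneMap_coneInl,
    comps_coneInlHom] at h1
  rw [← sub_eq_zero, ← h1]
  abel

theorem IsNormalPairMap.isNormalMap_lift {γ : Form (cone P.f)} {θ : Fam P.D}
    {γ' : Form (cone P'.f)} {θ' : Fam P'.D} {ζ : Form (cone P.f)} {η : Fam P'.D}
    (hP : P.IsPair n) (hP' : P'.IsPair n)
    (hm : IsNormalPairMap n P P' γ θ γ' θ' g h k δξ ξ ζ η) :
    IsNormalMap n
      ⟨cone P.f, P.liftφ n, γ, P.nullθ n - P.thomK + push (dgl (coneI P.f)) θ⟩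
      ⟨cone P'.f, P'.liftφ n, γ', P'.nullθ n - P'.thomK + push (dgl (coneI P'.f)) θ'⟩
      (coneMap g h k) (liftξ k δξ ξ n) ζ (liftη n k ξ + push (coneInl P'.f) η) where
  sym_chain := hm.pair_map.isSym_liftξ hP
  sym_equiv := hm.pair_map.lift_sym_equiv hP hP'
  bundle_equiv := hm.bundle_equiv
  hyp_chain := (hm.pair_map.isHyp_liftη hP).add (hm.hyp_chain.push _)
  hyp_equiv := by
    have := hP'.finC
    have := hP'.finD
    have h1 := congrArg (push (coneInl P'.f)) hm.hyp_equiv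
    rw [push_add, push_add, push_sub, push_sub, push_pushDualHtpy, push_pushDual,
      ← comps_coneInlHom, ← dHyp_push _ hm.hyp_chain] at h1
    have h2 := hm.pair_map.lift_equiv hP hP'
    have h3 : compL (comps (coneMap g h k)) P.inlEvD =
        fun p q => comps (coneInlHom P'.f) q ∘ₗ comps h q ∘ₗ P.evD p q := funext fun p =>
      funext fun q => by
        change comps (coneMap g h k) q ∘ₗ coneInl P.f q ∘ₗ P.evD p q = _
        rw [← comp_assoc, comps_coneMap_coneInl]
        rfl
    have h4 : compLR (comps (coneMap g h k)) P.inlEvD = fun p q => comps (coneInlHom P'.f) q ∘ₗ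
        comps h q ∘ₗ P.evD p q ∘ₗ dualMap (comps (coneMap g h k) p) := funext fun p =>
      funext fun q => congrArg (· ∘ₗ dualMap (comps (coneMap g h k) p))
        (congrFun (congrFun h3 p) q)
    simp only [dgl_coneI, hP.liftφ_zero, hP'.liftφ_zero, h3, h4]
    rw [dHyp_add, ← h2, ← comps_coneInlHom, ← h1, push_add, comps_coneInlHom,
      push_coneMap_coneInl]
    change _ - _ - _ + pushDualHtpy n (fun p q => coneInl P'.f q ∘ₗ pairMapHtpy k δξ ξ p q) _
      (fun p q => coneInl P'.f q ∘ₗ P'.evD p q) _ + _ = _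
    simp only [push_sub]
    abel

theorem BPairData.lift_cplx_of_BPairHE {β : Form B} {P P' : BPairData B} (hP : P.IsPoincare n β)
    (hP' : P'.IsPoincare n β) (H : BPairHE n β P P') :
    BNormalHE n β (P.lift n).cplx (P'.lift n).cplx := by
  obtain ⟨g, h, k, δξ, ξ, ζ, η, l, μ, hg, hh, hm, hl⟩ := H
  exact ⟨coneMap g h k, liftξ k δξ ξ n, ζ, liftη n k ξ + push (coneInl P'.f) η, l, μ,
    (QI.coneMap k hg.qi hh.qi).isChainEquiv
      (hP.poincare.dimC.1.cone hP.poincare.dimD.1 _)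
      (hP'.poincare.dimC.1.cone hP'.poincare.dimD.1 _),
    hm.isNormalMap_lift hP.poincare.toIsPair hP'.poincare.toIsPair, hl⟩

end LiftMap

section StrictMap

variable {B C D E : Cx A} {n : ℤ} {β : Form B}

theorem SurjZero.comp_equiv {f : C ⟶ D} (hf : SurjZero f) {h : D ⟶ E} (hh : IsChainEquiv h) :
    SurjZero (f ≫ h) := by
  obtain ⟨e, rfl⟩ := hh
  intro y hy
  have h1 : opg (comps e.inv) (DirectSum.of (fun i => E.X i) 0 y) =
      DirectSum.of (fun i => D.X i) 0 (comps e.inv 0 y) := opg_of _ _ _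
  obtain ⟨a, b, ha, hb⟩ := hf (comps e.inv 0 y) (by rw [← h1, ← opg_opd, hy, map_zero])
  have h2 := oph_htpy e.homotopyInvHomId (DirectSum.of (fun i => E.X i) 0 y)
  rw [hy, map_zero, add_zero, opg_comps_comp, AddMonoidHom.comp_apply, h1, hb, opg_comps_id] at h2
  refine ⟨a, opg (comps e.hom) b - oph 1 (hcomps e.homotopyInvHomId)
    (DirectSum.of (fun i => E.X i) 0 y), ha, ?_⟩
  rw [opg_comps_comp, AddMonoidHom.comp_apply, map_sub, ← opg_opd, h2, map_add]
  abel

variable {X X' : BNormalData B}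

/-- The target of a map of normal complexes, with the image of the symmetric structure of the
source. -/
def BNormalData.image (n : ℤ) (X X' : BNormalData B) (f : X.C ⟶ X'.C) (ξ : Fam X'.C) :
    BNormalData B where
  C := X'.C
  φ := push (comps f) X.φ
  γ := X'.γ
  θ := X'.θ - ξ + pushDualHtpy n (ξ 0) (compLR (comps f) (X.φ 0)) (X'.φ 0) X'.γ
  g := X'.g
  χ := X'.χ

theorem isChainH_compL (h : IsSymStructure n X.φ) (f : X.C ⟶ X'.C) :
    IsChainH (dmK n (compL (comps f) (X.φ 0))) :=
  isChainH_dmK (fun p q hpq => by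
      rw [compL, isDeg_zero_of_sym h.1 p q hpq, comp_zero])
    ((dmD_comp_left f).trans (by
      rw [dmD_zero_of_sym h]
      funext p q
      exact comp_zero _))

/-- The lift `f^* : X'.C^{n-*} → X.C^{n-*}` of the duality map of the image of a normal complex. -/
def BNormalData.imageLift (n : ℤ) (X X' : BNormalData B) (h : IsSymStructure n X.φ)
    (f : X.C ⟶ X'.C) (ξ : Fam X'.C) : LData B where
  Y := X'.C
  D := nDual n X.C
  e := dmK n (compL (comps f) (X.φ 0))
  he := isChainH_compL h f
  E := fun p q => comps (𝟙 (nDual n X.C)) q ∘ₗ idD n X.C p q ∘ₗ dualMap (comps f p)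
  φ := push (comps f) X.φ
  θ := X'.θ - ξ + pushDualHtpy n (ξ 0) (compLR (comps f) (X.φ 0)) (X'.φ 0) X'.γ
  α := suspFam n (pull (comps f) X'.γ)
  ω := 0
  γ := X'.γ
  g := X'.g
  χ := X'.χ

theorem imageLift_cplx (h : IsSymStructure n X.φ) (f : X.C ⟶ X'.C) (ξ : Fam X'.C) :
    (X.imageLift n X' h f ξ).cplx = X.image n X' f ξ := by
  rw [LData.cplx, BNormalData.imageLift, BNormalData.image]
  congr 2
  rw [push_zero, add_zero]

theorem isL_imageLift (hX : X.IsConnNormal n β) (hX' : X'.IsConnNormal n β) {f : X.C ⟶ X'.C}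
    {ξ η : Fam X'.C} {χ : Form X.C} (hf : IsChainEquiv f)
    (hm : IsNormalMap n X.toNormalData X'.toNormalData f ξ χ η) :
    (X.imageLift n X' hX.conn_normal.sym f ξ).IsL n β := by
  have hS := hX.conn_normal.sym
  have hS' := hX'.conn_normal.sym
  have hd := hX.conn_normal.dim
  have hd' := hX'.conn_normal.dim
  have := hd.finCx
  have := hd'.finCx
  obtain ⟨hγ, hθ, hn⟩ := hX'.conn_normal.normal
  have he := isChainH_compL (X' := X') hS f
  have hG := isDeg_zero_of_sym hS.1
  have hG' : IsDeg n (compL (comps f) (X.φ 0)) := fun p q hpq => by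
    rw [compL, hG p q hpq, comp_zero]
  have hG'' : IsDeg n (compLR (comps f) (X.φ 0)) := hG.comp _ _
  have hα : IsHyp n (suspFam n (pull (comps f) X'.γ)) := isHyp_suspFam (hγ.1.pull _) (by ring)
  have dα : dHyp n (suspFam n (pull (comps f) X'.γ)) = 0 := by
    rw [dHyp_suspFam, sub_self, dForm_pull _ hγ.1, hγ.2, pull_zero, suspFam_zero]
  have hE : IsDeg n (fun p q => comps (𝟙 (nDual n X.C)) q ∘ₗ idD n X.C p q ∘ₗ
    dualMap (comps f p)) := (isDeg_idD n X.C).comp _ _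
  have dE := dmD_comp_eq_zero (dmD_idD n X.C) (𝟙 (nDual n X.C)) f
  have eqE := (isChainEquiv_dmHom_iff hd'.1 hd.nDual.1 dE).2 ((dqi_idD n X.C).comp (dmD_idD n X.C)
    (IsChainEquiv.qi (f := 𝟙 (nDual n X.C)) ⟨HomotopyEquiv.refl _, rfl⟩) hf)
  have hφ : IsSymStructure n (push (comps f) X.φ) := by
    refine ⟨fun s p q hs => ?_, ?_⟩
    · rw [push, hS.1 s p q hs]; simp
    · rw [dHyp_push _ hS.1.isHyp, hS.2, push_zero]
  have h0 : push (comps f) X.φ 0 = fun p q => dmK n (compL (comps f) (X.φ 0)) q q ∘ₗ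
      comps (𝟙 (nDual n X.C)) q ∘ₗ idD n X.C p q ∘ₗ dualMap (comps f p) := by
    funext p q
    by_cases h : p + q = n
    · obtain rfl : p = n - q := by omega
      change _ = comps f q ∘ₗ X.φ 0 (n - q) q ∘ₗ dualMap (idMap X.C (n - q) (n - q)) ∘ₗ _
      rw [idMap_self, dualMap_id, LinearMap.id_comp]
      rfl
    · exact (hG.comp (comps f) (comps f) p q h).trans ((congrArg (dmK n (compL (comps f) (X.φ 0)) q
        q
        ∘ₗ ·) (hE p q h)).trans (comp_zero _)).symm
  have hθ' : IsHyp (n + 1) (X'.θ - ξ + pushDualHtpy n (ξ 0) (compLR (comps f) (X.φ 0))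
      (X'.φ 0) X'.γ) :=
    (hθ.sub hm.sym_chain.isHyp).add (isHyp_pushDualHtpy hγ.1 _ _ _ (by ring))
  have hξ : ξ (-1) = 0 := hm.sym_chain.eq_zero (by norm_num)
  have hd0 : push (comps f) X.φ - push (dgl (dmK n (compL (comps f) (X.φ 0))))
      (suspFam n (pull (comps f) X'.γ)) = dHyp (n + 1) (X'.θ - ξ +
        pushDualHtpy n (ξ 0) (compLR (comps f) (X.φ 0)) (X'.φ 0) X'.γ) := by
    have h1 : dmD (ξ 0) = X'.φ 0 - compLR (comps f) (X.φ 0) := by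
      rw [← dHyp_apply_zero hξ (m := n + 1), ← hm.sym_equiv]; rfl
    have h2 : dmD (compLR (comps f) (X.φ 0)) = 0 := dmD_comp_eq_zero (dmD_zero_of_sym hS) f f
    rw [dHyp_add, dHyp_sub, ← hn, ← hm.sym_equiv, dHyp_pushDualHtpy
      (fun p q hpq => hm.sym_chain 0 p q (by omega)) h2 (dmD_zero_of_sym hS') h1 hγ]
    change _ - push (dmG n (compL (comps f) (X.φ 0))) _ = _
    rw [← pushDual_eq, pushDual_pull]
    change _ - pushDual n (compLR (comps f) (X.φ 0)) X'.γ = _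
    abel
  have hF : ExBelow 0 (fiberCx _ he) := exBelow_fiber _ hd.nDual.exBelow hd'.exBelow (by
    have h1 : he.hom = dualityMap hS ≫ f := hom_ext_comps fun i => rfl
    rw [h1]
    exact (surjZero_of_exactAt hX.conn_normal.conn).comp_equiv hf)
  exact {
    dimY := hd'
    dimD := hd.nDual
    dimF := (isQuadPoincare_psiL he hd.nDual.1 hd'.1 hF hφ.1 hθ' hα hE dE eqE dα h0 hd0).1
    degE := hE
    dE := dE
    eqE := eqE
    sym := hφ
    φ0 := h0
    hypα := hα
    dα := dα
    hypθ := hθ'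
    dθ := hd0
    bundle := hγ
    hypω := IsHyp.zero
    dω := by
      change suspFam n (pull (comps f) X'.γ) - pushDual n (fun p q => idD n X.C p q ∘ₗ
        dualMap (comps f p)) X'.γ = dHyp (n + 1) 0
      rw [← pushDual_pull, pushDual_idD, sub_self, dHyp_zero]
    bundle_map := hX'.bundle_map }

theorem pair_imageLift (hX : X.IsConnNormal n β) (hX' : X'.IsConnNormal n β) {f : X.C ⟶ X'.C}
    {ξ η : Fam X'.C} {χ : Form X.C} (hf : IsChainEquiv f)
    (hm : IsNormalMap n X.toNormalData X'.toNormalData f ξ χ η)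
    {l : Homotopy (f ≫ X'.g) X.g} {μ : Form X.C}
    (hl : IsBundleHtpy β X.g X.χ (f ≫ X'.g) (χ + pull (comps f) X'.χ) l μ) :
    BPairHE n β ((X.lift n hX.conn_normal.sym).pair n)
      ((X.imageLift n X' hX.conn_normal.sym f ξ).pair n) := by
  have hL := isL_lift hX
  have hL' := isL_imageLift hX hX' hf hm
  have := hX.conn_normal.dim.finCx
  have hb : IsChainEquiv (𝟙 (nDual n X.C)) := ⟨HomotopyEquiv.refl _, rfl⟩
  have hab : ∀ i, comps f i ∘ₗ dmK n (X.φ 0) i i =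
    dmK n (compL (comps f) (X.φ 0)) i i ∘ₗ comps (𝟙 (nDual n X.C)) i := fun i => rfl
  refine LData.pair_map hL hL' f (𝟙 _) hab hb
    ((QI.fiberMap hab hf.qi hb.qi).isChainEquiv hL.dimF.1 hL'.dimF.1) rfl
    (ch := suspFam n χ) (η := 0) (et := η) (χ₀ := χ) (isHyp_suspFam hm.bundle_equiv.1 rfl)
    IsHyp.zero hm.hyp_chain ?_ ?_ hm.bundle_equiv ?_ l μ hl
  · have h1 : dHyp (n + 1) (suspFam n χ) = suspFam n (pull (comps f) X'.γ) - suspFam n X.γ := by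
      rw [dHyp_suspFam, show n + 1 - n = 1 by ring, hm.bundle_equiv.2, suspFam_sub]
    exact (add_sub_cancel (suspFam n X.γ) _).symm.trans (congrArg (suspFam n X.γ + ·) h1.symm)
  · refine Eq.trans ?_ (congrArg (push (comps f) X.θ -
      push (dmG n (compL (comps f) (X.φ 0))) (suspFam n χ) + ·) hm.hyp_equiv)
    rw [pushDual_eq]
    change X'.θ - ξ + pushDualHtpy n (ξ 0) (compLR (comps f) (X.φ 0)) (X'.φ 0) X'.γ = _
    abel
  · have h1 : (0 : Fam (nDual n X.C)) = push (comps (𝟙 (nDual n X.C))) 0 + suspFam n χ -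
        pushDual n (idD n X.C) χ + dHyp (n + 2) 0 := by
      rw [push_zero, pushDual_idD, dHyp_zero]
      abel
    exact h1

end StrictMap

section Path

variable {C D : Cx A}

/-- A chain homotopy with components `C_i → D_{i+1}`. -/
def htpyOfSucc {f g : C ⟶ D} (a : ∀ i, C.X i →ₗ[A] D.X (i + 1))
    (h : ∀ j (x : C.X (j + 1)), (D.d (j + 1 + 1) (j + 1)).hom (a (j + 1) x) +
      a j ((C.d (j + 1) j).hom x) = comps f (j + 1) x - comps g (j + 1) x) : Homotopy f g :=
  htpyOf (fun i j => idMap D (i + 1) j ∘ₗ a i) fun x => by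
    induction x using DirectSum.induction_on with
    | zero => simp
    | add x y hx hy => simp only [map_add, add_sub_add_comm, ← hx, ← hy]; abel
    | of i x =>
      obtain ⟨j, rfl⟩ : ∃ j, i = j + 1 := ⟨i - 1, by ring⟩
      rw [oph_of (j + 1 + 1) rfl, opd_of (j + 1) rfl, opd_of j rfl, oph_of (j + 1) rfl, opg_of,
        opg_of, idMap_self, idMap_self, ← map_add, ← map_sub, ← h j x]
      rfl

theorem hcomps_htpyOfSucc {f g : C ⟶ D} (a : ∀ i, C.X i →ₗ[A] D.X (i + 1)) (h) :
    hcomps (htpyOfSucc (f := f) (g := g) a h) = fun i j => idMap D (i + 1) j ∘ₗ a i :=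
  hcomps_htpyOf fun i j hij => by
    have h0 : idMap D (i + 1) j = 0 := dif_neg (by omega)
    rw [h0, zero_comp]

/-- The path object of a complex, `Z_r = C_r ⊕ C_r ⊕ C_{r+1}` with differential
`(a, c, w) ↦ (d a, d c, c - d w)`. -/
def pathCx (C : Cx A) : Cx A where
  X r := ModuleCat.of A (C.X r × (C.X r × C.X (r + 1)))
  d i j := ModuleCat.ofHom (LinearMap.prodMap (C.d i j).hom
    (LinearMap.prod ((C.d i j).hom ∘ₗ LinearMap.fst A (C.X i) (C.X (i + 1)))
      (LinearMap.coprod (idMap C i (j + 1)) (-(C.d (i + 1) (j + 1)).hom))))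
  shape i j hij := by
    simp only [ComplexShape.down_Rel] at hij
    have h1 : C.d i j = 0 := C.shape _ _ hij
    have h2 : C.d (i + 1) (j + 1) = 0 := C.shape _ _ (by
      simp only [ComplexShape.down_Rel]; omega)
    have h3 : idMap C i (j + 1) = 0 := dif_neg fun h => hij h.symm
    rw [h1, h2, h3]
    refine ModuleCat.hom_ext (LinearMap.ext fun x => Prod.ext ?_ (Prod.ext ?_ ?_)) <;> simp
  d_comp_d' i j k hij hjk := by
    simp only [ComplexShape.down_Rel] at hij hjk
    subst hjk hij
    have h1 := LinearMap.congr_fun (d_comp_d_hom C (k + 1 + 1) (k + 1) k)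
    have h2 := LinearMap.congr_fun (d_comp_d_hom C (k + 1 + 1 + 1) (k + 1 + 1) (k + 1))
    simp only [LinearMap.comp_apply, LinearMap.zero_apply] at h1 h2
    rw [← ModuleCat.ofHom_comp]
    refine ModuleCat.hom_ext (LinearMap.ext fun x => ?_)
    obtain ⟨a, c, w⟩ := x
    refine Prod.ext ?_ (Prod.ext ?_ ?_) <;> simp [h1, h2, idMap_self]

theorem pathCx_d (C : Cx A) (j : ℤ) (a c : C.X (j + 1)) (w : C.X (j + 1 + 1)) :
    ((pathCx C).d (j + 1) j).hom ((a, c, w) : C.X (j + 1) × C.X (j + 1) × C.X (j + 1 + 1)) =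
      (((C.d (j + 1) j).hom a, (C.d (j + 1) j).hom c, c - (C.d (j + 1 + 1) (j + 1)).hom w) :
        C.X j × C.X j × C.X (j + 1)) := by
  refine Prod.ext rfl (Prod.ext rfl ?_)
  change idMap C (j + 1) (j + 1) c + -(C.d (j + 1 + 1) (j + 1)).hom w = _
  rw [idMap_self, ← sub_eq_add_neg]
  rfl

/-- The first projection of the path object. -/
def pathZero (C : Cx A) : pathCx C ⟶ C where
  f i := ConcreteCategory.ofHom (C := ModuleCat A) (X := (pathCx C).X i) (Y := C.X i)
    (LinearMap.fst A (C.X i) (C.X i × C.X (i + 1)))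
  comm' _ _ _ := rfl

/-- The second projection of the path object. -/
def pathOne (C : Cx A) : pathCx C ⟶ C where
  f i := ConcreteCategory.ofHom (C := ModuleCat A) (X := (pathCx C).X i) (Y := C.X i)
    (LinearMap.coprod LinearMap.id (LinearMap.fst A (C.X i) (C.X (i + 1))))
  comm' i j _ := ModuleCat.hom_ext (LinearMap.ext fun _ => map_add (C.d i j).hom _ _)

/-- The inclusion of the constant paths. -/
def pathConst (C : Cx A) : C ⟶ pathCx C where
  f i := ConcreteCategory.ofHom (C := ModuleCat A) (X := C.X i) (Y := (pathCx C).X i)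
    (LinearMap.inl A (C.X i) (C.X i × C.X (i + 1)))
  comm' i j _ := ModuleCat.hom_ext (LinearMap.ext fun x => by
    refine Prod.ext rfl (Prod.ext ?_ ?_)
    · exact map_zero _
    · change idMap C i (j + 1) 0 + -(C.d (i + 1) (j + 1)).hom 0 = 0
      rw [map_zero, map_zero, neg_zero, add_zero])

/-- The second summand of the path object. -/
def pathIncl (C : Cx A) : GMap C (pathCx C) := fun i =>
  (LinearMap.inr A (C.X i) (C.X i × C.X (i + 1)) ∘ₗ LinearMap.inl A (C.X i) (C.X (i + 1)) :
    C.X i →ₗ[A] C.X i × C.X i × C.X (i + 1))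

/-- The third summand of the path object. -/
def pathLoop (C : Cx A) (i : ℤ) : (pathCx C).X i →ₗ[A] C.X (i + 1) :=
  (LinearMap.snd A (C.X i) (C.X (i + 1)) ∘ₗ LinearMap.snd A (C.X i) (C.X i × C.X (i + 1)) :
    C.X i × C.X i × C.X (i + 1) →ₗ[A] C.X (i + 1))

/-- The homotopy between the projections of the path object. -/
def pathHtpy (C : Cx A) : Homotopy (pathOne C) (pathZero C) :=
  htpyOfSucc (pathLoop C) fun j x => by
    obtain ⟨a, c, w⟩ := x
    rw [pathCx_d]
    change (C.d (j + 1 + 1) (j + 1)).hom w + (c - (C.d (j + 1 + 1) (j + 1)).hom w) = (a + c) - a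
    abel

/-- The contraction of the path object to the constant paths. -/
def pathRetr (C : Cx A) : Homotopy (𝟙 (pathCx C)) (pathZero C ≫ pathConst C) :=
  htpyOfSucc (fun i => (LinearMap.inr A (C.X (i + 1)) (C.X (i + 1) × C.X (i + 1 + 1)) ∘ₗ
      LinearMap.inl A (C.X (i + 1)) (C.X (i + 1 + 1)) ∘ₗ pathLoop C i :
        (pathCx C).X i →ₗ[A] C.X (i + 1) × C.X (i + 1) × C.X (i + 1 + 1))) fun j x => by
    obtain ⟨a, c, w⟩ := x
    rw [pathCx_d]
    change ((pathCx C).d (j + 1 + 1) (j + 1)).hom (((0 : C.X (j + 1 + 1)), w,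
      (0 : C.X (j + 1 + 1 + 1))) : C.X (j + 1 + 1) × C.X (j + 1 + 1) × C.X (j + 1 + 1 + 1)) + _ = _
    rw [pathCx_d]
    refine Prod.ext ?_ (Prod.ext ?_ ?_)
    · change (C.d (j + 1 + 1) (j + 1)).hom 0 + 0 = a - a
      rw [map_zero, add_zero, sub_self]
    · change (C.d (j + 1 + 1) (j + 1)).hom w + (c - (C.d (j + 1 + 1) (j + 1)).hom w) = c - 0
      abel
    · change (w - (C.d (j + 1 + 1 + 1) (j + 1 + 1)).hom 0) + 0 = w - 0
      rw [map_zero]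
      abel

theorem pathConst_pathZero (C : Cx A) : pathConst C ≫ pathZero C = 𝟙 C := rfl

theorem pathConst_pathOne (C : Cx A) : pathConst C ≫ pathOne C = 𝟙 C :=
  hom_ext_comps fun _ => LinearMap.ext fun x => add_zero x

theorem isChainEquiv_pathZero (C : Cx A) : IsChainEquiv (pathZero C) :=
  ⟨⟨pathZero C, pathConst C, (pathRetr C).symm, Homotopy.ofEq (pathConst_pathZero C)⟩, rfl⟩

theorem isChainEquiv_pathOne (C : Cx A) : IsChainEquiv (pathOne C) :=
  ⟨⟨pathOne C, pathConst C, ((pathHtpy C).compRight (pathConst C)).trans (pathRetr C).symm,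
    Homotopy.ofEq (pathConst_pathOne C)⟩, rfl⟩

theorem IsFinite.pathCx (h : IsFinite C) : IsFinite (pathCx C) := by
  obtain ⟨h1, N, hN⟩ := h
  refine ⟨fun i => ?_, max N (N + 1), fun i hi => ?_⟩
  · have := (h1 i).1; have := (h1 i).2; have := (h1 (i + 1)).1; have := (h1 (i + 1)).2
    exact ⟨inferInstanceAs (Module.Finite A (C.X i × C.X i × C.X (i + 1))),
      inferInstanceAs (Module.Projective A (C.X i × C.X i × C.X (i + 1)))⟩
  · have := hN i (by omega)
    have := hN (i + 1) (by omega)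
    exact inferInstanceAs (Subsingleton (C.X i × C.X i × C.X (i + 1)))

end Path

section PathNormal

variable {B C D : Cx A} {n : ℤ} {β : Form B}

instance [h : FinCx C] : FinCx (pathCx C) where
  finite i := by
    have := h.finite i; have := h.finite (i + 1)
    exact inferInstanceAs (Module.Finite A (C.X i × C.X i × C.X (i + 1)))
  projective i := by
    have := h.projective i; have := h.projective (i + 1)
    exact inferInstanceAs (Module.Projective A (C.X i × C.X i × C.X (i + 1)))

theorem opg'_zero (x) : opg' (0 : GMap C D) x = 0 := by
  revert x; refine dsum_induct fun i x => ?_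
  rw [opg'_of, Pi.zero_apply, dualMap_zero, LinearMap.zero_apply, map_zero]

theorem opg'_id (x) : opg' (comps (𝟙 C)) x = x := by
  revert x; refine dsum_induct fun i x => ?_
  rw [opg'_of]; rfl

theorem push_pathZero_const (θ : Fam C) :
    push (comps (pathZero C)) (push (comps (pathConst C)) θ) = θ := rfl

theorem push_pathOne_const (θ : Fam C) :
    push (comps (pathOne C)) (push (comps (pathConst C)) θ) = θ := by
  rw [← push_comps_comp, pathConst_pathOne, push_id]

theorem pathOne_incl (i : ℤ) : comps (pathOne C) i ∘ₗ pathIncl C i = LinearMap.id :=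
  LinearMap.ext fun x => zero_add x

theorem push_pathZero_incl (θ : Fam C) : push (comps (pathZero C)) (push (pathIncl C) θ) = 0 :=
  push_zero_left θ

theorem push_pathOne_incl (θ : Fam C) : push (comps (pathOne C)) (push (pathIncl C) θ) = θ := by
  have key : ∀ a b : GMap C C, a = b → push a θ = push b θ := fun a b hab => by rw [hab]
  exact key _ (comps (𝟙 C)) (funext pathOne_incl)

/-- The symmetric structure on the path object determined by a change `ξ` of the symmetric
structure `φ`. -/
def pathφ (n : ℤ) (φ ξ : Fam C) : Fam (pathCx C) :=
  push (comps (pathConst C)) φ + dHyp (n + 1) (push (pathIncl C) ξ)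

/-- The normal complex on the path object determined by a change `ξ` of the symmetric
structure. -/
def BNormalData.path (n : ℤ) (X : BNormalData B) (ξ : Fam X.C) : BNormalData B where
  C := pathCx X.C
  φ := pathφ n X.φ ξ
  γ := pull (comps (pathZero X.C)) X.γ
  θ := push (comps (pathConst X.C)) X.θ + push (pathIncl X.C) ξ
  g := pathZero X.C ≫ X.g
  χ := pull (comps (pathZero X.C)) X.χ

/-- The normal complex obtained by a change `ξ` of the symmetric structure. -/
def BNormalData.perturb (n : ℤ) (X : BNormalData B) (ξ : Fam X.C) : BNormalData B where
  C := X.C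
  φ := X.φ + dHyp (n + 1) ξ
  γ := X.γ
  θ := X.θ + ξ - pushDualHtpy n (ξ 0) (X.φ 0) (X.φ 0 + dmD (ξ 0)) X.γ
  g := X.g
  χ := X.χ

section

variable {φ ξ : Fam C} {γ : Form C}

theorem opm_pathφ_zero (hξ : IsSym (n + 1) ξ) (m : ℤ) (x) : opm m (pathφ n φ ξ 0) x =
    opg (comps (pathConst C)) (opm m (φ 0) (opg' (comps (pathConst C)) x)) +
    (opd (pathCx C) (opg (pathIncl C) (opm (m + 1) (ξ 0) (opg' (pathIncl C) x))) +
    eps (opg (pathIncl C) (opm (m + 1) (ξ 0) (opg' (pathIncl C) (opd' (pathCx C) x))))) := by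
  have h1 : push (pathIncl C) ξ (-1) = 0 := (hξ.push _).eq_zero (by norm_num)
  rw [pathφ, Pi.add_apply, dHyp_apply_zero h1, opm_add, opm_push, opm_dmD, opm_push, opm_push]

theorem opg'_incl_pathZero (x) : opg' (pathIncl C) (opg' (comps (pathZero C)) x) = 0 := by
  rw [← opg'_comp]
  exact opg'_zero x

theorem opg'_const_pathZero (x) : opg' (comps (pathConst C)) (opg' (comps (pathZero C)) x) = x := by
  rw [← opg'_comp]
  exact opg'_id x

theorem pathφ_pathZero (hξ : IsSym (n + 1) ξ) :
    (fun p q => pathφ n φ ξ 0 p q ∘ₗ dualMap (comps (pathZero C) p)) =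
      fun p q => comps (pathConst C) q ∘ₗ φ 0 p q := by
  refine dmap_ext fun m x => ?_
  rw [opm_comp_right, opm_pathφ_zero hξ, opm_comp_left, ← opg'_opd', opg'_incl_pathZero,
    opg'_incl_pathZero, opg'_const_pathZero]
  simp only [map_zero, add_zero]

variable [FinCx C]

theorem isSymStructure_pathφ (hφ : IsSymStructure n φ) (hξ : IsSym (n + 1) ξ) :
    IsSymStructure n (pathφ n φ ξ) := by
  refine ⟨(hφ.1.push _).add ((hξ.push _).dHyp rfl), ?_⟩
  rw [pathφ, dHyp_add, dHyp_push _ hφ.1.isHyp, hφ.2, push_zero, zero_add]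
  exact dHyp_dHyp (hξ.push _).isHyp

theorem push_pathZero_pathφ (hξ : IsSym (n + 1) ξ) :
    push (comps (pathZero C)) (pathφ n φ ξ) = φ := by
  rw [pathφ, push_add, push_pathZero_const, ← dHyp_push _ (hξ.push _).isHyp, push_pathZero_incl,
    dHyp_zero, add_zero]

theorem push_pathOne_pathφ (hξ : IsSym (n + 1) ξ) :
    push (comps (pathOne C)) (pathφ n φ ξ) = φ + dHyp (n + 1) ξ := by
  rw [pathφ, push_add, push_pathOne_const, ← dHyp_push _ (hξ.push _).isHyp, push_pathOne_incl]

theorem surjZero_pathφ (hφ : IsSymStructure n φ) (hξ : IsSym (n + 1) ξ)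
    (h : SurjZero (dualityMap hφ)) :
    SurjZero (dualityMap (isSymStructure_pathφ hφ hξ)) := by
  intro y hy
  have h1 : opg (comps (pathZero C)) (DirectSum.of (fun i => (pathCx C).X i) 0 y) =
      DirectSum.of (fun i => C.X i) 0 (comps (pathZero C) 0 y) := opg_of _ _ _
  obtain ⟨a, b, ha, hb⟩ := h (comps (pathZero C) 0 y) (by rw [← h1, ← opg_opd, hy, map_zero])
  obtain ⟨a', ha'⟩ := (und_bijective n (pathCx C)).2 (opg' (comps (pathZero C)) (und n C a))
  have h2 : opd (nDual n (pathCx C)) a' = 0 := (und_bijective n (pathCx C)).1 (by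
    rw [← und_opd, ha', opdn_apply, ← opg'_eps, ← opg'_opd', ← map_usmul, ← opdn_apply,
      und_opd, ha, map_zero, map_zero, map_zero])
  have h3 : ∀ {D : Cx A} {φ : Fam D} (h : IsSymStructure n φ) (x),
      opg (comps (dualityMap h)) x = opm n (φ 0) (und n D x) := fun h x =>
    opg_dmHom (dmD_zero_of_sym h) x
  have h4 : opg (comps (pathZero C)) (opm n (pathφ n φ ξ 0) (und n (pathCx C) a')) =
      opm n (φ 0) (und n C a) := by
    rw [ha', ← opm_push, push_pathZero_pathφ hξ]
  obtain ⟨w, hw⟩ := (isChainEquiv_pathZero C).qi.inj (DirectSum.of (fun i => (pathCx C).X i) 0 y -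
    opg (comps (dualityMap (isSymStructure_pathφ hφ hξ))) a') b
    (by rw [map_sub, hy, ← opg_opd, h2, map_zero, sub_zero])
    (by rw [map_sub, h1, hb, h3, h3, h4, add_sub_cancel_left])
  exact ⟨a', w, h2, by rw [← hw]; abel⟩

theorem pathLoop_const (r : ℤ) : pathLoop C r ∘ₗ comps (pathConst C) r = 0 := rfl

theorem pathLoop_incl (r : ℤ) : pathLoop C r ∘ₗ pathIncl C r = 0 := rfl

theorem pathLoop_d_incl (r : ℤ) :
    pathLoop C r ∘ₗ ((pathCx C).d (r + 1) r).hom ∘ₗ pathIncl C (r + 1) = LinearMap.id := by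
  refine LinearMap.ext fun x => ?_
  change pathLoop C r (((pathCx C).d (r + 1) r).hom
    (((0 : C.X (r + 1)), x, (0 : C.X (r + 1 + 1))) : C.X (r + 1) × C.X (r + 1) × C.X (r + 1 + 1)))
      = x
  rw [pathCx_d]
  change x - (C.d (r + 1 + 1) (r + 1)).hom 0 = x
  rw [map_zero, sub_zero]

theorem pathφ_pathHtpy {φ ξ : Fam C} (hξ : IsSym (n + 1) ξ) (p q : ℤ) {r : ℤ} (hr : r = p + 1) :
    (comps (pathOne C) q ∘ₗ pathφ n φ ξ 0 p q) ∘ₗ dualMap (hcomps (pathHtpy C) p r) =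
      q.negOnePow • ξ 0 r q := by
  subst hr
  have h1 : push (pathIncl C) ξ (-1) = 0 := (hξ.push _).eq_zero (by norm_num)
  have h2 : hcomps (pathHtpy C) p (p + 1) = pathLoop C p := by
    rw [pathHtpy, hcomps_htpyOfSucc]
    change idMap C (p + 1) (p + 1) ∘ₗ pathLoop C p = _
    rw [idMap_self, LinearMap.id_comp]
  have e1 : dualMap (comps (pathConst C) p) ∘ₗ dualMap (pathLoop C p) = 0 := by
    rw [← dualMap_comp, pathLoop_const, dualMap_zero]
  have e2 : dualMap (pathIncl C p) ∘ₗ dualMap (pathLoop C p) = 0 := by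
    rw [← dualMap_comp, pathLoop_incl, dualMap_zero]
  have e3 : dualMap (pathIncl C (p + 1)) ∘ₗ dualMap ((pathCx C).d (p + 1) p).hom ∘ₗ
      dualMap (pathLoop C p) = LinearMap.id := by
    rw [← dualMap_comp, ← dualMap_comp, comp_assoc, pathLoop_d_incl, dualMap_id]
  rw [h2, pathφ, Pi.add_apply, dHyp_apply_zero h1]
  refine LinearMap.ext fun x => ?_
  have f1 := LinearMap.congr_fun e1 x
  have f2 := LinearMap.congr_fun e2 x
  have f3 := LinearMap.congr_fun e3 x
  simp only [LinearMap.comp_apply, LinearMap.zero_apply, LinearMap.id_apply] at f1 f2 f3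
  simp only [dmD, push, Pi.add_apply, LinearMap.comp_apply, LinearMap.add_apply,
    LinearMap.smul_apply, f1, f2, f3, map_zero, zero_add, map_usmul]
  have e4 : comps (pathOne C) q (pathIncl C q (ξ 0 (p + 1) q x)) = ξ 0 (p + 1) q x := zero_add _
  refine (map_usmul (comps (pathOne C) q).toAddMonoidHom q.negOnePow _).trans ?_
  exact congrArg (fun z : C.X q => q.negOnePow • z) e4

theorem compL_pathφ_pathZero {φ ξ : Fam C} (hξ : IsSym (n + 1) ξ) :
    (fun p q => (comps (pathOne C) q ∘ₗ pathφ n φ ξ 0 p q) ∘ₗ dualMap (comps (pathZero C) p)) =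
      φ 0 := by
  have h1 := fun p q => congrFun (congrFun (pathφ_pathZero (n := n) (φ := φ) hξ) p) q
  funext p q
  rw [comp_assoc, h1, ← comp_assoc]
  have h2 : comps (pathOne C) q ∘ₗ comps (pathConst C) q = LinearMap.id :=
    LinearMap.ext fun x => add_zero x
  rw [h2, LinearMap.id_comp]

theorem pathOne_hyp_equiv {φ ξ θ : Fam C} {γ : Form C} (hξ : IsSym (n + 1) ξ) :
    (θ + ξ - pushDualHtpy n (ξ 0) (φ 0) (φ 0 + dmD (ξ 0)) γ) -
      push (comps (pathOne C)) (push (comps (pathConst C)) θ + push (pathIncl C) ξ) - 0 +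
      pushDual n (fun p q => comps (pathOne C) q ∘ₗ pathφ n φ ξ 0 p q) (pullHtpy 0
        (hcomps (pathHtpy C)) (comps (pathZero C)) (comps (pathOne C)) γ) = dHyp (n + 2) 0 := by
  have h1 := congrFun (push_pathOne_pathφ (φ := φ) hξ) 0
  rw [Pi.add_apply, dHyp_apply_zero (hξ.eq_zero (by norm_num))] at h1
  have h2 : (fun p q => (comps (pathOne C) q ∘ₗ pathφ n φ ξ 0 p q) ∘ₗ
      dualMap (comps (pathOne C) p)) = φ 0 + dmD (ξ 0) := h1
  rw [pushDual_pullHtpy n _ _ _ _ (ξ 0) fun q => by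
    rw [pathφ_pathHtpy hξ _ _ (by ring), smul_smul, ← negOnePow_add, negOnePow_even _ ⟨q, rfl⟩,
      one_smul], compL_pathφ_pathZero hξ, h2, push_add, push_pathOne_const, push_pathOne_incl,
        dHyp_zero]
  abel

end

variable {X : BNormalData B} {ξ : Fam X.C}

theorem isConnNormal_path (hX : X.IsConnNormal n β) (hξ : IsSym (n + 1) ξ) :
    (X.path n ξ).IsConnNormal n β := by
  have hd := hX.conn_normal.dim
  have := hd.finCx
  have hS := hX.conn_normal.sym
  obtain ⟨hγ, hθ, hn⟩ := hX.conn_normal.normal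
  have hbm := hX.bundle_map
  have hdim : IsDim n (pathCx X.C) := hd.of_equiv' (isChainEquiv_pathZero X.C) hd.1.pathCx
  have h1 : pathφ n X.φ ξ - pushDual n (pathφ n X.φ ξ 0) (pull (comps (pathZero X.C)) X.γ) =
      dHyp (n + 1) (push (comps (pathConst X.C)) X.θ + push (pathIncl X.C) ξ) := by
    rw [pushDual_pull, pathφ_pathZero hξ, ← push_pushDual, dHyp_add, dHyp_push _ hθ, ← hn,
      push_sub, pathφ]
    abel
  have h2 : dForm 1 (pull (comps (pathZero X.C)) X.χ) = pull (comps (pathZero X.C ≫ X.g)) β -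
      pull (comps (pathZero X.C)) X.γ := by
    rw [dForm_pull _ hbm.1, hbm.2, pull_sub, pull_comp]
  exact {
    conn_normal := {
      dim := hdim
      sym := isSymStructure_pathφ hS hξ
      normal := ⟨hγ.pull _, (hθ.push _).add (hξ.push _).isHyp, h1⟩
      conn := (surjZero_pathφ hS hξ (surjZero_of_exactAt hX.conn_normal.conn)).exactAt
        hdim.nDual.exBelow }
    bundle_map := ⟨hbm.1.pull _, h2⟩ }

theorem isNormalMap_pathZero (hX : X.IsConnNormal n β) (hξ : IsSym (n + 1) ξ) :
    IsNormalMap n (X.path n ξ).toNormalData X.toNormalData (pathZero X.C) 0 0 0 := by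
  have := hX.conn_normal.dim.finCx
  have h1 : X.φ - push (comps (pathZero X.C)) (pathφ n X.φ ξ) = dHyp (n + 1) 0 := by
    rw [push_pathZero_pathφ hξ, sub_self, dHyp_zero]
  have h2 : X.θ - push (comps (pathZero X.C)) (push (comps (pathConst X.C)) X.θ +
      push (pathIncl X.C) ξ) - 0 = dHyp (n + 2) 0 := by
    rw [push_add, push_pathZero_const, push_pathZero_incl, dHyp_zero, add_zero, sub_self, sub_zero]
  exact isNormalMap_of_zero IsSym.zero rfl h1 rfl IsHyp.zero h2

theorem isBundleHtpy_pathZero : IsBundleHtpy β (X.path n ξ).g (X.path n ξ).χ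
    (pathZero X.C ≫ X.g) ((0 : Form (pathCx X.C)) + pull (comps (pathZero X.C)) X.χ)
    (Homotopy.refl _) 0 :=
  isBundleHtpy_comp (pathZero X.C) X.g X.χ

theorem isNormalMap_pathOne (hX : X.IsConnNormal n β) (hξ : IsSym (n + 1) ξ) :
    IsNormalMap n (X.path n ξ).toNormalData (X.perturb n ξ).toNormalData (pathOne X.C) 0
      (pullHtpy 0 (hcomps (pathHtpy X.C)) (comps (pathZero X.C)) (comps (pathOne X.C)) X.γ) 0 := by
  have := hX.conn_normal.dim.finCx
  obtain ⟨hγ, hθ, hn⟩ := hX.conn_normal.normal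
  exact {
    sym_chain := IsSym.zero
    sym_equiv := by
      have h1 : X.φ + dHyp (n + 1) ξ - push (comps (pathOne X.C)) (pathφ n X.φ ξ) =
          dHyp (n + 1) 0 := by
        rw [push_pathOne_pathφ hξ, dHyp_zero, sub_self]
      exact h1
    bundle_equiv := by
      refine ⟨hγ.1.pullHtpy rfl _ _ _, ?_⟩
      have := dForm_pullHtpy (pathHtpy X.C) hγ.1
      rw [hγ.2, pullHtpy_zero, add_zero] at this
      exact this
    hyp_chain := IsHyp.zero
    hyp_equiv := by
      have h1 := pathOne_hyp_equiv (φ := X.φ) (θ := X.θ) (γ := X.γ) hξ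
      have h2 : ∀ a b : Fam X.C, ∀ G G' : DMap X.C X.C,
          a + pushDualHtpy n ((0 : Fam X.C) 0) G G' X.γ + b = a + b := fun a b G G' => by
        rw [Pi.zero_apply, pushDualHtpy_zero_left, add_zero]
      exact (h2 _ _ _ _).trans h1 }

theorem isBundleHtpy_pathOne (hX : X.IsConnNormal n β) :
    IsBundleHtpy β (pathZero X.C ≫ X.g) (pull (comps (pathZero X.C)) X.χ) (pathOne X.C ≫ X.g)
      (pullHtpy 0 (hcomps (pathHtpy X.C)) (comps (pathZero X.C)) (comps (pathOne X.C)) X.γ +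
        pull (comps (pathOne X.C)) X.χ) ((pathHtpy X.C).compRight X.g)
      (pullHtpy 1 (hcomps (pathHtpy X.C)) (comps (pathZero X.C)) (comps (pathOne X.C)) X.χ) := by
  obtain ⟨h1, h2⟩ := hX.bundle_map
  have := hX.conn_normal.dim.finCx
  refine ⟨h1.pullHtpy rfl _ _ _, ?_⟩
  have h3 := dForm_pullHtpy (pathHtpy X.C) h1
  rw [h2, pullHtpy_sub, pullHtpy_pull, sub_self, show (1 : ℤ) + 1 = 2 by norm_num] at h3
  change pull (comps (pathZero X.C)) X.χ - (pullHtpy 0 _ _ _ X.γ + _) + pullHtpy 0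
    (fun i j => comps X.g j ∘ₗ hcomps (pathHtpy X.C) i j)
    (fun i => comps X.g i ∘ₗ comps (pathZero X.C) i) (fun i => comps X.g i ∘ₗ comps (pathOne X.C) i)
    β = _
  rw [eq_sub_of_add_eq h3]
  abel

end PathNormal

section PairClass

variable {B : Cx A} {n : ℤ} {β : Form B}

theorem image_zero {X X' : BNormalData B} {f : X.C ⟶ X'.C}
    (h : X'.φ - push (comps f) X.φ = dHyp (n + 1) 0) : X.image n X' f 0 = X' := by
  obtain ⟨⟨C', φ', γ', θ'⟩, g', χ'⟩ := X'
  have h1 : φ' = push (comps f) X.φ := sub_eq_zero.1 (h.trans (dHyp_zero _))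
  have h2 : ∀ G G' : DMap C' C', θ' - 0 + pushDualHtpy n ((0 : Fam C') 0) G G' γ' = θ' :=
    fun G G' => by rw [Pi.zero_apply, pushDualHtpy_zero_left, sub_zero, add_zero]
  rw [BNormalData.image, h2]
  exact congrArg (fun φ => BNormalData.mk (NormalData.mk C' φ γ' θ') g' χ') h1.symm

theorem perturb_image {X X' : BNormalData B} {f : X.C ⟶ X'.C} {ξ : Fam X'.C}
    (hξ : IsSym (n + 1) ξ) (h : X'.φ - push (comps f) X.φ = dHyp (n + 1) ξ) :
    (X.image n X' f ξ).perturb n ξ = X' := by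
  obtain ⟨⟨C', φ', γ', θ'⟩, g', χ'⟩ := X'
  have h1 : φ' = push (comps f) X.φ + dHyp (n + 1) ξ := (sub_eq_iff_eq_add'.1 h)
  have h2 : compLR (comps f) (X.φ 0) + dmD (ξ 0) = φ' 0 := by
    rw [h1, Pi.add_apply, dHyp_apply_zero (hξ.eq_zero (by norm_num))]
    rfl
  have h3 : (θ' - ξ + pushDualHtpy n (ξ 0) (compLR (comps f) (X.φ 0)) (φ' 0) γ') + ξ -
      pushDualHtpy n (ξ 0) (compLR (comps f) (X.φ 0))
        (compLR (comps f) (X.φ 0) + dmD (ξ 0)) γ' = θ' := by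
    rw [h2]
    abel
  exact congrArg₂ (fun φ θ => BNormalData.mk (NormalData.mk C' φ γ' θ) g' χ') h1.symm h3

/-- The class of the pair of a connected `(B, β)`-normal complex. -/
def pairClass {X : BNormalData B} (hX : X.IsConnNormal n β) : BPairClass n β :=
  Quot.mk _ ⟨(X.lift n hX.conn_normal.sym).pair n, (isL_lift hX).pair_isPoincare⟩

theorem pairClass_congr {X X' : BNormalData B} (h : X = X') (hX : X.IsConnNormal n β)
    (hX' : X'.IsConnNormal n β) : pairClass hX = pairClass hX' := by
  subst h
  rfl

theorem LData.IsL.pairClass_cplx {L : LData B} (hL : L.IsL n β) :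
    pairClass hL.isConnNormal_cplx = Quot.mk _ ⟨L.pair n, hL.pair_isPoincare⟩ :=
  Quot.sound hL.pair_lift_cplx

variable {X X' : BNormalData B}

theorem isConnNormal_image (hX : X.IsConnNormal n β) (hX' : X'.IsConnNormal n β) {f : X.C ⟶ X'.C}
    {ξ η : Fam X'.C} {χ : Form X.C} (hf : IsChainEquiv f)
    (hm : IsNormalMap n X.toNormalData X'.toNormalData f ξ χ η) :
    (X.image n X' f ξ).IsConnNormal n β := by
  have h := (isL_imageLift hX hX' hf hm).isConnNormal_cplx
  rwa [imageLift_cplx] at h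

theorem pairClass_image (hX : X.IsConnNormal n β) (hX' : X'.IsConnNormal n β) {f : X.C ⟶ X'.C}
    {ξ η : Fam X'.C} {χ : Form X.C} (hf : IsChainEquiv f)
    (hm : IsNormalMap n X.toNormalData X'.toNormalData f ξ χ η)
    {l : Homotopy (f ≫ X'.g) X.g} {μ : Form X.C}
    (hl : IsBundleHtpy β X.g X.χ (f ≫ X'.g) (χ + pull (comps f) X'.χ) l μ) :
    pairClass hX = pairClass (isConnNormal_image hX hX' hf hm) := by
  have hL := isL_imageLift hX hX' hf hm
  have h1 : pairClass hX = Quot.mk _ ⟨_, hL.pair_isPoincare⟩ :=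
    Quot.sound (pair_imageLift hX hX' hf hm hl)
  rw [h1, ← hL.pairClass_cplx]
  exact pairClass_congr (imageLift_cplx _ _ _) _ _

theorem pairClass_eq_of_zero (hX : X.IsConnNormal n β) (hX' : X'.IsConnNormal n β) {f : X.C ⟶ X'.C}
    {η : Fam X'.C} {χ : Form X.C} (hf : IsChainEquiv f)
    (hm : IsNormalMap n X.toNormalData X'.toNormalData f 0 χ η)
    {l : Homotopy (f ≫ X'.g) X.g} {μ : Form X.C}
    (hl : IsBundleHtpy β X.g X.χ (f ≫ X'.g) (χ + pull (comps f) X'.χ) l μ) :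
    pairClass hX = pairClass hX' :=
  (pairClass_image hX hX' hf hm hl).trans (pairClass_congr (image_zero hm.sym_equiv) _ _)

theorem pairClass_perturb {ξ : Fam X.C} (hX : X.IsConnNormal n β) (hξ : IsSym (n + 1) ξ)
    (hX' : (X.perturb n ξ).IsConnNormal n β) : pairClass hX = pairClass hX' := by
  have h0 := pairClass_eq_of_zero (X := X.path n ξ) (X' := X) (isConnNormal_path hX hξ) hX
    (f := pathZero X.C) (isChainEquiv_pathZero X.C) (isNormalMap_pathZero hX hξ)
    isBundleHtpy_pathZero
  have h1 := pairClass_eq_of_zero (X := X.path n ξ) (X' := X.perturb n ξ)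
    (isConnNormal_path hX hξ) hX' (f := pathOne X.C) (isChainEquiv_pathOne X.C)
    (isNormalMap_pathOne hX hξ) (l := (pathHtpy X.C).compRight X.g) (isBundleHtpy_pathOne hX)
  exact h0.symm.trans h1

theorem pairClass_eq_of_BNormalHE (hX : X.IsConnNormal n β) (hX' : X'.IsConnNormal n β)
    (h : BNormalHE n β X X') : pairClass hX = pairClass hX' := by
  obtain ⟨f, ξ, χ, η, l, μ, hf, hm, hl⟩ := h
  have h1 := perturb_image hm.sym_chain hm.sym_equiv
  have h2 : ((X.image n X' f ξ).perturb n ξ).IsConnNormal n β := by rw [h1]; exact hX'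
  have h3 := pairClass_perturb (X := X.image n X' f ξ) (ξ := ξ)
    (isConnNormal_image hX hX' hf hm) hm.sym_chain h2
  exact (pairClass_image hX hX' hf hm hl).trans (h3.trans (pairClass_congr h1 _ _))

end PairClass

section Bijections

variable {B : Cx A} {n : ℤ} {β : Form B}

theorem BPairData.IsPoincare.isConnNormal_thom {P : BPairData B} (h : P.IsPoincare n β) :
    (P.thom n).IsConnNormal n β :=
  ⟨h.poincare.isConnNormal_thom h.normal, h.bundle_map⟩

/-- The class of the normal complex of a `(B, β)`-normal Poincaré pair. -/
def thomClass {P : BPairData B} (hP : P.IsPoincare n β) : BNormalClass n β :=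
  Quot.mk _ ⟨P.thom n, hP.isConnNormal_thom⟩

theorem thomClass_eq_cplx {P : BPairData B} (hP : P.IsPoincare n β) :
    thomClass hP = Quot.mk _ ⟨(P.lift n).cplx, hP.isL_lift.isConnNormal_cplx⟩ := by
  have h1 : (Quot.mk _ ⟨_, hP.isL_lift.isConnNormal_cplx⟩ : BNormalClass n β) = thomClass hP :=
    Quot.sound hP.cplx_lift
  exact h1.symm

theorem thomClass_eq_of_BPairHE {P P' : BPairData B} (hP : P.IsPoincare n β)
    (hP' : P'.IsPoincare n β) (h : BPairHE n β P P') : thomClass hP = thomClass hP' := by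
  rw [thomClass_eq_cplx, thomClass_eq_cplx]
  exact Quot.sound (BPairData.lift_cplx_of_BPairHE hP hP' h)

theorem cplx_lift_eq {X : BNormalData B} (h : IsSymStructure n X.φ) : (X.lift n h).cplx = X := by
  obtain ⟨⟨C, φ, γ, θ⟩, g, χ⟩ := X
  have h1 : ∀ e : GMap (nDual n C) C, θ + push e 0 = θ := fun e => by rw [push_zero, add_zero]
  exact congrArg (fun θ => BNormalData.mk (NormalData.mk C φ γ θ) g χ) (h1 _)

theorem thomClass_pair {X : BNormalData B} (hX : X.IsConnNormal n β) :
    thomClass (isL_lift hX).pair_isPoincare = Quot.mk _ ⟨X, hX⟩ := by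
  rw [thomClass_eq_cplx]
  have h1 : (Quot.mk _ ⟨_, (isL_lift hX).pair_isPoincare.isL_lift.isConnNormal_cplx⟩ :
      BNormalClass n β) = Quot.mk _ ⟨_, (isL_lift hX).isConnNormal_cplx⟩ :=
    Quot.sound (isL_lift hX).cplx_lift_pair
  exact h1.trans (congrArg (Quot.mk _) (Subtype.ext (cplx_lift_eq _)))

theorem pairClass_thom {P : BPairData B} (hP : P.IsPoincare n β) :
    pairClass hP.isConnNormal_thom = Quot.mk _ ⟨P, hP⟩ := by
  have h1 := pairClass_eq_of_BNormalHE hP.isL_lift.isConnNormal_cplx hP.isConnNormal_thom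
    hP.cplx_lift
  have h2 : (Quot.mk _ ⟨P, hP⟩ : BPairClass n β) =
      Quot.mk _ ⟨(P.lift n).pair n, hP.isL_lift.pair_isPoincare⟩ := Quot.sound hP.pair_lift
  rw [← h1, hP.isL_lift.pairClass_cplx, h2]

variable (n β) in
/-- The bijection between the homotopy equivalence classes of connected `(B, β)`-normal complexes
and of `(B, β)`-normal Poincaré pairs. -/
def bclassEquiv : BNormalClass n β ≃ BPairClass n β where
  toFun := Quot.lift (fun X => pairClass X.2) fun X X' h => pairClass_eq_of_BNormalHE X.2 X'.2 h
  invFun := Quot.lift (fun P => thomClass P.2) fun P P' h => thomClass_eq_of_BPairHE P.2 P'.2 h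
  left_inv := by
    rintro ⟨X, hX⟩
    exact thomClass_pair hX
  right_inv := by
    rintro ⟨P, hP⟩
    exact pairClass_thom hP

theorem exists_mk_eq {P : PairData A} {Q : BPairData B} (h : P = Q.toPairData) :
    ∃ γ θ g χ, BPairData.mk P γ θ g χ = Q := by
  subst h
  exact ⟨Q.γ, Q.θ, Q.g, Q.χ, rfl⟩

theorem exists_bdryPair {X : BNormalData B} (hX : X.IsConnNormal n β) :
    ∃ (γ : Form (cone (X.bdryPair hX.conn_normal.sym).f))
      (θ : Fam (X.bdryPair hX.conn_normal.sym).D)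
      (g : cone (X.bdryPair hX.conn_normal.sym).f ⟶ B)
      (χ : Form (cone (X.bdryPair hX.conn_normal.sym).f))
      (hP : (BPairData.mk (X.bdryPair hX.conn_normal.sym) γ θ g χ).IsPoincare n β),
      bclassEquiv n β (Quot.mk _ ⟨X, hX⟩) =
        Quot.mk _ ⟨BPairData.mk (X.bdryPair hX.conn_normal.sym) γ θ g χ, hP⟩ := by
  obtain ⟨γ, θ, g, χ, h⟩ := exists_mk_eq (bdryPair_eq hX)
  refine ⟨γ, θ, g, χ, h ▸ (isL_lift hX).pair_isPoincare, ?_⟩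
  exact congrArg (Quot.mk _) (Subtype.ext h.symm)

/-- The underlying class of Poincaré pairs. -/
def BPairClass.forget : BPairClass n β → PairClass A n :=
  Quot.map (fun P => ⟨P.1.toPairData, P.2.poincare⟩)
    fun _ _ ⟨g, h, k, δξ, ξ, _, _, _, _, hg, hh, hm, _⟩ => ⟨g, h, k, δξ, ξ, hg, hh, hm.pair_map⟩

/-- The underlying class of normal complexes. -/
def BNormalClass.forget : BNormalClass n β → NormalClass A n :=
  Quot.map (fun X => ⟨X.1.toNormalData, X.2.conn_normal⟩)
    fun _ _ ⟨f, ξ, χ, η, _, _, hf, hm, _⟩ => ⟨f, ξ, χ, η, hf, hm⟩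

theorem forget_pairClass {X : BNormalData B} (hX : X.IsConnNormal n β) :
    (pairClass hX).forget = Quot.mk _ ⟨X.bdryPair hX.conn_normal.sym,
      bdryPair_isPoincare hX.conn_normal⟩ :=
  congrArg (Quot.mk _) (Subtype.ext (bdryPair_eq hX).symm)

theorem isBundleHtpy_comp_id {C : Cx A} (g : C ⟶ B) (χ : Form C) :
    IsBundleHtpy β g χ (g ≫ 𝟙 B) (χ + pull (comps g) 0)
      (htpyCongr (Category.comp_id g) rfl (Homotopy.refl g)) 0 := by
  rw [pull_zero, add_zero]
  exact isBundleHtpy_of_eq (Category.comp_id g) χ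

theorem bdryPair_class_eq {X X' : NormalData A} (hX : X.IsConnNormal n) (hX' : X'.IsConnNormal n)
    (h : NormalHE n X X') :
    (Quot.mk _ ⟨X.bdryPair hX.sym, bdryPair_isPoincare hX⟩ : PairClass A n) =
      Quot.mk _ ⟨X'.bdryPair hX'.sym, bdryPair_isPoincare hX'⟩ := by
  obtain ⟨f, ξ, χ, η, hf, hm⟩ := h
  have h1 : (BNormalData.mk X f χ).IsConnNormal n X'.γ := ⟨hX, hm.bundle_equiv⟩
  have h2 := isConnNormal_toSelf hX'
  have h4 : BNormalHE n X'.γ (BNormalData.mk X f χ) X'.toSelf :=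
    ⟨f, ξ, χ, η, htpyCongr (Category.comp_id f) rfl (Homotopy.refl f), 0, hf, hm,
      isBundleHtpy_comp_id f χ⟩
  have h5 := congrArg BPairClass.forget (pairClass_eq_of_BNormalHE h1 h2 h4)
  rw [forget_pairClass, forget_pairClass] at h5
  exact h5

theorem isPoincare_toSelf {P : PairData A} (hP : P.IsPoincare n) {γ : Form (cone P.f)} {θ : Fam P.D}
    (hn : P.IsNormalStr n γ θ) :
    (BPairData.mk P γ θ (𝟙 (cone P.f)) 0).IsPoincare n γ := by
  refine ⟨hP, hn, IsForm.zero, ?_⟩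
  have h0 : dForm 1 (0 : Form (cone P.f)) = γ - γ := by rw [dForm_zero, sub_self]
  exact h0

theorem thom_class_eq {P P' : PairData A} (hP : P.IsPoincare n) (hP' : P'.IsPoincare n)
    (h : PairHE n P P') {γ : Form (cone P.f)} {θ : Fam P.D} {γ' : Form (cone P'.f)} {θ' : Fam P'.D}
    (hn : P.IsNormalStr n γ θ) (hn' : P'.IsNormalStr n γ' θ') :
    (Quot.mk _ ⟨P.thom n γ θ, hP.isConnNormal_thom hn⟩ : NormalClass A n) =
      Quot.mk _ ⟨P'.thom n γ' θ', hP'.isConnNormal_thom hn'⟩ := by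
  obtain ⟨g, b, k, δξ, ξ, hg, hb, hm⟩ := h
  obtain ⟨ζ, η, hm'⟩ := hm.exists_normalPairMap hP hP' hb hn hn'
  have h1 : (BPairData.mk P γ θ (coneMap g b k) ζ).IsPoincare n γ' := ⟨hP, hn, hm'.bundle_equiv⟩
  have h2 := isPoincare_toSelf hP' hn'
  have h4 : BPairHE n γ' (BPairData.mk P γ θ (coneMap g b k) ζ)
      (BPairData.mk P' γ' θ' (𝟙 (cone P'.f)) 0) :=
    ⟨g, b, k, δξ, ξ, ζ, η, htpyCongr (Category.comp_id (coneMap g b k)) rfl (Homotopy.refl _), 0,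
      hg, hb, hm', isBundleHtpy_comp_id (coneMap g b k) ζ⟩
  exact congrArg BNormalClass.forget (thomClass_eq_of_BPairHE h1 h2 h4)

theorem thom_class_eq_self {P : PairData A} (hP : P.IsPoincare n) {γ γ' : Form (cone P.f)}
    {θ θ' : Fam P.D} (hn : P.IsNormalStr n γ θ) (hn' : P.IsNormalStr n γ' θ') :
    (Quot.mk _ ⟨P.thom n γ θ, hP.isConnNormal_thom hn⟩ : NormalClass A n) =
      Quot.mk _ ⟨P.thom n γ' θ', hP.isConnNormal_thom hn'⟩ := by
  have h1 := isPoincare_toSelf hP hn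
  have hQ := h1.isL_lift.pair_isPoincare
  obtain ⟨g, h, k, δξ, ξ, _, _, _, _, hg, hh, hm, _⟩ := h1.pair_lift
  have h2 : PairHE n P _ := ⟨g, h, k, δξ, ξ, hg, hh, hm.pair_map⟩
  exact (thom_class_eq hP hQ.poincare h2 hn hQ.normal).trans
    (thom_class_eq hP hQ.poincare h2 hn' hQ.normal).symm

theorem thom_bdryPair_class {X : NormalData A} (hX : X.IsConnNormal n)
    {γ : Form (cone (X.bdryPair hX.sym).f)} {θ : Fam (X.bdryPair hX.sym).D}
    (hn : (X.bdryPair hX.sym).IsNormalStr n γ θ) :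
    (Quot.mk _ ⟨(X.bdryPair hX.sym).thom n γ θ, (bdryPair_isPoincare hX).isConnNormal_thom hn⟩ :
      NormalClass A n) = Quot.mk _ ⟨X, hX⟩ := by
  obtain ⟨γ', θ', g, χ, hP, h⟩ := exists_bdryPair (isConnNormal_toSelf hX)
  have h1 := (bclassEquiv n X.γ).symm_apply_eq.2 h.symm
  exact (thom_class_eq_self (bdryPair_isPoincare hX) hn hP.normal).trans
    (congrArg BNormalClass.forget h1)

theorem bdryPair_thom_class {P : PairData A} (hP : P.IsPoincare n) {γ : Form (cone P.f)}
    {θ : Fam P.D} (hn : P.IsNormalStr n γ θ) :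
    (Quot.mk _ ⟨(P.thom n γ θ).bdryPair (hP.isConnNormal_thom hn).sym,
      bdryPair_isPoincare (hP.isConnNormal_thom hn)⟩ : PairClass A n) = Quot.mk _ ⟨P, hP⟩ :=
  (forget_pairClass (isPoincare_toSelf hP hn).isConnNormal_thom).symm.trans
    (congrArg BPairClass.forget (pairClass_thom (isPoincare_toSelf hP hn)))

/-- The class of the normal complex of a Poincaré pair. -/
def PairData.IsPoincare.thomClass {P : PairData A} (hP : P.IsPoincare n) : NormalClass A n :=
  Quot.mk _ ⟨_, hP.isConnNormal_thom hP.exists_normalStr.choose_spec.choose_spec⟩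

theorem PairData.IsPoincare.thomClass_eq {P : PairData A} (hP : P.IsPoincare n)
    {γ : Form (cone P.f)} {θ : Fam P.D} (hn : P.IsNormalStr n γ θ) :
    hP.thomClass = Quot.mk _ ⟨P.thom n γ θ, hP.isConnNormal_thom hn⟩ :=
  thom_class_eq_self hP hP.exists_normalStr.choose_spec.choose_spec hn

theorem PairData.IsPoincare.thomClass_eq_of_pairHE {P P' : PairData A} (hP : P.IsPoincare n)
    (hP' : P'.IsPoincare n) (h : PairHE n P P') : hP.thomClass = hP'.thomClass :=
  thom_class_eq hP hP' h hP.exists_normalStr.choose_spec.choose_spec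
    hP'.exists_normalStr.choose_spec.choose_spec

/-- The map which takes the class of a normal complex to the class of its pair. -/
def NormalClass.bdryPair : NormalClass A n → PairClass A n :=
  Quot.lift (fun X => Quot.mk _ ⟨X.1.bdryPair X.2.sym, bdryPair_isPoincare X.2⟩)
    fun X X' h => bdryPair_class_eq X.2 X'.2 h

variable (A n) in
/-- The bijection between the homotopy equivalence classes of connected normal complexes and of
(symmetric, quadratic) Poincaré pairs. -/
def classEquiv : NormalClass A n ≃ PairClass A n where
  toFun := NormalClass.bdryPair
  invFun := Quot.lift (fun P => P.2.thomClass) fun P P' h => P.2.thomClass_eq_of_pairHE P'.2 h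
  left_inv := by
    rintro ⟨X, hX⟩
    obtain ⟨γ, θ, hn⟩ := (bdryPair_isPoincare hX).exists_normalStr
    exact ((bdryPair_isPoincare hX).thomClass_eq hn).trans (thom_bdryPair_class hX hn)
  right_inv := by
    rintro ⟨P, hP⟩
    obtain ⟨γ, θ, hn⟩ := hP.exists_normalStr
    exact (congrArg NormalClass.bdryPair (hP.thomClass_eq hn)).trans (bdryPair_thom_class hP hn)

theorem classEquiv_symm_mk {P : PairData A} (hP : P.IsPoincare n) {γ : Form (cone P.f)}
    {θ : Fam P.D} (hn : P.IsNormalStr n γ θ) :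
    (classEquiv A n).symm (Quot.mk _ ⟨P, hP⟩) =
      Quot.mk _ ⟨P.thom n γ θ, hP.isConnNormal_thom hn⟩ :=
  hP.thomClass_eq hn

end Bijections

end

end APC

theorem mainTheorem3 (A : Type u) [Ring A] [StarRing A] (n : ℕ) :
    (∀ (X : APC.NormalData A) (hX : X.IsConnNormal n),
      (X.bdryPair hX.sym).IsPoincare n ∧
        APC.IsQuadPoincare (n - 1) (APC.bdryCx hX.sym) (APC.bdryψ hX.sym X.γ X.θ)) ∧
    (∀ P : APC.PairData A, P.IsPoincare n →
      (∃ γ θ, P.IsNormalStr n γ θ) ∧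
      (∀ γ θ γ' θ', P.IsNormalStr n γ θ → P.IsNormalStr n γ' θ' →
        P.NormalStrEquiv n γ θ γ' θ') ∧
      (∀ γ θ, P.IsNormalStr n γ θ → (P.thom n γ θ).IsConnNormal n)) ∧
    (∃ Φ : APC.NormalClass A n ≃ APC.PairClass A n,
      (∀ (X : APC.NormalData A) (hX : X.IsConnNormal n),
        ∃ hP : (X.bdryPair hX.sym).IsPoincare n,
          Φ (Quot.mk _ ⟨X, hX⟩) = Quot.mk _ ⟨X.bdryPair hX.sym, hP⟩) ∧
      (∀ (P : APC.PairData A) (hP : P.IsPoincare n) (γ : APC.Form (APC.cone P.f))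
        (θ : APC.Fam P.D), P.IsNormalStr n γ θ →
        ∃ hX : (P.thom n γ θ).IsConnNormal n,
          Φ.symm (Quot.mk _ ⟨P, hP⟩) = Quot.mk _ ⟨P.thom n γ θ, hX⟩)) ∧
    (∀ (B : APC.Cx A) (β : APC.Form B), APC.IsBundle β →
      ∃ Ψ : APC.BNormalClass n β ≃ APC.BPairClass n β,
        (∀ (X : APC.BNormalData B) (hX : X.IsConnNormal n β),
          ∃ (γ : APC.Form (APC.cone (X.bdryPair hX.conn_normal.sym).f))
            (θ : APC.Fam (X.bdryPair hX.conn_normal.sym).D)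
            (g : APC.cone (X.bdryPair hX.conn_normal.sym).f ⟶ B)
            (χ : APC.Form (APC.cone (X.bdryPair hX.conn_normal.sym).f))
            (hP : (APC.BPairData.mk (X.bdryPair hX.conn_normal.sym) γ θ g χ).IsPoincare n β),
            Ψ (Quot.mk _ ⟨X, hX⟩) =
              Quot.mk _ ⟨APC.BPairData.mk (X.bdryPair hX.conn_normal.sym) γ θ g χ, hP⟩) ∧
        (∀ (P : APC.BPairData B) (hP : P.IsPoincare n β),
          ∃ hX : (P.thom n).IsConnNormal n β,
            Ψ.symm (Quot.mk _ ⟨P, hP⟩) = Quot.mk _ ⟨P.thom n, hX⟩)) := by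
  refine ⟨fun X hX => ⟨APC.bdryPair_isPoincare hX, APC.isQuadPoincare_bdryψ hX⟩,
    fun P hP => ⟨hP.exists_normalStr, fun γ θ γ' θ' h h' => hP.normalStrEquiv h h',
      fun γ θ h => hP.isConnNormal_thom h⟩,
    ⟨APC.classEquiv A n, fun X hX => ⟨APC.bdryPair_isPoincare hX, rfl⟩,
      fun P hP γ θ h => ⟨hP.isConnNormal_thom h, APC.classEquiv_symm_mk hP h⟩⟩,
    fun B β _ => ⟨APC.bclassEquiv n β, fun X hX => APC.exists_bdryPair hX,
      fun P hP => ⟨hP.isConnNormal_thom, rfl⟩⟩⟩
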